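/- **Setting.** Let $\mathbb{R}^2_+=\{x\in\mathbb{R}^2: x_2>0\}$ and let $M$ be the space of finite real regular Borel measures on $\overline{\mathbb{R}^2_+}$ with the total variation norm $\|\cdot\|_M$. A family in $M$ converges vaguely if its integrals against every $\varphi\in C_0(\overline{\mathbb{R}^2_+})$ converge. Put $x^*=(x_1,-x_2)$, $\nabla^\perp=(\partial_2,-\partial_1)$, $$E(x)=-\tfrac1{2\pi}\log|x|,\qquad D(x,y)=E(x-y)-E(x-y^*),\qquad \Gamma(x,t)=\tfrac1{4\pi t}e^{-|x|^2/4t}.$$ The Biot–Savart operator is $K\omega_0(x)=\int_{\overline{\mathbb{R}^2_+}}\nabla_x^\perp D(x,y)\,\omega_0(dy)$, and the Stokes semigroup is $S(t)u_0(x)=\int_{\mathbb{R}^2_+}G(x,z,t)u_0(z)\,dz$ for $t>0$, with the Green matrix $$G_{ij}(x,z,t)=\big(\Gamma(x-z,t)-\Gamma(x-z^*,t)\big)\delta_{ij}-4(1-\delta_{j2})\,\partial_{x_j}\int_0^{x_2}\!\!\int_{\mathbb{R}}\partial_{x_i}E(x-w)\,\Gamma(w-z^*,t)\,dw_1dw_2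 .$$ For $\omega_0\in M$ let $u_0=K\omega_0$ and $T(t)\omega_0=-\nabla^\perp\cdot S(t)K\omega_0$ for $t>0$. The function $T(t)\omega_0$ is identified with the measure on $\overline{\mathbb{R}^2_+}$ having it as density, and $T(0)$ is the identity. Let $u_0^1(x_1,0)$ be the first component of $K\omega_0$ at $(x_1,0)$; let $\delta_{x_2=0}\,u_0^1(\cdot,0)$ be the measure $u_0^1(x_1,0)\,dx_1$ on the line $\{x_2=0\}$; and set $\tilde\omega_0=\omega_0-\delta_{x_2=0}\,u_0^1(\cdot,0)$. **Lemma 4.1.** For every $\omega_0\in M$ these objects are well defined: the integral defining $K\omega_0(x)$ converges absolutely for a.e. $x\in\mathbb{R}^2_+$, and the integral defining $u_0^1(x_1,0)$ converges absolutely for a.e. $x_1$; $u^1_0(\cdot,0)\in L^1(\mathbb{R})$; the integral defining $S(t)K\omega_0(x)$ converges absolutely for all $t>0$ and $x\in\mathbb{R}^2_+$; $S(t)K\omega_0(x)$ and $T(t)\omega_0(x)$ are $C^\infty$ in $(t,x)\in(0,\infty)\times\mathbb{R}^2_+$; and $T(t)\omega_0$ is integrable for every $t>0$. Moreover: 1.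 For all integers $s\ge0$ and multi-indices $k=(k_1,k_2)$ there is a constant $C$ such that $$\|\partial_t^s\partial_x^kT(t)\omega_0\|_{L^q(\mathbb{R}^2_+)}\le C\,t^{-(1-1/q+|k|/2+s)}\,\|\omega_0\|_M,\qquad t>0,\ \omega_0\in M,\ 1\le q\le\infty .$$ 2. $T(t+s)\omega_0=T(t)T(s)\omega_0$ for all $t,s\ge0$ and $\omega_0\in M$. 3. If $|\omega_0|(\{x_2=0\})=0$, then $T(t)\omega_0\to\omega_0-\delta_{x_2=0}\,u_0^1(\cdot,0)$ vaguely as $t\to0^+$. For arbitrary $\omega_0\in M$, $T(t)\omega_0\to\omega_0|_{\{x_2>0\}}-\delta_{x_2=0}\,u_0^1(\cdot,0)$ vaguely as $t\to0^+$. 4. $T(t)\tilde\omega_0=T(t)\omega_0$ for all $t>0$ and $\omega_0\in M$; if $|\omega_0|(\{x_2=0\})=0$, then $T(t)\tilde\omega_0\to\tilde\omega_0$ vaguely as $t\to0^+$. -/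

import Mathlib

open MeasureTheory Filter Set
open scoped Topology ENNReal

namespace HalfPlane

noncomputable section

/-- The open upper half plane, as a subset of the plane `ℝ × ℝ`. -/
def openHalf : Set (ℝ × ℝ) := {x | 0 < x.2}

/-- The closed upper half plane, as a type. -/
abbrev ClosedHalf : Type := {x : ℝ × ℝ // 0 ≤ x.2}

/-- The interior of the closed half plane, as a subset of it. -/
def interiorPart : Set ClosedHalf := {y | 0 < y.1.2}

/-- The boundary line of the closed half plane, as a subset of it. -/
def boundaryPart : Set ClosedHalf := {y | y.1.2 = 0}

/-- Lebesgue measure on the closed half plane. -/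
def area : Measure ClosedHalf := (volume : Measure (ℝ × ℝ)).comap Subtype.val

/-- Finite real Borel measures on the closed half plane. Regularity is automatic on this
space, and signed measures with real values are finite. -/
abbrev M : Type := SignedMeasure ClosedHalf

/-- The integral of a real function against a finite real measure, through the Jordan
decomposition. -/
def sint {α : Type*} [MeasurableSpace α] (μ : SignedMeasure α) (f : α → ℝ) : ℝ :=
  (∫ y, f y ∂μ.toJordanDecomposition.posPart) - ∫ y, f y ∂μ.toJordanDecomposition.negPart

/-- Vague (weak-star) convergence in `M`, tested against the continuous functions on the closed
half plane which vanish at infinity. -/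
def VagueTendsto {ι : Type*} (μ : ι → M) (l : Filter ι) (ν : M) : Prop :=
  ∀ φ : ZeroAtInftyContinuousMap ClosedHalf ℝ,
    Tendsto (fun i => sint (μ i) (fun y => φ y)) l (𝓝 (sint ν (fun y => φ y)))

/-- The standard basis of the plane. Index `0` is the tangential coordinate `x₁`, index `1` the
normal coordinate `x₂`. -/
def basisVec (i : Fin 2) : ℝ × ℝ := if i = 0 then (1, 0) else (0, 1)

/-- The classical partial derivative of a real function on the plane in the direction `i`. -/
def pd (i : Fin 2) (f : ℝ × ℝ → ℝ) (x : ℝ × ℝ) : ℝ := lineDeriv ℝ f x (basisVec i)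

/-- Reflection in the boundary line. -/
def reflect (y : ℝ × ℝ) : ℝ × ℝ := (y.1, -y.2)

/-- The square of the Euclidean norm (the norm of `ℝ × ℝ` is the maximum norm). -/
def normSq (x : ℝ × ℝ) : ℝ := x.1 ^ 2 + x.2 ^ 2

/-- The fundamental solution `E(x) = -(2π)⁻¹ log |x|` of `-Δ` in the plane. -/
def E (x : ℝ × ℝ) : ℝ := -(1 / (2 * Real.pi)) * Real.log (Real.sqrt (normSq x))

/-- The Green function of the Dirichlet Laplacian in the half plane. -/
def D (x y : ℝ × ℝ) : ℝ := E (x - y) - E (x - reflect y)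

/-- The two-dimensional heat kernel. -/
def heatKernel (x : ℝ × ℝ) (t : ℝ) : ℝ :=
  1 / (4 * Real.pi * t) * Real.exp (-(normSq x) / (4 * t))

/-- The Biot-Savart kernel `∇^⊥_x D(x, y)`, where `∇^⊥ = (∂₂, -∂₁)`. -/
def biotSavartKernel (x y : ℝ × ℝ) (i : Fin 2) : ℝ :=
  if i = 0 then pd 1 (fun x' => D x' y) x else -pd 0 (fun x' => D x' y) x

/-- The Biot-Savart operator `K`. -/
def biotSavart (ω : M) (x : ℝ × ℝ) (i : Fin 2) : ℝ :=
  sint ω (fun y => biotSavartKernel x y.1 i)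

/-- The tangential trace `x₁ ↦ u¹(x₁, 0)` of the velocity `u = K ω`. -/
def tangentialTrace (ω : M) (x₁ : ℝ) : ℝ := biotSavart ω (x₁, 0) 0

/-- The correction term `G*` of the Green matrix of the Stokes semigroup,
`G*_ij(x, z, t) = -Γ(x - z*, t) δ_ij
  - 4 (1 - δ_j2) ∂_{x_j} ∫_0^{x₂} ∫_ℝ ∂_i E(x - w) Γ(w - z*, t) dw₁ dw₂`. -/
def greenCorrection (i j : Fin 2) (x z : ℝ × ℝ) (t : ℝ) : ℝ :=
  -(if i = j then heatKernel (x - reflect z) t else 0)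
    - 4 * (if j = 1 then 0 else
        pd j (fun x' => ∫ w in {w : ℝ × ℝ | 0 < w.2 ∧ w.2 < x'.2},
          pd i E (x' - w) * heatKernel (w - reflect z) t) x)

/-- The Green matrix of the Stokes semigroup in the half plane. -/
def greenMatrix (i j : Fin 2) (x z : ℝ × ℝ) (t : ℝ) : ℝ :=
  (if i = j then heatKernel (x - z) t else 0) + greenCorrection i j x z t

/-- The Stokes semigroup `S(t) u₀ (x) = ∫ G(x, z, t) u₀(z) dz`, for `t > 0`. -/
def stokes (t : ℝ) (u₀ : ℝ × ℝ → Fin 2 → ℝ) (x : ℝ × ℝ) (i : Fin 2) : ℝ :=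
  ∫ z in openHalf, ∑ j, greenMatrix i j x z t * u₀ z j

/-- The function `-∇^⊥ · v = -(∂₂ v¹ - ∂₁ v²)`. -/
def curl (v : ℝ × ℝ → Fin 2 → ℝ) (x : ℝ × ℝ) : ℝ :=
  -(pd 1 (fun x' => v x' 0) x - pd 0 (fun x' => v x' 1) x)

/-- The vorticity `T(t) ω = -∇^⊥ · S(t) K ω`, for `t > 0`, as a function on the half plane. -/
def vorticity (t : ℝ) (ω : M) : ℝ × ℝ → ℝ := curl (stokes t (biotSavart ω))

/-- The solution operator `T(t)` on `M`: for `t > 0` the function `-∇^⊥ · S(t) K ω` is identified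
with the measure of this density, and `T(0)` is the identity. -/
def T (t : ℝ) (ω : M) : M :=
  if 0 < t then area.withDensityᵥ (fun x => vorticity t ω x.1) else ω

/-- The derivative `∂_t^s ∂_x^k T(t) ω` at the point `x`, for `k = (k₁, k₂)`. -/
def vorticityDeriv (s k₁ k₂ : ℕ) (t : ℝ) (ω : M) (x : ℝ × ℝ) : ℝ :=
  iteratedDeriv s (fun τ => ((pd 0)^[k₁] ((pd 1)^[k₂] (vorticity τ ω))) x) t

/-- The measure `δ_{0,[0,∞)} g`, that is, the measure `g(x₁) dx₁` on the boundary line. -/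
def boundaryMeasure (g : ℝ → ℝ) : M :=
  ((volume : Measure ℝ).withDensityᵥ g).map
    (fun r => (⟨(r, 0), le_refl (0 : ℝ)⟩ : ClosedHalf))

/-- The normalization `ω - δ_{0,[0,∞)} u¹(·, 0)` of `ω`, where `u = K ω`. -/
def normalized (ω : M) : M := ω - boundaryMeasure (tangentialTrace ω)

end

end HalfPlane

open HalfPlane

/-!
The operator `T(t)` is an integral operator with an explicit kernel, and every assertion is read off
from that kernel.

Velocities are written as `u¹ - i u²`. The Biot–Savart kernel is then a difference of Cauchy kernels
(`bsKernel_complex`), its first component a difference of Poisson kernels, and the strip integral in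
the Green matrix becomes an integral over a segment of products of the one-dimensional heat kernel
`heat` with the half-line transform `lap n t ζ = ∫₀^∞ kⁿ exp(-t k² - k ζ) dk`, because the Cauchy
transform of the Gaussian is `lap 0` and Poisson convolution shifts `ζ`. Absolute convergence rests on
the bound of the Biot–Savart kernel by a product of inverse square roots (`abs_bsKernel_le`) and on the
quadratic decay of `lap 1`. After integration over the half plane the contributions of the whole normal
half line cancel (`integral_heatOdd_identity`), which leaves the kernel `velKernel` of `S(t) K`
(`integral_stokesIntegrand`). In the curl the parts of the velocity that are holomorphic in `x₂ - i x₁`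
cancel (`vorticity_eq`), and `T(t)` has the kernel `vortKernel 0 0 t x y`, namely
`heat(x₁ - y₁) (heat(x₂ - y₂) - heat(x₂ + y₂)) + 2 ∫₀^{y₂} heat'(x₂ + r) P_{y₂ - r} heat(x₁ - y₁) dr`,
where `P` is the Poisson semigroup in the tangential variable: the heat flow with Dirichlet conditions
plus the vorticity created at the boundary (`vortKernel_eq`, `vorticity_eq_sint`).

* Smoothness. The factors of the kernels solve heat equations, so the potentials `layerPot` form a
  family closed under differentiation (`contDiffOn_integral_family`), and time derivatives of the
  vorticity are Laplacians.
* Estimates. The derivatives of the kernel are bounded in `L¹`, uniformly in `y`, and in the supremum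
  norm, with the parabolic scaling in `t` (`exists_lintegral_vortKernel_le`,
  `exists_abs_vortKernel_le`); the other exponents follow by interpolation.
* Semigroup property. The tangential Fourier transform of the kernel is `exp(-t k²)` times `freqKernel`,
  which satisfies a first-order equation in `y` with the odd heat kernel on the right. An
  integration by parts reduces the Chapman–Kolmogorov identity at frequency `k` to that of the odd heat
  kernel on the half line (`integral_freqKernel_mul_freqKernel`).
* Initial values. As `t → 0`, the direct term of the kernel gives a point mass at `y`, its image
  vanishes, and the boundary term concentrates on the line with mass
  `2 ∫₀^∞ ∫₀^∞ heat'(a + b) da db = -1`, distributed by the Poisson kernel of height `y₂`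
  (`tendsto_integral_mul_vortKernel`). The Poisson integral of `ω` is the tangential trace of `K ω`
  (`tangentialTrace_eq`), and the uniform `L¹` bound allows dominated convergence in `y`.
* Normalization. The kernel vanishes for `y` on the boundary line, so that changing `ω` by a measure on
  this line does not change `T(t) ω` (`T_normalized`).
-/

/-! ### The Gaussian and its derivatives -/

/-- The polynomials `p n` with `(d/dx)^n exp(-x²/4) = p n x * exp(-x²/4)`. -/
noncomputable def gaussPoly : ℕ → Polynomial ℝ
  | 0 => 1
  | n + 1 => (gaussPoly n).derivative - Polynomial.C (1 / 2) * Polynomial.X * gaussPoly n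

/-- The `n`-th derivative of the normalized Gaussian `(4π)^{-1/2} exp(-x²/4)`. -/
noncomputable def gauss (n : ℕ) (x : ℝ) : ℝ :=
  (√(4 * Real.pi))⁻¹ * ((gaussPoly n).eval x * Real.exp (-x ^ 2 / 4))

theorem hasDerivAt_gauss (n : ℕ) (x : ℝ) : HasDerivAt (gauss n) (gauss (n + 1) x) x := by
  have h1 : HasDerivAt (fun x : ℝ => Real.exp (-x ^ 2 / 4)) (Real.exp (-x ^ 2 / 4) * (-x / 2)) x := by
    have : HasDerivAt (fun x : ℝ => -x ^ 2 / 4) (-x / 2) x := by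
      refine (((hasDerivAt_pow 2 x).neg).div_const 4).congr_deriv ?_
      norm_num; ring
    exact this.exp
  have h := (((gaussPoly n).hasDerivAt x).mul h1).const_mul (√(4 * Real.pi))⁻¹
  refine h.congr_deriv ?_
  simp only [gauss, gaussPoly, Polynomial.eval_sub, Polynomial.eval_mul, Polynomial.eval_C,
    Polynomial.eval_X]
  ring

/-- The Hermite relation for the polynomials `gaussPoly`. -/
theorem gaussPoly_derivative (n : ℕ) :
    (gaussPoly (n + 1)).derivative = - Polynomial.C (((n : ℝ) + 1) / 2) * gaussPoly n := by
  induction n with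
  | zero => simp [gaussPoly]
  | succ n ih =>
    rw [gaussPoly, Polynomial.derivative_sub, ih]
    simp only [Polynomial.derivative_mul, Polynomial.derivative_C, Polynomial.derivative_X,
      Polynomial.derivative_neg]
    rw [ih]
    conv_rhs => rw [gaussPoly]
    conv_lhs => rw [gaussPoly]
    have : Polynomial.C (((((n + 1 : ℕ) : ℝ) + 1) / 2)) =
      Polynomial.C (((n : ℝ) + 1) / 2) + Polynomial.C (1 / 2) := by
      rw [← Polynomial.C_add]; congr 1; push_cast; ring
    rw [this]
    ring

/-- The three-term recurrence of the Hermite functions. It is what makes `heat` a solution of the heat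
equation. -/
theorem gauss_recurrence (n : ℕ) (x : ℝ) :
    gauss (n + 2) x = -((n + 1) / 2) * gauss n x - x / 2 * gauss (n + 1) x := by
  have : gaussPoly (n + 2) = - Polynomial.C (((n : ℝ) + 1) / 2) * gaussPoly n -
      Polynomial.C (1 / 2) * Polynomial.X * gaussPoly (n + 1) := by
    rw [gaussPoly, gaussPoly_derivative]
  simp only [gauss, this, Polynomial.eval_sub, Polynomial.eval_mul, Polynomial.eval_neg,
    Polynomial.eval_C, Polynomial.eval_X]
  ring

theorem exists_poly_mul_exp_bound (p : Polynomial ℝ) :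
    ∃ C : ℝ, ∀ x : ℝ, |p.eval x| * Real.exp (-x ^ 2 / 8) ≤ C := by
  induction p using Polynomial.induction_on' with
  | add p q hp hq =>
    obtain ⟨C, hC⟩ := hp
    obtain ⟨D, hD⟩ := hq
    refine ⟨C + D, fun x => ?_⟩
    have := hC x
    have := hD x
    have h := abs_add_le (p.eval x) (q.eval x)
    have := mul_le_mul_of_nonneg_right h (Real.exp_pos (-x ^ 2 / 8)).le
    rw [Polynomial.eval_add]
    nlinarith
  | monomial n a =>
    refine ⟨|a| * (1 + 8 ^ n * n.factorial), fun x => ?_⟩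
    have h1 : |x| ^ n ≤ 1 + (x ^ 2) ^ n := by
      have : (x ^ 2) ^ n = (|x| ^ n) ^ 2 := by rw [← sq_abs]; ring
      rw [this]; nlinarith [sq_nonneg (|x| ^ n - 1), pow_nonneg (abs_nonneg x) n]
    have h2 : (x ^ 2 / 8) ^ n / n.factorial ≤ Real.exp (x ^ 2 / 8) :=
      Real.pow_div_factorial_le_exp _ (by positivity) n
    have h3 : Real.exp (-x ^ 2 / 8) * Real.exp (x ^ 2 / 8) = 1 := by
      rw [← Real.exp_add]; simp; ring
    have h4 : Real.exp (-x ^ 2 / 8) ≤ 1 := by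
      apply Real.exp_le_one_iff.2; nlinarith [sq_nonneg x]
    have h5 : (x ^ 2) ^ n ≤ 8 ^ n * n.factorial * Real.exp (x ^ 2 / 8) := by
      have hf : (0 : ℝ) < n.factorial := by exact_mod_cast n.factorial_pos
      rw [div_le_iff₀ hf, div_pow, div_le_iff₀ (by positivity)] at h2
      linarith
    rw [Polynomial.eval_monomial, abs_mul, abs_pow, mul_assoc]
    refine mul_le_mul_of_nonneg_left ?_ (abs_nonneg a)
    have hp := Real.exp_pos (-x ^ 2 / 8)
    calc |x| ^ n * Real.exp (-x ^ 2 / 8)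
        ≤ (1 + 8 ^ n * n.factorial * Real.exp (x ^ 2 / 8)) * Real.exp (-x ^ 2 / 8) := by
          apply mul_le_mul_of_nonneg_right _ hp.le; linarith
      _ = Real.exp (-x ^ 2 / 8) + 8 ^ n * n.factorial *
          (Real.exp (-x ^ 2 / 8) * Real.exp (x ^ 2 / 8)) := by ring
      _ ≤ _ := by rw [h3]; linarith

theorem exists_gauss_bound (n : ℕ) :
    ∃ C : ℝ, 0 ≤ C ∧ ∀ x : ℝ, |gauss n x| ≤ C * Real.exp (-x ^ 2 / 8) := by
  obtain ⟨C, hC⟩ := exists_poly_mul_exp_bound (gaussPoly n)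
  have hs : 0 ≤ (√(4 * Real.pi))⁻¹ := by positivity
  refine ⟨(√(4 * Real.pi))⁻¹ * C, mul_nonneg hs ((by positivity : (0:ℝ) ≤ _).trans (hC 0)), fun x => ?_⟩
  rw [gauss, abs_mul, abs_mul, abs_of_nonneg hs, Real.abs_exp, mul_assoc]
  refine mul_le_mul_of_nonneg_left ?_ hs
  have : Real.exp (-x ^ 2 / 4) = Real.exp (-x ^ 2 / 8) * Real.exp (-x ^ 2 / 8) := by
    rw [← Real.exp_add]; ring_nf
  rw [this, ← mul_assoc]
  exact mul_le_mul_of_nonneg_right (hC x) (Real.exp_pos _).le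

/-- The `n`-th space derivative of the one-dimensional heat kernel
`(4πt)^{-1/2} exp(-x²/(4t))`, in self-similar form. -/
noncomputable def heat (n : ℕ) (t x : ℝ) : ℝ := (√t)⁻¹ ^ (n + 1) * gauss n (x * (√t)⁻¹)

theorem hasDerivAt_inv_sqrt {t : ℝ} (ht : 0 < t) :
    HasDerivAt (fun t => (√t)⁻¹) (-(1 / 2) * (√t)⁻¹ ^ 3) t := by
  have h := (Real.hasDerivAt_sqrt ht.ne').inv (Real.sqrt_pos.2 ht).ne'
  refine h.congr_deriv ?_
  have := (Real.sqrt_pos.2 ht).ne'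
  field_simp

/-- The heat equation: the derivative in time raises the order by two. -/
theorem hasFDerivAt_heat (n : ℕ) {p : ℝ × ℝ} (hp : 0 < p.1) :
    HasFDerivAt (fun p : ℝ × ℝ => heat n p.1 p.2)
      (heat (n + 2) p.1 p.2 • ContinuousLinearMap.fst ℝ ℝ ℝ +
        heat (n + 1) p.1 p.2 • ContinuousLinearMap.snd ℝ ℝ ℝ) p := by
  have hs : HasFDerivAt (fun p : ℝ × ℝ => (√p.1)⁻¹)
      ((-(1 / 2) * (√p.1)⁻¹ ^ 3) • ContinuousLinearMap.fst ℝ ℝ ℝ) p :=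
    (hasDerivAt_inv_sqrt hp).comp_hasFDerivAt p hasFDerivAt_fst
  have h1 := hs.pow (n + 1)
  have h2 := (hasDerivAt_gauss n (p.2 * (√p.1)⁻¹)).comp_hasFDerivAt p
    ((hasFDerivAt_snd (𝕜 := ℝ) (p := p)).mul hs)
  refine (h1.mul h2).congr_fderiv ?_
  ext <;> simp [heat]
  · rw [gauss_recurrence]; ring
  · ring

theorem hasDerivAt_heat (n : ℕ) {t : ℝ} (ht : 0 < t) (x : ℝ) :
    HasDerivAt (heat n t) (heat (n + 1) t x) x := by
  have h := (hasFDerivAt_heat n (p := (t, x)) ht).comp_hasDerivAt x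
    ((hasDerivAt_const x t).prodMk (hasDerivAt_id x))
  exact h.congr_deriv (by simp)

theorem continuous_heat (n : ℕ) {t : ℝ} (ht : 0 < t) : Continuous (heat n t) :=
  continuous_iff_continuousAt.2 fun x => (hasDerivAt_heat n ht x).continuousAt

/-- Half of the Gaussian decay is given away to absorb the polynomial factor. -/
theorem exists_heat_bound (n : ℕ) : ∃ C : ℝ, 0 ≤ C ∧ ∀ t : ℝ, 0 < t → ∀ x,
    |heat n t x| ≤ C * (√t)⁻¹ ^ (n + 1) * Real.exp (-x ^ 2 / (8 * t)) := by
  obtain ⟨C, h0, hC⟩ := exists_gauss_bound n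
  refine ⟨C, h0, fun t ht x => ?_⟩
  have hs : 0 ≤ (√t)⁻¹ ^ (n + 1) := by positivity
  rw [heat, abs_mul, abs_of_nonneg hs]
  refine (mul_le_mul_of_nonneg_left (hC _) hs).trans (le_of_eq ?_)
  have : -(x * (√t)⁻¹) ^ 2 / 8 = -x ^ 2 / (8 * t) := by
    rw [mul_pow, inv_pow, Real.sq_sqrt ht.le]; field_simp
  rw [this]; ring

theorem heat_zero_eq {t : ℝ} (ht : 0 < t) (x : ℝ) :
    heat 0 t x = (√(4 * Real.pi * t))⁻¹ * Real.exp (-x ^ 2 / (4 * t)) := by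
  have : -(x * (√t)⁻¹) ^ 2 / 4 = -x ^ 2 / (4 * t) := by
    rw [mul_pow, inv_pow, Real.sq_sqrt ht.le]; field_simp
  simp only [heat, gauss, this, gaussPoly, Polynomial.eval_one]
  rw [Real.sqrt_mul (by positivity) t]
  simp; ring

theorem heat_zero_pos {t : ℝ} (ht : 0 < t) (x : ℝ) : 0 < heat 0 t x := by
  rw [heat_zero_eq ht]; have := Real.pi_pos; positivity

theorem heat_zero_neg (t x : ℝ) : heat 0 t (-x) = heat 0 t x := by
  simp [heat, gauss, gaussPoly]

theorem heatKernel_eq {t : ℝ} (ht : 0 < t) (x : ℝ × ℝ) :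
    heatKernel x t = heat 0 t x.1 * heat 0 t x.2 := by
  rw [heat_zero_eq ht, heat_zero_eq ht, heatKernel, normSq]
  have h : (√(4 * Real.pi * t))⁻¹ * (√(4 * Real.pi * t))⁻¹ = 1 / (4 * Real.pi * t) := by
    rw [← mul_inv, Real.mul_self_sqrt (by have := Real.pi_pos; positivity), one_div]
  have h2 : Real.exp (-(x.1 ^ 2 + x.2 ^ 2) / (4 * t)) =
      Real.exp (-x.1 ^ 2 / (4 * t)) * Real.exp (-x.2 ^ 2 / (4 * t)) := by
    rw [← Real.exp_add]; ring_nf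
  rw [h2, ← h]; ring

theorem integrable_exp_neg_sq_div {c : ℝ} (hc : 0 < c) :
    Integrable (fun x : ℝ => Real.exp (-x ^ 2 / c)) := by
  have := integrable_exp_neg_mul_sq (b := 1 / c) (by positivity)
  refine this.congr (ae_of_all _ fun x => ?_)
  simp only; congr 1; ring

theorem integral_exp_neg_sq_div (c : ℝ) :
    ∫ x : ℝ, Real.exp (-x ^ 2 / c) = √(Real.pi * c) := by
  have := integral_gaussian (1 / c)
  rw [div_div_eq_mul_div, div_one] at this
  rw [← this]
  congr 1; ext x; congr 1; ring

theorem integrable_heat (n : ℕ) {t : ℝ} (ht : 0 < t) : Integrable (heat n t) := by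
  obtain ⟨C, h0, hC⟩ := exists_heat_bound n
  refine Integrable.mono' ((integrable_exp_neg_sq_div (by positivity : 0 < 8 * t)).const_mul
    (C * (√t)⁻¹ ^ (n + 1))) (continuous_heat n ht).aestronglyMeasurable (ae_of_all _ fun x => hC t ht x)

theorem integral_heat_zero {t : ℝ} (ht : 0 < t) : ∫ x, heat 0 t x = 1 := by
  simp_rw [heat_zero_eq ht]
  rw [integral_const_mul, integral_exp_neg_sq_div]
  have : Real.pi * (4 * t) = 4 * Real.pi * t := by ring
  rw [this]
  have := Real.pi_pos
  exact inv_mul_cancel₀ (by positivity)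

theorem exists_integral_abs_heat_bound (n : ℕ) : ∃ C : ℝ, 0 ≤ C ∧ ∀ t : ℝ, 0 < t →
    ∫ x, |heat n t x| ≤ C * (√t)⁻¹ ^ n := by
  obtain ⟨C, h0, hC⟩ := exists_heat_bound n
  refine ⟨C * √(Real.pi * 8), by positivity, fun t ht => ?_⟩
  calc ∫ x, |heat n t x| ≤ ∫ x, C * (√t)⁻¹ ^ (n + 1) * Real.exp (-x ^ 2 / (8 * t)) :=
        integral_mono (integrable_heat n ht).abs
          ((integrable_exp_neg_sq_div (by positivity)).const_mul _) (hC t ht)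
    _ = C * (√t)⁻¹ ^ (n + 1) * √(Real.pi * 8 * t) := by
        rw [integral_const_mul, integral_exp_neg_sq_div, mul_assoc Real.pi]
    _ = _ := by
        rw [Real.sqrt_mul (by positivity) t]
        have := mul_inv_cancel₀ (Real.sqrt_pos.2 ht).ne'
        calc _ = C * √(Real.pi * 8) * (√t)⁻¹ ^ n * (√t * (√t)⁻¹) := by ring
          _ = _ := by rw [this, mul_one]

theorem integral_heat_mul_cexp {t : ℝ} (ht : 0 < t) (k : ℝ) :
    ∫ v : ℝ, (heat 0 t v : ℂ) * Complex.exp (-(Complex.I * k * v)) = Complex.exp (-(t * k ^ 2 : ℝ)) := by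
  have hb : 0 < ((1 / (4 * t) : ℝ) : ℂ).re := by simp; positivity
  have h := fourierIntegral_gaussian hb (-k : ℂ)
  have h2 : ∀ v : ℝ, (heat 0 t v : ℂ) * Complex.exp (-(Complex.I * k * v)) =
     ((√(4 * Real.pi * t))⁻¹ : ℝ) * (Complex.exp (Complex.I * (-k) * v) *
      Complex.exp (-((1 / (4 * t) : ℝ) : ℂ) * v ^ 2)) := by
    intro v
    rw [heat_zero_eq ht]
    push_cast
    rw [mul_assoc, mul_comm (Complex.exp (Complex.I * -(k:ℂ) * v))]
    congr 2
    · congr 1; field_simp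
    · congr 1; ring
  simp_rw [h2]
  rw [integral_const_mul, h]
  have h3 : (Real.pi : ℂ) / ((1 / (4 * t) : ℝ) : ℂ) = ((4 * Real.pi * t : ℝ) : ℂ) := by
    push_cast; field_simp
  have hpi := Real.pi_pos
  have hpos : 0 < 4 * Real.pi * t := by positivity
  rw [h3, show (1 / 2 : ℂ) = ((1 / 2 : ℝ) : ℂ) by push_cast; rfl, ← Complex.ofReal_cpow hpos.le,
    ← Real.sqrt_eq_rpow, ← mul_assoc, ← Complex.ofReal_mul,
    inv_mul_cancel₀ (Real.sqrt_pos.2 hpos).ne', Complex.ofReal_one, one_mul]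
  congr 1
  have : (t : ℂ) ≠ 0 := by exact_mod_cast ht.ne'
  push_cast
  field_simp

theorem integral_heat_conv {t s : ℝ} (ht : 0 < t) (hs : 0 < s) (x z : ℝ) :
    ∫ y, heat 0 t (x - y) * heat 0 s (y - z) = heat 0 (t + s) (x - z) := by
  have hts : 0 < t + s := by positivity
  have hpi := Real.pi_pos
  -- complete the square in `y`
  have key : ∀ y, heat 0 t (x - y) * heat 0 s (y - z) = heat 0 (t + s) (x - z) *
      heat 0 (t * s / (t + s)) (y - (s * x + t * z) / (t + s)) := by
    intro y
    rw [heat_zero_eq ht, heat_zero_eq hs, heat_zero_eq hts, heat_zero_eq (by positivity)]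
    have e1 : (√(4 * Real.pi * t))⁻¹ * (√(4 * Real.pi * s))⁻¹ =
        (√(4 * Real.pi * (t + s)))⁻¹ * (√(4 * Real.pi * (t * s / (t + s))))⁻¹ := by
      rw [← mul_inv, ← mul_inv, ← Real.sqrt_mul (by positivity), ← Real.sqrt_mul (by positivity)]
      congr 2; field_simp
    have e2 : Real.exp (-(x - y) ^ 2 / (4 * t)) * Real.exp (-(y - z) ^ 2 / (4 * s)) =
        Real.exp (-(x - z) ^ 2 / (4 * (t + s))) *
        Real.exp (-(y - (s * x + t * z) / (t + s)) ^ 2 / (4 * (t * s / (t + s)))) := by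
      rw [← Real.exp_add, ← Real.exp_add]
      congr 1
      field_simp
      ring
    calc _ = ((√(4 * Real.pi * t))⁻¹ * (√(4 * Real.pi * s))⁻¹) *
          (Real.exp (-(x - y) ^ 2 / (4 * t)) * Real.exp (-(y - z) ^ 2 / (4 * s))) := by ring
      _ = _ := by rw [e1, e2]; ring
  simp_rw [key]
  rw [integral_const_mul, integral_sub_right_eq_self (fun y => heat 0 (t * s / (t + s)) y),
    integral_heat_zero (by positivity), mul_one]

/-! ### Differentiation of families of integrals -/

section Family

variable {P Y ι κ : Type*} [NormedAddCommGroup P] [NormedSpace ℝ P] [MeasurableSpace Y]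
  [Fintype κ] {μ : Measure Y} {O : Set P} {f : ι → P → Y → ℂ} {σ : ι → κ → ι} {L : κ → P →L[ℝ] ℂ}

/-- If the derivatives of the members of a family of kernels are combinations of members of the
family, and all members are locally uniformly dominated, then the integrals of the family satisfy
the same differentiation rules. -/
theorem hasFDerivAt_integral_family (hO : IsOpen O)
    (hmeas : ∀ i, ∀ p ∈ O, AEStronglyMeasurable (f i p) μ)
    (hder : ∀ i, ∀ p ∈ O, ∀ y, HasFDerivAt (fun p => f i p y) (∑ l, f (σ i l) p y • L l) p)
    (hbd : ∀ i, ∀ p ∈ O, ∃ b : Y → ℝ, Integrable b μ ∧ ∃ s ∈ 𝓝 p, ∀ᵐ y ∂μ, ∀ p' ∈ s,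
      ‖f i p' y‖ ≤ b y) (i : ι) {p : P} (hp : p ∈ O) :
    HasFDerivAt (fun p => ∫ y, f i p y ∂μ) (∑ l, (∫ y, f (σ i l) p y ∂μ) • L l) p := by
  have hint : ∀ i, Integrable (f i p) μ := by
    intro i
    obtain ⟨b, hb, s, hs, hbs⟩ := hbd i p hp
    exact hb.mono' (hmeas i p hp) (hbs.mono fun y hy => hy p (mem_of_mem_nhds hs))
  choose b hb s hs hbs using fun l => hbd (σ i l) p hp
  have hsum : ∫ y, ∑ l, f (σ i l) p y • L l ∂μ = ∑ l, (∫ y, f (σ i l) p y ∂μ) • L l := by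
    rw [integral_finsetSum _ fun l _ => (hint _).smul_const _]
    simp_rw [integral_smul_const]
  have hsm : ∀ l, Integrable (fun y => f (σ i l) p y • L l) μ :=
    fun l => (hint (σ i l)).smul_const (L l)
  have hsi : Integrable (fun y => ∑ l, f (σ i l) p y • L l) μ :=
    integrable_finsetSum (f := fun l y => f (σ i l) p y • L l) _ fun l _ => hsm l
  have hsi' : AEStronglyMeasurable (fun y => ∑ l, f (σ i l) p y • L l) μ := hsi.aestronglyMeasurable
  have hmeas' : ∀ᶠ p' in 𝓝 p, AEStronglyMeasurable (f i p') μ :=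
    Filter.eventually_of_mem (hO.mem_nhds hp) fun p' hp' => hmeas i p' hp'
  have hB : Integrable (fun y => ∑ l, b l y * ‖L l‖) μ :=
    integrable_finsetSum _ fun l _ => (hb l).mul_const ‖L l‖
  have hbound : ∀ᵐ y ∂μ, ∀ p' ∈ O ∩ ⋂ l, s l,
      ‖∑ l, f (σ i l) p' y • L l‖ ≤ ∑ l, b l y * ‖L l‖ := by
    filter_upwards [ae_all_iff.2 hbs] with y hy p' hp'
    refine (norm_sum_le _ _).trans (Finset.sum_le_sum fun l _ => ?_)
    rw [norm_smul]
    exact mul_le_mul_of_nonneg_right (hy l p' (mem_iInter.1 hp'.2 l)) (norm_nonneg _)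
  have main := hasFDerivAt_integral_of_dominated_of_fderiv_le (𝕜 := ℝ)
    (Filter.inter_mem (hO.mem_nhds hp) (Filter.iInter_mem.2 hs)) hmeas' (hint i) hsi' hbound hB
    (ae_of_all _ fun y p' hp' => hder i p' hp'.1 y)
  rw [hsum] at main
  exact main

/-- Under the hypotheses of `hasFDerivAt_integral_family`, the integrals are smooth. -/
theorem contDiffOn_integral_family (hO : IsOpen O)
    (hmeas : ∀ i, ∀ p ∈ O, AEStronglyMeasurable (f i p) μ)
    (hder : ∀ i, ∀ p ∈ O, ∀ y, HasFDerivAt (fun p => f i p y) (∑ l, f (σ i l) p y • L l) p)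
    (hbd : ∀ i, ∀ p ∈ O, ∃ b : Y → ℝ, Integrable b μ ∧ ∃ s ∈ 𝓝 p, ∀ᵐ y ∂μ, ∀ p' ∈ s,
      ‖f i p' y‖ ≤ b y) (i : ι) :
    ContDiffOn ℝ ((⊤ : ℕ∞) : WithTop ℕ∞) (fun p => ∫ y, f i p y ∂μ) O := by
  have hd := fun i {p} hp => hasFDerivAt_integral_family (i := i) (p := p) hO hmeas hder hbd hp
  rw [contDiffOn_infty]
  intro n
  induction n generalizing i with
  | zero =>
    rw [Nat.cast_zero, contDiffOn_zero]
    exact fun p hp => (hd i hp).continuousAt.continuousWithinAt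
  | succ n ih =>
    rw [Nat.cast_succ, contDiffOn_succ_iff_fderiv_of_isOpen hO]
    refine ⟨fun p hp => (hd i hp).differentiableAt.differentiableWithinAt,
      fun h => absurd h (by exact_mod_cast WithTop.natCast_ne_top n), ?_⟩
    have : ContDiffOn ℝ n (fun p => ∑ l, (∫ y, f (σ i l) p y ∂μ) • L l) O :=
      ContDiffOn.sum fun l _ => (ih (σ i l)).smul contDiffOn_const
    exact this.congr fun p hp => (hd i hp).fderiv

end Family

/-- An integral over `[0, 1]` of a smooth function depends smoothly on the parameters. -/
theorem contDiffOn_integral_zero_one {P : Type*} [NormedAddCommGroup P] [NormedSpace ℝ P]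
    {O : Set P} (hO : IsOpen O) {F : P → ℝ → ℂ}
    (hF : ContDiffOn ℝ ((⊤ : ℕ∞) : WithTop ℕ∞) (fun q : P × ℝ => F q.1 q.2) (O ×ˢ univ)) :
    ContDiffOn ℝ ((⊤ : ℕ∞) : WithTop ℕ∞) (fun p => ∫ s in (0 : ℝ)..1, F p s) O := by
  -- a convolution of a cut-off of `F p` with the indicator of `[-1, 0]`, at the origin
  let b : ContDiffBump (0 : ℝ) := ⟨1, 2, by norm_num, by norm_num⟩
  have h := contDiffOn_convolution_right_with_param_comp (μ := volume) (n := ⊤)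
    (ContinuousLinearMap.lsmul ℝ ℝ : ℝ →L[ℝ] ℂ →L[ℝ] ℂ) (s := O) (v := fun _ => (0 : ℝ))
    contDiffOn_const (f := (Ico (-1 : ℝ) 0).indicator 1) (g := fun p x => (b x : ℝ) • F p x)
    (k := Metric.closedBall 0 2) hO (isCompact_closedBall _ _) ?_ ?_ ?_
  · refine h.congr fun p hp => ?_
    rw [convolution_def]
    simp only [ContinuousLinearMap.lsmul_apply, zero_sub]
    have e : ∀ t : ℝ, (Ico (-1 : ℝ) 0).indicator (1 : ℝ → ℝ) t • b (-t) • F p (-t) =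
        (Ioc (0 : ℝ) 1).indicator (fun s => F p s) (-t) := by
      intro t
      by_cases ht : t ∈ Ico (-1 : ℝ) 0
      · have h1 : -t ∈ Ioc (0 : ℝ) 1 := ⟨by linarith [ht.2], by linarith [ht.1]⟩
        rw [indicator_of_mem ht, indicator_of_mem h1, b.one_of_mem_closedBall]
        · simp
        · rw [mem_closedBall_zero_iff, Real.norm_eq_abs, abs_le]
          exact ⟨by linarith [h1.1], h1.2⟩
      · have h1 : -t ∉ Ioc (0 : ℝ) 1 := fun h => ht ⟨by linarith [h.2], by linarith [h.1]⟩
        rw [indicator_of_notMem ht, indicator_of_notMem h1, zero_smul]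
    simp_rw [e]
    rw [integral_neg_eq_self (fun t => (Ioc (0 : ℝ) 1).indicator (fun s => F p s) t),
      integral_indicator measurableSet_Ioc, intervalIntegral.integral_of_le zero_le_one]
  · intro p x _ hx
    have : b x = 0 := by
      by_contra hne
      have hm : x ∈ Function.support b := hne
      rw [b.support_eq] at hm
      exact hx (Metric.ball_subset_closedBall hm)
    simp [this]
  · exact ((integrable_indicator_iff measurableSet_Ico).2
      (integrableOn_const (by simp))).locallyIntegrable
  · exact (b.contDiff.comp contDiff_snd).contDiffOn.smul hF

/-! ### The half-line Fourier–Laplace transform of the Gaussian -/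

/-- `lap n t ζ = ∫₀^∞ k^n exp(-t k² - k ζ) dk`. -/
noncomputable def lap (n : ℕ) (t : ℝ) (ζ : ℂ) : ℂ :=
  ∫ k in Ioi (0 : ℝ), (k : ℂ) ^ n * Complex.exp (-(t * k ^ 2) - k * ζ)

theorem integrableOn_pow_mul_exp (n : ℕ) {t : ℝ} (ht : 0 < t) (A : ℝ) :
    IntegrableOn (fun k : ℝ => k ^ n * Real.exp (-(t * k ^ 2) + A * k)) (Ioi 0) := by
  have h := (integrable_rpow_mul_exp_neg_mul_sq (b := t / 2) (by positivity) (s := n)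
    (by have : (0:ℝ) ≤ n := n.cast_nonneg
        linarith)).const_mul (Real.exp (A ^ 2 / (2 * t)))
  refine Integrable.mono' h.integrableOn (by fun_prop) ?_
  filter_upwards [ae_restrict_mem measurableSet_Ioi] with k hk
  have hk : 0 < k := hk
  rw [Real.norm_eq_abs, abs_of_nonneg (by positivity), Real.rpow_natCast]
  have : Real.exp (-(t * k ^ 2) + A * k) ≤
      Real.exp (A ^ 2 / (2 * t)) * Real.exp (-(t / 2) * k ^ 2) := by
    rw [← Real.exp_add]
    apply Real.exp_le_exp.2
    have : A ^ 2 / (2 * t) + -(t / 2) * k ^ 2 - (-(t * k ^ 2) + A * k) = (A - t * k) ^ 2 / (2 * t) := by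
      field_simp; ring
    have h2 : 0 ≤ (A - t * k) ^ 2 / (2 * t) := by positivity
    linarith
  calc _ ≤ k ^ n * (Real.exp (A ^ 2 / (2 * t)) * Real.exp (-(t / 2) * k ^ 2)) := by gcongr
    _ = _ := by ring

theorem norm_lap_integrand (n : ℕ) (t : ℝ) (ζ : ℂ) {k : ℝ} (hk : 0 < k) :
    ‖(k : ℂ) ^ n * Complex.exp (-(t * k ^ 2) - k * ζ)‖ = k ^ n * Real.exp (-(t * k ^ 2) - k * ζ.re) := by
  rw [norm_mul, norm_pow, Complex.norm_exp, Complex.norm_real, Real.norm_eq_abs, abs_of_pos hk]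
  have : ((t : ℂ) * (k : ℂ) ^ 2) = ((t * k ^ 2 : ℝ) : ℂ) := by push_cast; rfl
  rw [this, Complex.sub_re, Complex.neg_re, Complex.ofReal_re, Complex.re_ofReal_mul]

theorem lap_integrand_bound (n : ℕ) {t s A : ℝ} (hs : s ≤ t) {ζ : ℂ} (hζ : -A ≤ ζ.re) {k : ℝ}
    (hk : 0 < k) : ‖(k : ℂ) ^ n * Complex.exp (-(t * k ^ 2) - k * ζ)‖ ≤
      k ^ n * Real.exp (-(s * k ^ 2) + A * k) := by
  rw [norm_lap_integrand n t ζ hk]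
  have : s * k ^ 2 ≤ t * k ^ 2 := by gcongr
  have : k * (-A) ≤ k * ζ.re := by gcongr
  gcongr
  linarith

theorem integrableOn_lap (n : ℕ) {t : ℝ} (ht : 0 < t) (ζ : ℂ) :
    IntegrableOn (fun k : ℝ => (k : ℂ) ^ n * Complex.exp (-(t * k ^ 2) - k * ζ)) (Ioi 0) := by
  refine Integrable.mono' (integrableOn_pow_mul_exp n ht (-ζ.re))
    (by fun_prop) ?_
  filter_upwards [ae_restrict_mem measurableSet_Ioi] with k hk
  exact lap_integrand_bound n le_rfl (by simp) hk

theorem norm_lap_le (n : ℕ) {t s A : ℝ} (h0 : 0 < s) (hs : s ≤ t) {ζ : ℂ} (hζ : -A ≤ ζ.re) :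
    ‖lap n t ζ‖ ≤ ∫ k in Ioi (0 : ℝ), k ^ n * Real.exp (-(s * k ^ 2) + A * k) := by
  refine norm_integral_le_of_norm_le (integrableOn_pow_mul_exp n h0 A) ?_
  filter_upwards [ae_restrict_mem measurableSet_Ioi] with k hk
  exact lap_integrand_bound n hs hζ hk

theorem lap_family_deriv (n : ℕ) (k : ℝ) (p : ℝ × ℂ) :
    HasFDerivAt (fun p : ℝ × ℂ => (k : ℂ) ^ n * Complex.exp (-(p.1 * k ^ 2) - k * p.2))
      (((k : ℂ) ^ (n + 2) * Complex.exp (-(p.1 * k ^ 2) - k * p.2)) •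
        (-(Complex.ofRealCLM.comp (ContinuousLinearMap.fst ℝ ℝ ℂ))) +
       ((k : ℂ) ^ (n + 1) * Complex.exp (-(p.1 * k ^ 2) - k * p.2)) •
        (-(ContinuousLinearMap.snd ℝ ℝ ℂ))) p := by
  have h1 : HasFDerivAt (fun p : ℝ × ℂ => (p.1 : ℂ)) (Complex.ofRealCLM.comp (ContinuousLinearMap.fst ℝ ℝ ℂ)) p :=
    (Complex.ofRealCLM.comp (ContinuousLinearMap.fst ℝ ℝ ℂ)).hasFDerivAt
  have h2 := ((h1.mul_const ((k : ℂ) ^ 2)).neg.sub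
    ((hasFDerivAt_snd (𝕜 := ℝ) (p := p)).const_mul (k : ℂ))).cexp.const_mul ((k : ℂ) ^ n)
  refine h2.congr_fderiv ?_
  ext <;> simp <;> ring

theorem lap_hyps (i : ℕ) (p : ℝ × ℂ) (hp : p ∈ {p : ℝ × ℂ | 0 < p.1}) :
    ∃ b : ℝ → ℝ, Integrable b (volume.restrict (Ioi 0)) ∧ ∃ s ∈ 𝓝 p,
      ∀ᵐ y : ℝ ∂(volume.restrict (Ioi (0 : ℝ))), ∀ p' ∈ s,
      ‖(y : ℂ) ^ i * Complex.exp (-(p'.1 * y ^ 2) - y * p'.2)‖ ≤ b y := by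
  have hp : 0 < p.1 := hp
  refine ⟨_, integrableOn_pow_mul_exp i (half_pos hp) (1 - p.2.re),
    {q | p.1 / 2 < q.1 ∧ p.2.re - 1 < q.2.re}, IsOpen.mem_nhds ?_ ⟨by linarith, by linarith⟩, ?_⟩
  · exact (isOpen_lt continuous_const continuous_fst).inter
      (isOpen_lt continuous_const (Complex.continuous_re.comp continuous_snd))
  · filter_upwards [ae_restrict_mem measurableSet_Ioi] with k hk q hq
    exact lap_integrand_bound i hq.1.le (by linarith [hq.2]) hk

theorem hasFDerivAt_lap (n : ℕ) {p : ℝ × ℂ} (hp : 0 < p.1) :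
    HasFDerivAt (fun p : ℝ × ℂ => lap n p.1 p.2)
      (lap (n + 2) p.1 p.2 • (-(Complex.ofRealCLM.comp (ContinuousLinearMap.fst ℝ ℝ ℂ))) +
       lap (n + 1) p.1 p.2 • (-(ContinuousLinearMap.snd ℝ ℝ ℂ))) p := by
  have := hasFDerivAt_integral_family (μ := volume.restrict (Ioi (0 : ℝ)))
    (O := {p : ℝ × ℂ | 0 < p.1})
    (f := fun n p k => (k : ℂ) ^ n * Complex.exp (-(p.1 * k ^ 2) - k * p.2))
    (σ := fun n => ![n + 2, n + 1])
    (L := ![-(Complex.ofRealCLM.comp (ContinuousLinearMap.fst ℝ ℝ ℂ)), -(ContinuousLinearMap.snd ℝ ℝ ℂ)])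
    (isOpen_lt continuous_const continuous_fst)
    (fun i p _ => by fun_prop)
    (fun i p _ k => by
      rw [Fin.sum_univ_two]
      exact lap_family_deriv i k p) lap_hyps n (p := p) hp
  rw [Fin.sum_univ_two] at this
  exact this

theorem hasDerivAt_lap (n : ℕ) {t : ℝ} (ht : 0 < t) (ζ : ℂ) (c : ℂ) (x : ℝ) :
    HasDerivAt (fun x : ℝ => lap n t (ζ + c * x)) (-c * lap (n + 1) t (ζ + c * x)) x := by
  have h1 : HasDerivAt (fun x : ℝ => (t, ζ + c * x)) ((0 : ℝ), c) x := by
    refine (hasDerivAt_const x t).prodMk ?_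
    have := ((Complex.ofRealCLM.hasDerivAt (x := x)).const_mul c).const_add ζ
    simpa using this
  have h := (hasFDerivAt_lap n (p := (t, ζ + c * x)) ht).comp_hasDerivAt x h1
  exact h.congr_deriv (by simp; ring)

theorem continuous_lap (n : ℕ) {t : ℝ} (ht : 0 < t) : Continuous (lap n t) := by
  rw [continuous_iff_continuousAt]
  intro ζ
  exact (hasFDerivAt_lap n (p := (t, ζ)) ht).continuousAt.comp
    (f := fun ζ : ℂ => (t, ζ)) (Continuous.prodMk_right t).continuousAt

/-- The uniform bound of `lap n t` on the closed right half plane has the parabolic scaling. -/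
theorem exists_lap_bound (n : ℕ) : ∃ C : ℝ, 0 ≤ C ∧ ∀ t : ℝ, 0 < t → ∀ ζ : ℂ, 0 ≤ ζ.re →
    ‖lap n t ζ‖ ≤ C * (√t)⁻¹ ^ (n + 1) := by
  have hn : (0 : ℝ) ≤ n := n.cast_nonneg
  refine ⟨1 / 2 * Real.Gamma ((n + 1) / 2), ?_, fun t ht ζ hζ => ?_⟩
  · have := Real.Gamma_pos_of_pos (by positivity : 0 < ((n : ℝ) + 1) / 2)
    positivity
  refine (norm_lap_le n ht le_rfl (A := 0) (by simpa using hζ)).trans (le_of_eq ?_)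
  have h := integral_rpow_mul_exp_neg_mul_rpow (p := 2) (q := n) (b := t) (by norm_num)
    (by linarith) ht
  have e : ∀ k : ℝ, k ^ n * Real.exp (-(t * k ^ 2) + 0 * k) =
      k ^ (n : ℝ) * Real.exp (-t * k ^ (2 : ℝ)) := by
    intro k
    rw [Real.rpow_natCast, Real.rpow_two]; ring_nf
  simp_rw [e]
  rw [h, mul_assoc, mul_comm]
  congr 1
  rw [Real.sqrt_eq_rpow, ← Real.rpow_neg ht.le, ← Real.rpow_natCast, ← Real.rpow_mul ht.le]
  congr 1
  push_cast; ring

open scoped FourierTransform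

/-! ### The Poisson kernel of the half plane -/

/-- The Poisson kernel of the half plane at height `a`. -/
noncomputable def poisson (a b : ℝ) : ℝ := a / (Real.pi * (a ^ 2 + b ^ 2))

theorem poisson_nonneg {a : ℝ} (ha : 0 ≤ a) (b : ℝ) : 0 ≤ poisson a b := by
  have := Real.pi_pos
  unfold poisson; positivity

theorem poisson_zero (b : ℝ) : poisson 0 b = 0 := by simp [poisson]

theorem continuous_poisson {a : ℝ} (ha : 0 < a) : Continuous (poisson a) := by
  unfold poisson
  refine continuous_const.div (by fun_prop) fun b => ?_
  have := Real.pi_pos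
  positivity

theorem poisson_eq {a : ℝ} (ha : 0 < a) (b : ℝ) :
    poisson a b = (Real.pi * a)⁻¹ * (1 + (b * a⁻¹) ^ 2)⁻¹ := by
  unfold poisson
  have := Real.pi_pos
  have : 0 < a ^ 2 + b ^ 2 := by positivity
  field_simp

theorem integrable_poisson {a : ℝ} (ha : 0 < a) : Integrable (poisson a) := by
  simp_rw [funext (poisson_eq ha)]
  exact (integrable_inv_one_add_sq.comp_mul_right' (inv_ne_zero ha.ne')).const_mul _

theorem integral_poisson {a : ℝ} (ha : 0 < a) : ∫ b, poisson a b = 1 := by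
  simp_rw [poisson_eq ha]
  rw [integral_const_mul, Measure.integral_comp_mul_right (fun x => (1 + x ^ 2)⁻¹),
    integral_univ_inv_one_add_sq]
  simp [abs_of_pos ha]
  have := Real.pi_pos
  field_simp

theorem integral_exp_neg_mul_Ioi {z : ℂ} (hz : 0 < z.re) :
    ∫ k in Ioi (0 : ℝ), Complex.exp (-(k * z)) = 1 / z := by
  have := integral_exp_mul_complex_Ioi (a := -z) (by simpa using hz) 0
  simp only [Complex.ofReal_zero, mul_zero, Complex.exp_zero, neg_div_neg_eq] at this
  rw [← this]
  congr 1; ext k; congr 1; ring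

theorem integrableOn_exp_neg_mul_Ioi {z : ℂ} (hz : 0 < z.re) :
    IntegrableOn (fun k : ℝ => Complex.exp (-(k * z))) (Ioi 0) := by
  have := integrableOn_exp_mul_complex_Ioi (a := -z) (by simpa using hz) 0
  refine this.congr_fun (fun k _ => ?_) measurableSet_Ioi
  simp only; congr 1; ring

/-- The Fourier transform of the Poisson kernel. -/
theorem integral_poisson_mul_cexp {b : ℝ} (hb : 0 < b) {k : ℝ} (hk : 0 ≤ k) :
    ∫ v : ℝ, (poisson b v : ℂ) * Complex.exp (-(Complex.I * k * v)) = Complex.exp (-(k * b)) := by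
  have hpi := Real.pi_pos
  -- the Poisson kernel is the Fourier transform of `exp (-2π b |x|)`
  let f : ℝ → ℂ := fun x => Complex.exp (-((2 * Real.pi * b * |x| : ℝ) : ℂ))
  have hz : ∀ s w : ℝ, 0 < (2 * Real.pi * (b + s * w * Complex.I) : ℂ).re := by
    intro s w; simp; positivity
  have h1 : ∀ w : ℝ, ∀ x ∈ Ioi (0 : ℝ), Complex.exp (↑(-2 * Real.pi * x * w) * Complex.I) • f x =
      Complex.exp (-(x * (2 * Real.pi * (b + (1 : ℝ) * w * Complex.I) : ℂ))) := by
    intro w x hx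
    simp only [f, smul_eq_mul, abs_of_pos (show 0 < x from hx), ← Complex.exp_add]
    congr 1; push_cast; ring
  have h2 : ∀ w : ℝ, ∀ x ∈ Ioi (0 : ℝ), Complex.exp (↑(-2 * Real.pi * (-x) * w) * Complex.I) • f (-x) =
      Complex.exp (-(x * (2 * Real.pi * (b + (-1 : ℝ) * w * Complex.I) : ℂ))) := by
    intro w x hx
    simp only [f, smul_eq_mul, abs_neg, abs_of_pos (show 0 < x from hx), ← Complex.exp_add]
    congr 1; push_cast; ring
  have hint : ∀ w : ℝ, Integrable (fun x : ℝ => Complex.exp (↑(-2 * Real.pi * x * w) * Complex.I) • f x) := by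
    intro w
    rw [← integrableOn_univ, ← Iic_union_Ioi (a := (0 : ℝ))]
    refine IntegrableOn.union ?_ ?_
    · have := (integrableOn_exp_neg_mul_Ioi (hz (-1) w)).congr_fun
        (fun x hx => (h2 w x hx).symm) measurableSet_Ioi
      rw [← integrableOn_Ici_iff_integrableOn_Ioi] at this
      have h3 := this.comp_neg
      simpa using h3
    · exact (integrableOn_exp_neg_mul_Ioi (hz 1 w)).congr_fun
        (fun x hx => (h1 w x hx).symm) measurableSet_Ioi
  have hF : 𝓕 f = fun w => (poisson b w : ℂ) := by
    ext w
    rw [Real.fourier_real_eq_integral_exp_smul, ← intervalIntegral.integral_Iic_add_Ioi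
      (hint w).integrableOn (hint w).integrableOn (b := 0), ← neg_zero, ← integral_comp_neg_Ioi,
      neg_zero, setIntegral_congr_fun measurableSet_Ioi (h1 w)]
    rw [show (∫ x in Ioi (0:ℝ), Complex.exp (↑(-2 * Real.pi * (-x) * w) * Complex.I) • f (-x)) = _ from
      setIntegral_congr_fun measurableSet_Ioi (h2 w), integral_exp_neg_mul_Ioi (hz _ w),
      integral_exp_neg_mul_Ioi (hz _ w)]
    have n1 : (b + (1:ℝ) * w * Complex.I : ℂ) ≠ 0 := by
      intro h; have := congrArg Complex.re h; simp at this; linarith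
    have n2 : (b + (-1:ℝ) * w * Complex.I : ℂ) ≠ 0 := by
      intro h; have := congrArg Complex.re h; simp at this; linarith
    have e3 : (b ^ 2 + w ^ 2 : ℂ) = (b + (1:ℝ) * w * Complex.I) * (b + (-1:ℝ) * w * Complex.I) := by
      push_cast; ring_nf; simp
    have e4 : (b : ℂ) = ((b + (1:ℝ) * w * Complex.I) + (b + (-1:ℝ) * w * Complex.I)) / 2 := by
      push_cast; ring
    have npi : (Real.pi : ℂ) ≠ 0 := by exact_mod_cast hpi.ne'
    simp only [poisson]
    rw [Complex.ofReal_div, Complex.ofReal_mul, Complex.ofReal_add, Complex.ofReal_pow,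
      Complex.ofReal_pow, e3]
    generalize (b + (1:ℝ) * w * Complex.I : ℂ) = p at *
    generalize (b + (-1:ℝ) * w * Complex.I : ℂ) = m at *
    rw [e4]
    field_simp
  have hfc : Continuous f := by fun_prop
  have hfi : Integrable f := by simpa using hint 0
  have hFi : Integrable (𝓕 f) := by rw [hF]; exact (integrable_poisson hb).ofReal
  have := congrFun (hfc.fourierInv_fourier_eq hfi hFi) (-k / (2 * Real.pi))
  rw [hF, Real.fourierInv_eq'] at this
  have e : f (-k / (2 * Real.pi)) = Complex.exp (-(k * b)) := by
    simp only [f]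
    rw [abs_div, abs_neg, abs_of_nonneg hk, abs_of_pos (by positivity)]
    congr 1
    rw [← Complex.ofReal_mul]
    congr 2
    field_simp
  rw [e] at this
  rw [← this]
  congr 1; ext v
  rw [smul_eq_mul, mul_comm]
  congr 2
  simp only [RCLike.inner_apply, conj_trivial]
  rw [show 2 * Real.pi * (-k / (2 * Real.pi) * v) = -(k * v) by field_simp]
  push_cast; ring

/-! ### Convolution identities -/

/-- The Cauchy transform of the Gaussian is `lap 0`. -/
theorem integral_heat_div {t a : ℝ} (ht : 0 < t) (ha : 0 < a) (X : ℝ) :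
    ∫ v : ℝ, (heat 0 t v : ℂ) * (1 / (a - Complex.I * (X - v))) = lap 0 t (a - Complex.I * X) := by
  have hre : ∀ v : ℝ, 0 < (a - Complex.I * (X - v) : ℂ).re := by intro v; simp [ha]
  have h1 : ∀ v : ℝ, (heat 0 t v : ℂ) * (1 / (a - Complex.I * (X - v))) =
      ∫ k in Ioi (0 : ℝ), (heat 0 t v : ℂ) * Complex.exp (-(k * (a - Complex.I * (X - v)))) := by
    intro v
    rw [integral_const_mul, integral_exp_neg_mul_Ioi (hre v)]
  simp_rw [h1]
  rw [integral_integral_swap]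
  · unfold lap
    refine setIntegral_congr_fun measurableSet_Ioi fun k _ => ?_
    have e : ∀ v : ℝ, (heat 0 t v : ℂ) * Complex.exp (-(k * (a - Complex.I * (X - v)))) =
       Complex.exp (-(k * (a - Complex.I * X))) *
        ((heat 0 t v : ℂ) * Complex.exp (-(Complex.I * k * v))) := by
      intro v
      rw [mul_left_comm, ← Complex.exp_add]
      congr 2; ring
    simp_rw [e]
    rw [integral_const_mul, integral_heat_mul_cexp ht, ← Complex.exp_add, pow_zero, one_mul]
    congr 1; push_cast; ring
  · have hk : IntegrableOn (fun k : ℝ => Real.exp (-a * k)) (Ioi 0) :=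
      exp_neg_integrableOn_Ioi 0 ha
    refine ((integrable_heat 0 ht).mul_prod hk).mono'
      ((((continuous_heat 0 ht).comp continuous_fst).measurable.complex_ofReal.mul
        (by fun_prop)).aestronglyMeasurable) (ae_of_all _ fun p => ?_)
    simp only [Function.uncurry]
    rw [norm_mul, Complex.norm_real, Real.norm_eq_abs, abs_of_pos (heat_zero_pos ht _),
      Complex.norm_exp]
    simp [mul_comm]

/-- Convolution with the Poisson kernel shifts the argument of `lap` into the right half plane. -/
theorem integral_poisson_mul_lap (n : ℕ) {t a b : ℝ} (ht : 0 < t) (hb : 0 < b) (X : ℝ) :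
    ∫ v : ℝ, (poisson b v : ℂ) * lap n t (a - Complex.I * (X - v)) =
      lap n t (a + b - Complex.I * X) := by
  unfold lap
  simp_rw [← integral_const_mul]
  rw [integral_integral_swap]
  · refine setIntegral_congr_fun measurableSet_Ioi fun k hk => ?_
    have e : ∀ v : ℝ, (poisson b v : ℂ) * ((k : ℂ) ^ n *
        Complex.exp (-(t * k ^ 2) - k * (a - Complex.I * (X - v)))) =
       ((k : ℂ) ^ n * Complex.exp (-(t * k ^ 2) - k * (a - Complex.I * X))) *
        ((poisson b v : ℂ) * Complex.exp (-(Complex.I * k * v))) := by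
      intro v
      rw [mul_left_comm (_ * _) (poisson b v : ℂ), mul_assoc, ← Complex.exp_add]
      congr 3; ring
    simp_rw [e]
    rw [integral_const_mul, integral_poisson_mul_cexp hb (le_of_lt hk), mul_assoc,
      ← Complex.exp_add]
    congr 2; ring
  · have hk := integrableOn_pow_mul_exp n ht (-a)
    refine ((integrable_poisson hb).mul_prod hk).mono'
      ((((continuous_poisson hb).comp continuous_fst).measurable.complex_ofReal.mul
        (by fun_prop)).aestronglyMeasurable) ?_
    have : ∀ᵐ p : ℝ × ℝ ∂(volume.prod (volume.restrict (Ioi 0))), p.2 ∈ Ioi (0 : ℝ) :=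
      Measure.quasiMeasurePreserving_snd.ae (ae_restrict_mem measurableSet_Ioi)
    filter_upwards [this] with p hp
    simp only [Function.uncurry]
    rw [norm_mul, Complex.norm_real, Real.norm_eq_abs, abs_of_nonneg (poisson_nonneg hb.le _)]
    refine mul_le_mul_of_nonneg_left ?_ (poisson_nonneg hb.le _)
    exact lap_integrand_bound n le_rfl (by simp) hp

/-- Fourier inversion for the derivatives of the Gaussian. -/
theorem heat_eq_re_lap (j : ℕ) {t : ℝ} (ht : 0 < t) (x : ℝ) :
    heat j t x = 1 / Real.pi * (Complex.I ^ j * lap j t (-(Complex.I * x))).re := by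
  induction j generalizing x with
  | zero =>
    have hpi := Real.pi_pos
    have htc : (t : ℂ) ≠ 0 := by exact_mod_cast ht.ne'
    have h := fourierIntegral_gaussian (b := t) (by simpa using ht) x
    let f : ℝ → ℂ := fun k => Complex.exp (Complex.I * x * k) * Complex.exp (-t * k ^ 2)
    have hf : ∀ k : ℝ, f k = (k : ℂ) ^ 0 * Complex.exp (-(t * k ^ 2) - k * (-(Complex.I * x))) := by
      intro k
      simp only [f]
      rw [pow_zero, one_mul, ← Complex.exp_add]; congr 1; ring
    have hfn : ∀ k : ℝ, f (-k) = (starRingEnd ℂ) (f k) := by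
      intro k
      simp only [f, map_mul, ← Complex.exp_conj, Complex.conj_I, Complex.conj_ofReal, map_neg, map_pow]
      push_cast; ring_nf
    have hi : IntegrableOn f (Ioi 0) :=
      (integrableOn_lap 0 ht (-(Complex.I * x))).congr_fun (fun k _ => (hf k).symm) measurableSet_Ioi
    have hi2 : IntegrableOn f (Iic 0) := by
      have : IntegrableOn (fun k => f (-k)) (Ici 0) := by
        rw [integrableOn_Ici_iff_integrableOn_Ioi]
        simp_rw [hfn]
        exact (Complex.conjCLE.toContinuousLinearMap.integrable_comp hi)
      have h3 := this.comp_neg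
      simpa using h3
    have hs : ∫ k, f k = (lap 0 t (-(Complex.I * x))) + (starRingEnd ℂ) (lap 0 t (-(Complex.I * x))) := by
      rw [← intervalIntegral.integral_Iic_add_Ioi hi2 hi, ← neg_zero, ← integral_comp_neg_Ioi,
        neg_zero, add_comm]
      simp_rw [hfn]
      rw [integral_conj]
      have : ∫ k in Ioi (0 : ℝ), f k = lap 0 t (-(Complex.I * x)) := by
        unfold lap
        exact setIntegral_congr_fun measurableSet_Ioi fun k _ => hf k
      rw [this]
    have hpos : 0 ≤ Real.pi / t := by positivity
    have hs2 : ∫ k, f k = ((2 * Real.pi * heat 0 t x : ℝ) : ℂ) := by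
      simp only [f]
      rw [h, show (1 / 2 : ℂ) = ((1 / 2 : ℝ) : ℂ) by push_cast; rfl, ← Complex.ofReal_div,
        ← Complex.ofReal_cpow hpos, ← Real.sqrt_eq_rpow, heat_zero_eq ht]
      have e : √(Real.pi / t) = 2 * Real.pi * (√(4 * Real.pi * t))⁻¹ := by
        rw [Real.sqrt_eq_iff_mul_self_eq hpos (by positivity)]
        have := Real.mul_self_sqrt (show 0 ≤ 4 * Real.pi * t by positivity)
        have h0 : 0 < √(4 * Real.pi * t) := Real.sqrt_pos.2 (by positivity)
        rw [mul_mul_mul_comm, ← mul_inv, this]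
        field_simp; ring
      rw [e]
      push_cast
      rw [mul_assoc (2 * (Real.pi : ℂ))]
    rw [hs2, Complex.add_conj] at hs
    have := Complex.ofReal_injective hs
    rw [pow_zero, one_mul]
    field_simp
    linarith
  | succ j ih =>
    have h1 := hasDerivAt_heat j ht x
    have h2 : HasDerivAt (fun x : ℝ => 1 / Real.pi * (Complex.I ^ j * lap j t (-(Complex.I * x))).re)
        (1 / Real.pi * (Complex.I ^ (j + 1) * lap (j + 1) t (-(Complex.I * x))).re) x := by
      have := ((hasDerivAt_lap j ht 0 (-Complex.I) x).const_mul (Complex.I ^ j))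
      have h3 := (Complex.reCLM.hasFDerivAt.comp_hasDerivAt x this).const_mul (1 / Real.pi)
      refine (h3.congr_deriv ?_).congr_of_eventuallyEq (Eventually.of_forall fun y => ?_)
      · simp [pow_succ, mul_assoc]
      · simp
    exact h1.unique (h2.congr_of_eventuallyEq (Eventually.of_forall fun y => ih y))

/-! ### The Poisson extension of the heat kernel -/

/-- The Poisson extension to height `a` of the `j`-th derivative of the heat kernel. -/
noncomputable def heatPoisson (j : ℕ) (t a X : ℝ) : ℝ :=
  1 / Real.pi * (Complex.I ^ j * lap j t (a - Complex.I * X)).re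

theorem heatPoisson_zero (j : ℕ) {t : ℝ} (ht : 0 < t) (X : ℝ) :
    heatPoisson j t 0 X = heat j t X := by
  rw [heat_eq_re_lap j ht, heatPoisson]; simp

theorem heatPoisson_eq_conv (j : ℕ) {t b : ℝ} (ht : 0 < t) (hb : 0 < b) (X : ℝ) :
    heatPoisson j t b X = ∫ v, poisson b v * heat j t (X - v) := by
  have h := integral_poisson_mul_lap j (a := 0) ht hb X
  rw [Complex.ofReal_zero, zero_add] at h
  have hi : Integrable fun v : ℝ => (poisson b v : ℂ) * lap j t (0 - Complex.I * (X - v)) := by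
    obtain ⟨C, hC0, hC⟩ := exists_lap_bound j
    refine ((integrable_poisson hb).mul_const (C * (√t)⁻¹ ^ (j + 1))).mono'
      (((continuous_poisson hb).measurable.complex_ofReal).aestronglyMeasurable.mul
        ((continuous_lap j ht).comp (by fun_prop)).aestronglyMeasurable) (ae_of_all _ fun v => ?_)
    rw [norm_mul, Complex.norm_real, Real.norm_eq_abs, abs_of_nonneg (poisson_nonneg hb.le _)]
    exact mul_le_mul_of_nonneg_left (hC t ht _ (by simp)) (poisson_nonneg hb.le _)
  rw [heatPoisson, ← h, ← integral_const_mul]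
  have h2 := integral_re (hi.const_mul (Complex.I ^ j))
  simp only [RCLike.re_to_complex] at h2
  rw [← h2, ← integral_const_mul]
  congr 1; ext v
  rw [heat_eq_re_lap j ht, mul_left_comm, Complex.re_ofReal_mul]
  push_cast
  rw [zero_sub]
  ring

theorem continuous_heatPoisson (j : ℕ) {t : ℝ} (ht : 0 < t) :
    Continuous fun p : ℝ × ℝ => heatPoisson j t p.1 p.2 := by
  unfold heatPoisson
  have := continuous_lap j ht
  fun_prop

theorem exists_heatPoisson_bound (j : ℕ) : ∃ C : ℝ, 0 ≤ C ∧ ∀ t : ℝ, 0 < t → ∀ a X : ℝ, 0 ≤ a →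
    |heatPoisson j t a X| ≤ C * (√t)⁻¹ ^ (j + 1) := by
  obtain ⟨C, hC0, hC⟩ := exists_lap_bound j
  have hpi := Real.pi_pos
  refine ⟨1 / Real.pi * C, by positivity, fun t ht a X ha => ?_⟩
  rw [heatPoisson, abs_mul, abs_of_pos (by positivity), mul_assoc]
  refine mul_le_mul_of_nonneg_left ?_ (by positivity)
  refine (Complex.abs_re_le_norm _).trans ?_
  rw [norm_mul, norm_pow, Complex.norm_I, one_pow, one_mul]
  exact hC t ht _ (by simpa using ha)

theorem integrable_poisson_mul_heat (j : ℕ) {t b : ℝ} (ht : 0 < t) (hb : 0 < b) :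
    Integrable (fun p : ℝ × ℝ => poisson b p.2 * heat j t (p.1 - p.2)) (volume.prod volume) :=
  (integrable_poisson hb).convolution_integrand (ContinuousLinearMap.mul ℝ ℝ) (integrable_heat j ht)

theorem integrable_heatPoisson (j : ℕ) {t a : ℝ} (ht : 0 < t) (ha : 0 ≤ a) :
    Integrable (heatPoisson j t a) := by
  rcases ha.eq_or_lt with rfl | ha
  · simp_rw [funext (heatPoisson_zero j ht)]; exact integrable_heat j ht
  · simp_rw [funext (heatPoisson_eq_conv j ht ha)]
    exact (integrable_poisson_mul_heat j ht ha).integral_prod_left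

theorem integral_abs_heatPoisson_le (j : ℕ) {t a : ℝ} (ht : 0 < t) (ha : 0 ≤ a) :
    ∫ X, |heatPoisson j t a X| ≤ ∫ X, |heat j t X| := by
  rcases ha.eq_or_lt with rfl | ha
  · simp_rw [heatPoisson_zero j ht]; rfl
  · have hi := (integrable_poisson_mul_heat j ht ha).abs
    calc ∫ X, |heatPoisson j t a X| ≤ ∫ X, ∫ v, |poisson a v * heat j t (X - v)| := by
          refine integral_mono (integrable_heatPoisson j ht ha.le).abs hi.integral_prod_left
            fun X => ?_
          simp only
          rw [heatPoisson_eq_conv j ht ha]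
          exact abs_integral_le_integral_abs
      _ = ∫ v, ∫ X, |poisson a v * heat j t (X - v)| := integral_integral_swap hi
      _ = ∫ v, poisson a v * ∫ X, |heat j t X| := by
          congr 1; ext v
          simp_rw [abs_mul, abs_of_nonneg (poisson_nonneg ha.le v)]
          rw [integral_const_mul, integral_sub_right_eq_self (fun X => |heat j t X|)]
      _ = _ := by rw [integral_mul_const, integral_poisson ha, one_mul]

theorem integral_heatPoisson_mul_cexp {s b k : ℝ} (hs : 0 < s) (hb : 0 ≤ b) (hk : 0 ≤ k) :
    ∫ v : ℝ, (heatPoisson 0 s b v : ℂ) * Complex.exp (-(Complex.I * k * v)) =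
      Complex.exp (-(s * k ^ 2) - k * b) := by
  rcases hb.eq_or_lt with rfl | hb
  · simp_rw [heatPoisson_zero 0 hs]
    rw [integral_heat_mul_cexp hs]; push_cast; simp
  · have hi := integrable_poisson_mul_heat 0 hs hb
    have e : ∀ v : ℝ, (heatPoisson 0 s b v : ℂ) * Complex.exp (-(Complex.I * k * v)) =
        ∫ w : ℝ, ((poisson b w * heat 0 s (v - w) : ℝ) : ℂ) * Complex.exp (-(Complex.I * k * v)) := by
      intro v
      rw [heatPoisson_eq_conv 0 hs hb, integral_mul_const, integral_complex_ofReal]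
    simp_rw [e]
    rw [integral_integral_swap]
    · have e2 : ∀ w : ℝ, ∫ v : ℝ, ((poisson b w * heat 0 s (v - w) : ℝ) : ℂ) *
          Complex.exp (-(Complex.I * k * v)) = ((poisson b w : ℂ) * Complex.exp (-(Complex.I * k * w))) *
            Complex.exp (-(s * k ^ 2 : ℝ)) := by
        intro w
        rw [← integral_heat_mul_cexp hs k, ← integral_sub_right_eq_self
          (fun v : ℝ => (heat 0 s v : ℂ) * Complex.exp (-(Complex.I * k * v))) w,
          ← integral_const_mul]
        congr 1; ext v
        rw [show (-(Complex.I * k * v) : ℂ) = -(Complex.I * k * w) + -(Complex.I * k * ((v - w : ℝ) : ℂ)) by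
          push_cast; ring, Complex.exp_add]
        push_cast; ring
      simp_rw [e2]
      rw [integral_mul_const, integral_poisson_mul_cexp hb hk, ← Complex.exp_add]
      congr 1; push_cast; ring
    · refine hi.norm.mono' ((Complex.continuous_ofReal.comp_aestronglyMeasurable
        hi.aestronglyMeasurable).mul (by fun_prop))
        (ae_of_all _ fun p => ?_)
      simp only [Function.uncurry]
      rw [norm_mul, Complex.norm_exp, Complex.norm_real]
      simp

/-! ### Decay of the transform -/

/-- Integration by parts in the frequency. In `lap_recurrence_zero` it has a boundary term. -/
theorem lap_recurrence (n : ℕ) {t : ℝ} (ht : 0 < t) (ζ : ℂ) :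
    ζ * lap (n + 1) t ζ + 2 * t * lap (n + 2) t ζ = (n + 1) * lap n t ζ := by
  let F : ℕ → ℝ → ℂ := fun n k => (k : ℂ) ^ n * Complex.exp (-(t * k ^ 2) - k * ζ)
  have hF : ∀ n, IntegrableOn (F n) (Ioi 0) := fun n => integrableOn_lap n ht ζ
  have hd : ∀ k : ℝ, HasDerivAt (F (n + 1))
      ((n + 1) * F n k - ζ * F (n + 1) k - 2 * t * F (n + 2) k) k := by
    intro k
    have h0 : HasDerivAt (fun k : ℝ => (k : ℂ)) 1 k := Complex.ofRealCLM.hasDerivAt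
    have h2 : HasDerivAt (fun k : ℝ => -((t : ℂ) * k ^ 2) - k * ζ) (-(t * (2 * k)) - ζ) k := by
      refine (((h0.pow 2).const_mul (t : ℂ)).neg.sub (h0.mul_const ζ)).congr_deriv ?_
      simp
    have h1 := (h0.pow (n + 1)).mul h2.cexp
    refine h1.congr_deriv ?_
    simp only [F, Pi.pow_apply, Nat.add_sub_cancel]
    push_cast; ring
  have hi : IntegrableOn (fun k => (n + 1) * F n k - ζ * F (n + 1) k - 2 * t * F (n + 2) k) (Ioi 0) :=
    (((hF n).const_mul _).sub ((hF (n + 1)).const_mul _)).sub ((hF (n + 2)).const_mul _)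
  have h := integral_Ioi_of_hasDerivAt_of_tendsto' (fun k _ => hd k) hi
    (tendsto_zero_of_hasDerivAt_of_integrableOn_Ioi (fun k _ => hd k) hi (hF (n + 1)))
  rw [integral_sub (f := fun k => (n + 1) * F n k - ζ * F (n + 1) k)
      (((hF n).const_mul _).sub ((hF (n + 1)).const_mul _)) ((hF (n + 2)).const_mul _),
    integral_sub ((hF n).const_mul _) ((hF (n + 1)).const_mul _), integral_const_mul,
    integral_const_mul, integral_const_mul] at h
  have h3 : F (n + 1) 0 = 0 := by simp [F]
  rw [h3, sub_zero] at h
  change (n + 1) * lap n t ζ - ζ * lap (n + 1) t ζ - 2 * t * lap (n + 2) t ζ = 0 at h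
  linear_combination -h

theorem lap_recurrence_zero {t : ℝ} (ht : 0 < t) (ζ : ℂ) :
    ζ * lap 0 t ζ + 2 * t * lap 1 t ζ = 1 := by
  let F : ℕ → ℝ → ℂ := fun n k => (k : ℂ) ^ n * Complex.exp (-(t * k ^ 2) - k * ζ)
  have hF : ∀ n, IntegrableOn (F n) (Ioi 0) := fun n => integrableOn_lap n ht ζ
  have hd : ∀ k : ℝ, HasDerivAt (F 0) (- ζ * F 0 k - 2 * t * F 1 k) k := by
    intro k
    have h0 : HasDerivAt (fun k : ℝ => (k : ℂ)) 1 k := Complex.ofRealCLM.hasDerivAt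
    have h2 : HasDerivAt (fun k : ℝ => -((t : ℂ) * k ^ 2) - k * ζ) (-(t * (2 * k)) - ζ) k := by
      refine (((h0.pow 2).const_mul (t : ℂ)).neg.sub (h0.mul_const ζ)).congr_deriv ?_
      simp
    have h1 := (h0.pow 0).mul h2.cexp
    refine h1.congr_deriv ?_
    simp only [F, Pi.pow_apply]
    push_cast; simp; ring
  have hi : IntegrableOn (fun k => - ζ * F 0 k - 2 * t * F 1 k) (Ioi 0) :=
    ((hF 0).const_mul _).sub ((hF 1).const_mul _)
  have h := integral_Ioi_of_hasDerivAt_of_tendsto' (fun k _ => hd k) hi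
    (tendsto_zero_of_hasDerivAt_of_integrableOn_Ioi (fun k _ => hd k) hi (hF 0))
  rw [integral_sub ((hF 0).const_mul _) ((hF 1).const_mul _), integral_const_mul,
    integral_const_mul] at h
  have h3 : F 0 0 = 1 := by simp [F]
  rw [h3] at h
  change -ζ * lap 0 t ζ - 2 * t * lap 1 t ζ = 0 - 1 at h
  linear_combination -h

/-- `ζ² lap 1 t ζ` is bounded by the recurrences, which gives decay of order two along vertical lines.
(`lap 0` decays only to order one.) -/
theorem exists_lap_one_decay {t : ℝ} (ht : 0 < t) : ∃ C : ℝ, 0 ≤ C ∧ ∀ a X : ℝ, 0 ≤ a →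
    ‖lap 1 t (a - Complex.I * X)‖ ≤ C * (1 + X ^ 2)⁻¹ := by
  obtain ⟨C1, h1, hC1⟩ := exists_lap_bound 1
  obtain ⟨C3, h3, hC3⟩ := exists_lap_bound 3
  set B1 := C1 * (√t)⁻¹ ^ (1 + 1)
  set B3 := C3 * (√t)⁻¹ ^ (3 + 1)
  have hB1 : 0 ≤ B1 := by positivity
  have hB3 : 0 ≤ B3 := by positivity
  refine ⟨B1 + 1 + 6 * t * B1 + 4 * t ^ 2 * B3, by positivity, fun a X ha => ?_⟩
  set ζ : ℂ := a - Complex.I * X with hζ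
  have hre : 0 ≤ ζ.re := by simpa [hζ] using ha
  have b1 : ‖lap 1 t ζ‖ ≤ B1 := hC1 t ht ζ hre
  have b3 : ‖lap 3 t ζ‖ ≤ B3 := hC3 t ht ζ hre
  have e : ζ ^ 2 * lap 1 t ζ = 1 - 6 * t * lap 1 t ζ + 4 * t ^ 2 * lap 3 t ζ := by
    have r0 := lap_recurrence_zero ht ζ
    have r1 := lap_recurrence 0 ht ζ
    have r2 := lap_recurrence 1 ht ζ
    push_cast at r1 r2
    simp only [zero_add, one_mul] at r0 r1 r2
    linear_combination ζ * r1 + r0 - 2 * t * r2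
  have hn : X ^ 2 * ‖lap 1 t ζ‖ ≤ 1 + 6 * t * B1 + 4 * t ^ 2 * B3 := by
    have hX : X ^ 2 ≤ ‖ζ ^ 2‖ := by
      rw [norm_pow, ← sq_abs X]
      have : |X| ≤ ‖ζ‖ := by
        have := Complex.abs_im_le_norm ζ
        simpa [hζ] using this
      gcongr
    calc X ^ 2 * ‖lap 1 t ζ‖ ≤ ‖ζ ^ 2‖ * ‖lap 1 t ζ‖ := by gcongr
      _ = ‖1 - 6 * t * lap 1 t ζ + 4 * t ^ 2 * lap 3 t ζ‖ := by rw [← norm_mul, e]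
      _ ≤ ‖(1 : ℂ)‖ + ‖6 * t * lap 1 t ζ‖ + ‖4 * t ^ 2 * lap 3 t ζ‖ :=
          (norm_add_le _ _).trans (by gcongr; exact norm_sub_le _ _)
      _ = 1 + 6 * t * ‖lap 1 t ζ‖ + 4 * t ^ 2 * ‖lap 3 t ζ‖ := by
          simp [abs_of_pos ht]
      _ ≤ _ := by gcongr
  rw [← div_eq_mul_inv, le_div_iff₀ (by positivity)]
  nlinarith

/-! ### The logarithmic kernel and the Biot–Savart kernel -/

theorem E_eq (x : ℝ × ℝ) : E x = -(1 / (4 * Real.pi)) * Real.log (normSq x) := by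
  rw [E, Real.log_sqrt (by unfold normSq; positivity)]
  have := Real.pi_pos
  field_simp; ring

theorem hasFDerivAt_E {x : ℝ × ℝ} (hx : normSq x ≠ 0) :
    HasFDerivAt E ((-(1 / (2 * Real.pi)) * (x.1 / normSq x)) • ContinuousLinearMap.fst ℝ ℝ ℝ +
      (-(1 / (2 * Real.pi)) * (x.2 / normSq x)) • ContinuousLinearMap.snd ℝ ℝ ℝ) x := by
  have h1 : HasFDerivAt normSq ((2 * x.1) • ContinuousLinearMap.fst ℝ ℝ ℝ +
      (2 * x.2) • ContinuousLinearMap.snd ℝ ℝ ℝ) x := by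
    have := ((hasFDerivAt_fst (𝕜 := ℝ) (p := x)).pow 2).add ((hasFDerivAt_snd (𝕜 := ℝ) (p := x)).pow 2)
    refine this.congr_fderiv ?_
    ext <;> simp
  have h2 := (h1.log hx).const_mul (-(1 / (4 * Real.pi)))
  refine (h2.congr_fderiv ?_).congr_of_eventuallyEq (Eventually.of_forall E_eq)
  have := Real.pi_pos
  ext <;> simp <;> field_simp <;> ring

theorem pd_eq_of_hasFDerivAt {f : ℝ × ℝ → ℝ} {f' : ℝ × ℝ →L[ℝ] ℝ} {x : ℝ × ℝ}
    (h : HasFDerivAt f f' x) (i : Fin 2) : pd i f x = f' (basisVec i) :=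
  (h.hasLineDerivAt (basisVec i)).lineDeriv

theorem pd_zero_eq_deriv (f : ℝ × ℝ → ℝ) (x : ℝ × ℝ) :
    pd 0 f x = deriv (fun s => f (s, x.2)) x.1 := by
  simp only [pd, lineDeriv, basisVec]
  have := deriv_comp_const_add (f := fun s => f (s, x.2)) x.1 0
  rw [add_zero] at this
  rw [← this]
  congr 1; ext s; congr 1; ext <;> simp

theorem pd_one_eq_deriv (f : ℝ × ℝ → ℝ) (x : ℝ × ℝ) :
    pd 1 f x = deriv (fun s => f (x.1, s)) x.2 := by
  simp only [pd, lineDeriv, basisVec]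
  have := deriv_comp_const_add (f := fun s => f (x.1, s)) x.2 0
  rw [add_zero] at this
  rw [← this]
  congr 1; ext s; congr 1; ext <;> simp

theorem pd_zero_E {x : ℝ × ℝ} (hx : normSq x ≠ 0) :
    pd 0 E x = -(1 / (2 * Real.pi)) * (x.1 / normSq x) := by
  rw [pd_eq_of_hasFDerivAt (hasFDerivAt_E hx)]; simp [basisVec]

theorem pd_one_E {x : ℝ × ℝ} (hx : normSq x ≠ 0) :
    pd 1 E x = -(1 / (2 * Real.pi)) * (x.2 / normSq x) := by
  rw [pd_eq_of_hasFDerivAt (hasFDerivAt_E hx)]; simp [basisVec]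

theorem normSq_eq_zero {x : ℝ × ℝ} : normSq x = 0 ↔ x = 0 := by
  unfold normSq
  constructor
  · intro h
    have h1 : x.1 = 0 := by nlinarith [sq_nonneg x.1, sq_nonneg x.2]
    have h2 : x.2 = 0 := by nlinarith [sq_nonneg x.1, sq_nonneg x.2]
    exact Prod.ext h1 h2
  · rintro rfl; simp

theorem continuous_normSq : Continuous normSq := by unfold normSq; fun_prop

/-- The explicit form of the Biot–Savart kernel away from its singularity. -/
noncomputable def bsKernel (z y : ℝ × ℝ) (i : Fin 2) : ℝ :=
  if i = 0 then 1 / (2 * Real.pi) * (-((z.2 - y.2) / normSq (z - y)) +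
    (z.2 + y.2) / normSq (z - reflect y))
  else 1 / (2 * Real.pi) * ((z.1 - y.1) / normSq (z - y) - (z.1 - y.1) / normSq (z - reflect y))

theorem reflect_of_zero {y : ℝ × ℝ} (hy : y.2 = 0) : reflect y = y := by
  ext <;> simp [reflect, hy]

/-- A point vortex on the boundary coincides with its image, and `D` vanishes identically. -/
theorem biotSavartKernel_boundary {y : ℝ × ℝ} (hy : y.2 = 0) (z : ℝ × ℝ) (i : Fin 2) :
    biotSavartKernel z y i = 0 := by
  have h : (fun x' => D x' y) = fun _ => 0 := by
    ext x'; simp [D, reflect_of_zero hy]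
  unfold biotSavartKernel
  rw [h]
  simp [pd, lineDeriv]

theorem bsKernel_boundary {y : ℝ × ℝ} (hy : y.2 = 0) (z : ℝ × ℝ) (i : Fin 2) :
    bsKernel z y i = 0 := by
  unfold bsKernel
  rw [reflect_of_zero hy, hy]; simp

theorem biotSavartKernel_eq {z y : ℝ × ℝ} (hzy : z ≠ y) (hz : 0 ≤ z.2) (hy : 0 ≤ y.2) (i : Fin 2) :
    biotSavartKernel z y i = bsKernel z y i := by
  rcases hy.eq_or_lt with hy | hy
  · rw [biotSavartKernel_boundary hy.symm, bsKernel_boundary hy.symm]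
  have h1 : normSq (z - y) ≠ 0 := by rwa [Ne, normSq_eq_zero, sub_eq_zero]
  have h2 : normSq (z - reflect y) ≠ 0 := by
    rw [Ne, normSq_eq_zero, sub_eq_zero]
    intro h
    have := congrArg Prod.snd h
    simp [reflect] at this
    linarith
  have hD : HasFDerivAt (fun x' => D x' y) _ z :=
    ((hasFDerivAt_E h1).comp z ((hasFDerivAt_id z).sub_const y)).sub
      ((hasFDerivAt_E h2).comp z ((hasFDerivAt_id z).sub_const (reflect y)))
  unfold biotSavartKernel bsKernel
  rw [pd_eq_of_hasFDerivAt hD, pd_eq_of_hasFDerivAt hD]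
  fin_cases i
  · simp [basisVec, reflect]; ring
  · simp [basisVec, reflect]; ring

theorem bsKernel_zero_eq (z y : ℝ × ℝ) :
    bsKernel z y 0 = 1 / 2 * (-poisson (z.2 - y.2) (z.1 - y.1) + poisson (z.2 + y.2) (z.1 - y.1)) := by
  simp only [bsKernel, poisson, if_true, normSq, reflect, Prod.fst_sub, Prod.snd_sub, sub_neg_eq_add]
  rw [add_comm ((z.1 - y.1) ^ 2), add_comm ((z.1 - y.1) ^ 2)]
  simp only [div_eq_mul_inv, mul_inv]
  ring

/-- `k₁ - i k₂` is a difference of Cauchy kernels. -/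
theorem bsKernel_complex (z y : ℝ × ℝ) :
    (bsKernel z y 0 : ℂ) - Complex.I * bsKernel z y 1 = -(1 / (2 * Real.pi)) *
      (1 / ((z.2 - y.2 : ℝ) - Complex.I * (z.1 - y.1 : ℝ)) -
        1 / ((z.2 + y.2 : ℝ) - Complex.I * (z.1 - y.1 : ℝ))) := by
  have key : ∀ a b : ℝ, (1 / ((a : ℂ) - Complex.I * b)) =
      ((a / (b ^ 2 + a ^ 2) : ℝ) : ℂ) + Complex.I * ((b / (b ^ 2 + a ^ 2) : ℝ) : ℂ) := by
    intro a b
    have h : Complex.normSq ((a : ℂ) - Complex.I * b) = b ^ 2 + a ^ 2 := by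
      simp [Complex.normSq_apply]; ring
    rw [one_div, Complex.inv_def, h]
    simp only [map_sub, map_mul, Complex.conj_I, Complex.conj_ofReal]
    push_cast; ring
  rw [key, key]
  simp only [bsKernel, if_true, normSq, reflect, Prod.fst_sub, Prod.snd_sub, sub_neg_eq_add,
    one_ne_zero, if_false]
  push_cast; ring

theorem inv_sqrt_add_sq_le (a b : ℝ) :
    (√(b ^ 2 + a ^ 2))⁻¹ ≤ (√|b|)⁻¹ * (√|a|)⁻¹ ∨ a = 0 ∨ b = 0 := by
  by_cases ha : a = 0
  · simp [ha]
  by_cases hb : b = 0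
  · simp [hb]
  left
  have ha' := abs_pos.2 ha
  have hb' := abs_pos.2 hb
  rw [← mul_inv, ← Real.sqrt_mul hb'.le]
  apply inv_anti₀ (by positivity)
  apply Real.sqrt_le_sqrt
  nlinarith [sq_abs a, sq_abs b, sq_nonneg (|a| - |b|)]

theorem abs_div_sq_add_sq_le {a b c : ℝ} (ha : a ≠ 0) (hb : b ≠ 0) (hc : |c| ≤ √(b ^ 2 + a ^ 2)) :
    |c / (b ^ 2 + a ^ 2)| ≤ (√|b|)⁻¹ * (√|a|)⁻¹ := by
  have h := (inv_sqrt_add_sq_le a b).resolve_right (by tauto)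
  have hp : 0 < b ^ 2 + a ^ 2 := by positivity
  refine le_trans ?_ h
  rw [abs_div, abs_of_pos hp, div_le_iff₀ hp]
  have := Real.mul_self_sqrt hp.le
  have h0 := Real.sqrt_pos.2 hp
  calc |c| ≤ √(b ^ 2 + a ^ 2) := hc
    _ = (√(b ^ 2 + a ^ 2))⁻¹ * (√(b ^ 2 + a ^ 2) * √(b ^ 2 + a ^ 2)) := by field_simp
    _ = _ := by rw [this]

/-- The singularity of the Biot–Savart kernel is bounded by a product of inverse square roots, which is
integrable in each variable separately. -/
theorem abs_bsKernel_le {z y : ℝ × ℝ} (h1 : z.1 ≠ y.1) (h2 : z.2 ≠ y.2) (hz : 0 ≤ z.2) (hy : 0 ≤ y.2)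
    (i : Fin 2) : |bsKernel z y i| ≤ (√|z.1 - y.1|)⁻¹ * (√|z.2 - y.2|)⁻¹ := by
  have h1' := sub_ne_zero.2 h1
  have h2' := sub_ne_zero.2 h2
  have h3 : z.2 + y.2 ≠ 0 := by
    intro h; apply h2; linarith
  have hm : (√|z.1 - y.1|)⁻¹ * (√|z.2 + y.2|)⁻¹ ≤ (√|z.1 - y.1|)⁻¹ * (√|z.2 - y.2|)⁻¹ := by
    have := abs_pos.2 h2'
    gcongr _ * ?_
    apply inv_anti₀ (Real.sqrt_pos.2 this)
    apply Real.sqrt_le_sqrt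
    rw [abs_of_nonneg (by linarith : 0 ≤ z.2 + y.2), abs_le]
    constructor <;> linarith
  have hs : ∀ a b : ℝ, |a| ≤ √(b ^ 2 + a ^ 2) ∧ |b| ≤ √(b ^ 2 + a ^ 2) := fun a b =>
    ⟨Real.abs_le_sqrt (by nlinarith [sq_nonneg b]), Real.abs_le_sqrt (by nlinarith [sq_nonneg a])⟩
  have e1 := abs_div_sq_add_sq_le h2' h1' (hs (z.2 - y.2) (z.1 - y.1)).1
  have e2 := abs_div_sq_add_sq_le h2' h1' (hs (z.2 - y.2) (z.1 - y.1)).2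
  have e3 := (abs_div_sq_add_sq_le h3 h1' (hs (z.2 + y.2) (z.1 - y.1)).1).trans hm
  have e4 := (abs_div_sq_add_sq_le h3 h1' (hs (z.2 + y.2) (z.1 - y.1)).2).trans hm
  have hpi : 1 / (2 * Real.pi) ≤ 1 / 2 := by
    apply one_div_le_one_div_of_le (by norm_num); linarith [Real.pi_gt_three]
  have hpi0 : 0 ≤ 1 / (2 * Real.pi) := by have := Real.pi_pos; positivity
  set B := (√|z.1 - y.1|)⁻¹ * (√|z.2 - y.2|)⁻¹
  have fin : ∀ p q : ℝ, |p| ≤ B → |q| ≤ B → |1 / (2 * Real.pi) * (p - q)| ≤ B := by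
    intro p q hp hq
    rw [abs_mul, abs_of_nonneg hpi0]
    have h := (abs_sub p q).trans (add_le_add hp hq)
    calc _ ≤ 1 / 2 * |p - q| := by gcongr
      _ ≤ _ := by linarith
  simp only [bsKernel, normSq, reflect, Prod.fst_sub, Prod.snd_sub, sub_neg_eq_add]
  split_ifs
  · rw [← sub_eq_neg_add]; exact fin _ _ e3 e1
  · exact fin _ _ e2 e4

/-! ### Integrals with an inverse square root singularity -/

theorem integrable_inv_sqrt_indicator :
    Integrable ((Ioo (-1 : ℝ) 1).indicator fun s => (√|s|)⁻¹) := by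
  rw [integrable_indicator_iff measurableSet_Ioo]
  have h1 : IntervalIntegrable (fun s : ℝ => s ^ (-(1 / 2) : ℝ)) volume 0 1 :=
    intervalIntegral.intervalIntegrable_rpow' (by norm_num)
  have h2 : IntegrableOn (fun s : ℝ => (√|s|)⁻¹) (Ioc 0 1) := by
    rw [intervalIntegrable_iff_integrableOn_Ioc_of_le zero_le_one] at h1
    refine h1.congr_fun (fun s hs => ?_) measurableSet_Ioc
    simp only
    rw [abs_of_pos hs.1, Real.rpow_neg hs.1.le, Real.sqrt_eq_rpow]
  have h3 : IntegrableOn (fun s : ℝ => (√|s|)⁻¹) (Ico (-1) 0) := by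
    have := h2.comp_neg
    simpa using this
  have h4 : IntegrableOn (fun s : ℝ => (√|s|)⁻¹) {0} := by simp
  refine ((h3.union h4).union h2).mono_set fun s hs => ?_
  rcases lt_trichotomy s 0 with h | h | h
  · exact Or.inl (Or.inl ⟨hs.1.le, h⟩)
  · exact Or.inl (Or.inr h)
  · exact Or.inr ⟨h, hs.2.le⟩

theorem inv_sqrt_mul_le {A : ℝ → ℝ} {M : ℝ} (h0 : ∀ v, 0 ≤ A v) (hM : ∀ v, A v ≤ M) (y v : ℝ) :
    (√|v - y|)⁻¹ * A v ≤ A v + M * (Ioo (-1 : ℝ) 1).indicator (fun s => (√|s|)⁻¹) (v - y) := by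
  by_cases h : v - y ∈ Ioo (-1 : ℝ) 1
  · rw [indicator_of_mem h]
    have := mul_le_mul_of_nonneg_left (hM v) (show 0 ≤ (√|v - y|)⁻¹ by positivity)
    linarith [h0 v]
  · rw [indicator_of_notMem h, mul_zero, add_zero]
    have : 1 ≤ √|v - y| := by
      rw [Real.one_le_sqrt]
      by_contra hc
      exact h (abs_lt.1 (not_le.1 hc))
    have := inv_le_one_of_one_le₀ this
    nlinarith [h0 v]

theorem integrable_inv_sqrt_mul {A : ℝ → ℝ} {M : ℝ} (h0 : ∀ v, 0 ≤ A v) (hM : ∀ v, A v ≤ M)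
    (hA : Integrable A) (y : ℝ) : Integrable fun v => (√|v - y|)⁻¹ * A v := by
  refine (hA.add ((integrable_inv_sqrt_indicator.comp_sub_right y).const_mul M)).mono'
    ((by fun_prop : Measurable fun v : ℝ => (√|v - y|)⁻¹).aestronglyMeasurable.mul
      hA.aestronglyMeasurable) (ae_of_all _ fun v => ?_)
  rw [Real.norm_eq_abs, abs_of_nonneg (mul_nonneg (by positivity) (h0 v))]
  exact inv_sqrt_mul_le h0 hM y v

theorem exists_integral_inv_sqrt_mul_le {A : ℝ → ℝ} {M : ℝ} (h0 : ∀ v, 0 ≤ A v) (hM : ∀ v, A v ≤ M)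
    (hA : Integrable A) : ∃ C, ∀ y, ∫ v, (√|v - y|)⁻¹ * A v ≤ C := by
  refine ⟨(∫ v, A v) + M * ∫ s, (Ioo (-1 : ℝ) 1).indicator (fun s => (√|s|)⁻¹) s, fun y => ?_⟩
  rw [← integral_sub_right_eq_self ((Ioo (-1 : ℝ) 1).indicator (fun s => (√|s|)⁻¹)) y,
    ← integral_const_mul, ← integral_add hA
      ((integrable_inv_sqrt_indicator.comp_sub_right y).const_mul M)]
  exact integral_mono (integrable_inv_sqrt_mul h0 hM hA y)
    (hA.add ((integrable_inv_sqrt_indicator.comp_sub_right y).const_mul M)) (inv_sqrt_mul_le h0 hM y)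

/-! ### The Green matrix -/

theorem exists_heat_le (n : ℕ) {t : ℝ} (ht : 0 < t) : ∃ M : ℝ, 0 ≤ M ∧ ∀ v, |heat n t v| ≤ M := by
  obtain ⟨C, h0, hC⟩ := exists_heat_bound n
  refine ⟨C * (√t)⁻¹ ^ (n + 1), by positivity, fun v => (hC t ht v).trans ?_⟩
  refine mul_le_of_le_one_right (by positivity) (Real.exp_le_one_iff.2 ?_)
  have : 0 ≤ v ^ 2 / (8 * t) := by positivity
  rw [neg_div]; linarith

theorem heat_zero_nonneg {t : ℝ} (ht : 0 < t) (x : ℝ) : 0 ≤ heat 0 t x := (heat_zero_pos ht x).le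

theorem heatKernel_reflect {t : ℝ} (ht : 0 < t) (w z : ℝ × ℝ) :
    heatKernel (w - reflect z) t = heat 0 t (w.1 - z.1) * heat 0 t (w.2 + z.2) := by
  rw [heatKernel_eq ht]; simp [reflect]

theorem strip_eq (h : ℝ) : {w : ℝ × ℝ | 0 < w.2 ∧ w.2 < h} = univ ×ˢ Ioo 0 h := by
  ext w; simp

theorem norm_one_div_cauchy (a b : ℝ) : ‖(1 / ((a : ℂ) - Complex.I * b))‖ = (√(b ^ 2 + a ^ 2))⁻¹ := by
  rw [norm_div, norm_one, one_div, Complex.norm_def]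
  congr 2
  simp [Complex.normSq_apply]; ring

theorem integrable_strip {t : ℝ} (ht : 0 < t) (x z : ℝ × ℝ) :
    Integrable (fun w : ℝ × ℝ => (1 / (((x.2 - w.2 : ℝ) : ℂ) - Complex.I * ((x.1 - w.1 : ℝ) : ℂ))) *
      ((heat 0 t (w.1 - z.1) * heat 0 t (w.2 + z.2) : ℝ) : ℂ))
      (volume.prod (volume.restrict (Ioo 0 x.2))) := by
  obtain ⟨M, hM0, hM⟩ := exists_heat_le 0 ht
  have hM' : ∀ v, heat 0 t v ≤ M := fun v => (le_abs_self _).trans (hM v)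
  have i1 := integrable_inv_sqrt_mul (A := fun v => heat 0 t (v - z.1)) (M := M)
    (fun v => heat_zero_nonneg ht _) (fun v => hM' _) ((integrable_heat 0 ht).comp_sub_right _) x.1
  have i2 := integrable_inv_sqrt_mul (A := fun v => heat 0 t (v + z.2)) (M := M)
    (fun v => heat_zero_nonneg ht _) (fun v => hM' _) ((integrable_heat 0 ht).comp_add_right _) x.2
  have hc := continuous_heat 0 ht
  refine (i1.mul_prod (i2.restrict (s := Ioo 0 x.2))).mono' ?_ ?_
  · refine Measurable.aestronglyMeasurable ?_
    have hm := hc.measurable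
    fun_prop
  · have h1 : ∀ᵐ w : ℝ × ℝ ∂(volume.prod (volume.restrict (Ioo 0 x.2))), w.1 ≠ x.1 :=
      Measure.quasiMeasurePreserving_fst.ae (p := fun s => s ≠ x.1) (Measure.ae_ne volume x.1)
    have h2 : ∀ᵐ w : ℝ × ℝ ∂(volume.prod (volume.restrict (Ioo 0 x.2))), w.2 ∈ Ioo 0 x.2 :=
      Measure.quasiMeasurePreserving_snd.ae (ae_restrict_mem measurableSet_Ioo)
    filter_upwards [h1, h2] with w hw1 hw2
    have hb := (inv_sqrt_add_sq_le (x.2 - w.2) (x.1 - w.1)).resolve_right (by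
      rintro (h | h)
      · linarith [hw2.2]
      · exact hw1 (by linarith))
    rw [norm_mul, norm_one_div_cauchy, Complex.norm_real, Real.norm_eq_abs, abs_mul,
      abs_of_nonneg (heat_zero_nonneg ht _), abs_of_nonneg (heat_zero_nonneg ht _),
      abs_sub_comm w.1, abs_sub_comm w.2]
    have := mul_nonneg (heat_zero_nonneg ht (w.1 - z.1)) (heat_zero_nonneg ht (w.2 + z.2))
    calc _ ≤ ((√|x.1 - w.1|)⁻¹ * (√|x.2 - w.2|)⁻¹) * _ := mul_le_mul_of_nonneg_right hb this
      _ = _ := by ring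

/-- The tangential integral is the Cauchy transform of the Gaussian, so that only an integral over the
normal variable remains. -/
theorem integral_strip {t : ℝ} (ht : 0 < t) (x z : ℝ × ℝ) (hx : 0 < x.2) :
    ∫ w : ℝ × ℝ, (1 / (((x.2 - w.2 : ℝ) : ℂ) - Complex.I * ((x.1 - w.1 : ℝ) : ℂ))) *
      ((heat 0 t (w.1 - z.1) * heat 0 t (w.2 + z.2) : ℝ) : ℂ)
      ∂(volume.prod (volume.restrict (Ioo 0 x.2))) =
    ∫ w in (0 : ℝ)..x.2, (heat 0 t (w + z.2) : ℂ) * lap 0 t (x.2 - w - Complex.I * (x.1 - z.1)) := by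
  rw [integral_prod_symm _ (integrable_strip ht x z), intervalIntegral.integral_of_le hx.le,
    integral_Ioc_eq_integral_Ioo]
  refine setIntegral_congr_fun measurableSet_Ioo fun w hw => ?_
  have ha : 0 < x.2 - w := by linarith [hw.2]
  have h := integral_heat_div ht ha (x.1 - z.1)
  simp only
  rw [show lap 0 t ((x.2 : ℂ) - w - Complex.I * (x.1 - z.1)) = lap 0 t ((x.2 - w : ℝ) - Complex.I *
    ((x.1 - z.1 : ℝ) : ℂ)) by push_cast; rfl, ← h, ← integral_const_mul,
    ← integral_sub_right_eq_self (fun v : ℝ => (heat 0 t (w + z.2) : ℂ) * ((heat 0 t v : ℂ) *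
      (1 / ((x.2 - w : ℝ) - Complex.I * ((x.1 - z.1 : ℝ) - v))))) z.1]
  congr 1; ext v
  push_cast
  rw [show (x.1 : ℂ) - z.1 - (v - z.1) = x.1 - v by ring]
  ring

/-- The two strip integrals in the Green matrix, combined into one complex integral. -/
theorem strip_integral_eq {t : ℝ} (ht : 0 < t) (x z : ℝ × ℝ) (hx : 0 < x.2) :
    (∫ w in {w : ℝ × ℝ | 0 < w.2 ∧ w.2 < x.2}, pd 1 E (x - w) * heatKernel (w - reflect z) t) =
      (-(1 / (2 * Real.pi)) * ∫ w in (0 : ℝ)..x.2, (heat 0 t (w + z.2) : ℂ) *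
        lap 0 t (x.2 - w - Complex.I * (x.1 - z.1)) : ℂ).re ∧
    (∫ w in {w : ℝ × ℝ | 0 < w.2 ∧ w.2 < x.2}, pd 0 E (x - w) * heatKernel (w - reflect z) t) =
      (-(1 / (2 * Real.pi)) * ∫ w in (0 : ℝ)..x.2, (heat 0 t (w + z.2) : ℂ) *
        lap 0 t (x.2 - w - Complex.I * (x.1 - z.1)) : ℂ).im := by
  have hi := (integrable_strip ht x z).const_mul (-(1 / (2 * Real.pi)) : ℂ)
  rw [← integral_strip ht x z hx, ← integral_const_mul]
  have hm : (volume : Measure (ℝ × ℝ)).restrict {w : ℝ × ℝ | 0 < w.2 ∧ w.2 < x.2} =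
      volume.prod (volume.restrict (Ioo 0 x.2)) := by
    rw [strip_eq, Measure.volume_eq_prod, ← Measure.prod_restrict, Measure.restrict_univ]
  have h2 : ∀ᵐ w : ℝ × ℝ ∂(volume.prod (volume.restrict (Ioo 0 x.2))), w.2 ∈ Ioo 0 x.2 :=
    Measure.quasiMeasurePreserving_snd.ae (ae_restrict_mem measurableSet_Ioo)
  have key : ∀ a b : ℝ, (1 / ((a : ℂ) - Complex.I * b)) =
      ((a / (b ^ 2 + a ^ 2) : ℝ) : ℂ) + Complex.I * ((b / (b ^ 2 + a ^ 2) : ℝ) : ℂ) := by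
    intro a b
    have h : Complex.normSq ((a : ℂ) - Complex.I * b) = b ^ 2 + a ^ 2 := by
      simp [Complex.normSq_apply]; ring
    rw [one_div, Complex.inv_def, h]
    simp only [map_sub, map_mul, Complex.conj_I, Complex.conj_ofReal]
    push_cast; ring
  have e : ∀ (a b r : ℝ), -(1 / (2 * Real.pi) : ℂ) * (1 / ((a : ℂ) - Complex.I * b) * (r : ℂ)) =
      ((-(1 / (2 * Real.pi)) * (a / (b ^ 2 + a ^ 2)) * r : ℝ) : ℂ) +
        Complex.I * ((-(1 / (2 * Real.pi)) * (b / (b ^ 2 + a ^ 2)) * r : ℝ) : ℂ) := by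
    intro a b r
    rw [key]; push_cast; ring
  rw [hm]
  constructor
  · have := integral_re hi
    simp only [RCLike.re_to_complex] at this
    rw [← this]
    refine integral_congr_ae ?_
    filter_upwards [h2] with w hw
    have hn : normSq (x - w) ≠ 0 := by
      rw [Ne, normSq_eq_zero, sub_eq_zero]
      rintro rfl; exact lt_irrefl _ hw.2
    rw [e, pd_one_E hn, heatKernel_reflect ht]
    simp only [Complex.add_re, Complex.ofReal_re, Complex.mul_re, Complex.I_re, Complex.I_im,
      Complex.ofReal_im, normSq, Prod.fst_sub, Prod.snd_sub]
    ring
  · have := integral_im hi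
    simp only [RCLike.im_to_complex] at this
    rw [← this]
    refine integral_congr_ae ?_
    filter_upwards [h2] with w hw
    have hn : normSq (x - w) ≠ 0 := by
      rw [Ne, normSq_eq_zero, sub_eq_zero]
      rintro rfl; exact lt_irrefl _ hw.2
    rw [e, pd_zero_E hn, heatKernel_reflect ht]
    simp only [Complex.add_im, Complex.ofReal_re, Complex.mul_im, Complex.I_re, Complex.I_im,
      Complex.ofReal_im, normSq, Prod.fst_sub, Prod.snd_sub]
    ring

/-- The complex form of the non-diagonal part of the Green matrix: its real part and minus its
imaginary part are the two components. -/
noncomputable def greenC (t : ℝ) (x z : ℝ × ℝ) : ℂ :=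
  2 / Real.pi * ∫ w in (0 : ℝ)..x.2, (heat 0 t (w + z.2) : ℂ) *
    lap 1 t (x.2 - w - Complex.I * (x.1 - z.1))

/-- The tangential derivative in the Green matrix. -/
theorem hasDerivAt_strip {t : ℝ} (ht : 0 < t) (x z : ℝ × ℝ) (hx : 0 < x.2) :
    HasDerivAt (fun s : ℝ => -(1 / (2 * Real.pi) : ℂ) * ∫ w in (0 : ℝ)..x.2, (heat 0 t (w + z.2) : ℂ) *
        lap 0 t (x.2 - w - Complex.I * (s - z.1)))
      (-(Complex.I / 4) * greenC t x z) x.1 := by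
  obtain ⟨C, hC0, hC⟩ := exists_lap_bound 1
  have hc := continuous_heat 0 ht
  have hl0 := continuous_lap 0 ht
  have hl1 := continuous_lap 1 ht
  have h := (intervalIntegral.hasDerivAt_integral_of_dominated_loc_of_deriv_le (𝕜 := ℝ)
    (F := fun (s : ℝ) (w : ℝ) => (heat 0 t (w + z.2) : ℂ) *
        lap 0 t (x.2 - w - Complex.I * (s - z.1)))
    (F' := fun (s : ℝ) (w : ℝ) => (heat 0 t (w + z.2) : ℂ) *
        (Complex.I * lap 1 t (x.2 - w - Complex.I * (s - z.1))))
    (bound := fun w => heat 0 t (w + z.2) * (C * (√t)⁻¹ ^ (1 + 1)))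
    (a := 0) (b := x.2) (μ := volume) (x₀ := x.1) (s := univ) univ_mem
    (Eventually.of_forall fun s => Continuous.aestronglyMeasurable (by fun_prop))
    (Continuous.intervalIntegrable (by fun_prop) _ _)
    (Continuous.aestronglyMeasurable (by fun_prop)) ?_
    (Continuous.intervalIntegrable (by fun_prop) _ _) ?_).2
  · refine (h.const_mul (-(1 / (2 * Real.pi)) : ℂ)).congr_deriv ?_
    have e : ∀ w : ℝ, (heat 0 t (w + z.2) : ℂ) *
        (Complex.I * lap 1 t (x.2 - w - Complex.I * (x.1 - z.1))) = Complex.I *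
          ((heat 0 t (w + z.2) : ℂ) * lap 1 t (x.2 - w - Complex.I * (x.1 - z.1))) := by
      intro w; ring
    simp_rw [e]
    rw [intervalIntegral.integral_const_mul, greenC]
    ring
  · refine ae_of_all _ fun w hw s _ => ?_
    rw [uIoc_of_le hx.le] at hw
    rw [norm_mul, norm_mul, Complex.norm_I, one_mul, Complex.norm_real, Real.norm_eq_abs,
      abs_of_nonneg (heat_zero_nonneg ht _)]
    refine mul_le_mul_of_nonneg_left (hC t ht _ ?_) (heat_zero_nonneg ht _)
    simpa using hw.2
  · refine ae_of_all _ fun w _ s _ => ?_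
    have h1 := (hasDerivAt_lap 0 ht (x.2 - w + Complex.I * z.1) (-Complex.I) s).const_mul
      (heat 0 t (w + z.2) : ℂ)
    have e : ∀ s : ℝ, (x.2 : ℂ) - w + Complex.I * z.1 + -Complex.I * s =
      x.2 - w - Complex.I * (s - z.1) := by intro s; ring
    simp only [e, neg_neg, zero_add] at h1
    exact h1

/-- The second column of the Green matrix is that of the heat flow with Dirichlet conditions. -/
theorem greenMatrix_col_one {t : ℝ} (ht : 0 < t) (i : Fin 2) (x z : ℝ × ℝ) :
    greenMatrix i 1 x z t = if i = 1 then
      heat 0 t (x.1 - z.1) * (heat 0 t (x.2 - z.2) - heat 0 t (x.2 + z.2)) else 0 := by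
  unfold greenMatrix greenCorrection
  rw [heatKernel_reflect ht, heatKernel_eq ht]
  by_cases hi : i = 1
  · simp [hi]; ring
  · simp [hi]

theorem greenMatrix_col_zero {t : ℝ} (ht : 0 < t) (x z : ℝ × ℝ) (hx : 0 < x.2) :
    greenMatrix 0 0 x z t = heat 0 t (x.1 - z.1) * (heat 0 t (x.2 - z.2) - heat 0 t (x.2 + z.2)) +
      (greenC t x z).re ∧ greenMatrix 1 0 x z t = -(greenC t x z).im := by
  have hd := hasDerivAt_strip ht x z hx
  have h0 := Complex.imCLM.hasFDerivAt.comp_hasDerivAt x.1 hd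
  have h1 := Complex.reCLM.hasFDerivAt.comp_hasDerivAt x.1 hd
  have p0 : pd 0 (fun x' => ∫ w in {w : ℝ × ℝ | 0 < w.2 ∧ w.2 < x'.2},
      pd 0 E (x' - w) * heatKernel (w - reflect z) t) x = -((greenC t x z).re / 4) := by
    rw [pd_zero_eq_deriv]
    have e : (fun s => ∫ w in {w : ℝ × ℝ | 0 < w.2 ∧ w.2 < x.2},
      pd 0 E ((s, x.2) - w) * heatKernel (w - reflect z) t) = _ :=
      funext fun s => (strip_integral_eq ht (s, x.2) z hx).2
    refine (congrArg (fun f => deriv f x.1) e).trans (h0.deriv.trans ?_)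
    simp; ring
  have p1 : pd 0 (fun x' => ∫ w in {w : ℝ × ℝ | 0 < w.2 ∧ w.2 < x'.2},
      pd 1 E (x' - w) * heatKernel (w - reflect z) t) x = (greenC t x z).im / 4 := by
    rw [pd_zero_eq_deriv]
    have e : (fun s => ∫ w in {w : ℝ × ℝ | 0 < w.2 ∧ w.2 < x.2},
      pd 1 E ((s, x.2) - w) * heatKernel (w - reflect z) t) = _ :=
      funext fun s => (strip_integral_eq ht (s, x.2) z hx).1
    refine (congrArg (fun f => deriv f x.1) e).trans (h1.deriv.trans ?_)
    simp; ring
  unfold greenMatrix greenCorrection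
  rw [p0, p1, heatKernel_reflect ht, heatKernel_eq ht]
  constructor
  · simp; ring
  · simp; ring

theorem continuous_greenC {t : ℝ} (ht : 0 < t) (x : ℝ × ℝ) : Continuous (greenC t x) := by
  have hc := continuous_heat 0 ht
  have hl1 := continuous_lap 1 ht
  unfold greenC
  refine continuous_const.mul ?_
  apply intervalIntegral.continuous_parametric_intervalIntegral_of_continuous'
  simp only [Function.uncurry_def]
  fun_prop

/-! ### An identity between integrals of the Gaussian and its transform -/

/-- Gaussian bound for the heat kernel, uniform for bounded shifts and compact times. -/
theorem exists_heat_shift_bound (n : ℕ) {t₀ t₁ : ℝ} (h0 : 0 < t₀) (R : ℝ) : ∃ C : ℝ, 0 ≤ C ∧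
    ∀ t w z : ℝ, t₀ ≤ t → t ≤ t₁ → |w| ≤ R →
      |heat n t (w + z)| ≤ C * Real.exp (-z ^ 2 / (16 * t₁)) := by
  obtain ⟨C, hC0, hC⟩ := exists_heat_bound n
  refine ⟨C * (√t₀)⁻¹ ^ (n + 1) * Real.exp (R ^ 2 / (8 * t₀)), by positivity, fun t w z h1 h2 hw => ?_⟩
  have ht : 0 < t := h0.trans_le h1
  have ht1 : 0 < t₁ := ht.trans_le h2
  refine (hC t ht _).trans ?_
  have e1 : (√t)⁻¹ ^ (n + 1) ≤ (√t₀)⁻¹ ^ (n + 1) := by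
    have := Real.sqrt_pos.2 h0
    gcongr
  have e2 : Real.exp (-(w + z) ^ 2 / (8 * t)) ≤
      Real.exp (R ^ 2 / (8 * t₀)) * Real.exp (-z ^ 2 / (16 * t₁)) := by
    rw [← Real.exp_add]
    apply Real.exp_le_exp.2
    have a1 : w ^ 2 ≤ R ^ 2 := by rw [← sq_abs]; exact pow_le_pow_left₀ (abs_nonneg _) hw 2
    have a2 : -(w + z) ^ 2 ≤ R ^ 2 - z ^ 2 / 2 := by nlinarith [sq_nonneg (2 * w + z)]
    have a3 : -(w + z) ^ 2 / (8 * t) ≤ (R ^ 2 - z ^ 2 / 2) / (8 * t) := by gcongr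
    have a4 : R ^ 2 / (8 * t) ≤ R ^ 2 / (8 * t₀) := by gcongr
    have a5 : z ^ 2 / (16 * t₁) ≤ z ^ 2 / (16 * t) := by gcongr
    have a6 : (R ^ 2 - z ^ 2 / 2) / (8 * t) = R ^ 2 / (8 * t) - z ^ 2 / (16 * t) := by
      field_simp; ring
    have a7 : -z ^ 2 / (16 * t₁) = -(z ^ 2 / (16 * t₁)) := neg_div _ _
    linarith
  calc _ ≤ C * (√t₀)⁻¹ ^ (n + 1) * (Real.exp (R ^ 2 / (8 * t₀)) * Real.exp (-z ^ 2 / (16 * t₁))) := by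
        gcongr
    _ = _ := by ring

/-- The difference `g(w - z) - g(w + z)` of heat kernel derivatives. -/
noncomputable def heatOdd (n : ℕ) (t w z : ℝ) : ℝ := heat n t (w - z) - heat n t (w + z)

/-- The sum `g(w - z) + g(w + z)` of heat kernel derivatives. -/
noncomputable def heatEven (n : ℕ) (t w z : ℝ) : ℝ := heat n t (w - z) + heat n t (w + z)

theorem heatEven_eq (n : ℕ) (t w z : ℝ) : heatEven n t w z = heatOdd n t w z + 2 * heat n t (w + z) := by
  unfold heatEven heatOdd; ring

theorem exists_heatOdd_bound (n : ℕ) {t₀ t₁ : ℝ} (h0 : 0 < t₀) (R : ℝ) : ∃ C : ℝ, 0 ≤ C ∧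
    ∀ t w z : ℝ, t₀ ≤ t → t ≤ t₁ → |w| ≤ R →
      |heatOdd n t w z| ≤ C * Real.exp (-z ^ 2 / (16 * t₁)) ∧
      |heatEven n t w z| ≤ C * Real.exp (-z ^ 2 / (16 * t₁)) ∧
      |heat n t (w + z)| ≤ C * Real.exp (-z ^ 2 / (16 * t₁)) := by
  obtain ⟨C, hC0, hC⟩ := exists_heat_shift_bound n (t₁ := t₁) h0 R
  refine ⟨2 * C, by positivity, fun t w z h1 h2 hw => ?_⟩
  have a := hC t w (-z) h1 h2 hw
  have b := hC t w z h1 h2 hw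
  rw [neg_sq, ← sub_eq_add_neg] at a
  refine ⟨(abs_sub _ _).trans ?_, (abs_add_le _ _).trans ?_, ?_⟩
  · linarith
  · linarith
  · nlinarith [Real.exp_pos (-z ^ 2 / (16 * t₁))]

theorem continuous_heatOdd (n : ℕ) {t : ℝ} (ht : 0 < t) :
    Continuous fun p : ℝ × ℝ => heatOdd n t p.1 p.2 := by
  have := continuous_heat n ht
  unfold heatOdd; fun_prop

theorem continuous_heatEven (n : ℕ) {t : ℝ} (ht : 0 < t) :
    Continuous fun p : ℝ × ℝ => heatEven n t p.1 p.2 := by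
  have := continuous_heat n ht
  unfold heatEven; fun_prop

theorem hasDerivAt_heatOdd_left (n : ℕ) {t : ℝ} (ht : 0 < t) (w z : ℝ) :
    HasDerivAt (fun w => heatOdd n t w z) (heatOdd (n + 1) t w z) w := by
  have h1 := (hasDerivAt_heat n ht (w - z)).comp_sub_const w z
  have h2 := (hasDerivAt_heat n ht (w + z)).comp_add_const w z
  exact h1.sub h2

theorem hasDerivAt_heatEven_right (n : ℕ) {t : ℝ} (ht : 0 < t) (w z : ℝ) :
    HasDerivAt (fun z => heatEven n t w z) (-heatOdd (n + 1) t w z) z := by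
  have h1 := (hasDerivAt_heat n ht (w - z)).comp_const_sub w z
  have h2 := (hasDerivAt_heat n ht (w + z)).comp_const_add w z
  exact (h1.add h2).congr_deriv (by unfold heatOdd; ring)

theorem hasDerivAt_heatOdd_right (n : ℕ) {t : ℝ} (ht : 0 < t) (w z : ℝ) :
    HasDerivAt (fun z => heatOdd n t w z) (-heatEven (n + 1) t w z) z := by
  have h1 := (hasDerivAt_heat n ht (w - z)).comp_const_sub w z
  have h2 := (hasDerivAt_heat n ht (w + z)).comp_const_add w z
  exact (h1.sub h2).congr_deriv (by unfold heatEven; ring)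

theorem heatOdd_zero_left (t z : ℝ) : heatOdd 0 t 0 z = 0 := by
  simp [heatOdd, heat_zero_neg]

theorem heatOdd_zero_right (n : ℕ) (t w : ℝ) : heatOdd n t w 0 = 0 := by simp [heatOdd]

/-- The fundamental theorem of calculus on the half line for a function which is not
differentiable at one point. -/
theorem integral_Ioi_zero_of_hasDerivAt_ne {f f' : ℝ → ℂ} (c : ℝ) (hf : Continuous f)
    (hd : ∀ z, z ≠ c → HasDerivAt f (f' z) z) (hi : IntegrableOn f' (Ioi 0))
    (hl : Tendsto f atTop (𝓝 0)) : ∫ z in Ioi (0 : ℝ), f' z = -f 0 := by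
  have h1 := intervalIntegral_tendsto_integral_Ioi 0 hi tendsto_id
  have h2 : ∀ᶠ b in atTop, ∫ z in (0 : ℝ)..b, f' z = f b - f 0 := by
    filter_upwards [eventually_ge_atTop (0 : ℝ)] with b hb
    refine integral_eq_of_hasDerivAt_off_countable_of_le f f' hb (countable_singleton c)
      hf.continuousOn (fun z hz => hd z hz.2) ?_
    rw [intervalIntegrable_iff_integrableOn_Ioc_of_le hb]
    exact hi.mono_set Ioc_subset_Ioi_self
  have h3 : Tendsto (fun b => ∫ z in (0 : ℝ)..b, f' z) atTop (𝓝 (0 - f 0)) :=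
    (hl.sub_const (f 0)).congr' (h2.mono fun b hb => hb.symm)
  rw [← zero_sub]
  exact tendsto_nhds_unique h1 h3

/-- `1` below the level `y` and `-1` above it. -/
noncomputable def levelSign (y z : ℝ) : ℝ := if z < y then 1 else -1

theorem measurable_levelSign (y : ℝ) : Measurable (levelSign y) :=
  Measurable.ite measurableSet_Iio measurable_const measurable_const

theorem abs_levelSign (y z : ℝ) : |levelSign y z| = 1 := by unfold levelSign; split_ifs <;> simp

theorem tendsto_exp_neg_sq_div {c : ℝ} (hc : 0 < c) :
    Tendsto (fun z : ℝ => Real.exp (-z ^ 2 / c)) atTop (𝓝 0) := by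
  refine Real.tendsto_exp_atBot.comp ?_
  have : Tendsto (fun z : ℝ => z ^ 2 / c) atTop atTop :=
    (tendsto_pow_atTop two_ne_zero).atTop_div_const hc
  refine (tendsto_neg_atTop_atBot.comp this).congr fun z => ?_
  simp [neg_div]

section Identity

variable {φ₀ φ₁ : ℝ → ℂ} {B t : ℝ}

/-- Integration by parts in `z`. Below the level `y` the factor `φ₁ (b + |z - y|)` occurs twice, above it
it cancels; what remains is the integral over `[0, y]` and the contribution of the image `w + z`. -/
theorem integral_heatEven_parts (ht : 0 < t) (hd : ∀ a, HasDerivAt φ₀ (-φ₁ a) a)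
    (hc : Continuous φ₁) (h0 : ∀ a, 0 ≤ a → ‖φ₀ a‖ ≤ B) (h1 : ∀ a, 0 ≤ a → ‖φ₁ a‖ ≤ B)
    {b y w : ℝ} (hb : 0 ≤ b) (hy : 0 ≤ y) :
    ∫ z in Ioi (0 : ℝ), ((heatOdd 1 t w z : ℂ) * (φ₀ (b + |z - y|) - φ₀ (b + z + y)) +
        heatOdd 0 t w z * (φ₁ (b + |z - y|) - φ₁ (b + z + y))) =
      2 * ((∫ z in (0 : ℝ)..y, heatOdd 0 t w z * φ₁ (b + y - z)) +
        ∫ z in Ioi (0 : ℝ), heat 0 t (w + z) *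
          (levelSign y z * φ₁ (b + |z - y|) + φ₁ (b + z + y))) := by
  have hc0 : Continuous φ₀ := continuous_iff_continuousAt.2 fun a => (hd a).continuousAt
  obtain ⟨C0, hC00, hC0⟩ := exists_heatOdd_bound 0 (t₁ := t) ht |w|
  obtain ⟨C1, hC10, hC1⟩ := exists_heatOdd_bound 1 (t₁ := t) ht |w|
  have k0 := fun z => hC0 t w z le_rfl le_rfl le_rfl
  have k1 := fun z => hC1 t w z le_rfl le_rfl le_rfl
  have c1 : Continuous fun z => heatOdd 1 t w z :=
    (continuous_heatOdd 1 ht).comp (Continuous.prodMk_right w)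
  have c0 : Continuous fun z => heatOdd 0 t w z :=
    (continuous_heatOdd 0 ht).comp (Continuous.prodMk_right w)
  have ce : Continuous fun z => heatEven 0 t w z :=
    (continuous_heatEven 0 ht).comp (Continuous.prodMk_right w)
  have ch := continuous_heat 0 ht
  have hB : 0 ≤ B := (norm_nonneg _).trans (h0 0 le_rfl)
  let G : ℝ → ℝ := fun z => Real.exp (-z ^ 2 / (16 * t))
  have hG : Integrable G := integrable_exp_neg_sq_div (by positivity)
  -- all integrands are a Gaussian-dominated real factor times a bounded complex factor
  have dom : ∀ (r : ℝ → ℝ) (ψ : ℝ → ℂ) (C D : ℝ), Measurable r → Measurable ψ →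
      (∀ z, |r z| ≤ C * G z) → (∀ z, 0 < z → ‖ψ z‖ ≤ D) → 0 ≤ C →
      IntegrableOn (fun z => (r z : ℂ) * ψ z) (Ioi 0) := by
    intro r ψ C D hr hψ hrC hψD hC
    refine ((hG.const_mul C).mul_const D).integrableOn.mono'
      ((hr.complex_ofReal.mul hψ).aestronglyMeasurable) ?_
    filter_upwards [ae_restrict_mem measurableSet_Ioi] with z hz
    rw [norm_mul, Complex.norm_real, Real.norm_eq_abs]
    exact mul_le_mul (hrC z) (hψD z hz) (norm_nonneg _) (mul_nonneg hC (Real.exp_pos _).le)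
  have nn : ∀ z, 0 < z → 0 ≤ b + |z - y| ∧ 0 ≤ b + z + y := fun z hz =>
    ⟨by positivity, by positivity⟩
  have mls := measurable_levelSign y
  let l : ℝ → ℂ := fun z => φ₀ (b + |z - y|) - φ₀ (b + z + y)
  let ld : ℝ → ℂ := fun z => levelSign y z * φ₁ (b + |z - y|) + φ₁ (b + z + y)
  let m : ℝ → ℂ := fun z => φ₁ (b + |z - y|) - φ₁ (b + z + y)
  have hl : ∀ z, 0 < z → ‖l z‖ ≤ B + B := fun z hz =>
    (norm_sub_le _ _).trans (add_le_add (h0 _ (nn z hz).1) (h0 _ (nn z hz).2))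
  have hm : ∀ z, 0 < z → ‖m z‖ ≤ B + B := fun z hz =>
    (norm_sub_le _ _).trans (add_le_add (h1 _ (nn z hz).1) (h1 _ (nn z hz).2))
  have hld : ∀ z, 0 < z → ‖ld z‖ ≤ B + B := fun z hz => by
    refine (norm_add_le _ _).trans (add_le_add ?_ (h1 _ (nn z hz).2))
    rw [norm_mul, Complex.norm_real, Real.norm_eq_abs, abs_levelSign, one_mul]
    exact h1 _ (nn z hz).1
  have lm : Continuous l := by fun_prop
  have mm : Continuous m := by fun_prop
  have ldm : Measurable ld := by
    have : Measurable fun z => φ₁ (b + |z - y|) := Continuous.measurable (by fun_prop)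
    have h2 : Measurable fun z => φ₁ (b + z + y) := Continuous.measurable (by fun_prop)
    exact (mls.complex_ofReal.mul this).add h2
  have i1 := dom _ l _ _ c1.measurable lm.measurable (fun z => (k1 z).1) hl hC10
  have i2 := dom _ m _ _ c0.measurable mm.measurable (fun z => (k0 z).1) hm hC00
  have i3 := dom _ ld _ _ ce.measurable ldm (fun z => (k0 z).2.1) hld hC00
  have i4 := dom _ ld _ _ c0.measurable ldm (fun z => (k0 z).1) hld hC00
  have i5 := dom (fun z => heat 0 t (w + z)) ld _ _ (by fun_prop) ldm (fun z => (k0 z).2.2) hld hC00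
  have i1' : IntegrableOn (fun z => ((-heatOdd 1 t w z : ℝ) : ℂ) * l z) (Ioi 0) :=
    i1.neg.congr_fun (fun z _ => by simp [l]) measurableSet_Ioi
  -- integration by parts
  have parts : (∫ z in Ioi (0 : ℝ), ((-heatOdd 1 t w z : ℝ) : ℂ) * l z + heatEven 0 t w z * ld z) = 0 := by
    have hi : IntegrableOn (fun z => ((-heatOdd 1 t w z : ℝ) : ℂ) * l z + heatEven 0 t w z * ld z) (Ioi 0) := by
      exact Integrable.add i1' i3
    have hD : ∀ z, z ≠ y → HasDerivAt (fun z => (heatEven 0 t w z : ℂ) * l z)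
        (((-heatOdd 1 t w z : ℝ) : ℂ) * l z + heatEven 0 t w z * ld z) z := by
      intro z hz
      have e1 := (hasDerivAt_heatEven_right 0 ht w z).ofReal_comp
      have e2 : HasDerivAt (fun z => b + |z - y|) (-levelSign y z) z := by
        unfold levelSign
        split_ifs with h
        · have := ((hasDerivAt_abs_neg (by linarith : z - y < 0)).comp_sub_const z y).const_add b
          exact this
        · have := ((hasDerivAt_abs_pos (by
            have := lt_of_le_of_ne (not_lt.1 h) hz.symm
            linarith : 0 < z - y)).comp_sub_const z y).const_add b
          simpa using this
      have e3 : HasDerivAt (fun z => b + z + y) 1 z := ((hasDerivAt_id z).const_add b).add_const y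
      have e4 := ((hd (b + |z - y|)).scomp z e2).sub ((hd (b + z + y)).scomp z e3)
      refine (e1.mul e4).congr_deriv ?_
      simp only [ld, Complex.real_smul, Function.comp_apply, Pi.sub_apply, l]
      push_cast
      ring
    rw [integral_Ioi_zero_of_hasDerivAt_ne y (by fun_prop) hD hi]
    · simp [l, abs_of_nonneg hy]
    · rw [tendsto_zero_iff_norm_tendsto_zero]
      refine squeeze_zero' (Eventually.of_forall fun z => norm_nonneg _) ?_
        (by simpa using ((tendsto_exp_neg_sq_div (by positivity : 0 < 16 * t)).const_mul C0).mul_const (B + B))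
      filter_upwards [eventually_gt_atTop 0] with z hz
      rw [norm_mul, Complex.norm_real, Real.norm_eq_abs]
      exact mul_le_mul (k0 z).2.1 (hl z hz) (norm_nonneg _) (by positivity)
  have e1 : (∫ z in Ioi (0 : ℝ), (heatOdd 1 t w z : ℂ) * l z) =
      ∫ z in Ioi (0 : ℝ), (heatEven 0 t w z : ℂ) * ld z := by
    rw [integral_add i1' i3] at parts
    have : (∫ z in Ioi (0 : ℝ), ((-heatOdd 1 t w z : ℝ) : ℂ) * l z) =
        -∫ z in Ioi (0 : ℝ), (heatOdd 1 t w z : ℂ) * l z := by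
      rw [← integral_neg]; congr 1; ext z; push_cast; ring
    rw [this] at parts
    linear_combination -parts
  have e2 : (∫ z in Ioi (0 : ℝ), (heatEven 0 t w z : ℂ) * ld z) =
      (∫ z in Ioi (0 : ℝ), (heatOdd 0 t w z : ℂ) * ld z) +
        2 * ∫ z in Ioi (0 : ℝ), (heat 0 t (w + z) : ℂ) * ld z := by
    rw [← integral_const_mul, ← integral_add i4 (i5.const_mul 2)]
    congr 1; ext z; rw [heatEven_eq]; push_cast; ring
  -- `levelSign` is `1` below `y` and cancels the factor above it
  have e3 : (∫ z in Ioi (0 : ℝ), (heatOdd 0 t w z : ℂ) * ld z) +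
      (∫ z in Ioi (0 : ℝ), (heatOdd 0 t w z : ℂ) * m z) =
      2 * ∫ z in (0 : ℝ)..y, heatOdd 0 t w z * φ₁ (b + y - z) := by
    rw [← integral_add i4 i2, ← intervalIntegral.integral_const_mul,
      intervalIntegral.integral_of_le hy, integral_Ioc_eq_integral_Ioo, ← Ioi_inter_Iio,
      ← setIntegral_indicator measurableSet_Iio]
    congr 1; ext z
    by_cases h : z < y
    · rw [indicator_of_mem (show z ∈ Iio y from h)]
      simp only [ld, m, levelSign, if_pos h, abs_of_neg (show z - y < 0 by linarith)]
      rw [show b + -(z - y) = b + y - z by ring]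
      push_cast; ring
    · rw [indicator_of_notMem (show z ∉ Iio y from h)]
      simp only [ld, m, levelSign, if_neg h]
      push_cast; ring
  rw [integral_add i1 i2, e1, e2, mul_add, ← e3]
  ring

/-- The left side is the integral over `w ∈ [0, x]` of the derivative of
`heatOdd 0 t w z * (φ₀ (x - w + |z - y|) - φ₀ (x - w + z + y))`, which vanishes at `w = 0`; for each `w`
the integral over `z` is `integral_heatEven_parts`. With `lap` for `φ₀` and `φ₁` the last integral
cancels the contribution of `greenC` to the kernel of `S(t) K`. -/
theorem integral_heatOdd_identity (ht : 0 < t) (hd : ∀ a, HasDerivAt φ₀ (-φ₁ a) a)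
    (hc : Continuous φ₁) (h0 : ∀ a, 0 ≤ a → ‖φ₀ a‖ ≤ B) (h1 : ∀ a, 0 ≤ a → ‖φ₁ a‖ ≤ B)
    {x y : ℝ} (hx : 0 ≤ x) (hy : 0 ≤ y) :
    ∫ z in Ioi (0 : ℝ), (heatOdd 0 t x z : ℂ) * (φ₀ |z - y| - φ₀ (z + y)) =
      2 * ∫ w in (0 : ℝ)..x, ((∫ z in (0 : ℝ)..y, heatOdd 0 t w z * φ₁ (x - w + y - z)) +
        ∫ z in Ioi (0 : ℝ), heat 0 t (w + z) *
          (levelSign y z * φ₁ (x - w + |z - y|) + φ₁ (x - w + z + y))) := by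
  have hc0 : Continuous φ₀ := continuous_iff_continuousAt.2 fun a => (hd a).continuousAt
  obtain ⟨C0, hC00, hC0⟩ := exists_heatOdd_bound 0 (t₁ := t) ht x
  obtain ⟨C1, hC10, hC1⟩ := exists_heatOdd_bound 1 (t₁ := t) ht x
  have hB : 0 ≤ B := (norm_nonneg _).trans (h0 0 le_rfl)
  have c1 := continuous_heatOdd 1 ht
  have c0 := continuous_heatOdd 0 ht
  let F : ℝ → ℝ → ℂ := fun z w =>
    ((heatOdd 1 t w z : ℂ) * (φ₀ (x - w + |z - y|) - φ₀ (x - w + z + y)) +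
        heatOdd 0 t w z * (φ₁ (x - w + |z - y|) - φ₁ (x - w + z + y)))
  have hFc : Continuous (Function.uncurry F) := by
    have e1 : Continuous fun p : ℝ × ℝ => heatOdd 1 t p.2 p.1 := c1.comp continuous_swap
    have e0 : Continuous fun p : ℝ × ℝ => heatOdd 0 t p.2 p.1 := c0.comp continuous_swap
    simp only [F, Function.uncurry_def]
    fun_prop
  -- the integrand is the integral of `F` over `[0, x]`
  have hF : ∀ z : ℝ, (heatOdd 0 t x z : ℂ) * (φ₀ |z - y| - φ₀ (z + y)) = ∫ w in (0 : ℝ)..x, F z w := by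
    intro z
    have hD : ∀ w, HasDerivAt (fun w => (heatOdd 0 t w z : ℂ) *
        (φ₀ (x - w + |z - y|) - φ₀ (x - w + z + y))) (F z w) w := by
      intro w
      have a1 := (hasDerivAt_heatOdd_left 0 ht w z).ofReal_comp
      have a2 : HasDerivAt (fun w => x - w + |z - y|) (-1) w :=
        ((hasDerivAt_id w).const_sub x).add_const _
      have a3 : HasDerivAt (fun w => x - w + z + y) (-1) w :=
        (((hasDerivAt_id w).const_sub x).add_const _).add_const _
      have a4 := ((hd _).scomp w a2).sub ((hd _).scomp w a3)
      refine (a1.mul a4).congr_deriv ?_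
      simp only [F, Complex.real_smul, Function.comp_apply, Pi.sub_apply]
      push_cast; ring
    rw [intervalIntegral.integral_eq_sub_of_hasDerivAt (fun w _ => hD w)
      ((hFc.comp (Continuous.prodMk_right z)).intervalIntegrable _ _), heatOdd_zero_left]
    simp
  simp_rw [hF]
  have hint : Integrable (Function.uncurry F)
      ((volume.restrict (Ioi (0 : ℝ))).prod (volume.restrict (Ioc 0 x))) := by
    have hG : Integrable (fun z : ℝ => (C1 + C0) * Real.exp (-z ^ 2 / (16 * t)) * (B + B)) :=
      ((integrable_exp_neg_sq_div (by positivity)).const_mul _).mul_const _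
    have hG2 := (hG.restrict (s := Ioi 0)).mul_prod (ν := volume.restrict (Ioc 0 x))
      (g := fun _ => (1 : ℝ)) (integrable_const _)
    refine hG2.mono' hFc.aestronglyMeasurable ?_
    have m1 : ∀ᵐ p : ℝ × ℝ ∂((volume.restrict (Ioi (0 : ℝ))).prod (volume.restrict (Ioc 0 x))),
      p.1 ∈ Ioi (0 : ℝ) := Measure.quasiMeasurePreserving_fst.ae (ae_restrict_mem measurableSet_Ioi)
    have m2 : ∀ᵐ p : ℝ × ℝ ∂((volume.restrict (Ioi (0 : ℝ))).prod (volume.restrict (Ioc 0 x))),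
      p.2 ∈ Ioc 0 x := Measure.quasiMeasurePreserving_snd.ae (ae_restrict_mem measurableSet_Ioc)
    filter_upwards [m1, m2] with p hp1 hp2
    have hp1 : 0 < p.1 := hp1
    have hw : |p.2| ≤ x := by rw [abs_of_pos hp2.1]; exact hp2.2
    have n1 : 0 ≤ x - p.2 + |p.1 - y| := by
      have := abs_nonneg (p.1 - y); linarith [hp2.2]
    have n2 : 0 ≤ x - p.2 + p.1 + y := by linarith [hp2.2]
    have k1 := (hC1 t p.2 p.1 le_rfl le_rfl hw).1
    have k0 := (hC0 t p.2 p.1 le_rfl le_rfl hw).1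
    have f0 := (norm_sub_le _ _).trans (add_le_add (h0 _ n1) (h0 _ n2))
    have f1 := (norm_sub_le _ _).trans (add_le_add (h1 _ n1) (h1 _ n2))
    simp only [Function.uncurry, F, mul_one]
    refine (norm_add_le _ _).trans ?_
    rw [norm_mul, norm_mul, Complex.norm_real, Complex.norm_real, Real.norm_eq_abs, Real.norm_eq_abs]
    have g1 := mul_le_mul k1 f0 (norm_nonneg _) (by positivity)
    have g2 := mul_le_mul k0 f1 (norm_nonneg _) (by positivity)
    linarith
  simp_rw [intervalIntegral.integral_of_le hx]
  rw [integral_integral_swap hint, ← integral_const_mul]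
  refine setIntegral_congr_fun measurableSet_Ioc fun w hw => ?_
  have hb : 0 ≤ x - w := by linarith [hw.2]
  have := integral_heatEven_parts (w := w) ht hd hc h0 h1 hb hy
  simp only [F]
  exact this

end Identity

/-! ### The Stokes semigroup applied to the Biot-Savart kernel -/

/-- Inverse square root singularities at the points of a finite measure are integrable against bounded
integrable weights. -/
theorem integrable_mul_inv_sqrt {A B : ℝ → ℝ} {M N : ℝ} (cA : Continuous A) (cB : Continuous B)
    (A0 : ∀ v, 0 ≤ A v) (AM : ∀ v, A v ≤ M) (hA : Integrable A)
    (B0 : ∀ v, 0 ≤ B v) (BN : ∀ v, B v ≤ N) (hB : Integrable B)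
    (μ : Measure ClosedHalf) [IsFiniteMeasure μ] :
    Integrable (fun p : (ℝ × ℝ) × ClosedHalf => ((√|p.1.1 - p.2.1.1|)⁻¹ * A p.1.1) *
      ((√|p.1.2 - p.2.1.2|)⁻¹ * B p.1.2)) ((volume : Measure (ℝ × ℝ)).prod μ) := by
  have hm : AEStronglyMeasurable (fun p : (ℝ × ℝ) × ClosedHalf => ((√|p.1.1 - p.2.1.1|)⁻¹ * A p.1.1) *
      ((√|p.1.2 - p.2.1.2|)⁻¹ * B p.1.2)) ((volume : Measure (ℝ × ℝ)).prod μ) := by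
    have := cA.measurable
    have := cB.measurable
    exact Measurable.aestronglyMeasurable (by fun_prop)
  obtain ⟨C, hC⟩ := exists_integral_inv_sqrt_mul_le A0 AM hA
  obtain ⟨C', hC'⟩ := exists_integral_inv_sqrt_mul_le B0 BN hB
  have hi : ∀ y : ℝ × ℝ, Integrable (fun z : ℝ × ℝ => ((√|z.1 - y.1|)⁻¹ * A z.1) *
      ((√|z.2 - y.2|)⁻¹ * B z.2)) := fun y =>
    (integrable_inv_sqrt_mul A0 AM hA y.1).mul_prod (integrable_inv_sqrt_mul B0 BN hB y.2)
  rw [integrable_prod_iff' hm]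
  refine ⟨ae_of_all _ fun y => hi y.1, ?_⟩
  refine (integrable_const (C * C')).mono' hm.norm.prod_swap.integral_prod_right' (ae_of_all _ fun y => ?_)
  rw [Real.norm_eq_abs, abs_of_nonneg (integral_nonneg fun _ => norm_nonneg _)]
  have e : ∀ z : ℝ × ℝ, ‖((√|z.1 - y.1.1|)⁻¹ * A z.1) * ((√|z.2 - y.1.2|)⁻¹ * B z.2)‖ =
      ((√|z.1 - y.1.1|)⁻¹ * A z.1) * ((√|z.2 - y.1.2|)⁻¹ * B z.2) := fun z => by
    rw [Real.norm_eq_abs, abs_of_nonneg]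
    have := A0 z.1
    have := B0 z.2
    positivity
  refine (le_of_eq (integral_congr_ae (ae_of_all _ fun z => e z))).trans ?_
  rw [Measure.volume_eq_prod, integral_prod_mul (fun v => (√|v - y.1.1|)⁻¹ * A v)
    (fun v => (√|v - y.1.2|)⁻¹ * B v)]
  have p1 : 0 ≤ ∫ v, (√|v - y.1.2|)⁻¹ * B v :=
    integral_nonneg fun v => mul_nonneg (by positivity) (B0 v)
  have p2 : 0 ≤ ∫ v, (√|v - y.1.1|)⁻¹ * A v :=
    integral_nonneg fun v => mul_nonneg (by positivity) (A0 v)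
  exact mul_le_mul (hC _) (hC' _) p1 (p2.trans (hC _))

theorem ae_prod_ne (y : ℝ × ℝ) : ∀ᵐ z : ℝ × ℝ, z.1 ≠ y.1 ∧ z.2 ≠ y.2 := by
  have h : ∀ c : ℝ, ∀ᵐ v : ℝ, v ≠ c := fun c => compl_mem_ae_iff.2 (measure_singleton c)
  rw [Measure.volume_eq_prod]
  exact (Measure.quasiMeasurePreserving_fst.ae (h y.1)).and (Measure.quasiMeasurePreserving_snd.ae (h y.2))

theorem ae_prod_prod_ne (μ : Measure ClosedHalf) [SFinite μ] :
    ∀ᵐ p : (ℝ × ℝ) × ClosedHalf ∂(volume : Measure (ℝ × ℝ)).prod μ,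
      p.1.1 ≠ p.2.1.1 ∧ p.1.2 ≠ p.2.1.2 := by
  have h : ∀ᵐ q : ClosedHalf × (ℝ × ℝ) ∂μ.prod (volume : Measure (ℝ × ℝ)),
      q.2.1 ≠ q.1.1.1 ∧ q.2.2 ≠ q.1.1.2 := by
    rw [Measure.ae_prod_iff_ae_ae]
    · exact ae_of_all _ fun y => ae_prod_ne y.1
    · have m1 : IsOpen {q : ClosedHalf × (ℝ × ℝ) | q.2.1 ≠ q.1.1.1} :=
        isOpen_ne_fun (by fun_prop) (by fun_prop)
      have m2 : IsOpen {q : ClosedHalf × (ℝ × ℝ) | q.2.2 ≠ q.1.1.2} :=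
        isOpen_ne_fun (by fun_prop) (by fun_prop)
      exact (m1.inter m2).measurableSet
  exact (Measure.measurePreserving_swap (μ := (volume : Measure (ℝ × ℝ))) (ν := μ)).quasiMeasurePreserving.ae h

theorem measurable_bsKernel (i : Fin 2) :
    Measurable fun p : (ℝ × ℝ) × ClosedHalf => bsKernel p.1 p.2.1 i := by
  have hn : Measurable normSq := continuous_normSq.measurable
  have hr : Measurable reflect := (by unfold reflect; fun_prop : Continuous reflect).measurable
  unfold bsKernel
  by_cases h : i = 0 <;> simp only [h, if_true, if_false] <;> fun_prop

/-- A weight of decay order two along the boundary and of Gaussian decay in the normal direction. -/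
noncomputable def decay (t : ℝ) (x z : ℝ × ℝ) : ℝ :=
  (1 + (x.1 - z.1) ^ 2)⁻¹ * Real.exp (-z.2 ^ 2 / (16 * t))

theorem integrable_decay_mul_bsKernel {t : ℝ} (ht : 0 < t) (x : ℝ × ℝ) (μ : Measure ClosedHalf)
    [IsFiniteMeasure μ] (i : Fin 2) :
    Integrable (fun p : (ℝ × ℝ) × ClosedHalf => decay t x p.1 * bsKernel p.1 p.2.1 i)
      ((volume.restrict openHalf).prod μ) := by
  have hA : Integrable fun v : ℝ => (1 + (x.1 - v) ^ 2)⁻¹ :=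
    integrable_inv_one_add_sq.comp_sub_left x.1
  have hA1 : ∀ v : ℝ, (1 + (x.1 - v) ^ 2)⁻¹ ≤ 1 := fun v =>
    inv_le_one_of_one_le₀ (by nlinarith [sq_nonneg (x.1 - v)])
  have cA : Continuous fun v : ℝ => (1 + (x.1 - v) ^ 2)⁻¹ :=
    Continuous.inv₀ (by fun_prop) fun v => by positivity
  have hB1 : ∀ v : ℝ, Real.exp (-v ^ 2 / (16 * t)) ≤ 1 := fun v => by
    rw [Real.exp_le_one_iff, neg_div]
    have : 0 ≤ v ^ 2 / (16 * t) := by positivity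
    linarith
  have h := integrable_mul_inv_sqrt cA (B := fun v => Real.exp (-v ^ 2 / (16 * t))) (by fun_prop)
    (fun v => by positivity) hA1 hA (fun v => (Real.exp_pos _).le) hB1
    (integrable_exp_neg_sq_div (by positivity)) μ
  have hle : (volume.restrict openHalf).prod μ ≤ (volume : Measure (ℝ × ℝ)).prod μ :=
    Measure.prod_mono Measure.restrict_le_self le_rfl
  refine (h.mono_measure hle).mono' ?_ ?_
  · have : Measurable fun p : (ℝ × ℝ) × ClosedHalf => decay t x p.1 := by unfold decay; fun_prop
    exact (this.mul (measurable_bsKernel i)).aestronglyMeasurable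
  · have m1 : ∀ᵐ p : (ℝ × ℝ) × ClosedHalf ∂((volume.restrict openHalf).prod μ), p.1 ∈ openHalf :=
      Measure.quasiMeasurePreserving_fst.ae (ae_restrict_mem (measurableSet_lt measurable_const measurable_snd))
    filter_upwards [m1, Measure.absolutelyContinuous_of_le hle |>.ae_le (ae_prod_prod_ne μ)] with p hp hne
    have hk := abs_bsKernel_le hne.1 hne.2 (le_of_lt hp) p.2.2 i
    have hd : 0 ≤ decay t x p.1 := by unfold decay; positivity
    rw [norm_mul, Real.norm_eq_abs, Real.norm_eq_abs, abs_of_nonneg hd]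
    refine (mul_le_mul_of_nonneg_left hk hd).trans (le_of_eq ?_)
    unfold decay; ring

theorem exists_heat_decay (n : ℕ) {t : ℝ} (ht : 0 < t) : ∃ C : ℝ, 0 ≤ C ∧ ∀ v,
    |heat n t v| ≤ C * (1 + v ^ 2)⁻¹ := by
  obtain ⟨C, h0, hC⟩ := exists_heat_bound n
  refine ⟨C * (√t)⁻¹ ^ (n + 1) * (1 + 8 * t), by positivity, fun v => (hC t ht v).trans ?_⟩
  have h1 : 0 < 1 + v ^ 2 / (8 * t) := by positivity
  have h2 : Real.exp (-v ^ 2 / (8 * t)) ≤ (1 + v ^ 2 / (8 * t))⁻¹ := by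
    rw [neg_div, Real.exp_neg]
    apply inv_anti₀ h1
    linarith [Real.add_one_le_exp (v ^ 2 / (8 * t))]
  have h3 : Real.exp (-v ^ 2 / (8 * t)) ≤ (1 + 8 * t) * (1 + v ^ 2)⁻¹ := by
    refine h2.trans ?_
    rw [← div_eq_mul_inv, le_div_iff₀ (by positivity), inv_mul_le_iff₀ h1]
    have : (1 + v ^ 2 / (8 * t)) * (1 + 8 * t) = 1 + v ^ 2 + 8 * t + v ^ 2 / (8 * t) := by
      field_simp; ring
    rw [this]
    have : 0 ≤ v ^ 2 / (8 * t) := by positivity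
    linarith
  rw [mul_assoc _ (1 + 8 * t)]
  gcongr

/-- Both factors of the Biot-Savart kernel in `stokesIntegrand` decay to order two along the boundary. -/
theorem exists_stokes_factor_bound {t : ℝ} (ht : 0 < t) {x : ℝ × ℝ} (hx : 0 < x.2) : ∃ C : ℝ, 0 ≤ C ∧
    ∀ z : ℝ × ℝ, |heat 0 t (x.1 - z.1) * heatOdd 0 t x.2 z.2| ≤ C * decay t x z ∧
      ‖greenC t x z‖ ≤ C * decay t x z := by
  obtain ⟨A, hA0, hA⟩ := exists_heat_decay 0 ht
  obtain ⟨B, hB0, hB⟩ := exists_heatOdd_bound 0 (t₁ := t) ht x.2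
  obtain ⟨L, hL0, hL⟩ := exists_lap_one_decay ht
  have hpi := Real.pi_pos
  refine ⟨A * B + 2 / Real.pi * (B * L * x.2), by positivity, fun z => ?_⟩
  have hd : 0 ≤ decay t x z := by unfold decay; positivity
  constructor
  · have h1 := hA (x.1 - z.1)
    have h2 := (hB t x.2 z.2 le_rfl le_rfl (abs_of_pos hx).le).1
    rw [abs_mul]
    calc _ ≤ (A * (1 + (x.1 - z.1) ^ 2)⁻¹) * (B * Real.exp (-z.2 ^ 2 / (16 * t))) := by gcongr
      _ = A * B * decay t x z := by unfold decay; ring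
      _ ≤ _ := by gcongr; nlinarith [show 0 ≤ 2 / Real.pi * (B * L * x.2) by positivity]
  · unfold greenC
    have hn : ‖(2 / Real.pi : ℂ)‖ = 2 / Real.pi := by
      rw [norm_div, Complex.norm_real]; simp [abs_of_pos hpi]
    rw [norm_mul, hn]
    have hi := intervalIntegral.norm_integral_le_of_norm_le_const (a := 0) (b := x.2)
      (f := fun w => (heat 0 t (w + z.2) : ℂ) * lap 1 t (x.2 - w - Complex.I * (x.1 - z.1)))
      (C := B * L * decay t x z) fun w hw => by
        rw [uIoc_of_le hx.le] at hw
        have h2 := (hB t w z.2 le_rfl le_rfl (by rw [abs_of_pos hw.1]; exact hw.2)).2.2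
        have h3 := hL (x.2 - w) (x.1 - z.1) (by linarith [hw.2])
        push_cast at h3
        rw [norm_mul, Complex.norm_real, Real.norm_eq_abs]
        refine (mul_le_mul h2 h3 (norm_nonneg _) (by positivity)).trans (le_of_eq ?_)
        unfold decay; ring
    rw [sub_zero, abs_of_pos hx] at hi
    calc _ ≤ 2 / Real.pi * (B * L * decay t x z * x.2) := by gcongr
      _ = (2 / Real.pi * (B * L * x.2)) * decay t x z := by ring
      _ ≤ _ := by gcongr; nlinarith [mul_nonneg hA0 hB0]

/-- The complex combination of the two components of `G(x, z, t) k(z, y)`, for the Green matrix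
`G` and the Biot-Savart kernel `k`: first component minus `i` times the second. -/
noncomputable def stokesIntegrand (t : ℝ) (x z y : ℝ × ℝ) : ℂ :=
  ((heat 0 t (x.1 - z.1) * heatOdd 0 t x.2 z.2 : ℝ) : ℂ) *
      (bsKernel z y 0 - Complex.I * bsKernel z y 1) + greenC t x z * bsKernel z y 0

theorem integrable_stokesIntegrand {t : ℝ} (ht : 0 < t) {x : ℝ × ℝ} (hx : 0 < x.2)
    (μ : Measure ClosedHalf) [IsFiniteMeasure μ] :
    Integrable (fun p : (ℝ × ℝ) × ClosedHalf => stokesIntegrand t x p.1 p.2.1)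
      ((volume.restrict openHalf).prod μ) := by
  obtain ⟨C, hC0, hC⟩ := exists_stokes_factor_bound ht hx
  have i0 := integrable_decay_mul_bsKernel ht x μ 0
  have i1 := integrable_decay_mul_bsKernel ht x μ 1
  refine (((i0.norm.add i1.norm).add i0.norm).const_mul C).mono' ?_ (ae_of_all _ fun p => ?_)
  · have m0 := measurable_bsKernel 0
    have m1 := measurable_bsKernel 1
    have h0 := (continuous_heat 0 ht).measurable
    have h1 : Measurable fun z : ℝ => heatOdd 0 t x.2 z :=
      ((continuous_heatOdd 0 ht).comp (Continuous.prodMk_right x.2)).measurable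
    have h2 := (continuous_greenC ht x).measurable
    refine Measurable.aestronglyMeasurable ?_
    unfold stokesIntegrand
    fun_prop
  · have hd : 0 ≤ decay t x p.1 := by unfold decay; positivity
    obtain ⟨c1, c2⟩ := hC p.1
    simp only [Pi.add_apply, norm_mul, Real.norm_eq_abs, abs_of_nonneg hd]
    unfold stokesIntegrand
    refine (norm_add_le _ _).trans ?_
    rw [norm_mul, norm_mul, Complex.norm_real, Complex.norm_real, Real.norm_eq_abs, Real.norm_eq_abs]
    have h3 : ‖(bsKernel p.1 p.2.1 0 - Complex.I * bsKernel p.1 p.2.1 1 : ℂ)‖ ≤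
        |bsKernel p.1 p.2.1 0| + |bsKernel p.1 p.2.1 1| := by
      refine (norm_sub_le _ _).trans ?_
      simp
    have := mul_le_mul c1 h3 (norm_nonneg _) (by positivity)
    have := mul_le_mul_of_nonneg_right c2 (abs_nonneg (bsKernel p.1 p.2.1 0))
    linarith

/-! ### The kernel of the velocity -/

theorem integrable_heat_mul_cauchy {t a : ℝ} (ht : 0 < t) (ha : a ≠ 0) (x₁ y₁ : ℝ) :
    Integrable fun z : ℝ => (heat 0 t (x₁ - z) : ℂ) * (1 / ((a : ℂ) - Complex.I * ((z - y₁ : ℝ) : ℂ))) := by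
  have hne : ∀ z : ℝ, ((a : ℂ) - Complex.I * ((z - y₁ : ℝ) : ℂ)) ≠ 0 := fun z h => ha (by
    have := congrArg Complex.re h
    simpa using this)
  refine (((integrable_heat 0 ht).comp_sub_left x₁).ofReal (𝕜 := ℂ)).mul_bdd
    (c := |a|⁻¹) (Continuous.aestronglyMeasurable ?_) (ae_of_all _ fun z => ?_)
  · exact Continuous.div continuous_const (by fun_prop) hne
  · rw [norm_one_div_cauchy]
    apply inv_anti₀ (abs_pos.2 ha)
    exact Real.abs_le_sqrt (by nlinarith [sq_nonneg (z - y₁)])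

theorem integral_heat_mul_cauchy_pos {t a : ℝ} (ht : 0 < t) (ha : 0 < a) (x₁ y₁ : ℝ) :
    ∫ z : ℝ, (heat 0 t (x₁ - z) : ℂ) * (1 / ((a : ℂ) - Complex.I * ((z - y₁ : ℝ) : ℂ))) =
      lap 0 t (a - Complex.I * (x₁ - y₁)) := by
  rw [← integral_sub_left_eq_self (fun z : ℝ => (heat 0 t (x₁ - z) : ℂ) *
    (1 / ((a : ℂ) - Complex.I * ((z - y₁ : ℝ) : ℂ)))) volume x₁]
  have := integral_heat_div ht ha (x₁ - y₁)
  push_cast at this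
  rw [← this]
  congr 1; ext v
  rw [sub_sub_cancel]
  push_cast
  ring_nf

theorem integral_heat_mul_cauchy_neg {t a : ℝ} (ht : 0 < t) (ha : 0 < a) (x₁ y₁ : ℝ) :
    ∫ z : ℝ, (heat 0 t (x₁ - z) : ℂ) * (1 / (((-a : ℝ) : ℂ) - Complex.I * ((z - y₁ : ℝ) : ℂ))) =
      -(starRingEnd ℂ) (lap 0 t (a - Complex.I * (x₁ - y₁))) := by
  rw [← integral_heat_mul_cauchy_pos ht ha, ← integral_conj, ← integral_neg]
  congr 1; ext z
  rw [map_mul, map_div₀, map_sub, map_mul, map_one, Complex.conj_I, Complex.conj_ofReal,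
    Complex.conj_ofReal, Complex.conj_ofReal]
  have : ((((-a : ℝ) : ℂ) - Complex.I * ((z - y₁ : ℝ) : ℂ))) =
    -((a : ℂ) - -Complex.I * ((z - y₁ : ℝ) : ℂ)) := by push_cast; ring
  rw [this, one_div, one_div, inv_neg]; ring

theorem norm_greenC_integrand_le {t : ℝ} (ht : 0 < t) (x : ℝ × ℝ) : ∃ C : ℝ, 0 ≤ C ∧
    ∀ w v z : ℝ, w ≤ x.2 → ‖(heat 0 t (w + z) : ℂ) * lap 1 t (x.2 - w - Complex.I * (x.1 - v))‖ ≤ C := by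
  obtain ⟨M, hM0, hM⟩ := exists_heat_le 0 ht
  obtain ⟨L, hL0, hL⟩ := exists_lap_bound 1
  refine ⟨M * (L * (√t)⁻¹ ^ (1 + 1)), by positivity, fun w v z hw => ?_⟩
  rw [norm_mul, Complex.norm_real, Real.norm_eq_abs]
  exact mul_le_mul (hM _) (hL t ht _ (by
    simp only [Complex.sub_re, Complex.mul_re, Complex.I_re, Complex.I_im, Complex.ofReal_re,
      Complex.sub_im, Complex.ofReal_im]
    linarith)) (norm_nonneg _) hM0

theorem integrable_greenC_mul_poisson {t b : ℝ} (ht : 0 < t) (hb : 0 < b) {x : ℝ × ℝ} (y₁ z₂ : ℝ) :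
    Integrable (fun p : ℝ × ℝ => ((poisson b (p.1 - y₁) : ℂ)) *
      ((heat 0 t (p.2 + z₂) : ℂ) * lap 1 t (x.2 - p.2 - Complex.I * (x.1 - p.1))))
      (volume.prod (volume.restrict (Ioc 0 x.2))) := by
  obtain ⟨C, hC0, hC⟩ := norm_greenC_integrand_le ht x
  have i1 : Integrable (fun p : ℝ × ℝ => poisson b (p.1 - y₁) * (1 : ℝ))
      (volume.prod (volume.restrict (Ioc 0 x.2))) :=
    ((integrable_poisson hb).comp_sub_right y₁).mul_prod (integrable_const _)
  simp only [mul_one] at i1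
  have ch := continuous_heat 0 ht
  have cl := continuous_lap 1 ht
  refine i1.ofReal (𝕜 := ℂ) |>.mul_bdd (c := C) (Continuous.aestronglyMeasurable (by fun_prop)) ?_
  have m2 : ∀ᵐ p : ℝ × ℝ ∂(volume.prod (volume.restrict (Ioc 0 x.2))), p.2 ∈ Ioc 0 x.2 :=
    Measure.quasiMeasurePreserving_snd.ae (ae_restrict_mem measurableSet_Ioc)
  filter_upwards [m2] with p hp
  exact hC _ _ _ hp.2

/-- By the Poisson semigroup property, the tangential integral again gives values of `lap`. -/
theorem integral_greenC_mul_poisson {t b : ℝ} (ht : 0 < t) (hb : 0 < b) {x : ℝ × ℝ} (hx : 0 < x.2)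
    (y₁ z₂ : ℝ) :
    Integrable (fun z : ℝ => greenC t x (z, z₂) * poisson b (z - y₁)) ∧
    ∫ z : ℝ, greenC t x (z, z₂) * poisson b (z - y₁) =
      2 / Real.pi * ∫ w in (0 : ℝ)..x.2, (heat 0 t (w + z₂) : ℂ) *
        lap 1 t (x.2 - w + b - Complex.I * (x.1 - y₁)) := by
  have hi := integrable_greenC_mul_poisson ht hb (x := x) y₁ z₂
  have e : ∀ z : ℝ, greenC t x (z, z₂) * poisson b (z - y₁) = 2 / Real.pi *
      ∫ w in Ioc 0 x.2, ((poisson b (z - y₁) : ℂ)) *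
      ((heat 0 t (w + z₂) : ℂ) * lap 1 t (x.2 - w - Complex.I * (x.1 - z))) := fun z => by
    rw [integral_const_mul, greenC, intervalIntegral.integral_of_le hx.le]; ring
  simp_rw [e]
  refine ⟨hi.integral_prod_left.const_mul _, ?_⟩
  rw [integral_const_mul, integral_integral_swap hi, intervalIntegral.integral_of_le hx.le]
  congr 2; ext w
  rw [← integral_add_right_eq_self _ y₁]
  have := integral_poisson_mul_lap 1 (a := x.2 - w) ht hb (x.1 - y₁)
  push_cast at this
  rw [← this, ← integral_const_mul]
  congr 1; ext v
  rw [add_sub_cancel_right]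
  push_cast
  ring_nf

theorem poisson_neg_left (a b : ℝ) : poisson (-a) b = -poisson a b := by
  unfold poisson; rw [neg_sq, neg_div]

/-- The kernel of `S(t) K`, first component minus `i` times the second component. -/
noncomputable def velKernel (t : ℝ) (x y : ℝ × ℝ) : ℂ :=
  1 / Real.pi * (∫ r in (0 : ℝ)..y.2,
    (heatOdd 0 t x.2 r : ℂ) * ((lap 0 t (y.2 - r - Complex.I * (x.1 - y.1))).re : ℂ)) -
  1 / Real.pi * ∫ w in (0 : ℝ)..x.2, ∫ r in (0 : ℝ)..y.2,
    (heatOdd 0 t w r : ℂ) * lap 1 t (x.2 - w + y.2 - r - Complex.I * (x.1 - y.1))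

theorem integral_mul_sub_mul_add_mul {α : Type*} [MeasurableSpace α] {μ : Measure α} {f g h : α → ℂ}
    (a b c : ℂ) (hf : Integrable f μ) (hg : Integrable g μ) (hh : Integrable h μ) :
    ∫ x, (a * f x - b * g x + c * h x) ∂μ = a * (∫ x, f x ∂μ) - b * (∫ x, g x ∂μ) + c * ∫ x, h x ∂μ := by
  have h1 : Integrable (fun x => a * f x - b * g x) μ := (hf.const_mul a).sub (hg.const_mul b)
  rw [integral_add h1 (hh.const_mul c), integral_sub (hf.const_mul a) (hg.const_mul b),
    integral_const_mul, integral_const_mul, integral_const_mul]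

/-- The integral over the tangential coordinate. The Cauchy kernel of negative height `z₂ - y₂` gives
minus a conjugate of `lap`; writing this as `lap` minus twice its real part produces the first term. -/
theorem integral_stokesIntegrand_fst {t : ℝ} (ht : 0 < t) {x y : ℝ × ℝ} {z₂ : ℝ} (hx : 0 < x.2) (hy : 0 < y.2)
    (hz : 0 < z₂) (hne : z₂ ≠ y.2) :
    ∫ z₁, stokesIntegrand t x (z₁, z₂) y =
      1 / Real.pi * (Iio y.2).indicator (fun z₂ => (heatOdd 0 t x.2 z₂ : ℂ) *
          ((lap 0 t (y.2 - z₂ - Complex.I * (x.1 - y.1))).re : ℂ)) z₂ -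
        1 / (2 * Real.pi) * ((heatOdd 0 t x.2 z₂ : ℂ) *
          (lap 0 t ((|z₂ - y.2| : ℝ) - Complex.I * (x.1 - y.1)) -
            lap 0 t ((z₂ + y.2 : ℝ) - Complex.I * (x.1 - y.1)))) +
        1 / Real.pi * ∫ w in (0 : ℝ)..x.2, (heat 0 t (w + z₂) : ℂ) *
          (levelSign y.2 z₂ * lap 1 t ((x.2 - w + |z₂ - y.2| : ℝ) - Complex.I * (x.1 - y.1)) +
            lap 1 t ((x.2 - w + z₂ + y.2 : ℝ) - Complex.I * (x.1 - y.1))) := by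
  have hpi : (Real.pi : ℂ) ≠ 0 := by exact_mod_cast Real.pi_ne_zero
  have ha : z₂ - y.2 ≠ 0 := sub_ne_zero.2 hne
  have hb : 0 < z₂ + y.2 := by linarith
  have habs : 0 < |z₂ - y.2| := abs_pos.2 ha
  have i1 := integrable_heat_mul_cauchy ht ha x.1 y.1
  have i2 := integrable_heat_mul_cauchy ht hb.ne' x.1 y.1
  obtain ⟨j1, e1⟩ := integral_greenC_mul_poisson ht habs hx y.1 z₂
  obtain ⟨j2, e2⟩ := integral_greenC_mul_poisson ht hb hx y.1 z₂
  have hP : ∀ b, -poisson (z₂ - y.2) b = levelSign y.2 z₂ * poisson |z₂ - y.2| b := fun b => by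
    unfold levelSign
    split_ifs with h
    · rw [abs_of_neg (by linarith), poisson_neg_left]; ring
    · rw [abs_of_nonneg (by linarith)]; ring
  have hs : ∀ z₁, stokesIntegrand t x (z₁, z₂) y =
      -(1 / (2 * Real.pi)) * (heatOdd 0 t x.2 z₂ : ℂ) *
        ((heat 0 t (x.1 - z₁) : ℂ) * (1 / (((z₂ - y.2 : ℝ) : ℂ) - Complex.I * ((z₁ - y.1 : ℝ) : ℂ))) -
          (heat 0 t (x.1 - z₁) : ℂ) * (1 / (((z₂ + y.2 : ℝ) : ℂ) - Complex.I * ((z₁ - y.1 : ℝ) : ℂ)))) +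
      1 / 2 * (levelSign y.2 z₂ * (greenC t x (z₁, z₂) * poisson |z₂ - y.2| (z₁ - y.1)) +
        greenC t x (z₁, z₂) * poisson (z₂ + y.2) (z₁ - y.1)) := fun z₁ => by
    unfold stokesIntegrand
    rw [bsKernel_complex, bsKernel_zero_eq, hP]
    push_cast; ring
  simp_rw [hs]
  have hi : Integrable (fun z₁ => (heat 0 t (x.1 - z₁) : ℂ) *
      (1 / (((z₂ - y.2 : ℝ) : ℂ) - Complex.I * ((z₁ - y.1 : ℝ) : ℂ))) - (heat 0 t (x.1 - z₁) : ℂ) *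
      (1 / (((z₂ + y.2 : ℝ) : ℂ) - Complex.I * ((z₁ - y.1 : ℝ) : ℂ)))) := i1.sub i2
  have hj : Integrable (fun z₁ => levelSign y.2 z₂ * (greenC t x (z₁, z₂) *
      poisson |z₂ - y.2| (z₁ - y.1)) + greenC t x (z₁, z₂) * poisson (z₂ + y.2) (z₁ - y.1)) :=
    (j1.const_mul _).add j2
  rw [integral_add (hi.const_mul _) (hj.const_mul _),
    integral_const_mul, integral_const_mul, integral_sub i1 i2, integral_add (j1.const_mul _) j2,
    integral_const_mul, e1, e2, integral_heat_mul_cauchy_pos ht hb]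
  obtain ⟨ch, cl⟩ := And.intro (continuous_heat 0 ht) (continuous_lap 1 ht)
  have k1 : IntervalIntegrable (fun w : ℝ => (heat 0 t (w + z₂) : ℂ) *
        lap 1 t (x.2 - w + (|z₂ - y.2| : ℝ) - Complex.I * (x.1 - y.1))) volume 0 x.2 :=
    Continuous.intervalIntegrable (by fun_prop) _ _
  have k2 : IntervalIntegrable (fun w : ℝ => (heat 0 t (w + z₂) : ℂ) *
        lap 1 t (x.2 - w + (z₂ + y.2 : ℝ) - Complex.I * (x.1 - y.1))) volume 0 x.2 :=
    Continuous.intervalIntegrable (by fun_prop) _ _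
  have hint : (∫ w in (0 : ℝ)..x.2, (heat 0 t (w + z₂) : ℂ) *
          (levelSign y.2 z₂ * lap 1 t ((x.2 - w + |z₂ - y.2| : ℝ) - Complex.I * (x.1 - y.1)) +
            lap 1 t ((x.2 - w + z₂ + y.2 : ℝ) - Complex.I * (x.1 - y.1)))) =
      levelSign y.2 z₂ * (∫ w in (0 : ℝ)..x.2, (heat 0 t (w + z₂) : ℂ) *
        lap 1 t (x.2 - w + (|z₂ - y.2| : ℝ) - Complex.I * (x.1 - y.1))) +
      ∫ w in (0 : ℝ)..x.2, (heat 0 t (w + z₂) : ℂ) *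
        lap 1 t (x.2 - w + (z₂ + y.2 : ℝ) - Complex.I * (x.1 - y.1)) := by
    rw [← intervalIntegral.integral_const_mul, ← intervalIntegral.integral_add (k1.const_mul _) k2]
    congr 1; ext w
    push_cast
    rw [add_assoc _ (z₂ : ℂ)]
    ring
  rw [hint]
  by_cases h : z₂ < y.2
  · rw [indicator_of_mem (show z₂ ∈ Iio y.2 from h)]
    have h3 := integral_heat_mul_cauchy_neg ht (sub_pos.2 h) x.1 y.1
    rw [neg_sub] at h3
    rw [h3, abs_of_neg (by linarith : z₂ - y.2 < 0), neg_sub, ← Complex.ofReal_sub y.2 z₂]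
    have h4 : ((lap 0 t (((y.2 - z₂ : ℝ) : ℂ) - Complex.I * (x.1 - y.1))).re : ℂ) =
        1 / 2 * (lap 0 t (((y.2 - z₂ : ℝ) : ℂ) - Complex.I * (x.1 - y.1)) +
          (starRingEnd ℂ) (lap 0 t (((y.2 - z₂ : ℝ) : ℂ) - Complex.I * (x.1 - y.1)))) := by
      rw [Complex.add_conj, Complex.ofReal_mul, Complex.ofReal_ofNat]; ring
    rw [h4]
    field_simp
    ring
  · rw [indicator_of_notMem (show z₂ ∉ Iio y.2 from h)]
    have h1 : 0 < z₂ - y.2 := lt_of_le_of_ne (by linarith) ha.symm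
    rw [integral_heat_mul_cauchy_pos ht h1, abs_of_pos h1]
    field_simp
    ring

/-- The kernel of `S(t) K`. By `integral_heatOdd_identity`, the integrals over the half plane reduce to
integrals over the segments from the boundary to `x` and to `y`. -/
theorem integral_stokesIntegrand {t : ℝ} (ht : 0 < t) {x : ℝ × ℝ} (hx : 0 < x.2) (y : ClosedHalf) :
    ∫ z in openHalf, stokesIntegrand t x z y.1 = velKernel t x y.1 := by
  have hpi : (Real.pi : ℂ) ≠ 0 := by exact_mod_cast Real.pi_ne_zero
  -- both sides vanish for a vortex on the boundary
  rcases y.2.eq_or_lt with h0 | hy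
  · have : ∀ z, stokesIntegrand t x z y.1 = 0 := fun z => by
      unfold stokesIntegrand; simp [bsKernel_boundary h0.symm]
    simp_rw [this]
    simp [velKernel, ← h0]
  -- integrability for the single point `y` is that for the point mass at `y`
  have hz : ∀ᵐ y' ∂(Measure.dirac y), Integrable (fun z => stokesIntegrand t x z y'.1)
      (volume.restrict openHalf) := (integrable_stokesIntegrand ht hx (Measure.dirac y)).prod_left_ae
  rw [ae_dirac_eq] at hz
  replace hz : Integrable (fun z => stokesIntegrand t x z y.1) (volume.restrict openHalf) := hz
  have hO : (volume.restrict openHalf : Measure (ℝ × ℝ)) = volume.prod (volume.restrict (Ioi 0)) := by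
    have : openHalf = univ ×ˢ Ioi 0 := by ext; simp [openHalf]
    rw [this, Measure.volume_eq_prod, ← Measure.prod_restrict, Measure.restrict_univ]
  rw [hO] at hz ⊢
  rw [integral_prod_symm _ hz]
  set X : ℂ := x.1 - y.1.1 with hX
  have hXr : X = ((x.1 - y.1.1 : ℝ) : ℂ) := by push_cast; rfl
  let φ : ℕ → ℝ → ℂ := fun n a => lap n t (a - Complex.I * X)
  obtain ⟨L0, hL00, hL0⟩ := exists_lap_bound 0
  obtain ⟨L1, hL10, hL1⟩ := exists_lap_bound 1
  set B := L0 * (√t)⁻¹ ^ (0 + 1) + L1 * (√t)⁻¹ ^ (1 + 1)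
  have hre : ∀ a : ℝ, 0 ≤ a → 0 ≤ ((a : ℂ) - Complex.I * X).re := fun a ha => by
    rw [hXr]; simpa using ha
  have b0 : ∀ a, 0 ≤ a → ‖φ 0 a‖ ≤ B := fun a ha =>
    (hL0 t ht _ (hre a ha)).trans (le_add_of_nonneg_right (by positivity))
  have b1 : ∀ a, 0 ≤ a → ‖φ 1 a‖ ≤ B := fun a ha =>
    (hL1 t ht _ (hre a ha)).trans (le_add_of_nonneg_left (by positivity))
  have cl0 := continuous_lap 0 ht
  have cl1 := continuous_lap 1 ht
  have ch := continuous_heat 0 ht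
  have c0 : Continuous (φ 0) := by fun_prop
  have c1 : Continuous (φ 1) := by fun_prop
  have hd : ∀ a, HasDerivAt (φ 0) (-φ 1 a) a := fun a => by
    have := hasDerivAt_lap 0 ht (-(Complex.I * X)) 1 a
    simp only [one_mul, neg_one_mul, neg_add_eq_sub] at this
    exact this
  have hid := integral_heatOdd_identity ht hd c1 b0 b1 hx.le hy.le
  obtain ⟨C, hC0, hC⟩ := exists_heatOdd_bound 0 (t₁ := t) ht x.2
  have hG : Integrable (fun z : ℝ => Real.exp (-z ^ 2 / (16 * t))) :=
    integrable_exp_neg_sq_div (by positivity)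
  have co : Continuous fun z => heatOdd 0 t x.2 z :=
    (continuous_heatOdd 0 ht).comp (Continuous.prodMk_right x.2)
  have ca0 : Continuous fun z : ℝ => φ 0 |z - y.1.2| - φ 0 (z + y.1.2) := by fun_prop
  -- the three parts of the integral over the normal coordinate
  let f1 : ℝ → ℂ := fun z => (heatOdd 0 t x.2 z : ℂ) * ((φ 0 (y.1.2 - z)).re : ℂ)
  let f2 : ℝ → ℂ := fun z => (heatOdd 0 t x.2 z : ℂ) * (φ 0 |z - y.1.2| - φ 0 (z + y.1.2))
  let F3 : ℝ → ℝ → ℂ := fun z w => (heat 0 t (w + z) : ℂ) *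
    (levelSign y.1.2 z * φ 1 (x.2 - w + |z - y.1.2|) + φ 1 (x.2 - w + z + y.1.2))
  have i1 : IntegrableOn ((Iio y.1.2).indicator f1) (Ioi 0) := by
    rw [IntegrableOn, integrable_indicator_iff measurableSet_Iio, IntegrableOn,
      Measure.restrict_restrict measurableSet_Iio]
    have : Continuous f1 := by fun_prop
    exact (this.integrableOn_Icc (a := 0) (b := y.1.2)).mono_set fun z hz => ⟨hz.2.le, hz.1.le⟩
  have i2 : IntegrableOn f2 (Ioi 0) := by
    refine ((hG.const_mul C).mul_const (B + B)).integrableOn.mono'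
      (Continuous.aestronglyMeasurable (by fun_prop)) ?_
    filter_upwards [ae_restrict_mem measurableSet_Ioi] with z hz
    have hz : 0 < z := hz
    rw [norm_mul, Complex.norm_real, Real.norm_eq_abs]
    exact mul_le_mul (hC t _ z le_rfl le_rfl (abs_of_pos hx).le).1
      ((norm_sub_le _ _).trans (add_le_add (b0 _ (abs_nonneg _)) (b0 _ (by linarith)))) (norm_nonneg _)
      (by positivity)
  have i3 : Integrable (Function.uncurry F3)
      ((volume.restrict (Ioi (0 : ℝ))).prod (volume.restrict (Ioc 0 x.2))) := by
    have hG2 := (((hG.const_mul C).mul_const (B + B)).restrict (s := Ioi 0)).mul_prod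
      (ν := volume.restrict (Ioc 0 x.2)) (g := fun _ => (1 : ℝ)) (integrable_const _)
    refine hG2.mono' ?_ ?_
    · have ml := measurable_levelSign y.1.2
      have m1 : Measurable fun p : ℝ × ℝ => φ 1 (x.2 - p.2 + |p.1 - y.1.2|) :=
        Continuous.measurable (by fun_prop)
      have m2 : Measurable fun p : ℝ × ℝ => φ 1 (x.2 - p.2 + p.1 + y.1.2) :=
        Continuous.measurable (by fun_prop)
      have m3 : Measurable fun p : ℝ × ℝ => heat 0 t (p.2 + p.1) :=
        Continuous.measurable (by fun_prop)
      refine Measurable.aestronglyMeasurable ?_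
      simp only [F3, Function.uncurry_def]
      fun_prop
    · have m1 : ∀ᵐ p : ℝ × ℝ ∂((volume.restrict (Ioi (0 : ℝ))).prod (volume.restrict (Ioc 0 x.2))),
        p.1 ∈ Ioi (0 : ℝ) := Measure.quasiMeasurePreserving_fst.ae (ae_restrict_mem measurableSet_Ioi)
      have m2 : ∀ᵐ p : ℝ × ℝ ∂((volume.restrict (Ioi (0 : ℝ))).prod (volume.restrict (Ioc 0 x.2))),
        p.2 ∈ Ioc 0 x.2 := Measure.quasiMeasurePreserving_snd.ae (ae_restrict_mem measurableSet_Ioc)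
      filter_upwards [m1, m2] with p hp1 hp2
      have hp1 : 0 < p.1 := hp1
      have n1 : 0 ≤ x.2 - p.2 + |p.1 - y.1.2| := by
        have := abs_nonneg (p.1 - y.1.2); linarith [hp2.2]
      have n2 : 0 ≤ x.2 - p.2 + p.1 + y.1.2 := by linarith [hp2.2]
      simp only [Function.uncurry, F3, mul_one]
      rw [norm_mul, Complex.norm_real, Real.norm_eq_abs]
      refine mul_le_mul (hC t _ p.1 le_rfl le_rfl (by rw [abs_of_pos hp2.1]; exact hp2.2)).2.2
        ((norm_add_le _ _).trans (add_le_add ?_ (b1 _ n2))) (norm_nonneg _) (by positivity)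
      rw [norm_mul, Complex.norm_real, Real.norm_eq_abs, abs_levelSign, one_mul]
      exact b1 _ n1
  have hin : ∀ᵐ z ∂(volume.restrict (Ioi (0 : ℝ))), ∫ z₁, stokesIntegrand t x (z₁, z) y.1 =
      1 / Real.pi * (Iio y.1.2).indicator f1 z - 1 / (2 * Real.pi) * f2 z +
        1 / Real.pi * ∫ w in Ioc 0 x.2, F3 z w := by
    have h : ∀ᵐ v : ℝ, v ≠ y.1.2 := compl_mem_ae_iff.2 (measure_singleton _)
    filter_upwards [ae_restrict_mem measurableSet_Ioi, ae_restrict_of_ae h] with z hz hne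
    rw [integral_stokesIntegrand_fst ht hx hy hz hne, intervalIntegral.integral_of_le hx.le]
    simp only [f1, f2, F3, φ, hX, Complex.ofReal_sub]
  have i4 : IntegrableOn (fun z => ∫ w in Ioc 0 x.2, F3 z w) (Ioi 0) := i3.integral_prod_left
  rw [integral_congr_ae hin, integral_mul_sub_mul_add_mul _ _ _ i1 i2 i4, hid,
    setIntegral_indicator measurableSet_Iio, Ioi_inter_Iio, ← integral_Ioc_eq_integral_Ioo,
    integral_integral_swap i3]
  have k1 : IntervalIntegrable (fun w : ℝ => ∫ z in (0 : ℝ)..y.1.2,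
      (heatOdd 0 t w z : ℂ) * φ 1 (x.2 - w + y.1.2 - z)) volume 0 x.2 := by
    refine Continuous.intervalIntegrable ?_ _ _
    apply intervalIntegral.continuous_parametric_intervalIntegral_of_continuous'
    have := continuous_heatOdd 0 ht
    simp only [Function.uncurry_def]
    fun_prop
  have k2 : IntervalIntegrable (fun w : ℝ => ∫ z in Ioi (0 : ℝ), F3 z w) volume 0 x.2 := by
    rw [intervalIntegrable_iff_integrableOn_Ioc_of_le hx.le]
    exact i3.integral_prod_right
  rw [intervalIntegral.integral_add k1 k2, velKernel, intervalIntegral.integral_of_le hy.le,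
    intervalIntegral.integral_of_le hx.le (f := fun w : ℝ => ∫ z in Ioi (0 : ℝ), F3 z w)]
  have e1 : (∫ z in Ioc 0 y.1.2, f1 z) = ∫ r in Ioc 0 y.1.2, (heatOdd 0 t x.2 r : ℂ) *
      ((lap 0 t (y.1.2 - r - Complex.I * (x.1 - y.1.1))).re : ℂ) := by
    simp only [f1, φ, hX, Complex.ofReal_sub]
  have e2 : (∫ w in (0 : ℝ)..x.2, ∫ z in (0 : ℝ)..y.1.2,
      (heatOdd 0 t w z : ℂ) * φ 1 (x.2 - w + y.1.2 - z)) =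
      ∫ w in (0 : ℝ)..x.2, ∫ r in (0 : ℝ)..y.1.2, (heatOdd 0 t w r : ℂ) *
        lap 1 t (x.2 - w + y.1.2 - r - Complex.I * (x.1 - y.1.1)) := by
    simp only [φ, hX, Complex.ofReal_sub, Complex.ofReal_add]
  rw [e1, e2]
  field_simp
  ring

/-! ### The velocity of a measure -/

theorem measurableSet_openHalf : MeasurableSet openHalf :=
  measurableSet_lt measurable_const measurable_snd

theorem ae_integrable_bsKernel (μ : Measure ClosedHalf) [IsFiniteMeasure μ] :
    ∀ᵐ z ∂(volume.restrict openHalf), ∀ i : Fin 2,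
      Integrable (fun y : ClosedHalf => bsKernel z y.1 i) μ ∧
      (fun y : ClosedHalf => biotSavartKernel z y.1 i) =ᵐ[μ] fun y => bsKernel z y.1 i := by
  have h0 := (integrable_decay_mul_bsKernel one_pos 0 μ 0).prod_right_ae
  have h1 := (integrable_decay_mul_bsKernel one_pos 0 μ 1).prod_right_ae
  have h2 := ae_restrict_of_ae (s := openHalf) (Measure.ae_ae_of_ae_prod (ae_prod_prod_ne μ))
  filter_upwards [h0, h1, h2, ae_restrict_mem measurableSet_openHalf] with z h0 h1 h2 hz i
  have hd : decay 1 0 z ≠ 0 := by unfold decay; positivity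
  constructor
  · fin_cases i
    · exact (integrable_const_mul_iff (isUnit_iff_ne_zero.2 hd) _).1 h0
    · exact (integrable_const_mul_iff (isUnit_iff_ne_zero.2 hd) _).1 h1
  · filter_upwards [h2] with y hy
    exact biotSavartKernel_eq (fun h => hy.1 (by rw [h])) (le_of_lt hz) y.2 i

/-- The kernel of the tangential trace is the Poisson kernel; for `y` on the boundary both vanish. -/
theorem biotSavartKernel_trace (x₁ : ℝ) (y : ClosedHalf) :
    biotSavartKernel (x₁, 0) y.1 0 = poisson y.1.2 (x₁ - y.1.1) := by
  rcases y.2.eq_or_lt with h | h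
  · rw [biotSavartKernel_boundary h.symm, ← h, poisson_zero]
  · rw [biotSavartKernel_eq (fun h' => by rw [← h'] at h; exact lt_irrefl _ h) le_rfl y.2, bsKernel_zero_eq]
    simp only [zero_sub, zero_add, poisson_neg_left]
    ring

theorem integrable_trace_kernel (μ : Measure ClosedHalf) [IsFiniteMeasure μ] :
    Integrable (fun p : ℝ × ClosedHalf => poisson p.2.1.2 (p.1 - p.2.1.1)) (volume.prod μ) := by
  have hm : AEStronglyMeasurable (fun p : ℝ × ClosedHalf => poisson p.2.1.2 (p.1 - p.2.1.1))
      (volume.prod μ) := by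
    refine Measurable.aestronglyMeasurable ?_
    unfold poisson; fun_prop
  rw [integrable_prod_iff' hm]
  have hle : ∀ y : ClosedHalf, Integrable (fun x : ℝ => poisson y.1.2 (x - y.1.1)) ∧
      ∫ x : ℝ, ‖poisson y.1.2 (x - y.1.1)‖ ≤ 1 := fun y => by
    rcases y.2.eq_or_lt with h | h
    · rw [← h]; simp [poisson_zero]
    · refine ⟨(integrable_poisson h).comp_sub_right _, le_of_eq ?_⟩
      rw [integral_sub_right_eq_self (fun x => ‖poisson y.1.2 x‖), ← integral_poisson h]
      congr 1; ext x
      rw [Real.norm_eq_abs, abs_of_nonneg (poisson_nonneg h.le x)]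
  refine ⟨ae_of_all _ fun y => (hle y).1, ?_⟩
  refine (integrable_const (1 : ℝ)).mono' hm.norm.prod_swap.integral_prod_right' (ae_of_all _ fun y => ?_)
  rw [Real.norm_eq_abs, abs_of_nonneg (integral_nonneg fun _ => norm_nonneg _)]
  exact (hle y).2

theorem sint_eq {α : Type*} [MeasurableSpace α] (ω : SignedMeasure α) (f : α → ℝ) :
    sint ω f = (∫ y, f y ∂ω.toJordanDecomposition.posPart) -
      ∫ y, f y ∂ω.toJordanDecomposition.negPart := rfl

theorem integrable_totalVariation_iff {α E : Type*} [MeasurableSpace α] [NormedAddCommGroup E]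
    (ω : SignedMeasure α) (f : α → E) :
    Integrable f ω.totalVariation ↔ Integrable f ω.toJordanDecomposition.posPart ∧
      Integrable f ω.toJordanDecomposition.negPart := integrable_add_measure

theorem tangentialTrace_eq (ω : M) (x₁ : ℝ) : tangentialTrace ω x₁ =
    (∫ y, poisson y.1.2 (x₁ - y.1.1) ∂ω.toJordanDecomposition.posPart) -
      ∫ y, poisson y.1.2 (x₁ - y.1.1) ∂ω.toJordanDecomposition.negPart := by
  simp only [tangentialTrace, biotSavart, sint_eq, biotSavartKernel_trace]

theorem integrable_tangentialTrace (ω : M) : Integrable (tangentialTrace ω) := by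
  rw [funext (tangentialTrace_eq ω)]
  exact (integrable_trace_kernel _).integral_prod_left.sub (integrable_trace_kernel _).integral_prod_left

theorem ae_integrable_biotSavartKernel (ω : M) :
    ∀ᵐ x ∂(volume.restrict openHalf), ∀ i : Fin 2,
        Integrable (fun y : ClosedHalf => biotSavartKernel x y.1 i) ω.totalVariation := by
  filter_upwards [ae_integrable_bsKernel ω.toJordanDecomposition.posPart,
    ae_integrable_bsKernel ω.toJordanDecomposition.negPart] with x h1 h2 i
  rw [integrable_totalVariation_iff]
  exact ⟨(h1 i).1.congr (h1 i).2.symm, (h2 i).1.congr (h2 i).2.symm⟩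

theorem ae_integrable_biotSavartKernel_trace (ω : M) :
    ∀ᵐ x₁ : ℝ, Integrable (fun y : ClosedHalf => biotSavartKernel (x₁, 0) y.1 0) ω.totalVariation := by
  filter_upwards [(integrable_trace_kernel ω.toJordanDecomposition.posPart).prod_right_ae,
    (integrable_trace_kernel ω.toJordanDecomposition.negPart).prod_right_ae] with x h1 h2
  rw [integrable_totalVariation_iff]
  simp only [biotSavartKernel_trace]
  exact ⟨h1, h2⟩

/-- The velocity `S(t) K μ` of a positive measure, first component minus `i` times the second. -/
noncomputable def velocity (μ : Measure ClosedHalf) (t : ℝ) (x : ℝ × ℝ) : ℂ :=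
  ∫ y, velKernel t x y.1 ∂μ

theorem integral_integral_stokesIntegrand {t : ℝ} (ht : 0 < t) {x : ℝ × ℝ} (hx : 0 < x.2)
    (μ : Measure ClosedHalf) [IsFiniteMeasure μ] :
    ∫ z in openHalf, ∫ y, stokesIntegrand t x z y.1 ∂μ = velocity μ t x := by
  have := integral_integral_swap (f := fun z (y : ClosedHalf) => stokesIntegrand t x z y.1)
    (integrable_stokesIntegrand ht hx μ)
  rw [this, velocity]
  congr 1; ext y
  exact integral_stokesIntegrand ht hx y

theorem integral_stokesIntegrand_measure (t : ℝ) (x z : ℝ × ℝ) (μ : Measure ClosedHalf)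
    (h0 : Integrable (fun y : ClosedHalf => bsKernel z y.1 0) μ)
    (h1 : Integrable (fun y : ClosedHalf => bsKernel z y.1 1) μ) :
    ∫ y, stokesIntegrand t x z y.1 ∂μ = ((heat 0 t (x.1 - z.1) * heatOdd 0 t x.2 z.2 : ℝ) : ℂ) *
      ((∫ y, bsKernel z y.1 0 ∂μ : ℝ) - Complex.I * (∫ y, bsKernel z y.1 1 ∂μ : ℝ)) +
        greenC t x z * (∫ y, bsKernel z y.1 0 ∂μ : ℝ) := by
  have k0 : Integrable (fun y : ClosedHalf => (bsKernel z y.1 0 : ℂ)) μ := h0.ofReal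
  have k1 : Integrable (fun y : ClosedHalf => (bsKernel z y.1 1 : ℂ)) μ := h1.ofReal
  have k2 : Integrable (fun y : ClosedHalf => (bsKernel z y.1 0 - Complex.I * bsKernel z y.1 1 : ℂ)) μ :=
    k0.sub (k1.const_mul _)
  unfold stokesIntegrand
  rw [integral_add (k2.const_mul _) (k0.const_mul _), integral_const_mul, integral_const_mul,
    integral_sub k0 (k1.const_mul _), integral_const_mul, integral_complex_ofReal, integral_complex_ofReal]

/-- The velocity `S(t) K ω` of a signed measure, first component minus `i` times the second. -/
noncomputable def signedVelocity (ω : M) (t : ℝ) (x : ℝ × ℝ) : ℂ :=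
  velocity ω.toJordanDecomposition.posPart t x - velocity ω.toJordanDecomposition.negPart t x

/-- The integrand of `S(t) K ω` in terms of `stokesIntegrand`. It holds almost everywhere because the
explicit Biot–Savart kernel is valid off the singularity only. -/
theorem ae_sum_greenMatrix_eq {t : ℝ} (ht : 0 < t) {x : ℝ × ℝ} (hx : 0 < x.2) (ω : M) :
    ∀ᵐ z ∂(volume.restrict openHalf),
      (∑ j, greenMatrix 0 j x z t * biotSavart ω z j =
        ((∫ y, stokesIntegrand t x z y.1 ∂ω.toJordanDecomposition.posPart) -
          ∫ y, stokesIntegrand t x z y.1 ∂ω.toJordanDecomposition.negPart).re) ∧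
      ∑ j, greenMatrix 1 j x z t * biotSavart ω z j =
        -((∫ y, stokesIntegrand t x z y.1 ∂ω.toJordanDecomposition.posPart) -
          ∫ y, stokesIntegrand t x z y.1 ∂ω.toJordanDecomposition.negPart).im := by
  filter_upwards [ae_integrable_bsKernel ω.toJordanDecomposition.posPart,
    ae_integrable_bsKernel ω.toJordanDecomposition.negPart] with z h1 h2
  have hb : ∀ i, biotSavart ω z i = (∫ y, bsKernel z y.1 i ∂ω.toJordanDecomposition.posPart) -
      ∫ y, bsKernel z y.1 i ∂ω.toJordanDecomposition.negPart := fun i => by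
    rw [biotSavart, sint_eq, integral_congr_ae (h1 i).2, integral_congr_ae (h2 i).2]
  rw [integral_stokesIntegrand_measure t x z _ (h1 0).1 (h1 1).1,
    integral_stokesIntegrand_measure t x z _ (h2 0).1 (h2 1).1]
  simp only [Fin.sum_univ_two, hb, greenMatrix_col_one ht, (greenMatrix_col_zero ht x z hx).1,
    (greenMatrix_col_zero ht x z hx).2, heatOdd]
  constructor
  · simp
    ring
  · simp
    ring

theorem integrable_integral_stokesIntegrand {t : ℝ} (ht : 0 < t) {x : ℝ × ℝ} (hx : 0 < x.2) (ω : M) :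
    Integrable (fun z => (∫ y, stokesIntegrand t x z y.1 ∂ω.toJordanDecomposition.posPart) -
          ∫ y, stokesIntegrand t x z y.1 ∂ω.toJordanDecomposition.negPart) (volume.restrict openHalf) :=
  (integrable_stokesIntegrand ht hx _).integral_prod_left.sub
    (integrable_stokesIntegrand ht hx _).integral_prod_left

theorem integrableOn_stokes {t : ℝ} (ht : 0 < t) {x : ℝ × ℝ} (hx : 0 < x.2) (ω : M) (i : Fin 2) :
    IntegrableOn (fun z => ∑ j, greenMatrix i j x z t * biotSavart ω z j) openHalf := by
  have h := ae_sum_greenMatrix_eq ht hx ω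
  have hi := integrable_integral_stokesIntegrand ht hx ω
  fin_cases i
  · exact hi.re.congr (h.mono fun z hz => hz.1.symm)
  · exact hi.im.neg.congr (h.mono fun z hz => hz.2.symm)

theorem stokes_biotSavart {t : ℝ} (ht : 0 < t) {x : ℝ × ℝ} (hx : 0 < x.2) (ω : M) :
    stokes t (biotSavart ω) x 0 = (signedVelocity ω t x).re ∧
      stokes t (biotSavart ω) x 1 = -(signedVelocity ω t x).im := by
  have h := ae_sum_greenMatrix_eq ht hx ω
  have hi := integrable_integral_stokesIntegrand ht hx ω
  have e : ∫ z in openHalf, ((∫ y, stokesIntegrand t x z y.1 ∂ω.toJordanDecomposition.posPart) -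
      ∫ y, stokesIntegrand t x z y.1 ∂ω.toJordanDecomposition.negPart) = signedVelocity ω t x := by
    rw [integral_sub (integrable_stokesIntegrand ht hx _).integral_prod_left
      (integrable_stokesIntegrand ht hx _).integral_prod_left, signedVelocity,
      ← integral_integral_stokesIntegrand ht hx, ← integral_integral_stokesIntegrand ht hx]
  unfold stokes
  constructor
  · rw [integral_congr_ae (h.mono fun z hz => hz.1), ← e]
    exact integral_re hi
  · rw [integral_congr_ae (h.mono fun z hz => hz.2), ← e, integral_neg]
    exact congrArg Neg.neg (integral_im hi)

/-! ### Smooth dependence on time and space -/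

theorem hasFDerivAt_heatOdd (m : ℕ) (r : ℝ) {p : ℝ × ℝ} (hp : 0 < p.1) :
    HasFDerivAt (fun p : ℝ × ℝ => heatOdd m p.1 p.2 r)
      (heatOdd (m + 2) p.1 p.2 r • ContinuousLinearMap.fst ℝ ℝ ℝ +
        heatOdd (m + 1) p.1 p.2 r • ContinuousLinearMap.snd ℝ ℝ ℝ) p := by
  have h : ∀ c : ℝ, HasFDerivAt (fun p : ℝ × ℝ => heat m p.1 (p.2 + c))
      (heat (m + 2) p.1 (p.2 + c) • ContinuousLinearMap.fst ℝ ℝ ℝ +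
        heat (m + 1) p.1 (p.2 + c) • ContinuousLinearMap.snd ℝ ℝ ℝ) p := fun c => by
    have h1 := (hasFDerivAt_heat m (p := (p.1, p.2 + c)) hp).comp p
      ((hasFDerivAt_fst (𝕜 := ℝ) (p := p)).prodMk ((hasFDerivAt_snd (𝕜 := ℝ) (p := p)).add_const c))
    refine h1.congr_fderiv ?_
    ext <;> simp
  have := (h (-r)).sub (h r)
  simp only [← sub_eq_add_neg] at this
  refine this.congr_fderiv ?_
  unfold heatOdd
  ext <;> simp

/-- The indicator of the pairs `(y, r)` with `0 < r ≤ y₂`. -/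
noncomputable def segCut (q : ClosedHalf × ℝ) : ℂ := if 0 < q.2 ∧ q.2 ≤ q.1.1.2 then 1 else 0

/-- The integrand of the layer integrals: the heat kernel difference in the normal variable times
the transform of the Gaussian, cut off to the segment below the point `q.1`. Time, complex position
and normal position are the entries of `p`. -/
noncomputable def layerIntegrand (i : ℕ × ℕ) (p : ℝ × ℂ × ℝ) (q : ClosedHalf × ℝ) : ℂ :=
  segCut q * ((heatOdd i.1 p.1 p.2.2 q.2 : ℂ) *
    lap i.2 p.1 (p.2.1 + q.1.1.2 - q.2 + Complex.I * q.1.1.1))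

/-- The index of the kernel multiplying the `l`-th linear form in the derivative of a layer. -/
def layerShift (i : ℕ × ℕ) (l : Fin 4) : ℕ × ℕ :=
  ![(i.1 + 2, i.2), (i.1, i.2 + 2), (i.1, i.2 + 1), (i.1 + 1, i.2)] l

/-- The linear forms in the derivative of a layer. Time occurs twice, with the two factors of the
integrand. -/
noncomputable def layerForm : Fin 4 → (ℝ × ℂ × ℝ →L[ℝ] ℂ) :=
  ![Complex.ofRealCLM.comp (ContinuousLinearMap.fst ℝ ℝ (ℂ × ℝ)),
    -Complex.ofRealCLM.comp (ContinuousLinearMap.fst ℝ ℝ (ℂ × ℝ)),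
    -(ContinuousLinearMap.fst ℝ ℂ ℝ).comp (ContinuousLinearMap.snd ℝ ℝ (ℂ × ℝ)),
    Complex.ofRealCLM.comp ((ContinuousLinearMap.snd ℝ ℂ ℝ).comp (ContinuousLinearMap.snd ℝ ℝ (ℂ × ℝ)))]

/-- Both factors solve a heat equation, so the family `layerIntegrand` is closed under differentiation in
its parameters. -/
theorem hasFDerivAt_layerIntegrand (i : ℕ × ℕ) {p : ℝ × ℂ × ℝ} (hp : 0 < p.1) (q : ClosedHalf × ℝ) :
    HasFDerivAt (fun p => layerIntegrand i p q)
      (∑ l, layerIntegrand (layerShift i l) p q • layerForm l) p := by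
  have h1 : HasFDerivAt (fun p : ℝ × ℂ × ℝ => (p.1, p.2.2))
      ((ContinuousLinearMap.fst ℝ ℝ (ℂ × ℝ)).prod
        ((ContinuousLinearMap.snd ℝ ℂ ℝ).comp (ContinuousLinearMap.snd ℝ ℝ (ℂ × ℝ)))) p :=
    ((ContinuousLinearMap.fst ℝ ℝ (ℂ × ℝ)).prod
        ((ContinuousLinearMap.snd ℝ ℂ ℝ).comp (ContinuousLinearMap.snd ℝ ℝ (ℂ × ℝ)))).hasFDerivAt
  have h2 := (hasFDerivAt_heatOdd i.1 q.2 (p := (p.1, p.2.2)) hp).comp p h1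
  have h3 := Complex.ofRealCLM.hasFDerivAt.comp p h2
  have k1 : HasFDerivAt (fun p : ℝ × ℂ × ℝ => (p.1, p.2.1 + (q.1.1.2 - q.2 + Complex.I * q.1.1.1)))
      ((ContinuousLinearMap.fst ℝ ℝ (ℂ × ℝ)).prod
        ((ContinuousLinearMap.fst ℝ ℂ ℝ).comp (ContinuousLinearMap.snd ℝ ℝ (ℂ × ℝ)))) p :=
    (ContinuousLinearMap.fst ℝ ℝ (ℂ × ℝ)).hasFDerivAt.prodMk
      ((((ContinuousLinearMap.fst ℝ ℂ ℝ).comp (ContinuousLinearMap.snd ℝ ℝ (ℂ × ℝ))).hasFDerivAt).add_const _)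
  have k2 := (hasFDerivAt_lap i.2
    (p := (p.1, p.2.1 + (q.1.1.2 - q.2 + Complex.I * q.1.1.1))) hp).comp p k1
  have := (h3.mul k2).const_mul (segCut q)
  have e : (fun p => layerIntegrand i p q) = fun p : ℝ × ℂ × ℝ => segCut q *
      (Complex.ofRealCLM (heatOdd i.1 p.1 p.2.2 q.2) *
        lap i.2 p.1 (p.2.1 + (q.1.1.2 - q.2 + Complex.I * q.1.1.1))) := by
    ext p
    simp only [layerIntegrand, Complex.ofRealCLM_apply]
    congr 3; ring
  rw [e]
  refine this.congr_fderiv ?_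
  have e2 : (p.2.1 + (q.1.1.2 - q.2 + Complex.I * q.1.1.1) : ℂ) =
    p.2.1 + q.1.1.2 - q.2 + Complex.I * q.1.1.1 := by ring
  rw [e2]
  refine ContinuousLinearMap.ext fun v => ?_
  simp [Fin.sum_univ_four, layerIntegrand, layerShift, layerForm]
  ring_nf

theorem measurable_layerIntegrand (i : ℕ × ℕ) {p : ℝ × ℂ × ℝ} (hp : 0 < p.1) :
    Measurable (layerIntegrand i p) := by
  have h1 : Measurable fun z : ℝ => heatOdd i.1 p.1 p.2.2 z :=
    ((continuous_heatOdd i.1 hp).comp (Continuous.prodMk_right p.2.2)).measurable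
  have h2 := (continuous_lap i.2 hp).measurable
  have h3 : MeasurableSet {q : ClosedHalf × ℝ | 0 < q.2 ∧ q.2 ≤ q.1.1.2} :=
    (measurableSet_lt measurable_const measurable_snd).inter
      (measurableSet_le measurable_snd (by fun_prop))
  have h4 : Measurable segCut :=
    Measurable.ite h3 measurable_const measurable_const
  unfold layerIntegrand
  fun_prop

theorem layerIntegrand_bound (i : ℕ × ℕ) {t₀ t₁ R A : ℝ} (h0 : 0 < t₀) : ∃ C : ℝ, 0 ≤ C ∧
    ∀ (p : ℝ × ℂ × ℝ) (q : ClosedHalf × ℝ), t₀ ≤ p.1 → p.1 ≤ t₁ → |p.2.2| ≤ R → -A ≤ p.2.1.re →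
      ‖layerIntegrand i p q‖ ≤ C * Real.exp (-q.2 ^ 2 / (16 * t₁)) := by
  obtain ⟨C, hC0, hC⟩ := exists_heatOdd_bound i.1 (t₁ := t₁) h0 R
  have hK : 0 ≤ ∫ k in Ioi (0 : ℝ), k ^ i.2 * Real.exp (-(t₀ * k ^ 2) + A * k) :=
    setIntegral_nonneg measurableSet_Ioi fun k hk => mul_nonneg (pow_nonneg (le_of_lt hk) _) (Real.exp_pos _).le
  refine ⟨C * ∫ k in Ioi (0 : ℝ), k ^ i.2 * Real.exp (-(t₀ * k ^ 2) + A * k), by positivity,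
    fun p q h1 h2 hw hA => ?_⟩
  unfold layerIntegrand segCut
  split_ifs with h
  · rw [one_mul, norm_mul, Complex.norm_real, Real.norm_eq_abs]
    have a := (hC p.1 p.2.2 q.2 h1 h2 hw).1
    have b := norm_lap_le i.2 (A := A) h0 h1 (ζ := p.2.1 + q.1.1.2 - q.2 + Complex.I * q.1.1.1) (by
      simp only [Complex.add_re, Complex.sub_re, Complex.mul_re, Complex.ofReal_re, Complex.I_re,
        Complex.I_im, Complex.ofReal_im]
      linarith [h.2])
    refine (mul_le_mul a b (norm_nonneg _) (by positivity)).trans (le_of_eq (by ring))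
  · rw [zero_mul, norm_zero]; positivity

theorem layerIntegrand_dominated (μ : Measure ClosedHalf) [IsFiniteMeasure μ] (i : ℕ × ℕ)
    {p : ℝ × ℂ × ℝ} (hp : 0 < p.1) :
    ∃ b : ClosedHalf × ℝ → ℝ, Integrable b (μ.prod volume) ∧ ∃ s ∈ 𝓝 p, ∀ᵐ y ∂(μ.prod volume), ∀ p' ∈ s,
      ‖layerIntegrand i p' y‖ ≤ b y := by
  obtain ⟨C, hC0, hC⟩ := layerIntegrand_bound i (t₀ := p.1 / 2) (t₁ := 2 * p.1) (R := |p.2.2| + 1)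
    (A := 1 - p.2.1.re) (half_pos hp)
  refine ⟨fun q => C * Real.exp (-q.2 ^ 2 / (16 * (2 * p.1))), ?_, {p' | p.1 / 2 < p'.1 ∧ p'.1 < 2 * p.1 ∧
    |p'.2.2| < |p.2.2| + 1 ∧ p.2.1.re - 1 < p'.2.1.re}, ?_, ae_of_all _ fun y p' hp' => ?_⟩
  · have := (integrable_const C (μ := μ)).mul_prod (ν := (volume : Measure ℝ))
      (integrable_exp_neg_sq_div (by positivity : 0 < 16 * (2 * p.1)))
    exact this
  · have o1 : IsOpen {p' : ℝ × ℂ × ℝ | p.1 / 2 < p'.1} := isOpen_lt (by fun_prop) (by fun_prop)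
    have o2 : IsOpen {p' : ℝ × ℂ × ℝ | p'.1 < 2 * p.1} := isOpen_lt (by fun_prop) (by fun_prop)
    have o3 : IsOpen {p' : ℝ × ℂ × ℝ | |p'.2.2| < |p.2.2| + 1} := isOpen_lt (by fun_prop) (by fun_prop)
    have o4 : IsOpen {p' : ℝ × ℂ × ℝ | p.2.1.re - 1 < p'.2.1.re} :=
      isOpen_lt (by fun_prop) (Complex.continuous_re.comp (by fun_prop))
    exact (o1.inter (o2.inter (o3.inter o4))).mem_nhds
      ⟨half_lt_self hp, show p.1 < 2 * p.1 by linarith, by simp, by simp⟩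
  · exact hC p' y hp'.1.le hp'.2.1.le hp'.2.2.1.le (by linarith [hp'.2.2.2])

/-- The layer kernel, an integral over the segment from the boundary to the point `y`. -/
noncomputable def layer (i : ℕ × ℕ) (p : ℝ × ℂ × ℝ) (y : ℝ × ℝ) : ℂ :=
  ∫ r in (0 : ℝ)..y.2, (heatOdd i.1 p.1 p.2.2 r : ℂ) *
    lap i.2 p.1 (p.2.1 + y.2 - r + Complex.I * y.1)

/-- The integral of the layer kernel against a measure. -/
noncomputable def layerPot (μ : Measure ClosedHalf) (i : ℕ × ℕ) (p : ℝ × ℂ × ℝ) : ℂ :=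
  ∫ y, layer i p y.1 ∂μ

theorem integrable_layerIntegrand (μ : Measure ClosedHalf) [IsFiniteMeasure μ] (i : ℕ × ℕ)
    {p : ℝ × ℂ × ℝ} (hp : 0 < p.1) : Integrable (layerIntegrand i p) (μ.prod volume) := by
  obtain ⟨b, hb, s, hs, h⟩ := layerIntegrand_dominated μ i hp
  exact hb.mono' (measurable_layerIntegrand i hp).aestronglyMeasurable
    (h.mono fun y hy => hy p (mem_of_mem_nhds hs))

theorem integral_layerIntegrand_snd (i : ℕ × ℕ) (p : ℝ × ℂ × ℝ) (y : ClosedHalf) :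
    ∫ r, layerIntegrand i p (y, r) = layer i p y.1 := by
  rw [layer, intervalIntegral.integral_of_le y.2, ← integral_indicator measurableSet_Ioc]
  congr 1; ext r
  unfold layerIntegrand segCut
  by_cases h : r ∈ Ioc 0 y.1.2
  · rw [indicator_of_mem h, if_pos (show 0 < (y, r).2 ∧ (y, r).2 ≤ (y, r).1.1.2 from h), one_mul]
  · rw [indicator_of_notMem h, if_neg (show ¬(0 < (y, r).2 ∧ (y, r).2 ≤ (y, r).1.1.2) from h), zero_mul]

theorem layerPot_eq (μ : Measure ClosedHalf) [IsFiniteMeasure μ] (i : ℕ × ℕ) {p : ℝ × ℂ × ℝ} (hp : 0 < p.1) :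
    layerPot μ i p = ∫ q, layerIntegrand i p q ∂(μ.prod volume) := by
  rw [integral_prod _ (integrable_layerIntegrand μ i hp), layerPot]
  simp_rw [integral_layerIntegrand_snd]

theorem isOpen_pos_time {P : Type*} [TopologicalSpace P] : IsOpen {p : ℝ × P | 0 < p.1} :=
  isOpen_lt continuous_const continuous_fst

theorem contDiffOn_layerPot (μ : Measure ClosedHalf) [IsFiniteMeasure μ] (i : ℕ × ℕ) :
    ContDiffOn ℝ ((⊤ : ℕ∞) : WithTop ℕ∞) (layerPot μ i) {p | 0 < p.1} :=
  (contDiffOn_integral_family (f := layerIntegrand) isOpen_pos_time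
    (fun i _ hp => (measurable_layerIntegrand i hp).aestronglyMeasurable)
    (fun i _ hp y => hasFDerivAt_layerIntegrand i hp y)
    (fun i _ hp => layerIntegrand_dominated μ i hp) i).congr fun _ hp => layerPot_eq μ i hp

theorem hasFDerivAt_layerPot (μ : Measure ClosedHalf) [IsFiniteMeasure μ] (i : ℕ × ℕ) {p : ℝ × ℂ × ℝ}
    (hp : 0 < p.1) :
    HasFDerivAt (layerPot μ i) (∑ l, layerPot μ (layerShift i l) p • layerForm l) p := by
  have := hasFDerivAt_integral_family (f := layerIntegrand) (μ := μ.prod volume) isOpen_pos_time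
    (fun i _ hp => (measurable_layerIntegrand i hp).aestronglyMeasurable)
    (fun i _ hp y => hasFDerivAt_layerIntegrand i hp y)
    (fun i _ hp => layerIntegrand_dominated μ i hp) i (p := p) hp
  simp_rw [← layerPot_eq μ _ hp] at this
  refine this.congr_of_eventuallyEq ?_
  filter_upwards [isOpen_pos_time.mem_nhds hp] with p' hp'
  exact layerPot_eq μ i hp'

/-! ### The velocity as a layer potential -/

theorem exists_norm_layer_le (i : ℕ × ℕ) {t : ℝ} (ht : 0 < t) (R A : ℝ) : ∃ C : ℝ, 0 ≤ C ∧
    ∀ (p : ℝ × ℂ × ℝ) (y : ClosedHalf), p.1 = t → |p.2.2| ≤ R → -A ≤ p.2.1.re → ‖layer i p y.1‖ ≤ C := by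
  obtain ⟨C, hC0, hC⟩ := layerIntegrand_bound i (t₀ := t) (t₁ := t) (R := R) (A := A) ht
  refine ⟨∫ r : ℝ, C * Real.exp (-r ^ 2 / (16 * t)), integral_nonneg fun r => by positivity,
    fun p y hp hR hA => ?_⟩
  rw [← integral_layerIntegrand_snd]
  refine norm_integral_le_of_norm_le ((integrable_exp_neg_sq_div (by positivity)).const_mul C)
    (ae_of_all _ fun r => hC p (y, r) hp.ge hp.le hR hA)

theorem integrable_layer (μ : Measure ClosedHalf) [IsFiniteMeasure μ] (i : ℕ × ℕ) {p : ℝ × ℂ × ℝ} (hp : 0 < p.1) :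
    Integrable (fun y : ClosedHalf => layer i p y.1) μ := by
  have := (integrable_layerIntegrand μ i hp).integral_prod_left
  simpa only [integral_layerIntegrand_snd] using this

theorem norm_layerPot_le (μ : Measure ClosedHalf) [IsFiniteMeasure μ] (i : ℕ × ℕ) {p : ℝ × ℂ × ℝ} {C : ℝ}
    (h : ∀ y : ClosedHalf, ‖layer i p y.1‖ ≤ C) : ‖layerPot μ i p‖ ≤ C * μ.real univ := by
  exact norm_integral_le_of_norm_le_const (ae_of_all _ h)

/-- The layer integrals along the segment from the boundary. -/
noncomputable def layerPath (μ : Measure ClosedHalf) (i : ℕ × ℕ) (t : ℝ) (ζ : ℂ) (q : ℝ) : ℂ :=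
  ∫ w in (0 : ℝ)..q, layerPot μ i (t, ζ - w, w)

theorem velKernel_eq (t : ℝ) (ht : 0 < t) (x : ℝ × ℝ) (y : ClosedHalf) :
    velKernel t x y.1 = 1 / Real.pi * ((layer (0, 0) (t, -(Complex.I * x.1), x.2) y.1).re : ℂ) -
      1 / Real.pi * ∫ w in (0 : ℝ)..x.2, layer (0, 1) (t, x.2 - Complex.I * x.1 - w, w) y.1 := by
  have ch := continuous_heatOdd 0 ht
  have cl := continuous_lap 0 ht
  unfold velKernel layer
  congr 2
  · have hi : IntervalIntegrable (fun r : ℝ => (heatOdd 0 t x.2 r : ℂ) *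
        lap 0 t (-(Complex.I * x.1) + y.1.2 - r + Complex.I * y.1.1)) volume 0 y.1.2 :=
      Continuous.intervalIntegrable (by fun_prop) _ _
    have h := Complex.reCLM.intervalIntegral_comp_comm hi
    simp only [Complex.reCLM_apply] at h
    simp only
    rw [← h, ← intervalIntegral.integral_ofReal]
    refine intervalIntegral.integral_congr fun r _ => ?_
    simp only [Complex.re_ofReal_mul, Complex.ofReal_mul]
    congr 4
    ring
  · refine intervalIntegral.integral_congr fun w _ => ?_
    refine intervalIntegral.integral_congr fun r _ => ?_
    simp only
    congr 2
    ring

theorem continuous_layer_path (i : ℕ × ℕ) {t : ℝ} (ht : 0 < t) (ζ : ℂ) :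
    Continuous fun p : ℝ × ClosedHalf => layer i (t, ζ - p.1, p.1) p.2.1 := by
  have ch := continuous_heatOdd i.1 ht
  have cl := continuous_lap i.2 ht
  unfold layer
  refine intervalIntegral.continuous_parametric_intervalIntegral_of_continuous
    (f := fun (p : ℝ × ClosedHalf) (r : ℝ) => (heatOdd i.1 t p.1 r : ℂ) *
    lap i.2 t (ζ - p.1 + p.2.1.2 - r + Complex.I * p.2.1.1)) ?_ (by fun_prop)
  simp only [Function.uncurry_def]
  fun_prop

/-- Of the two terms, the first carries the real part of a potential and the second depends on position
holomorphically through `x₂ - i x₁`, up to its dependence on the length of the path. -/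
theorem velocity_eq (μ : Measure ClosedHalf) [IsFiniteMeasure μ] {t : ℝ} (ht : 0 < t) {x : ℝ × ℝ} (hx : 0 ≤ x.2) :
    velocity μ t x = 1 / Real.pi * ((layerPot μ (0, 0) (t, -(Complex.I * x.1), x.2)).re : ℂ) -
      1 / Real.pi * layerPath μ (0, 1) t (x.2 - Complex.I * x.1) x.2 := by
  obtain ⟨C, hC0, hC⟩ := exists_norm_layer_le (0, 1) ht x.2 0
  have hint : Integrable (Function.uncurry fun (w : ℝ) (y : ClosedHalf) =>
      layer (0, 1) (t, x.2 - Complex.I * x.1 - w, w) y.1) ((volume.restrict (Ioc 0 x.2)).prod μ) := by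
    refine (integrable_const C).mono' (continuous_layer_path _ ht _).aestronglyMeasurable ?_
    have m1 : ∀ᵐ p : ℝ × ClosedHalf ∂((volume.restrict (Ioc 0 x.2)).prod μ), p.1 ∈ Ioc 0 x.2 :=
      Measure.quasiMeasurePreserving_fst.ae (ae_restrict_mem measurableSet_Ioc)
    filter_upwards [m1] with p hp
    refine hC _ _ rfl (by rw [abs_of_pos hp.1]; exact hp.2) ?_
    simp only [neg_zero, Complex.sub_re, Complex.mul_re, Complex.I_re, Complex.I_im,
      Complex.ofReal_re, Complex.ofReal_im]
    linarith [hp.2]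
  have h0 := integrable_layer μ (0, 0) (p := (t, -(Complex.I * x.1), x.2)) ht
  have h1 : Integrable (fun y : ClosedHalf => ∫ w in Ioc 0 x.2,
    layer (0, 1) (t, x.2 - Complex.I * x.1 - w, w) y.1) μ := hint.integral_prod_right
  have h0' : Integrable (fun y : ClosedHalf =>
    ((layer (0, 0) (t, -(Complex.I * x.1), x.2) y.1).re : ℂ)) μ := h0.re.ofReal
  unfold velocity layerPath layerPot
  simp_rw [velKernel_eq t ht, intervalIntegral.integral_of_le hx]
  rw [integral_sub (h0'.const_mul _) (h1.const_mul _), integral_const_mul, integral_const_mul,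
    integral_integral_swap hint, integral_complex_ofReal]
  congr 3
  exact integral_re h0

/-- Rescaling to the interval `[0, 1]` moves the dependence on the end point into the integrand, where
`contDiffOn_integral_zero_one` applies. -/
theorem layerPath_eq (μ : Measure ClosedHalf) (i : ℕ × ℕ) (t : ℝ) (ζ : ℂ) (q : ℝ) :
    layerPath μ i t ζ q = q • ∫ s in (0 : ℝ)..1, layerPot μ i (t, ζ - (q * s : ℝ), q * s) := by
  rw [intervalIntegral.smul_integral_comp_mul_left (fun w : ℝ => layerPot μ i (t, ζ - w, w)), layerPath]
  simp

theorem isOpen_openHalf : IsOpen openHalf := isOpen_lt continuous_const continuous_snd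

theorem contDiffOn_velocity (μ : Measure ClosedHalf) [IsFiniteMeasure μ] :
    ContDiffOn ℝ ((⊤ : ℕ∞) : WithTop ℕ∞) (fun p : ℝ × (ℝ × ℝ) => velocity μ p.1 p.2)
      (Ioi 0 ×ˢ openHalf) := by
  have hO : IsOpen (Ioi (0 : ℝ) ×ˢ openHalf) := isOpen_Ioi.prod isOpen_openHalf
  have c := Complex.ofRealCLM.contDiff (n := ((⊤ : ℕ∞) : WithTop ℕ∞))
  have cr := Complex.reCLM.contDiff (n := ((⊤ : ℕ∞) : WithTop ℕ∞))
  have e1 : ContDiffOn ℝ ((⊤ : ℕ∞) : WithTop ℕ∞) (fun p : ℝ × (ℝ × ℝ) =>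
      layerPot μ (0, 0) (p.1, -(Complex.I * p.2.1), p.2.2)) (Ioi 0 ×ˢ openHalf) := by
    have h : ContDiff ℝ ((⊤ : ℕ∞) : WithTop ℕ∞) (fun p : ℝ × (ℝ × ℝ) =>
      ((p.1, -(Complex.I * p.2.1), p.2.2) : ℝ × ℂ × ℝ)) :=
      contDiff_fst.prodMk ((contDiff_const.mul (c.comp (contDiff_fst.comp contDiff_snd))).neg.prodMk
        (contDiff_snd.comp contDiff_snd))
    exact (contDiffOn_layerPot μ (0, 0)).comp h.contDiffOn fun p hp => hp.1
  have e2 : ContDiffOn ℝ ((⊤ : ℕ∞) : WithTop ℕ∞) (fun p : ℝ × (ℝ × ℝ) =>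
      layerPath μ (0, 1) p.1 (p.2.2 - Complex.I * p.2.1) p.2.2) (Ioi 0 ×ˢ openHalf) := by
    simp_rw [layerPath_eq]
    refine (contDiff_snd.comp contDiff_snd).contDiffOn.smul ?_
    refine contDiffOn_integral_zero_one hO (F := fun (p : ℝ × (ℝ × ℝ)) s => layerPot μ (0, 1)
      (p.1, p.2.2 - Complex.I * p.2.1 - (p.2.2 * s : ℝ), p.2.2 * s)) ?_
    have h2 : ContDiff ℝ ((⊤ : ℕ∞) : WithTop ℕ∞) (fun p : (ℝ × (ℝ × ℝ)) × ℝ => p.1.2.2 * p.2) :=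
      (contDiff_snd.comp (contDiff_snd.comp contDiff_fst)).mul contDiff_snd
    have h : ContDiff ℝ ((⊤ : ℕ∞) : WithTop ℕ∞) (fun p : (ℝ × (ℝ × ℝ)) × ℝ =>
      ((p.1.1, p.1.2.2 - Complex.I * p.1.2.1 - (p.1.2.2 * p.2 : ℝ), p.1.2.2 * p.2) : ℝ × ℂ × ℝ)) :=
      (contDiff_fst.comp contDiff_fst).prodMk ((((c.comp (contDiff_snd.comp (contDiff_snd.comp contDiff_fst))).sub
        (contDiff_const.mul (c.comp (contDiff_fst.comp (contDiff_snd.comp contDiff_fst))))).sub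
        (c.comp h2)).prodMk h2)
    exact (contDiffOn_layerPot μ (0, 1)).comp h.contDiffOn fun p hp => hp.1.1
  refine ((contDiffOn_const (c := (1 / Real.pi : ℂ))).mul (c.comp_contDiffOn (cr.comp_contDiffOn e1))
    |>.sub ((contDiffOn_const (c := (1 / Real.pi : ℂ))).mul e2)).congr fun p hp => ?_
  exact velocity_eq μ hp.1 (le_of_lt hp.2)

theorem contDiffOn_stokes (ω : M) (i : Fin 2) : ContDiffOn ℝ ((⊤ : ℕ∞) : WithTop ℕ∞)
    (fun p : ℝ × (ℝ × ℝ) => stokes p.1 (biotSavart ω) p.2 i) (Ioi 0 ×ˢ openHalf) := by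
  have h := (contDiffOn_velocity ω.toJordanDecomposition.posPart).sub
    (contDiffOn_velocity ω.toJordanDecomposition.negPart)
  fin_cases i
  · exact ((Complex.reCLM.contDiff (n := ((⊤ : ℕ∞) : WithTop ℕ∞))).comp_contDiffOn h).congr
      fun p hp => (stokes_biotSavart hp.1 hp.2 ω).1
  · exact ((Complex.imCLM.contDiff (n := ((⊤ : ℕ∞) : WithTop ℕ∞))).comp_contDiffOn h).neg.congr
      fun p hp => (stokes_biotSavart hp.1 hp.2 ω).2

/-! ### The vorticity -/

section Derivatives

variable (μ : Measure ClosedHalf) [IsFiniteMeasure μ]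

theorem hasDerivAt_layerPot_fst (i : ℕ × ℕ) {t : ℝ} (ht : 0 < t) (ζ c : ℂ) (w s : ℝ) :
    HasDerivAt (fun s : ℝ => layerPot μ i (t, ζ + c * s, w))
      (-c * layerPot μ (i.1, i.2 + 1) (t, ζ + c * s, w)) s := by
  have h : HasDerivAt (fun s : ℝ => ((t, ζ + c * s, w) : ℝ × ℂ × ℝ)) (0, c, 0) s := by
    refine (hasDerivAt_const s t).prodMk (HasDerivAt.prodMk ?_ (hasDerivAt_const s w))
    have := ((hasDerivAt_id s).ofReal_comp.const_mul c).const_add ζ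
    simpa using this
  have := (hasFDerivAt_layerPot μ i (p := (t, ζ + c * s, w)) ht).comp_hasDerivAt s h
  refine this.congr_deriv ?_
  simp [Fin.sum_univ_four, layerForm, layerShift]
  ring

theorem hasDerivAt_layerPot_snd (i : ℕ × ℕ) {t : ℝ} (ht : 0 < t) (ζ : ℂ) (s : ℝ) :
    HasDerivAt (fun s : ℝ => layerPot μ i (t, ζ, s)) (layerPot μ (i.1 + 1, i.2) (t, ζ, s)) s := by
  have h : HasDerivAt (fun s : ℝ => ((t, ζ, s) : ℝ × ℂ × ℝ)) (0, 0, 1) s :=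
    (hasDerivAt_const s t).prodMk ((hasDerivAt_const s ζ).prodMk (hasDerivAt_id s))
  have := (hasFDerivAt_layerPot μ i (p := (t, ζ, s)) ht).comp_hasDerivAt s h
  refine this.congr_deriv ?_
  simp [Fin.sum_univ_four, layerForm, layerShift]

theorem hasDerivAt_layerPot_time (i : ℕ × ℕ) {t : ℝ} (ht : 0 < t) (ζ : ℂ) (s : ℝ) :
    HasDerivAt (fun t : ℝ => layerPot μ i (t, ζ, s))
      (layerPot μ (i.1 + 2, i.2) (t, ζ, s) - layerPot μ (i.1, i.2 + 2) (t, ζ, s)) t := by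
  have h : HasDerivAt (fun t : ℝ => ((t, ζ, s) : ℝ × ℂ × ℝ)) (1, 0, 0) t :=
    (hasDerivAt_id t).prodMk ((hasDerivAt_const t ζ).prodMk (hasDerivAt_const t s))
  have := (hasFDerivAt_layerPot μ i (p := (t, ζ, s)) ht).comp_hasDerivAt t h
  refine this.congr_deriv ?_
  simp [Fin.sum_univ_four, layerForm, layerShift]
  ring

theorem continuous_layerPot (i : ℕ × ℕ) {t : ℝ} (ht : 0 < t) {X : Type*} [TopologicalSpace X]
    {f : X → ℂ} {g : X → ℝ} (hf : Continuous f) (hg : Continuous g) :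
    Continuous fun x => layerPot μ i (t, f x, g x) := by
  rw [continuous_iff_continuousAt]
  intro x
  have h1 : ContinuousAt (layerPot μ i) (t, f x, g x) := (hasFDerivAt_layerPot μ i ht).continuousAt
  exact h1.comp (f := fun x => ((t, f x, g x) : ℝ × ℂ × ℝ))
    (continuous_const.prodMk (hf.prodMk hg)).continuousAt

theorem hasDerivAt_integral_layerPot (i : ℕ × ℕ) {t : ℝ} (ht : 0 < t) (ζ c : ℂ) {q : ℝ} (hq : 0 ≤ q) (s₀ : ℝ) :
    HasDerivAt (fun s : ℝ => layerPath μ i t (ζ + c * s) q)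
      (-c * layerPath μ (i.1, i.2 + 1) t (ζ + c * s₀) q) s₀ := by
  set A := -ζ.re + ‖c‖ * (|s₀| + 1) + q with hA
  obtain ⟨C, hC0, hC⟩ := exists_norm_layer_le (i.1, i.2 + 1) ht q A
  have hcont : ∀ (j : ℕ × ℕ) (s : ℝ), Continuous fun w : ℝ => layerPot μ j (t, ζ + c * s - w, w) :=
    fun j s => continuous_layerPot μ j ht (by fun_prop) continuous_id
  have h := intervalIntegral.hasDerivAt_integral_of_dominated_loc_of_deriv_le (μ := volume) (𝕜 := ℝ)
    (F := fun s w : ℝ => layerPot μ i (t, ζ + c * s - w, w)) (x₀ := s₀) (a := 0) (b := q)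
    (F' := fun s w => -c * layerPot μ (i.1, i.2 + 1) (t, ζ + c * s - w, w))
    (bound := fun _ => ‖c‖ * (C * μ.real univ)) (s := Metric.ball s₀ 1)
    (Metric.ball_mem_nhds s₀ one_pos) (Eventually.of_forall fun s => (hcont i s).aestronglyMeasurable)
    ((hcont i s₀).intervalIntegrable _ _) ((continuous_const.mul (hcont _ s₀)).aestronglyMeasurable)
    (ae_of_all _ fun w hw s hs => ?_) (by simp) (ae_of_all _ fun w _ s _ => ?_)
  · have := h.2
    rw [intervalIntegral.integral_const_mul] at this
    exact this
  · rw [uIoc_of_le hq] at hw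
    rw [norm_mul, norm_neg]
    gcongr
    refine norm_layerPot_le μ _ fun y => hC _ y rfl (by rw [abs_of_pos hw.1]; exact hw.2) ?_
    have h1 : |(c * s).re| ≤ ‖c‖ * (|s₀| + 1) := by
      refine (Complex.abs_re_le_norm _).trans ?_
      rw [norm_mul, Complex.norm_real, Real.norm_eq_abs]
      gcongr
      rw [Metric.mem_ball, Real.dist_eq] at hs
      have := abs_sub_abs_le_abs_sub s s₀
      linarith
    simp only [Complex.sub_re, Complex.add_re, Complex.ofReal_re]
    have := (abs_le.1 h1).1
    linarith [hw.2]
  · have := hasDerivAt_layerPot_fst μ i ht (ζ - w) c w s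
    have e : ∀ s : ℝ, ζ - w + c * s = ζ + c * s - w := fun s => by ring
    simp only [e] at this
    exact this

/-- The derivative of an integral of a function over a short interval, at length zero. -/
theorem hasDerivAt_integral_diag {G : ℝ → ℝ → ℂ} {s₀ : ℝ} (hG : Continuous (Function.uncurry G)) :
    HasDerivAt (fun s => ∫ w in s₀..s, G s w) (G s₀ s₀) s₀ := by
  rw [hasDerivAt_iff_isLittleO, Asymptotics.isLittleO_iff]
  intro ε hε
  obtain ⟨δ, hδ, h⟩ := Metric.continuous_iff.1 hG (s₀, s₀) ε hε
  filter_upwards [Metric.ball_mem_nhds s₀ hδ] with s hs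
  have hs' : |s - s₀| < δ := by rwa [Metric.mem_ball, Real.dist_eq] at hs
  have hi : IntervalIntegrable (G s) volume s₀ s :=
    (hG.comp (Continuous.prodMk_right s)).intervalIntegrable _ _
  have e : (∫ w in s₀..s, G s w) - (∫ w in s₀..s₀, G s₀ w) - (s - s₀) • G s₀ s₀ =
      ∫ w in s₀..s, (G s w - G s₀ s₀) := by
    rw [intervalIntegral.integral_sub hi (by simp), intervalIntegral.integral_same,
      intervalIntegral.integral_const, sub_zero]
  rw [e, Real.norm_eq_abs]
  refine intervalIntegral.norm_integral_le_of_norm_le_const fun w hw => ?_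
  have hw' : |w - s₀| ≤ |s - s₀| := abs_sub_left_of_mem_uIcc (uIoc_subset_uIcc hw)
  have := h (s, w) (by
    rw [Prod.dist_eq, max_lt_iff, Real.dist_eq, Real.dist_eq]
    exact ⟨hs', hw'.trans_lt hs'⟩)
  rw [dist_eq_norm] at this
  exact this.le

/-- The end point and the first argument both move; the integrand at the end point is the first term. -/
theorem hasDerivAt_layerPath_snd (i : ℕ × ℕ) {t : ℝ} (ht : 0 < t) (ζ : ℂ) {s₀ : ℝ} (hs : 0 ≤ s₀) :
    HasDerivAt (fun s : ℝ => layerPath μ i t (s + ζ) s)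
      (layerPot μ i (t, ζ, s₀) - layerPath μ (i.1, i.2 + 1) t (s₀ + ζ) s₀) s₀ := by
  have hc : Continuous (Function.uncurry fun s w : ℝ => layerPot μ i (t, s + ζ - w, w)) :=
    continuous_layerPot μ i ht (by fun_prop) continuous_snd
  have h1 := hasDerivAt_integral_diag (s₀ := s₀) hc
  have h2 := hasDerivAt_integral_layerPot μ i ht ζ 1 hs s₀
  simp only [one_mul, neg_mul, add_comm ζ] at h2
  have h := (h2.add h1).congr_of_eventuallyEq (f₁ := fun s : ℝ => layerPath μ i t (s + ζ) s)
    (Eventually.of_forall fun s => ?_)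
  · refine h.congr_deriv ?_
    rw [add_sub_cancel_left]; ring
  · have hi : ∀ a b : ℝ, IntervalIntegrable (fun w : ℝ => layerPot μ i (t, s + ζ - w, w)) volume a b :=
      fun a b => (hc.comp (Continuous.prodMk_right s)).intervalIntegrable a b
    exact (intervalIntegral.integral_add_adjacent_intervals (hi 0 s₀) (hi s₀ s)).symm

end Derivatives

section Vorticity

variable (μ : Measure ClosedHalf) [IsFiniteMeasure μ]

/-- The derivative `∂₁^j ∂₂^m` of the vorticity `T(t) μ` of a positive measure, as a function of
time and position. -/
noncomputable def vortLayer (μ : Measure ClosedHalf) (j m : ℕ) (t : ℝ) (x : ℝ × ℝ) : ℝ :=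
  1 / Real.pi * (Complex.I ^ j * (layerPot μ (m, j + 1) (t, -(Complex.I * x.1), x.2) -
    layerPot μ (m + 1, j) (t, -(Complex.I * x.1), x.2))).re

theorem hasDerivAt_vortLayer_fst (j m : ℕ) {t : ℝ} (ht : 0 < t) (x : ℝ × ℝ) :
    HasDerivAt (fun s => vortLayer μ j m t (s, x.2)) (vortLayer μ (j + 1) m t x) x.1 := by
  have h := fun i => hasDerivAt_layerPot_fst μ i ht 0 (-Complex.I) x.2 x.1
  simp only [zero_add, neg_mul, neg_neg] at h
  have := ((Complex.reCLM.hasFDerivAt.comp_hasDerivAt x.1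
    (((h (m, j + 1)).sub (h (m + 1, j))).const_mul (Complex.I ^ j)))).const_mul (1 / Real.pi)
  refine this.congr_deriv ?_
  rw [vortLayer, Complex.reCLM_apply]
  congr 2; ring

theorem hasDerivAt_vortLayer_snd (j m : ℕ) {t : ℝ} (ht : 0 < t) (x : ℝ × ℝ) :
    HasDerivAt (fun s => vortLayer μ j m t (x.1, s)) (vortLayer μ j (m + 1) t x) x.2 := by
  have h := fun i => hasDerivAt_layerPot_snd μ i ht (-(Complex.I * x.1)) x.2
  exact ((Complex.reCLM.hasFDerivAt.comp_hasDerivAt x.2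
    (((h (m, j + 1)).sub (h (m + 1, j))).const_mul (Complex.I ^ j)))).const_mul (1 / Real.pi)

/-- The vorticity solves the heat equation. -/
theorem hasDerivAt_vortLayer_time (j m : ℕ) {t : ℝ} (ht : 0 < t) (x : ℝ × ℝ) :
    HasDerivAt (fun t => vortLayer μ j m t x) (vortLayer μ (j + 2) m t x + vortLayer μ j (m + 2) t x) t := by
  have h := fun i => hasDerivAt_layerPot_time μ i ht (-(Complex.I * x.1)) x.2
  have := ((Complex.reCLM.hasFDerivAt.comp_hasDerivAt t
    (((h (m, j + 1)).sub (h (m + 1, j))).const_mul (Complex.I ^ j)))).const_mul (1 / Real.pi)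
  refine this.congr_deriv ?_
  rw [vortLayer, vortLayer, ← mul_add, ← Complex.add_re, Complex.reCLM_apply]
  congr 2
  rw [pow_add, Complex.I_sq]
  ring

theorem contDiffOn_vortLayer (j m : ℕ) : ContDiffOn ℝ ((⊤ : ℕ∞) : WithTop ℕ∞)
    (fun p : ℝ × (ℝ × ℝ) => vortLayer μ j m p.1 p.2) (Ioi 0 ×ˢ openHalf) := by
  have c := Complex.ofRealCLM.contDiff (n := ((⊤ : ℕ∞) : WithTop ℕ∞))
  have cr := Complex.reCLM.contDiff (n := ((⊤ : ℕ∞) : WithTop ℕ∞))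
  have e : ∀ i, ContDiffOn ℝ ((⊤ : ℕ∞) : WithTop ℕ∞) (fun p : ℝ × (ℝ × ℝ) =>
      layerPot μ i (p.1, -(Complex.I * p.2.1), p.2.2)) (Ioi 0 ×ˢ openHalf) := fun i => by
    have h : ContDiff ℝ ((⊤ : ℕ∞) : WithTop ℕ∞) (fun p : ℝ × (ℝ × ℝ) =>
      ((p.1, -(Complex.I * p.2.1), p.2.2) : ℝ × ℂ × ℝ)) :=
      contDiff_fst.prodMk ((contDiff_const.mul (c.comp (contDiff_fst.comp contDiff_snd))).neg.prodMk
        (contDiff_snd.comp contDiff_snd))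
    exact (contDiffOn_layerPot μ i).comp h.contDiffOn fun p hp => hp.1
  exact contDiffOn_const.mul (cr.comp_contDiffOn (contDiffOn_const.mul ((e (m, j + 1)).sub (e (m + 1, j)))))

theorem hasDerivAt_velocity_snd {t : ℝ} (ht : 0 < t) {x : ℝ × ℝ} (hx : 0 < x.2) :
    HasDerivAt (fun s => velocity μ t (x.1, s))
      (1 / Real.pi * ((layerPot μ (1, 0) (t, -(Complex.I * x.1), x.2)).re : ℂ) -
        1 / Real.pi * (layerPot μ (0, 1) (t, -(Complex.I * x.1), x.2) -
          layerPath μ (0, 2) t (x.2 - Complex.I * x.1) x.2)) x.2 := by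
  have h1 := Complex.reCLM.hasFDerivAt.comp_hasDerivAt x.2
    (hasDerivAt_layerPot_snd μ (0, 0) ht (-(Complex.I * x.1)) x.2)
  have h2 := hasDerivAt_layerPath_snd μ (0, 1) ht (-(Complex.I * x.1)) hx.le
  simp only [← sub_eq_add_neg] at h2
  have := (h1.ofReal_comp.const_mul (1 / Real.pi : ℂ)).sub (h2.const_mul (1 / Real.pi : ℂ))
  refine this.congr_of_eventuallyEq ?_
  filter_upwards [Ioi_mem_nhds hx] with s hs
  exact velocity_eq μ ht (x := (x.1, s)) (le_of_lt hs)

theorem hasDerivAt_velocity_fst {t : ℝ} (ht : 0 < t) {x : ℝ × ℝ} (hx : 0 < x.2) :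
    HasDerivAt (fun s => velocity μ t (s, x.2))
      (1 / Real.pi * ((Complex.I * layerPot μ (0, 1) (t, -(Complex.I * x.1), x.2)).re : ℂ) -
        1 / Real.pi * (Complex.I * layerPath μ (0, 2) t (x.2 - Complex.I * x.1) x.2)) x.1 := by
  have h1 := hasDerivAt_layerPot_fst μ (0, 0) ht 0 (-Complex.I) x.2 x.1
  simp only [zero_add, neg_mul, neg_neg] at h1
  have h2 := hasDerivAt_integral_layerPot μ (0, 1) ht x.2 (-Complex.I) hx.le x.1
  simp only [neg_mul, ← sub_eq_add_neg, neg_neg] at h2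
  have := ((Complex.reCLM.hasFDerivAt.comp_hasDerivAt x.1 h1).ofReal_comp.const_mul
    (1 / Real.pi : ℂ)).sub (h2.const_mul (1 / Real.pi : ℂ))
  refine this.congr_of_eventuallyEq (Eventually.of_forall fun s => ?_)
  exact velocity_eq μ ht (x := (s, x.2)) hx.le

end Vorticity

/-- The derivative `∂₁^j ∂₂^m` of the vorticity `T(t) ω`. -/
noncomputable def signedVortLayer (ω : M) (j m : ℕ) (t : ℝ) (x : ℝ × ℝ) : ℝ :=
  vortLayer ω.toJordanDecomposition.posPart j m t x - vortLayer ω.toJordanDecomposition.negPart j m t x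

/-- The curl of the velocity. The terms with `layerPath` cancel, since they are holomorphic, and
only potentials of `layer` remain. -/
theorem vorticity_eq (ω : M) {t : ℝ} (ht : 0 < t) {x : ℝ × ℝ} (hx : 0 < x.2) :
    vorticity t ω x = signedVortLayer ω 0 0 t x := by
  have s1 : pd 1 (fun x' => stokes t (biotSavart ω) x' 0) x =
      deriv (fun s => (signedVelocity ω t (x.1, s)).re) x.2 := by
    rw [pd_one_eq_deriv]
    refine Filter.EventuallyEq.deriv_eq ?_
    filter_upwards [Ioi_mem_nhds hx] with s hs
    exact (stokes_biotSavart ht (x := (x.1, s)) hs ω).1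
  have s0 : pd 0 (fun x' => stokes t (biotSavart ω) x' 1) x =
      deriv (fun s => -(signedVelocity ω t (s, x.2)).im) x.1 := by
    rw [pd_zero_eq_deriv]
    congr 1; ext s
    exact (stokes_biotSavart ht (x := (s, x.2)) hx ω).2
  have d1 := Complex.reCLM.hasFDerivAt.comp_hasDerivAt x.2
    ((hasDerivAt_velocity_snd ω.toJordanDecomposition.posPart ht hx).sub
    (hasDerivAt_velocity_snd ω.toJordanDecomposition.negPart ht hx))
  have d0 := (Complex.imCLM.hasFDerivAt.comp_hasDerivAt x.1
    ((hasDerivAt_velocity_fst ω.toJordanDecomposition.posPart ht hx).sub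
    (hasDerivAt_velocity_fst ω.toJordanDecomposition.negPart ht hx))).neg
  have d1' : deriv (fun s => (signedVelocity ω t (x.1, s)).re) x.2 = _ := d1.deriv
  have d0' : deriv (fun s => -(signedVelocity ω t (s, x.2)).im) x.1 = _ := d0.deriv
  unfold vorticity curl
  rw [s1, s0, d1', d0', signedVortLayer, vortLayer, vortLayer]
  have hpi : (1 / Real.pi : ℂ) = ((1 / Real.pi : ℝ) : ℂ) := by push_cast; rfl
  rw [hpi]
  simp only [Complex.reCLM_apply, Complex.imCLM_apply, Complex.sub_re, Complex.sub_im,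
    Complex.re_ofReal_mul, Complex.im_ofReal_mul, Complex.ofReal_re, Complex.ofReal_im,
    Complex.I_mul_im, pow_zero, one_mul, zero_add]
  ring

theorem contDiffOn_vorticity (ω : M) : ContDiffOn ℝ ((⊤ : ℕ∞) : WithTop ℕ∞)
    (fun p : ℝ × (ℝ × ℝ) => vorticity p.1 ω p.2) (Ioi 0 ×ˢ openHalf) :=
  ((contDiffOn_vortLayer ω.toJordanDecomposition.posPart 0 0).sub
    (contDiffOn_vortLayer ω.toJordanDecomposition.negPart 0 0)).congr fun _ hp =>
      vorticity_eq ω hp.1 hp.2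

/-! ### The kernel of the solution operator -/

/-- The kernel of the derivative `∂₁^j ∂₂^m` of the solution operator `ω ↦ T(t) ω`: the density at `x`
produced by a unit vortex at `y`. The first term is the heat flow with Dirichlet conditions, the second
the vorticity created at the boundary. -/
noncomputable def vortKernel (j m : ℕ) (t : ℝ) (x y : ℝ × ℝ) : ℝ :=
  heat j t (x.1 - y.1) * heatOdd m t x.2 y.2 +
    2 * ∫ r in (0 : ℝ)..y.2, heat (m + 1) t (x.2 + r) * heatPoisson j t (y.2 - r) (x.1 - y.1)

/-- Integration by parts over the segment, using `∂_r heatOdd m = -heatEven (m + 1)`. -/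
theorem layer_sub_layer (j m : ℕ) {t : ℝ} (ht : 0 < t) (x y : ℝ × ℝ) :
    layer (m, j + 1) (t, -(Complex.I * x.1), x.2) y - layer (m + 1, j) (t, -(Complex.I * x.1), x.2) y =
      heatOdd m t x.2 y.2 * lap j t (-(Complex.I * (x.1 - y.1 : ℝ))) +
      2 * ∫ r in (0 : ℝ)..y.2, (heat (m + 1) t (x.2 + r) : ℂ) *
        lap j t ((y.2 - r : ℝ) - Complex.I * (x.1 - y.1 : ℝ)) := by
  set X : ℝ := x.1 - y.1
  have eζ : ∀ r : ℝ, (-(Complex.I * x.1) + y.2 - r + Complex.I * y.1 : ℂ) =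
      ((y.2 - r : ℝ) - Complex.I * X) := fun r => by
    simp only [X]; push_cast; ring
  simp only [layer, eζ]
  have ho : ∀ n, Continuous fun r => heatOdd n t x.2 r := fun n =>
    (continuous_heatOdd n ht).comp (Continuous.prodMk_right x.2)
  have he : ∀ n, Continuous fun r => heatEven n t x.2 r := fun n =>
    (continuous_heatEven n ht).comp (Continuous.prodMk_right x.2)
  have hl := fun n => continuous_lap n ht
  have hh := fun n => continuous_heat n ht
  have hou := ho m
  have ho1 := ho (m + 1)
  have he1 := he (m + 1)
  have hlj := hl j
  have hlj1 := hl (j + 1)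
  have hh1 := hh (m + 1)
  have i1 : IntervalIntegrable (fun r : ℝ => (heatOdd m t x.2 r : ℂ) *
      lap (j + 1) t ((y.2 - r : ℝ) - Complex.I * X)) volume 0 y.2 :=
    Continuous.intervalIntegrable (by fun_prop) _ _
  have i2 : IntervalIntegrable (fun r : ℝ => (heatOdd (m + 1) t x.2 r : ℂ) *
      lap j t ((y.2 - r : ℝ) - Complex.I * X)) volume 0 y.2 :=
    Continuous.intervalIntegrable (by fun_prop) _ _
  have i3 : IntervalIntegrable (fun r : ℝ => 2 * ((heat (m + 1) t (x.2 + r) : ℂ) *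
      lap j t ((y.2 - r : ℝ) - Complex.I * X))) volume 0 y.2 :=
    Continuous.intervalIntegrable (by fun_prop) _ _
  have hD : ∀ r : ℝ, HasDerivAt (fun r : ℝ => (heatOdd m t x.2 r : ℂ) *
      lap j t ((y.2 - r : ℝ) - Complex.I * X))
      (((heatOdd m t x.2 r : ℂ) * lap (j + 1) t ((y.2 - r : ℝ) - Complex.I * X) -
        (heatOdd (m + 1) t x.2 r : ℂ) * lap j t ((y.2 - r : ℝ) - Complex.I * X)) -
        2 * ((heat (m + 1) t (x.2 + r) : ℂ) * lap j t ((y.2 - r : ℝ) - Complex.I * X))) r := by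
    intro r
    have a1 := (hasDerivAt_heatOdd_right m ht x.2 r).ofReal_comp
    have a2 := hasDerivAt_lap j ht (y.2 - Complex.I * X) (-1) r
    have e : ∀ r : ℝ, (y.2 - Complex.I * X + -1 * r : ℂ) = ((y.2 - r : ℝ) - Complex.I * X) := fun r => by
      push_cast; ring
    simp only [e] at a2
    refine (a1.mul a2).congr_deriv ?_
    rw [heatEven_eq]
    push_cast
    ring
  have h := intervalIntegral.integral_eq_sub_of_hasDerivAt (a := 0) (b := y.2) (fun r _ => hD r)
    ((i1.sub i2).sub i3)
  rw [intervalIntegral.integral_sub (i1.sub i2) i3, intervalIntegral.integral_sub i1 i2,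
    intervalIntegral.integral_const_mul, heatOdd_zero_right] at h
  rw [sub_eq_iff_eq_add.1 h]
  simp

theorem vortKernel_eq (j m : ℕ) {t : ℝ} (ht : 0 < t) (x y : ℝ × ℝ) :
    vortKernel j m t x y = 1 / Real.pi * (Complex.I ^ j * (layer (m, j + 1) (t, -(Complex.I * x.1), x.2) y -
      layer (m + 1, j) (t, -(Complex.I * x.1), x.2) y)).re := by
  rw [layer_sub_layer j m ht, vortKernel, heat_eq_re_lap j ht]
  have hl := continuous_lap j ht
  have hh := continuous_heat (m + 1) ht
  have hi : IntervalIntegrable (fun r : ℝ => Complex.I ^ j * ((heat (m + 1) t (x.2 + r) : ℂ) *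
      lap j t ((y.2 - r : ℝ) - Complex.I * (x.1 - y.1 : ℝ)))) volume 0 y.2 :=
    Continuous.intervalIntegrable (by fun_prop) _ _
  have h := Complex.reCLM.intervalIntegral_comp_comm hi
  simp only [Complex.reCLM_apply, intervalIntegral.integral_const_mul] at h
  have e : ∀ r : ℝ, (Complex.I ^ j * ((heat (m + 1) t (x.2 + r) : ℂ) *
      lap j t ((y.2 - r : ℝ) - Complex.I * (x.1 - y.1 : ℝ)))).re =
      Real.pi * (heat (m + 1) t (x.2 + r) * heatPoisson j t (y.2 - r) (x.1 - y.1)) := fun r => by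
    rw [mul_left_comm, Complex.re_ofReal_mul, heatPoisson]
    field_simp
  simp_rw [e, intervalIntegral.integral_const_mul] at h
  rw [mul_add, Complex.add_re, mul_left_comm (Complex.I ^ j), mul_left_comm (Complex.I ^ j) 2,
    Complex.re_ofReal_mul, ← Complex.ofReal_ofNat, Complex.re_ofReal_mul, ← h]
  field_simp

theorem integral_vortKernel (μ : Measure ClosedHalf) [IsFiniteMeasure μ] (j m : ℕ) {t : ℝ} (ht : 0 < t)
    (x : ℝ × ℝ) :
    Integrable (fun y : ClosedHalf => vortKernel j m t x y.1) μ ∧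
    ∫ y, vortKernel j m t x y.1 ∂μ = vortLayer μ j m t x := by
  have h1 := integrable_layer μ (m, j + 1) (p := (t, -(Complex.I * x.1), x.2)) ht
  have h2 := integrable_layer μ (m + 1, j) (p := (t, -(Complex.I * x.1), x.2)) ht
  have h3 : Integrable (fun y : ClosedHalf => Complex.I ^ j *
      (layer (m, j + 1) (t, -(Complex.I * x.1), x.2) y.1 -
      layer (m + 1, j) (t, -(Complex.I * x.1), x.2) y.1)) μ := (h1.sub h2).const_mul _
  simp_rw [vortKernel_eq j m ht]
  refine ⟨h3.re.const_mul _, ?_⟩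
  rw [integral_const_mul, vortLayer, layerPot, layerPot, ← integral_sub h1 h2,
    ← integral_const_mul (Complex.I ^ j)]
  exact congrArg (1 / Real.pi * ·) (integral_re h3)

theorem continuous_vortKernel (j m : ℕ) {t : ℝ} (ht : 0 < t) :
    Continuous fun p : (ℝ × ℝ) × (ℝ × ℝ) => vortKernel j m t p.1 p.2 := by
  have h1 := continuous_heat j ht
  have h2 := continuous_heat (m + 1) ht
  have h3 : Continuous fun p : (ℝ × ℝ) × (ℝ × ℝ) => heatOdd m t p.1.2 p.2.2 :=
    (continuous_heatOdd m ht).comp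
      (by fun_prop : Continuous fun p : (ℝ × ℝ) × (ℝ × ℝ) => (p.1.2, p.2.2))
  have h4 : Continuous fun p : (ℝ × ℝ) × (ℝ × ℝ) => ∫ r in (0 : ℝ)..p.2.2,
      heat (m + 1) t (p.1.2 + r) * heatPoisson j t (p.2.2 - r) (p.1.1 - p.2.1) := by
    refine intervalIntegral.continuous_parametric_intervalIntegral_of_continuous
      (f := fun (p : (ℝ × ℝ) × (ℝ × ℝ)) (r : ℝ) =>
        heat (m + 1) t (p.1.2 + r) * heatPoisson j t (p.2.2 - r) (p.1.1 - p.2.1)) ?_ (by fun_prop)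
    have h5 := (continuous_heatPoisson j ht).comp (g := fun p : ℝ × ℝ => heatPoisson j t p.1 p.2)
      (by fun_prop : Continuous fun q : ((ℝ × ℝ) × (ℝ × ℝ)) × ℝ => (q.1.2.2 - q.2, q.1.1.1 - q.1.2.1))
    exact (h2.comp (by fun_prop)).mul h5
  unfold vortKernel
  fun_prop

theorem continuous_vortKernel_half (j m : ℕ) {t : ℝ} (ht : 0 < t) :
    Continuous fun p : (ℝ × ℝ) × ClosedHalf => vortKernel j m t p.1 p.2.1 :=
  (continuous_vortKernel j m ht).comp
    (by fun_prop : Continuous fun p : (ℝ × ℝ) × ClosedHalf => (p.1, p.2.1))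

/-- The factor `(√t)⁻¹ ^ (m + 2)` of `heat (m + 1)` loses one power when integrated over the normal variable. -/
theorem exists_abs_vortKernel_le (j m : ℕ) : ∃ C : ℝ, 0 ≤ C ∧ ∀ t : ℝ, 0 < t → ∀ x y : ℝ × ℝ,
    0 ≤ x.2 → 0 ≤ y.2 → |vortKernel j m t x y| ≤ C * (√t)⁻¹ ^ (j + m + 2) := by
  obtain ⟨A, hA0, hA⟩ := exists_heat_bound j
  obtain ⟨B, hB0, hB⟩ := exists_heat_bound m
  obtain ⟨B', hB'0, hB'⟩ := exists_heat_bound (m + 1)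
  obtain ⟨P, hP0, hP⟩ := exists_heatPoisson_bound j
  refine ⟨A * (2 * B) + 2 * (B' * √(Real.pi * 8) * P), by positivity, fun t ht x y hx hy => ?_⟩
  have hst := Real.sqrt_pos.2 ht
  have hexp : ∀ v : ℝ, Real.exp (-v ^ 2 / (8 * t)) ≤ 1 := fun v => by
    rw [Real.exp_le_one_iff, neg_div]
    have : 0 ≤ v ^ 2 / (8 * t) := by positivity
    linarith
  have a1 : |heat j t (x.1 - y.1)| ≤ A * (√t)⁻¹ ^ (j + 1) :=
    (hA t ht _).trans (mul_le_of_le_one_right (by positivity) (hexp _))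
  have b1 : ∀ v, |heat m t v| ≤ B * (√t)⁻¹ ^ (m + 1) := fun v =>
    (hB t ht _).trans (mul_le_of_le_one_right (by positivity) (hexp _))
  have b2 : |heatOdd m t x.2 y.2| ≤ 2 * B * (√t)⁻¹ ^ (m + 1) := by
    refine (abs_sub _ _).trans ?_
    linarith [b1 (x.2 - y.2), b1 (x.2 + y.2)]
  have i1 : |∫ r in (0 : ℝ)..y.2, heat (m + 1) t (x.2 + r) * heatPoisson j t (y.2 - r) (x.1 - y.1)| ≤
      ∫ r : ℝ, (B' * (√t)⁻¹ ^ (m + 2) * (P * (√t)⁻¹ ^ (j + 1))) * Real.exp (-r ^ 2 / (8 * t)) := by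
    have hg := (integrable_exp_neg_sq_div (by positivity : 0 < 8 * t)).const_mul
      (B' * (√t)⁻¹ ^ (m + 2) * (P * (√t)⁻¹ ^ (j + 1)))
    rw [intervalIntegral.integral_of_le hy, ← Real.norm_eq_abs]
    refine (norm_integral_le_of_norm_le hg.integrableOn ?_).trans
      (setIntegral_le_integral hg (ae_of_all _ fun r => by positivity))
    filter_upwards [ae_restrict_mem measurableSet_Ioc] with r hr
    rw [norm_mul, Real.norm_eq_abs, Real.norm_eq_abs]
    have c1 := hB' t ht (x.2 + r)
    have c2 := hP t ht (y.2 - r) (x.1 - y.1) (by linarith [hr.2])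
    have c3 : Real.exp (-(x.2 + r) ^ 2 / (8 * t)) ≤ Real.exp (-r ^ 2 / (8 * t)) := by
      gcongr
      · exact hr.1.le
      · linarith
    calc _ ≤ (B' * (√t)⁻¹ ^ (m + 2) * Real.exp (-r ^ 2 / (8 * t))) * (P * (√t)⁻¹ ^ (j + 1)) := by
          refine mul_le_mul (c1.trans ?_) c2 (abs_nonneg _) (by positivity)
          gcongr
      _ = _ := by ring
  rw [integral_const_mul, integral_exp_neg_sq_div, ← mul_assoc Real.pi,
    Real.sqrt_mul (by positivity)] at i1
  unfold vortKernel
  refine (abs_add_le _ _).trans ?_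
  rw [abs_mul, abs_mul, abs_two]
  have e1 : (√t)⁻¹ ^ (m + 2) * √t = (√t)⁻¹ ^ (m + 1) := by
    rw [pow_succ _ (m + 1), mul_assoc, inv_mul_cancel₀ hst.ne', mul_one]
  calc _ ≤ A * (√t)⁻¹ ^ (j + 1) * (2 * B * (√t)⁻¹ ^ (m + 1)) +
        2 * (B' * (√t)⁻¹ ^ (m + 2) * (P * (√t)⁻¹ ^ (j + 1)) * (√(Real.pi * 8) * √t)) := by
        gcongr
    _ = A * (2 * B) * ((√t)⁻¹ ^ (j + 1) * (√t)⁻¹ ^ (m + 1)) +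
        2 * (B' * √(Real.pi * 8) * P) * ((√t)⁻¹ ^ (j + 1) * ((√t)⁻¹ ^ (m + 2) * √t)) := by ring
    _ = _ := by rw [e1, ← pow_add, ← add_mul]; congr 2; ring

theorem lintegral_enorm_heat_le (n : ℕ) : ∃ C : ℝ, 0 ≤ C ∧ ∀ t : ℝ, 0 < t →
    ∫⁻ v, ‖heat n t v‖ₑ ≤ ENNReal.ofReal (C * (√t)⁻¹ ^ n) := by
  obtain ⟨C, hC0, hC⟩ := exists_integral_abs_heat_bound n
  refine ⟨C, hC0, fun t ht => ?_⟩
  rw [← ofReal_integral_norm_eq_lintegral_enorm (integrable_heat n ht)]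
  exact ENNReal.ofReal_le_ofReal (hC t ht)

theorem lintegral_enorm_heatPoisson_le (j : ℕ) : ∃ C : ℝ, 0 ≤ C ∧ ∀ t : ℝ, 0 < t → ∀ a : ℝ, 0 ≤ a →
    ∫⁻ v, ‖heatPoisson j t a v‖ₑ ≤ ENNReal.ofReal (C * (√t)⁻¹ ^ j) := by
  obtain ⟨C, hC0, hC⟩ := exists_integral_abs_heat_bound j
  refine ⟨C, hC0, fun t ht a ha => ?_⟩
  rw [← ofReal_integral_norm_eq_lintegral_enorm (integrable_heatPoisson j ht ha)]
  exact ENNReal.ofReal_le_ofReal ((integral_abs_heatPoisson_le j ht ha).trans (hC t ht))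

/-- For positive `x` and `r`, the Gaussian in `x + r` is at most the product of those in `x` and `r`. -/
theorem lintegral_lintegral_heat_add_le (n : ℕ) : ∃ C : ℝ, 0 ≤ C ∧ ∀ t : ℝ, 0 < t →
    ∫⁻ r in Ioi (0 : ℝ), ∫⁻ x in Ioi (0 : ℝ), ‖heat (n + 1) t (x + r)‖ₑ ≤
      ENNReal.ofReal (C * (√t)⁻¹ ^ n) := by
  obtain ⟨C, hC0, hC⟩ := exists_heat_bound (n + 1)
  refine ⟨C * (Real.pi * 8), by positivity, fun t ht => ?_⟩
  have hst := Real.sqrt_pos.2 ht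
  have hG := integrable_exp_neg_sq_div (by positivity : 0 < 8 * t)
  have hL : ∫⁻ x : ℝ, ENNReal.ofReal (Real.exp (-x ^ 2 / (8 * t))) =
      ENNReal.ofReal (√(Real.pi * 8) * √t) := by
    rw [← ofReal_integral_eq_lintegral_ofReal hG (ae_of_all _ fun x => (Real.exp_pos _).le),
      integral_exp_neg_sq_div, ← mul_assoc, Real.sqrt_mul (by positivity)]
  calc _ ≤ ∫⁻ r in Ioi (0 : ℝ), ∫⁻ x in Ioi (0 : ℝ), ENNReal.ofReal (C * (√t)⁻¹ ^ (n + 2)) *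
        ENNReal.ofReal (Real.exp (-r ^ 2 / (8 * t))) * ENNReal.ofReal (Real.exp (-x ^ 2 / (8 * t))) := by
        refine setLIntegral_mono' measurableSet_Ioi fun r hr => setLIntegral_mono' measurableSet_Ioi fun x hx => ?_
        have hr : 0 < r := hr
        have hx : 0 < x := hx
        rw [← ENNReal.ofReal_mul (by positivity), ← ENNReal.ofReal_mul (by positivity), Real.enorm_eq_ofReal_abs]
        apply ENNReal.ofReal_le_ofReal
        refine (hC t ht _).trans ?_
        rw [mul_assoc, mul_assoc, ← Real.exp_add, ← add_div, mul_assoc]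
        gcongr
        nlinarith [mul_pos hr hx]
    _ ≤ ∫⁻ r : ℝ, ∫⁻ x : ℝ, ENNReal.ofReal (C * (√t)⁻¹ ^ (n + 2)) *
        ENNReal.ofReal (Real.exp (-r ^ 2 / (8 * t))) * ENNReal.ofReal (Real.exp (-x ^ 2 / (8 * t))) :=
        (setLIntegral_le_lintegral _ _).trans (lintegral_mono fun r => setLIntegral_le_lintegral _ _)
    _ = ENNReal.ofReal (C * (√t)⁻¹ ^ (n + 2)) * (∫⁻ r : ℝ, ENNReal.ofReal (Real.exp (-r ^ 2 / (8 * t)))) *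
        ∫⁻ x : ℝ, ENNReal.ofReal (Real.exp (-x ^ 2 / (8 * t))) := by
        simp_rw [lintegral_const_mul' _ _ (ENNReal.mul_ne_top ENNReal.ofReal_ne_top ENNReal.ofReal_ne_top)]
        rw [lintegral_mul_const' _ _ (by rw [hL]; exact ENNReal.ofReal_ne_top),
          lintegral_const_mul' _ _ ENNReal.ofReal_ne_top]
    _ = _ := by
        rw [hL, ← ENNReal.ofReal_mul (by positivity), ← ENNReal.ofReal_mul (by positivity)]
        congr 1
        have e1 : (√t)⁻¹ ^ (n + 2) * √t * √t = (√t)⁻¹ ^ n := by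
          rw [pow_add]; field_simp
        calc _ = C * (√(Real.pi * 8) * √(Real.pi * 8)) * ((√t)⁻¹ ^ (n + 2) * √t * √t) := by ring
          _ = _ := by rw [e1, Real.mul_self_sqrt (by positivity)]

theorem restrict_openHalf : (volume.restrict openHalf : Measure (ℝ × ℝ)) = volume.prod (volume.restrict (Ioi 0)) := by
  have : openHalf = univ ×ˢ Ioi 0 := by ext; simp [openHalf]
  rw [this, Measure.volume_eq_prod, ← Measure.prod_restrict, Measure.restrict_univ]

/-- The bound in `L¹`, uniform in the position `y` of the point vortex. -/
theorem exists_lintegral_vortKernel_le (j m : ℕ) : ∃ C : ℝ, 0 ≤ C ∧ ∀ t : ℝ, 0 < t → ∀ y : ℝ × ℝ,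
    0 ≤ y.2 → ∫⁻ x in openHalf, ‖vortKernel j m t x y‖ₑ ≤ ENNReal.ofReal (C * (√t)⁻¹ ^ (j + m)) := by
  obtain ⟨A, hA0, hA⟩ := lintegral_enorm_heat_le j
  obtain ⟨B, hB0, hB⟩ := lintegral_enorm_heat_le m
  obtain ⟨P, hP0, hP⟩ := lintegral_enorm_heatPoisson_le j
  obtain ⟨H, hH0, hH⟩ := lintegral_lintegral_heat_add_le m
  refine ⟨A * (B + B) + 2 * (P * H), by positivity, fun t ht y hy => ?_⟩
  have ch := continuous_heat m ht
  have cm := continuous_heat (m + 1) ht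
  have cj := continuous_heat j ht
  have cp := continuous_heatPoisson j ht
  have co : Continuous fun w => heatOdd m t w y.2 := by unfold heatOdd; fun_prop
  have b1 : ∫⁻ w in Ioi (0 : ℝ), ‖heatOdd m t w y.2‖ₑ ≤ ENNReal.ofReal ((B + B) * (√t)⁻¹ ^ m) := by
    refine (setLIntegral_le_lintegral _ _).trans ?_
    calc _ ≤ ∫⁻ w, (‖heat m t (w - y.2)‖ₑ + ‖heat m t (w + y.2)‖ₑ) :=
          lintegral_mono fun w => enorm_sub_le
      _ = (∫⁻ w, ‖heat m t w‖ₑ) + ∫⁻ w, ‖heat m t w‖ₑ := by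
          have := ch.measurable
          rw [lintegral_add_left (Measurable.enorm (by fun_prop)), lintegral_sub_right_eq_self (fun w => ‖heat m t w‖ₑ),
            lintegral_add_right_eq_self (fun w => ‖heat m t w‖ₑ)]
      _ ≤ ENNReal.ofReal (B * (√t)⁻¹ ^ m) + ENNReal.ofReal (B * (√t)⁻¹ ^ m) := add_le_add (hB t ht) (hB t ht)
      _ = _ := by rw [← ENNReal.ofReal_add (by positivity) (by positivity)]; congr 1; ring
  have cpp : Continuous fun p : (ℝ × ℝ) × ℝ => heatPoisson j t (y.2 - p.2) (p.1.1 - y.1) :=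
    cp.comp (g := fun p : ℝ × ℝ => heatPoisson j t p.1 p.2)
      (f := fun p : (ℝ × ℝ) × ℝ => (y.2 - p.2, p.1.1 - y.1)) (by fun_prop)
  have hpt : ∀ x : ℝ × ℝ, ‖vortKernel j m t x y‖ₑ ≤ ‖heat j t (x.1 - y.1)‖ₑ * ‖heatOdd m t x.2 y.2‖ₑ +
      2 * ∫⁻ r in Ioc 0 y.2, ‖heatPoisson j t (y.2 - r) (x.1 - y.1)‖ₑ * ‖heat (m + 1) t (x.2 + r)‖ₑ := fun x => by
    unfold vortKernel
    refine (enorm_add_le _ _).trans ?_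
    rw [enorm_mul, enorm_mul, intervalIntegral.integral_of_le hy]
    gcongr
    · rw [Real.enorm_eq_ofReal_abs]; simp
    · refine (enorm_integral_le_lintegral_enorm _).trans (le_of_eq ?_)
      simp_rw [enorm_mul, mul_comm]
  refine (lintegral_mono hpt).trans ?_
  have e1 : ∫⁻ x in openHalf, ‖heat j t (x.1 - y.1)‖ₑ * ‖heatOdd m t x.2 y.2‖ₑ ≤
      ENNReal.ofReal (A * (√t)⁻¹ ^ j) * ENNReal.ofReal ((B + B) * (√t)⁻¹ ^ m) := by
    rw [restrict_openHalf, lintegral_prod_mul (f := fun v => ‖heat j t (v - y.1)‖ₑ)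
      (g := fun w => ‖heatOdd m t w y.2‖ₑ) (by fun_prop) (by fun_prop),
      lintegral_sub_right_eq_self (fun v => ‖heat j t v‖ₑ)]
    exact mul_le_mul' (hA t ht) b1
  have e2 : ∫⁻ x in openHalf, ∫⁻ r in Ioc 0 y.2, ‖heatPoisson j t (y.2 - r) (x.1 - y.1)‖ₑ *
      ‖heat (m + 1) t (x.2 + r)‖ₑ ≤ ENNReal.ofReal (P * (√t)⁻¹ ^ j) * ENNReal.ofReal (H * (√t)⁻¹ ^ m) := by
    rw [lintegral_lintegral_swap (by fun_prop)]
    calc _ ≤ ∫⁻ r in Ioc 0 y.2, ENNReal.ofReal (P * (√t)⁻¹ ^ j) *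
          ∫⁻ w in Ioi (0 : ℝ), ‖heat (m + 1) t (w + r)‖ₑ := by
          refine setLIntegral_mono' measurableSet_Ioc fun r hr => ?_
          have cpr : Continuous fun v => heatPoisson j t (y.2 - r) (v - y.1) :=
            cp.comp (g := fun p : ℝ × ℝ => heatPoisson j t p.1 p.2)
              (f := fun v : ℝ => (y.2 - r, v - y.1)) (by fun_prop)
          rw [restrict_openHalf, lintegral_prod_mul (f := fun v => ‖heatPoisson j t (y.2 - r) (v - y.1)‖ₑ)
            (g := fun w => ‖heat (m + 1) t (w + r)‖ₑ) (by fun_prop) (by fun_prop),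
            lintegral_sub_right_eq_self (fun v => ‖heatPoisson j t (y.2 - r) v‖ₑ)]
          exact mul_le_mul' (hP t ht _ (by linarith [hr.2])) le_rfl
      _ = ENNReal.ofReal (P * (√t)⁻¹ ^ j) * ∫⁻ r in Ioc 0 y.2, 
          ∫⁻ w in Ioi (0 : ℝ), ‖heat (m + 1) t (w + r)‖ₑ := lintegral_const_mul' _ _ ENNReal.ofReal_ne_top
      _ ≤ _ := mul_le_mul' le_rfl ((lintegral_mono_set Ioc_subset_Ioi_self).trans (hH t ht))
  rw [lintegral_add_left (by fun_prop), lintegral_const_mul' _ _ (by simp)]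
  refine (add_le_add e1 (mul_le_mul' le_rfl e2)).trans (le_of_eq ?_)
  rw [← ENNReal.ofReal_mul (by positivity), ← ENNReal.ofReal_mul (by positivity),
    show (2 : ℝ≥0∞) = ENNReal.ofReal 2 by simp, ← ENNReal.ofReal_mul (by positivity),
    ← ENNReal.ofReal_add (by positivity) (by positivity)]
  congr 1
  rw [pow_add]; ring

/-! ### Estimates of the derivatives of the vorticity -/

theorem lintegral_vortLayer_le (j m : ℕ) : ∃ C : ℝ, 0 ≤ C ∧ ∀ (μ : Measure ClosedHalf) [IsFiniteMeasure μ]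
    (t : ℝ), 0 < t →
    ∫⁻ x in openHalf, ‖vortLayer μ j m t x‖ₑ ≤ ENNReal.ofReal (C * (√t)⁻¹ ^ (j + m)) * μ univ := by
  obtain ⟨C, hC0, hC⟩ := exists_lintegral_vortKernel_le j m
  refine ⟨C, hC0, fun μ _ t ht => ?_⟩
  calc _ ≤ ∫⁻ x in openHalf, ∫⁻ y, ‖vortKernel j m t x y.1‖ₑ ∂μ := lintegral_mono fun x => by
        rw [← (integral_vortKernel μ j m ht x).2]
        exact enorm_integral_le_lintegral_enorm _
    _ = ∫⁻ y, (∫⁻ x in openHalf, ‖vortKernel j m t x y.1‖ₑ) ∂μ :=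
        lintegral_lintegral_swap (continuous_vortKernel_half j m ht).enorm.aemeasurable
    _ ≤ ∫⁻ _, ENNReal.ofReal (C * (√t)⁻¹ ^ (j + m)) ∂μ := lintegral_mono fun y => hC t ht y.1 y.2
    _ = _ := lintegral_const _

theorem enorm_vortLayer_le (j m : ℕ) : ∃ C : ℝ, 0 ≤ C ∧ ∀ (μ : Measure ClosedHalf) [IsFiniteMeasure μ]
    (t : ℝ), 0 < t → ∀ x ∈ openHalf,
    ‖vortLayer μ j m t x‖ₑ ≤ ENNReal.ofReal (C * (√t)⁻¹ ^ (j + m + 2)) * μ univ := by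
  obtain ⟨C, hC0, hC⟩ := exists_abs_vortKernel_le j m
  refine ⟨C, hC0, fun μ _ t ht x hx => ?_⟩
  rw [← (integral_vortKernel μ j m ht x).2]
  refine (enorm_integral_le_lintegral_enorm _).trans ?_
  rw [← lintegral_const]
  refine lintegral_mono fun y => ?_
  rw [Real.enorm_eq_ofReal_abs]
  exact ENNReal.ofReal_le_ofReal (hC t ht x y.1 (le_of_lt hx) y.2)

theorem totalVariation_univ (ω : M) : ω.totalVariation univ =
    ω.toJordanDecomposition.posPart univ + ω.toJordanDecomposition.negPart univ := rfl

/-- The derivative `∂_t^s ∂₁^j ∂₂^m` of the vorticity: each derivative in time is a Laplacian. -/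
noncomputable def heatDeriv (ω : M) : ℕ → ℕ → ℕ → ℝ → ℝ × ℝ → ℝ
  | 0, j, m, t, x => signedVortLayer ω j m t x
  | s + 1, j, m, t, x => heatDeriv ω s (j + 2) m t x + heatDeriv ω s j (m + 2) t x

theorem hasDerivAt_heatDeriv (ω : M) (s j m : ℕ) {t : ℝ} (ht : 0 < t) (x : ℝ × ℝ) :
    HasDerivAt (fun t => heatDeriv ω s j m t x) (heatDeriv ω (s + 1) j m t x) t := by
  induction s generalizing j m with
  | zero =>
    refine ((hasDerivAt_vortLayer_time ω.toJordanDecomposition.posPart j m ht x).sub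
      (hasDerivAt_vortLayer_time ω.toJordanDecomposition.negPart j m ht x)).congr_deriv ?_
    simp only [heatDeriv, signedVortLayer]; ring
  | succ s ih => exact (ih (j + 2) m).add (ih j (m + 2))

theorem pd_congr_on {f g : ℝ × ℝ → ℝ} (h : EqOn f g openHalf) (i : Fin 2) :
    EqOn (pd i f) (pd i g) openHalf := by
  intro x hx
  exact Filter.EventuallyEq.lineDeriv_eq (Filter.eventuallyEq_of_mem (isOpen_openHalf.mem_nhds hx) h)

theorem pd_signedVortLayer (ω : M) (j m : ℕ) {t : ℝ} (ht : 0 < t) (x : ℝ × ℝ) :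
    pd 0 (signedVortLayer ω j m t) x = signedVortLayer ω (j + 1) m t x ∧
    pd 1 (signedVortLayer ω j m t) x = signedVortLayer ω j (m + 1) t x := by
  rw [pd_zero_eq_deriv, pd_one_eq_deriv]
  exact ⟨((hasDerivAt_vortLayer_fst ω.toJordanDecomposition.posPart j m ht x).sub
      (hasDerivAt_vortLayer_fst ω.toJordanDecomposition.negPart j m ht x)).deriv,
    ((hasDerivAt_vortLayer_snd ω.toJordanDecomposition.posPart j m ht x).sub
      (hasDerivAt_vortLayer_snd ω.toJordanDecomposition.negPart j m ht x)).deriv⟩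

theorem iterate_pd_vorticity (ω : M) (k₁ k₂ : ℕ) {t : ℝ} (ht : 0 < t) :
    EqOn ((pd 0)^[k₁] ((pd 1)^[k₂] (vorticity t ω))) (signedVortLayer ω k₁ k₂ t) openHalf := by
  have h : EqOn ((pd 1)^[k₂] (vorticity t ω)) (signedVortLayer ω 0 k₂ t) openHalf := by
    induction k₂ with
    | zero => exact fun x hx => vorticity_eq ω ht hx
    | succ k ih =>
      rw [Function.iterate_succ_apply']
      exact fun x hx => (pd_congr_on ih 1 hx).trans (pd_signedVortLayer ω 0 k ht x).2
  induction k₁ with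
  | zero => exact h
  | succ k ih =>
    rw [Function.iterate_succ_apply']
    exact fun x hx => (pd_congr_on ih 0 hx).trans (pd_signedVortLayer ω k k₂ ht x).1

/-- The iterated classical derivatives are those of the kernel, with time derivatives replaced by
Laplacians. -/
theorem vorticityDeriv_eq (ω : M) (s k₁ k₂ : ℕ) {t : ℝ} (ht : 0 < t) {x : ℝ × ℝ} (hx : x ∈ openHalf) :
    vorticityDeriv s k₁ k₂ t ω x = heatDeriv ω s k₁ k₂ t x := by
  unfold vorticityDeriv
  induction s generalizing t with
  | zero => exact iterate_pd_vorticity ω k₁ k₂ ht hx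
  | succ s ih =>
    rw [iteratedDeriv_succ]
    refine Eq.trans (Filter.EventuallyEq.deriv_eq ?_) (hasDerivAt_heatDeriv ω s k₁ k₂ ht x).deriv
    filter_upwards [Ioi_mem_nhds ht] with τ hτ
    exact ih hτ

theorem exists_heatDeriv_bound (s j m : ℕ) : ∃ C : ℝ, 0 ≤ C ∧ ∀ (ω : M) (t : ℝ), 0 < t →
    (∫⁻ x in openHalf, ‖heatDeriv ω s j m t x‖ₑ ≤
      ENNReal.ofReal (C * (√t)⁻¹ ^ (j + m + 2 * s)) * ω.totalVariation univ) ∧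
    ∀ x ∈ openHalf, ‖heatDeriv ω s j m t x‖ₑ ≤
      ENNReal.ofReal (C * (√t)⁻¹ ^ (j + m + 2 * s + 2)) * ω.totalVariation univ := by
  induction s generalizing j m with
  | zero =>
    obtain ⟨A, hA0, hA⟩ := lintegral_vortLayer_le j m
    obtain ⟨B, hB0, hB⟩ := enorm_vortLayer_le j m
    refine ⟨A + B, by positivity, fun ω t ht => ⟨?_, fun x hx => ?_⟩⟩
    · have hm : AEMeasurable (fun x => ‖vortLayer ω.toJordanDecomposition.posPart j m t x‖ₑ)
          (volume.restrict openHalf) := by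
        have := (continuous_vortKernel_half j m ht).aestronglyMeasurable
          (μ := (volume.restrict openHalf).prod ω.toJordanDecomposition.posPart)
        have := this.integral_prod_right'
        simp only [(integral_vortKernel ω.toJordanDecomposition.posPart j m ht _).2] at this
        exact this.enorm
      calc _ ≤ ∫⁻ x in openHalf, (‖vortLayer ω.toJordanDecomposition.posPart j m t x‖ₑ +
            ‖vortLayer ω.toJordanDecomposition.negPart j m t x‖ₑ) := lintegral_mono fun x => enorm_sub_le
        _ = _ := lintegral_add_left' hm _
        _ ≤ ENNReal.ofReal (A * (√t)⁻¹ ^ (j + m)) * ω.toJordanDecomposition.posPart univ +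
            ENNReal.ofReal (A * (√t)⁻¹ ^ (j + m)) * ω.toJordanDecomposition.negPart univ :=
            add_le_add (hA _ t ht) (hA _ t ht)
        _ ≤ _ := by
          rw [← mul_add, ← totalVariation_univ, mul_zero, add_zero]
          gcongr
          linarith
    · calc _ ≤ ‖vortLayer ω.toJordanDecomposition.posPart j m t x‖ₑ +
            ‖vortLayer ω.toJordanDecomposition.negPart j m t x‖ₑ := enorm_sub_le
        _ ≤ ENNReal.ofReal (B * (√t)⁻¹ ^ (j + m + 2)) * ω.toJordanDecomposition.posPart univ +
            ENNReal.ofReal (B * (√t)⁻¹ ^ (j + m + 2)) * ω.toJordanDecomposition.negPart univ :=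
            add_le_add (hB _ t ht x hx) (hB _ t ht x hx)
        _ ≤ _ := by
          rw [← mul_add, ← totalVariation_univ, mul_zero, add_zero]
          gcongr
          linarith
  | succ s ih =>
    obtain ⟨A, hA0, hA⟩ := ih (j + 2) m
    obtain ⟨B, hB0, hB⟩ := ih j (m + 2)
    have e : ∀ (t : ℝ) (n : ℕ) (V : ℝ≥0∞), ENNReal.ofReal (A * (√t)⁻¹ ^ n) * V +
        ENNReal.ofReal (B * (√t)⁻¹ ^ n) * V = ENNReal.ofReal ((A + B) * (√t)⁻¹ ^ n) * V := fun t n V => by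
      rw [← add_mul, ← ENNReal.ofReal_add (by positivity) (by positivity), ← add_mul]
    refine ⟨A + B, by positivity, fun ω t ht => ⟨?_, fun x hx => ?_⟩⟩
    · have hm : AEMeasurable (fun x => ‖heatDeriv ω s (j + 2) m t x‖ₑ) (volume.restrict openHalf) := by
        refine ContinuousOn.aemeasurable ?_ measurableSet_openHalf
        refine ContinuousOn.enorm ?_
        clear hA hB ih e
        induction s generalizing j m with
        | zero =>
          have h := fun μ [IsFiniteMeasure μ] => (contDiffOn_vortLayer μ (j + 2) m).continuousOn.comp
            (f := fun x : ℝ × ℝ => (t, x)) (t := Ioi 0 ×ˢ openHalf) (s := openHalf)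
            (Continuous.prodMk_right t).continuousOn fun x hx => ⟨ht, hx⟩
          exact (h ω.toJordanDecomposition.posPart).sub (h ω.toJordanDecomposition.negPart)
        | succ s ih => exact (ih (j + 2) m).add (ih j (m + 2))
      calc _ ≤ ∫⁻ x in openHalf, (‖heatDeriv ω s (j + 2) m t x‖ₑ + ‖heatDeriv ω s j (m + 2) t x‖ₑ) :=
            lintegral_mono fun x => enorm_add_le _ _
        _ = _ := lintegral_add_left' hm _
        _ ≤ _ := add_le_add (hA ω t ht).1 (hB ω t ht).1
        _ = _ := by
          rw [show j + 2 + m + 2 * s = j + m + 2 * (s + 1) by ring,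
            show j + (m + 2) + 2 * s = j + m + 2 * (s + 1) by ring, e]
    · calc _ ≤ ‖heatDeriv ω s (j + 2) m t x‖ₑ + ‖heatDeriv ω s j (m + 2) t x‖ₑ := enorm_add_le _ _
        _ ≤ _ := add_le_add ((hA ω t ht).2 x hx) ((hB ω t ht).2 x hx)
        _ = _ := by
          rw [show j + 2 + m + 2 * s = j + m + 2 * (s + 1) by ring,
            show j + (m + 2) + 2 * s = j + m + 2 * (s + 1) by ring, e]

/-- Interpolation between the `L¹` norm and a uniform bound. -/
theorem eLpNorm_le_rpow_mul_rpow {α : Type*} [MeasurableSpace α] {ν : Measure α} {f : α → ℝ} {A B q : ℝ≥0∞}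
    (hq : 1 ≤ q) (hA' : A ≠ ∞) (hA : ∀ᵐ x ∂ν, ‖f x‖ₑ ≤ A) (hB : ∫⁻ x, ‖f x‖ₑ ∂ν ≤ B) :
    eLpNorm f q ν ≤ A ^ (1 - (q⁻¹).toReal) * B ^ (q⁻¹).toReal := by
  rcases eq_or_ne q ∞ with rfl | hne
  · simp only [ENNReal.inv_top, ENNReal.toReal_zero, sub_zero, ENNReal.rpow_one, ENNReal.rpow_zero, mul_one,
      eLpNorm_exponent_top]
    exact eLpNormEssSup_le_of_ae_enorm_bound hA
  have h0 : q ≠ 0 := (zero_lt_one.trans_le hq).ne'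
  have hp : 1 ≤ q.toReal := by
    rw [← ENNReal.toReal_one]; exact ENNReal.toReal_mono hne hq
  have hp0 : 0 < q.toReal := by linarith
  rw [eLpNorm_eq_lintegral_rpow_enorm_toReal h0 hne, ENNReal.toReal_inv]
  have h1 : ∫⁻ x, ‖f x‖ₑ ^ q.toReal ∂ν ≤ A ^ (q.toReal - 1) * B := by
    calc _ ≤ ∫⁻ x, A ^ (q.toReal - 1) * ‖f x‖ₑ ∂ν := by
          refine lintegral_mono_ae (hA.mono fun x hx => ?_)
          have : ‖f x‖ₑ ^ q.toReal = ‖f x‖ₑ ^ (q.toReal - 1) * ‖f x‖ₑ := by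
            nth_rewrite 3 [← ENNReal.rpow_one ‖f x‖ₑ]
            rw [← ENNReal.rpow_add_of_nonneg _ _ (by linarith) zero_le_one, sub_add_cancel]
          rw [this]
          exact mul_le_mul' (ENNReal.rpow_le_rpow hx (by linarith)) le_rfl
      _ ≤ A ^ (q.toReal - 1) * ∫⁻ x, ‖f x‖ₑ ∂ν := by
          rw [lintegral_const_mul' _ _ (ENNReal.rpow_ne_top_of_nonneg (by linarith) hA')]
      _ ≤ _ := by gcongr
  refine (ENNReal.rpow_le_rpow h1 (by positivity)).trans (le_of_eq ?_)
  rw [ENNReal.mul_rpow_of_nonneg _ _ (by positivity), ← ENNReal.rpow_mul]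
  congr 2
  · field_simp
  · rw [one_div]

theorem exists_eLpNorm_vorticityDeriv_le (s k₁ k₂ : ℕ) : ∃ C : ℝ, ∀ (ω : M) (t : ℝ) (q : ℝ≥0∞), 0 < t → 1 ≤ q →
      eLpNorm (vorticityDeriv s k₁ k₂ t ω) q (volume.restrict openHalf) ≤
        ENNReal.ofReal
            (C * t ^ (-(1 - (q⁻¹).toReal + ((k₁ : ℝ) + (k₂ : ℝ)) / 2 + (s : ℝ)))) *
          ω.totalVariation univ := by
  obtain ⟨C, hC0, hC⟩ := exists_heatDeriv_bound s k₁ k₂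
  refine ⟨C, fun ω t q ht hq => ?_⟩
  obtain ⟨h1, h2⟩ := hC ω t ht
  set n := k₁ + k₂ + 2 * s with hn
  set V := ω.totalVariation univ
  have hV : V ≠ ∞ := by
    change ω.toJordanDecomposition.posPart univ + ω.toJordanDecomposition.negPart univ ≠ ∞
    exact ENNReal.add_ne_top.2 ⟨measure_ne_top _ _, measure_ne_top _ _⟩
  have hst := Real.sqrt_pos.2 ht
  set θ := (q⁻¹).toReal
  have hθ0 : 0 ≤ θ := ENNReal.toReal_nonneg
  have hθ1 : θ ≤ 1 := by
    have : q⁻¹ ≤ 1 := ENNReal.inv_le_one.2 hq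
    rw [← ENNReal.toReal_one]; exact ENNReal.toReal_mono ENNReal.one_ne_top this
  have hae : vorticityDeriv s k₁ k₂ t ω =ᵐ[volume.restrict openHalf] heatDeriv ω s k₁ k₂ t := by
    filter_upwards [ae_restrict_mem measurableSet_openHalf] with x hx
    exact vorticityDeriv_eq ω s k₁ k₂ ht hx
  rw [eLpNorm_congr_ae hae]
  refine (eLpNorm_le_rpow_mul_rpow hq (ENNReal.mul_ne_top ENNReal.ofReal_ne_top hV)
    ((ae_restrict_mem measurableSet_openHalf).mono h2) h1).trans (le_of_eq ?_)
  rw [ENNReal.mul_rpow_of_nonneg _ _ (sub_nonneg.2 hθ1), ENNReal.mul_rpow_of_nonneg _ _ hθ0,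
    mul_mul_mul_comm, ← ENNReal.rpow_add_of_nonneg _ _ (sub_nonneg.2 hθ1) hθ0, sub_add_cancel,
    ENNReal.rpow_one, ENNReal.ofReal_rpow_of_nonneg (by positivity) (sub_nonneg.2 hθ1),
    ENNReal.ofReal_rpow_of_nonneg (by positivity) hθ0, ← ENNReal.ofReal_mul (by positivity)]
  congr 2
  -- powers of the square root of time are real powers of time
  have hpow : ∀ k : ℕ, (√t)⁻¹ ^ k = t ^ (-((k : ℝ) / 2)) := fun k => by
    rw [Real.sqrt_eq_rpow, ← Real.rpow_neg ht.le, ← Real.rpow_natCast, ← Real.rpow_mul ht.le]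
    congr 1; ring
  rw [hpow, hpow, Real.mul_rpow hC0 (by positivity), Real.mul_rpow hC0 (by positivity),
    mul_mul_mul_comm, ← Real.rpow_add_of_nonneg hC0 (sub_nonneg.2 hθ1) hθ0, sub_add_cancel, Real.rpow_one,
    ← Real.rpow_mul ht.le, ← Real.rpow_mul ht.le, ← Real.rpow_add ht]
  congr 2
  rw [hn]; push_cast; ring

/-! ### Integrals against signed measures -/

section SignedIntegral

variable {α : Type*} [MeasurableSpace α]

theorem signedMeasure_apply (s : SignedMeasure α) {A : Set α} (hA : MeasurableSet A) :
    s A = s.toJordanDecomposition.posPart.real A - s.toJordanDecomposition.negPart.real A := by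
  nth_rewrite 1 [← s.toSignedMeasure_toJordanDecomposition]
  rw [JordanDecomposition.toSignedMeasure, Measure.toSignedMeasure_sub_apply hA]

/-- The integral of a bounded function against a signed measure can be computed from any
representation of the signed measure as a difference of finite measures. -/
theorem sint_eq_sub {s : SignedMeasure α} {μ ν : Measure α} [IsFiniteMeasure μ] [IsFiniteMeasure ν]
    (h : ∀ A, MeasurableSet A → s A = μ.real A - ν.real A) {f : α → ℝ} (hf : Measurable f) {C : ℝ}
    (hC : ∀ y, |f y| ≤ C) : sint s f = (∫ y, f y ∂μ) - ∫ y, f y ∂ν := by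
  have hi : ∀ (ρ : Measure α) [IsFiniteMeasure ρ], Integrable f ρ := fun ρ _ =>
    (integrable_const C).mono' hf.aestronglyMeasurable (ae_of_all _ hC)
  have e : s.toJordanDecomposition.posPart + ν = s.toJordanDecomposition.negPart + μ := by
    refine Measure.ext fun A hA => ?_
    have h1 := h A hA
    have h2 := signedMeasure_apply s hA
    have h3 : (s.toJordanDecomposition.posPart + ν).real A = (s.toJordanDecomposition.negPart + μ).real A := by
      rw [measureReal_add_apply, measureReal_add_apply]; linarith
    exact (measureReal_eq_measureReal_iff).1 h3
  have h4 : ∫ y, f y ∂(s.toJordanDecomposition.posPart + ν) =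
      ∫ y, f y ∂(s.toJordanDecomposition.negPart + μ) := by rw [e]
  rw [integral_add_measure (hi _) (hi _), integral_add_measure (hi _) (hi _)] at h4
  rw [sint_eq]; linarith

theorem sint_sub_measure (s s' : SignedMeasure α) {f : α → ℝ} (hf : Measurable f) {C : ℝ}
    (hC : ∀ y, |f y| ≤ C) : sint (s - s') f = sint s f - sint s' f := by
  have hi : ∀ (ρ : Measure α) [IsFiniteMeasure ρ], Integrable f ρ := fun ρ _ =>
    (integrable_const C).mono' hf.aestronglyMeasurable (ae_of_all _ hC)
  rw [sint_eq_sub (μ := s.toJordanDecomposition.posPart + s'.toJordanDecomposition.negPart)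
    (ν := s.toJordanDecomposition.negPart + s'.toJordanDecomposition.posPart) (fun A hA => ?_) hf hC,
    integral_add_measure (hi _) (hi _), integral_add_measure (hi _) (hi _), sint_eq, sint_eq]
  · ring
  · rw [show (s - s') A = s A - s' A from rfl, signedMeasure_apply s hA, signedMeasure_apply s' hA,
      measureReal_add_apply, measureReal_add_apply]
    ring

theorem sint_restrict (s : SignedMeasure α) {S : Set α} (hS : MeasurableSet S) {f : α → ℝ} (hf : Measurable f)
    {C : ℝ} (hC : ∀ y, |f y| ≤ C) : sint (s.restrict S) f =
      (∫ y in S, f y ∂s.toJordanDecomposition.posPart) - ∫ y in S, f y ∂s.toJordanDecomposition.negPart := by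
  refine sint_eq_sub (fun A hA => ?_) hf hC
  rw [VectorMeasure.restrict_apply _ hS hA, signedMeasure_apply s (hA.inter hS),
    measureReal_restrict_apply hA, measureReal_restrict_apply hA]

theorem integral_withDensity_ofReal {μ : Measure α} {g : α → ℝ} (hg : Integrable g μ) (f : α → ℝ) :
    ∫ y, f y ∂(μ.withDensity fun x => ENNReal.ofReal (g x)) = ∫ y, max (g y) 0 * f y ∂μ := by
  rw [integral_withDensity_eq_integral_toReal_smul₀ hg.aemeasurable.ennreal_ofReal
    (ae_of_all _ fun x => ENNReal.ofReal_lt_top)]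
  simp only [ENNReal.toReal_ofReal', smul_eq_mul]

theorem withDensityᵥ_apply_eq {μ : Measure α} {g : α → ℝ} (hg : Integrable g μ) {A : Set α}
    (hA : MeasurableSet A) : μ.withDensityᵥ g A =
      (μ.withDensity fun x => ENNReal.ofReal (g x)).real A -
        (μ.withDensity fun x => ENNReal.ofReal (-g x)).real A := by
  have := isFiniteMeasure_withDensity_ofReal hg.2
  have := isFiniteMeasure_withDensity_ofReal hg.neg.2
  rw [withDensityᵥ_eq_withDensity_pos_part_sub_withDensity_neg_part hg]
  exact Measure.toSignedMeasure_sub_apply hA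

theorem integral_pos_part_sub_neg_part {μ : Measure α} {g : α → ℝ} (hg : Integrable g μ) {f : α → ℝ}
    (hf : AEStronglyMeasurable f μ) {C : ℝ} (hC : ∀ y, |f y| ≤ C) :
    (∫ y, max (g y) 0 * f y ∂μ) - ∫ y, max (-g y) 0 * f y ∂μ = ∫ y, f y * g y ∂μ := by
  rw [← integral_sub (hg.pos_part.mul_bdd (c := C) hf (ae_of_all _ hC)) (hg.neg_part.mul_bdd (c := C) hf (ae_of_all _ hC))]
  congr 1; ext y
  rcases le_total 0 (g y) with h | h
  · rw [max_eq_left h, max_eq_right (by linarith)]; ring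
  · rw [max_eq_right h, max_eq_left (by linarith)]; ring

theorem sint_withDensity {μ : Measure α} {g : α → ℝ} (hg : Integrable g μ) {f : α → ℝ} (hf : Measurable f)
    {C : ℝ} (hC : ∀ y, |f y| ≤ C) : sint (μ.withDensityᵥ g) f = ∫ y, f y * g y ∂μ := by
  have := isFiniteMeasure_withDensity_ofReal hg.2
  have : IsFiniteMeasure (μ.withDensity fun x => ENNReal.ofReal (-g x)) :=
    isFiniteMeasure_withDensity_ofReal hg.neg.2
  rw [sint_eq_sub (fun A hA => withDensityᵥ_apply_eq hg hA) hf hC, integral_withDensity_ofReal hg,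
    integral_withDensity_ofReal (g := fun x => -g x) hg.neg]
  exact integral_pos_part_sub_neg_part hg hf.aestronglyMeasurable hC

theorem sint_map_withDensity {β : Type*} [MeasurableSpace β] {μ : Measure α} {g : α → ℝ} (hg : Integrable g μ)
    {F : α → β} (hF : Measurable F) {f : β → ℝ} (hf : Measurable f) {C : ℝ} (hC : ∀ y, |f y| ≤ C) :
    sint ((μ.withDensityᵥ g).map F) f = ∫ y, f (F y) * g y ∂μ := by
  have := isFiniteMeasure_withDensity_ofReal hg.2
  have : IsFiniteMeasure (μ.withDensity fun x => ENNReal.ofReal (-g x)) :=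
    isFiniteMeasure_withDensity_ofReal hg.neg.2
  rw [sint_eq_sub (μ := (μ.withDensity fun x => ENNReal.ofReal (g x)).map F)
    (ν := (μ.withDensity fun x => ENNReal.ofReal (-g x)).map F) (fun A hA => ?_) hf hC,
    integral_map hF.aemeasurable hf.aestronglyMeasurable,
    integral_map hF.aemeasurable hf.aestronglyMeasurable, integral_withDensity_ofReal hg,
    integral_withDensity_ofReal (g := fun x => -g x) hg.neg]
  · exact integral_pos_part_sub_neg_part hg (hf.comp hF).aestronglyMeasurable fun y => hC (F y)
  · rw [VectorMeasure.map_apply _ hF hA, withDensityᵥ_apply_eq hg (hF hA), map_measureReal_apply hF hA,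
      map_measureReal_apply hF hA]

end SignedIntegral

/-! ### The solution operator as an integral operator -/

theorem measurableSet_closedHalf : MeasurableSet {x : ℝ × ℝ | 0 ≤ x.2} :=
  measurableSet_le measurable_const measurable_snd

theorem measurableEmbedding_closedHalf : MeasurableEmbedding (Subtype.val : ClosedHalf → ℝ × ℝ) :=
  MeasurableEmbedding.subtype_coe measurableSet_closedHalf

theorem map_area : area.map Subtype.val = volume.restrict openHalf := by
  rw [area, measurableEmbedding_closedHalf.map_comap, Subtype.range_coe_subtype]
  refine Measure.restrict_congr_set ?_
  have h := (ae_prod_ne 0)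
  filter_upwards [h] with x hx
  refine propext ⟨fun hx' => lt_of_le_of_ne hx' (Ne.symm hx.2), fun hx' => le_of_lt hx'⟩

theorem ae_area {p : ℝ × ℝ → Prop} (h : ∀ᵐ x ∂(volume.restrict openHalf), p x) :
    ∀ᵐ x ∂area, p x.1 := by
  rw [← map_area] at h
  exact ae_of_ae_map measurable_subtype_coe.aemeasurable h

theorem integrable_area_iff {f : ℝ × ℝ → ℝ} :
    Integrable (fun x : ClosedHalf => f x.1) area ↔ IntegrableOn f openHalf := by
  rw [IntegrableOn, ← map_area, measurableEmbedding_closedHalf.integrable_map_iff]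
  rfl

theorem integral_area (f : ℝ × ℝ → ℝ) : ∫ x, f x.1 ∂area = ∫ x in openHalf, f x := by
  rw [← map_area, measurableEmbedding_closedHalf.integral_map]

theorem vorticity_eq_sint (ω : M) {t : ℝ} (ht : 0 < t) {x : ℝ × ℝ} (hx : x ∈ openHalf) :
    vorticity t ω x = sint ω fun y => vortKernel 0 0 t x y.1 := by
  rw [vorticity_eq ω ht hx, sint_eq, (integral_vortKernel _ 0 0 ht x).2, (integral_vortKernel _ 0 0 ht x).2]
  rfl

theorem integrable_vorticity (ω : M) {t : ℝ} (ht : 0 < t) :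
    Integrable (fun x : ClosedHalf => vorticity t ω x.1) area := by
  rw [integrable_area_iff]
  have hm : ContinuousOn (vorticity t ω) openHalf :=
    (contDiffOn_vorticity ω).continuousOn.comp (f := fun x : ℝ × ℝ => (t, x)) (t := Ioi 0 ×ˢ openHalf)
      (Continuous.prodMk_right t).continuousOn fun x hx => ⟨ht, hx⟩
  refine ⟨hm.aestronglyMeasurable measurableSet_openHalf, ?_⟩
  obtain ⟨C, _, hC⟩ := exists_heatDeriv_bound 0 0 0
  have hV : ω.totalVariation univ < ∞ := by
    change ω.toJordanDecomposition.posPart univ + ω.toJordanDecomposition.negPart univ < ∞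
    exact ENNReal.add_lt_top.2 ⟨measure_lt_top _ _, measure_lt_top _ _⟩
  refine lt_of_le_of_lt ?_ ((hC ω t ht).1.trans_lt (ENNReal.mul_lt_top ENNReal.ofReal_lt_top hV))
  · refine le_of_eq ?_
    refine setLIntegral_congr_fun measurableSet_openHalf fun x hx => ?_
    rw [vorticity_eq ω ht hx, heatDeriv]

theorem T_of_pos (ω : M) {t : ℝ} (ht : 0 < t) :
    T t ω = area.withDensityᵥ (fun x => vorticity t ω x.1) := if_pos ht

theorem T_zero (ω : M) : T 0 ω = ω := if_neg (lt_irrefl 0)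

/-- Two measures with equal integrals of the kernel of the solution operator evolve equally. -/
theorem T_congr {ω ω' : M} {t t' : ℝ} (ht : 0 < t) (ht' : 0 < t')
    (h : ∀ x ∈ openHalf, sint ω (fun y => vortKernel 0 0 t x y.1) =
      sint ω' fun y => vortKernel 0 0 t' x y.1) : T t ω = T t' ω' := by
  rw [T_of_pos ω ht, T_of_pos ω' ht']
  refine WithDensityᵥEq.congr_ae (ae_area (p := fun x => vorticity t ω x = vorticity t' ω' x) ?_)
  filter_upwards [ae_restrict_mem measurableSet_openHalf] with x hx
  rw [vorticity_eq_sint ω ht hx, vorticity_eq_sint ω' ht' hx, h x hx]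

theorem exists_vortKernel_bdd {t : ℝ} (ht : 0 < t) : ∃ C : ℝ, 0 ≤ C ∧ ∀ x y : ℝ × ℝ, 0 ≤ x.2 → 0 ≤ y.2 →
    |vortKernel 0 0 t x y| ≤ C := by
  obtain ⟨C, h0, hC⟩ := exists_abs_vortKernel_le 0 0
  exact ⟨_, by positivity, hC t ht⟩

theorem measurable_vortKernel_right {t : ℝ} (ht : 0 < t) (x : ℝ × ℝ) :
    Measurable fun y : ClosedHalf => vortKernel 0 0 t x y.1 :=
  ((continuous_vortKernel_half 0 0 ht).comp (Continuous.prodMk_right x)).measurable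

/-- Vorticity on the boundary does not influence the evolution. -/
theorem vortKernel_boundary (t : ℝ) (x : ℝ × ℝ) (r : ℝ) : vortKernel 0 0 t x (r, 0) = 0 := by
  simp [vortKernel, heatOdd_zero_right]

theorem measurable_boundary : Measurable fun r : ℝ => (⟨(r, 0), le_refl (0 : ℝ)⟩ : ClosedHalf) :=
  Measurable.subtype_mk (by fun_prop)

/-- The measure `ω` and its normalization differ by a measure on the boundary line, where the
kernel of the solution operator vanishes. -/
theorem T_normalized (ω : M) {t : ℝ} (ht : 0 < t) : T t (normalized ω) = T t ω := by
  refine T_congr ht ht fun x hx => ?_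
  obtain ⟨C, _, hC⟩ := exists_vortKernel_bdd ht
  have hC' : ∀ y : ClosedHalf, |vortKernel 0 0 t x y.1| ≤ C := fun y => hC x y.1 (le_of_lt hx) y.2
  have hm := measurable_vortKernel_right ht x
  rw [normalized, sint_sub_measure _ _ hm hC', boundaryMeasure,
    sint_map_withDensity (integrable_tangentialTrace ω) measurable_boundary hm hC']
  simp [vortKernel_boundary]

/-! ### The Chapman-Kolmogorov identity at a fixed tangential frequency -/

theorem integral_heat_one_conv {t s : ℝ} (ht : 0 < t) (hs : 0 < s) (x z : ℝ) :
    ∫ y, heat 1 t (x - y) * heat 0 s (y - z) = heat 1 (t + s) (x - z) := by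
  obtain ⟨M, hM0, hM⟩ := exists_heat_le 1 ht
  have c0 := continuous_heat 0 ht
  have c1 := continuous_heat 1 ht
  have cs := continuous_heat 0 hs
  obtain ⟨N, hN0, hN⟩ := exists_heat_le 0 ht
  have hi : Integrable fun y => heat 0 s (y - z) := (integrable_heat 0 hs).comp_sub_right z
  have h := hasDerivAt_integral_of_dominated_loc_of_deriv_le (𝕜 := ℝ) (μ := (volume : Measure ℝ))
    (F := fun x y => heat 0 t (x - y) * heat 0 s (y - z)) (x₀ := x)
    (F' := fun x y => heat 1 t (x - y) * heat 0 s (y - z)) (bound := fun y => M * |heat 0 s (y - z)|)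
    (s := univ) Filter.univ_mem (Eventually.of_forall fun x => Continuous.aestronglyMeasurable (by fun_prop))
    (hi.bdd_mul (c := N) (Continuous.aestronglyMeasurable (by fun_prop)) (ae_of_all _ fun y => hN _))
    (Continuous.aestronglyMeasurable (by fun_prop))
    (ae_of_all _ fun y x _ => by
      rw [norm_mul]; exact mul_le_mul_of_nonneg_right (hM _) (norm_nonneg _))
    (hi.norm.const_mul M)
    (ae_of_all _ fun y x _ => ((hasDerivAt_heat 0 ht (x - y)).comp_sub_const x y).mul_const _)
  have h2 := h.2
  simp only [integral_heat_conv ht hs] at h2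
  exact h2.unique ((hasDerivAt_heat 0 (add_pos ht hs) (x - z)).comp_sub_const x z)

theorem heatOdd_neg_right (n : ℕ) (t w z : ℝ) : heatOdd n t w (-z) = -heatOdd n t w z := by
  unfold heatOdd; rw [sub_neg_eq_add, ← sub_eq_add_neg]; ring

theorem heatOdd_zero_comm (t w z : ℝ) : heatOdd 0 t w z = heatOdd 0 t z w := by
  unfold heatOdd; rw [← heat_zero_neg t (w - z), neg_sub, add_comm w z]

/-- The half-line Chapman-Kolmogorov identity for the odd heat kernel, obtained from the one on the
line by reflection. -/
theorem integral_heatOdd_mul_heatOdd {n : ℕ} (hn : ∀ {t s : ℝ}, 0 < t → 0 < s → ∀ x z : ℝ,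
    ∫ y, heat n t (x - y) * heat 0 s (y - z) = heat n (t + s) (x - z)) {t s : ℝ} (ht : 0 < t) (hs : 0 < s)
    (x r : ℝ) : ∫ y in Ioi (0 : ℝ), heatOdd n t x y * heatOdd 0 s y r = heatOdd n (t + s) x r := by
  obtain ⟨N, hN0, hN⟩ := exists_heat_le n ht
  have cn := continuous_heat n ht
  have i : ∀ a b : ℝ, Integrable fun y => heat n t (a - y) * heat 0 s (y - b) := fun a b =>
    ((integrable_heat 0 hs).comp_sub_right b).bdd_mul (c := N) (Continuous.aestronglyMeasurable (by fun_prop))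
      (ae_of_all _ fun y => hN _)
  -- the integrand is even, so its half-line integral is half of the line integral
  have heven : ∫ y in Ioi (0 : ℝ), heatOdd n t x y * heatOdd 0 s y r =
      1 / 2 * ∫ y, heatOdd n t x y * heatOdd 0 s y r := by
    have h := integral_comp_abs (f := fun y => heatOdd n t x y * heatOdd 0 s y r)
    have e : ∀ y : ℝ, heatOdd n t x |y| * heatOdd 0 s |y| r = heatOdd n t x y * heatOdd 0 s y r := fun y => by
      rcases abs_choice y with h | h
      · rw [h]
      · rw [h, heatOdd_neg_right, heatOdd_zero_comm s (-y), heatOdd_neg_right, heatOdd_zero_comm s r y]; ring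
    simp only [e] at h
    rw [h]; ring
  have e2 : ∀ y : ℝ, heatOdd n t x y * heatOdd 0 s y r =
      (heat n t (x - y) * heat 0 s (y - r) - heat n t (x - y) * heat 0 s (y - -r)) -
      (heat n t (x - -y) * heat 0 s (-y - -r) - heat n t (x - -y) * heat 0 s (-y - r)) := fun y => by
    have h1 : heat 0 s (-y - -r) = heat 0 s (y - r) := by rw [← heat_zero_neg s (y - r)]; congr 1; ring
    have h2 : heat 0 s (-y - r) = heat 0 s (y - -r) := by rw [← heat_zero_neg s (y - -r)]; congr 1; ring
    rw [h1, h2, heatOdd, heatOdd, sub_neg_eq_add, sub_neg_eq_add]; ring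
  have j1 : Integrable fun y => heat n t (x - y) * heat 0 s (y - r) - heat n t (x - y) * heat 0 s (y - -r) :=
    (i x r).sub (i x (-r))
  have j2 : Integrable fun y => heat n t (x - -y) * heat 0 s (-y - -r) - heat n t (x - -y) * heat 0 s (-y - r) :=
    (i x (-r)).comp_neg.sub (i x r).comp_neg
  rw [heven]
  simp_rw [e2]
  rw [integral_sub j1 j2, integral_sub (i x r) (i x (-r)),
    integral_sub (i x (-r)).comp_neg (i x r).comp_neg,
    integral_neg_eq_self (fun y => heat n t (x - y) * heat 0 s (y - -r)),
    integral_neg_eq_self (fun y => heat n t (x - y) * heat 0 s (y - r)), hn ht hs, hn ht hs,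
    heatOdd, sub_neg_eq_add]
  ring

/-- The kernel of the solution operator at tangential frequency `k`, without the factor
`exp (-t k²)`. -/
noncomputable def freqKernel (k t x y : ℝ) : ℝ :=
  heatOdd 0 t x y + 2 * ∫ r in (0 : ℝ)..y, heat 1 t (x + r) * Real.exp (-(k * (y - r)))

/-- Integration by parts turns the point value of `heatOdd` into an integral over the segment. -/
theorem freqKernel_eq {t : ℝ} (k : ℝ) (ht : 0 < t) (x z : ℝ) :
    freqKernel k t x z = ∫ r in (0 : ℝ)..z,
      (k * heatOdd 0 t x r - heatOdd 1 t x r) * Real.exp (-(k * (z - r))) := by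
  have c0 : Continuous fun r => heatOdd 0 t x r := (continuous_heatOdd 0 ht).comp (Continuous.prodMk_right x)
  have c1 : Continuous fun r => heatOdd 1 t x r := (continuous_heatOdd 1 ht).comp (Continuous.prodMk_right x)
  have ch := continuous_heat 1 ht
  have hD : ∀ r : ℝ, HasDerivAt (fun r => heatOdd 0 t x r * Real.exp (-(k * (z - r))))
      ((k * heatOdd 0 t x r - heatOdd 1 t x r) * Real.exp (-(k * (z - r))) -
        2 * (heat 1 t (x + r) * Real.exp (-(k * (z - r))))) r := fun r => by
    have e : HasDerivAt (fun r => Real.exp (-(k * (z - r)))) (Real.exp (-(k * (z - r))) * k) r := by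
      have := (((hasDerivAt_id r).const_sub z).const_mul k).neg.exp
      simpa using this
    refine ((hasDerivAt_heatOdd_right 0 ht x r).mul e).congr_deriv ?_
    rw [heatEven_eq]; ring
  have i1 : IntervalIntegrable (fun r => (k * heatOdd 0 t x r - heatOdd 1 t x r) * Real.exp (-(k * (z - r))))
    volume 0 z := Continuous.intervalIntegrable (by fun_prop) _ _
  have i2 : IntervalIntegrable (fun r => 2 * (heat 1 t (x + r) * Real.exp (-(k * (z - r)))))
    volume 0 z := Continuous.intervalIntegrable (by fun_prop) _ _
  have h := intervalIntegral.integral_eq_sub_of_hasDerivAt (a := 0) (b := z) (fun r _ => hD r) (i1.sub i2)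
  rw [intervalIntegral.integral_sub i1 i2, intervalIntegral.integral_const_mul, heatOdd_zero_right] at h
  simp only [sub_self, mul_zero, neg_zero, Real.exp_zero, mul_one, zero_mul, sub_zero] at h
  rw [freqKernel]; linarith

/-- The first-order equation `(∂_y + k) freqKernel = (k - ∂_x) heatOdd`. -/
theorem hasDerivAt_freqKernel {t : ℝ} (k : ℝ) (ht : 0 < t) (x y : ℝ) :
    HasDerivAt (freqKernel k t x) (k * heatOdd 0 t x y - heatOdd 1 t x y - k * freqKernel k t x y) y := by
  have ch := continuous_heat 1 ht
  have e : ∀ y : ℝ, ∫ r in (0 : ℝ)..y, heat 1 t (x + r) * Real.exp (-(k * (y - r))) =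
      Real.exp (-(k * y)) * ∫ r in (0 : ℝ)..y, heat 1 t (x + r) * Real.exp (k * r) := fun y => by
    rw [← intervalIntegral.integral_const_mul]
    congr 1; ext r
    rw [show -(k * (y - r)) = -(k * y) + k * r by ring, Real.exp_add]; ring
  have hc : Continuous fun r => heat 1 t (x + r) * Real.exp (k * r) := by fun_prop
  have h1 := hc.integral_hasStrictDerivAt 0 y |>.hasDerivAt
  have h2 : HasDerivAt (fun y => Real.exp (-(k * y))) (Real.exp (-(k * y)) * -k) y := by
    have := ((hasDerivAt_id y).const_mul k).neg.exp
    simpa using this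
  have h3 := (hasDerivAt_heatOdd_right 0 ht x y).add ((h2.mul h1).const_mul 2)
  have e2 : freqKernel k t x = fun y => heatOdd 0 t x y + 2 * (Real.exp (-(k * y)) *
      ∫ r in (0 : ℝ)..y, heat 1 t (x + r) * Real.exp (k * r)) := by
    ext y; rw [freqKernel, e]
  rw [e2]
  refine h3.congr_deriv ?_
  have e3 : Real.exp (-(k * y)) * (heat 1 t (x + y) * Real.exp (k * y)) = heat 1 t (x + y) := by
    rw [mul_left_comm, ← Real.exp_add, neg_add_cancel, Real.exp_zero, mul_one]
  rw [e3, heatEven_eq]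
  ring

/-- The bound is uniform in the frequency, since the exponential factor is at most one. -/
theorem exists_freqKernel_bound {t : ℝ} (ht : 0 < t) : ∃ C : ℝ, 0 ≤ C ∧ ∀ k x y : ℝ, 0 ≤ k → 0 ≤ y →
    |freqKernel k t x y| ≤ C := by
  obtain ⟨M, hM0, hM⟩ := exists_heat_le 0 ht
  refine ⟨2 * M + 2 * ∫ r, |heat 1 t r|, by positivity, fun k x y hk hy => ?_⟩
  have h1 : |heatOdd 0 t x y| ≤ 2 * M := (abs_sub _ _).trans (by linarith [hM (x - y), hM (x + y)])
  have hi : Integrable fun r => |heat 1 t (x + r)| := ((integrable_heat 1 ht).comp_add_left x).norm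
  have h2 : |∫ r in (0 : ℝ)..y, heat 1 t (x + r) * Real.exp (-(k * (y - r)))| ≤ ∫ r, |heat 1 t r| := by
    rw [← integral_add_left_eq_self _ x, intervalIntegral.integral_of_le hy, ← Real.norm_eq_abs]
    refine (norm_integral_le_of_norm_le hi.integrableOn ?_).trans
      (setIntegral_le_integral hi (ae_of_all _ fun r => abs_nonneg _))
    filter_upwards [ae_restrict_mem measurableSet_Ioc] with r hr
    rw [norm_mul, Real.norm_eq_abs, Real.norm_eq_abs, Real.abs_exp]
    refine mul_le_of_le_one_right (abs_nonneg _) (Real.exp_le_one_iff.2 ?_)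
    have : 0 ≤ k * (y - r) := mul_nonneg hk (by linarith [hr.2])
    linarith
  unfold freqKernel
  refine (abs_add_le _ _).trans ?_
  rw [abs_mul, abs_two]
  linarith

theorem exists_heatOdd_left_bound (n : ℕ) {s : ℝ} (hs : 0 < s) (z : ℝ) : ∃ C : ℝ, 0 ≤ C ∧
    ∀ y r : ℝ, |r| ≤ z → |heatOdd n s y r| ≤ C * Real.exp (-y ^ 2 / (16 * s)) := by
  obtain ⟨C, hC0, hC⟩ := exists_heat_shift_bound n (t₁ := s) hs z
  refine ⟨2 * C, by positivity, fun y r hr => ?_⟩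
  have a := hC s r y le_rfl le_rfl hr
  have b := hC s (-r) y le_rfl le_rfl (by rwa [abs_neg])
  rw [neg_add_eq_sub] at b
  rw [add_comm] at a
  refine (abs_sub _ _).trans ?_
  linarith

/-- Write the second factor as `(k - ∂_y) V` with an integral `V` of odd heat kernels. Integration by
parts moves the operator to `(∂_y + k) freqKernel = (k - ∂_x) heatOdd`; the product of odd heat kernels
is then integrated by their Chapman-Kolmogorov identity. -/
theorem integral_freqKernel_mul_freqKernel {k t s : ℝ} (hk : 0 ≤ k) (ht : 0 < t) (hs : 0 < s) (x : ℝ) {z : ℝ}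
    (hz : 0 ≤ z) :
    ∫ y in Ioi (0 : ℝ), freqKernel k t x y * freqKernel k s y z = freqKernel k (t + s) x z := by
  -- `V 1` is the derivative of `V 0`, and `freqKernel k s y z = k * V 0 y - V 1 y`
  let V : ℕ → ℝ → ℝ := fun n y => ∫ r in (0 : ℝ)..z, heatOdd n s y r * Real.exp (-(k * (z - r)))
  have co := fun n => continuous_heatOdd n hs
  have co' := fun n => continuous_heatOdd n ht
  have cr : ∀ n y, Continuous fun r => heatOdd n s y r := fun n y => (co n).comp (Continuous.prodMk_right y)
  have ct : ∀ n, Continuous fun y => heatOdd n t x y := fun n => (co' n).comp (Continuous.prodMk_right x)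
  have hVc : ∀ n, Continuous (V n) := fun n => by
    apply intervalIntegral.continuous_parametric_intervalIntegral_of_continuous'
    have := co n
    simp only [Function.uncurry_def]
    fun_prop
  have hexp : ∀ r ∈ Ioc 0 z, Real.exp (-(k * (z - r))) ≤ 1 := fun r hr => by
    rw [Real.exp_le_one_iff]
    have : 0 ≤ k * (z - r) := mul_nonneg hk (by linarith [hr.2])
    linarith
  have hVb : ∀ n, ∃ C, 0 ≤ C ∧ ∀ y, |V n y| ≤ C * Real.exp (-y ^ 2 / (16 * s)) := fun n => by
    obtain ⟨C, hC0, hC⟩ := exists_heatOdd_left_bound n hs z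
    refine ⟨C * z, by positivity, fun y => ?_⟩
    have := intervalIntegral.norm_integral_le_of_norm_le_const (a := 0) (b := z)
      (f := fun r => heatOdd n s y r * Real.exp (-(k * (z - r))))
      (C := C * Real.exp (-y ^ 2 / (16 * s))) fun r hr => by
        rw [uIoc_of_le hz] at hr
        rw [norm_mul, Real.norm_eq_abs, Real.norm_eq_abs, Real.abs_exp]
        exact (mul_le_of_le_one_right (abs_nonneg _) (hexp r hr)).trans
          (hC y r (by rw [abs_of_pos hr.1]; exact hr.2))
    rw [sub_zero, abs_of_nonneg hz] at this
    refine this.trans (le_of_eq (by ring))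
  have hVd : ∀ y, HasDerivAt (V 0) (V 1 y) y := fun y => by
    obtain ⟨M, hM0, hM⟩ := exists_heat_le 1 hs
    refine (intervalIntegral.hasDerivAt_integral_of_dominated_loc_of_deriv_le (μ := volume) (𝕜 := ℝ)
      (F := fun y r => heatOdd 0 s y r * Real.exp (-(k * (z - r)))) (x₀ := y) (a := 0) (b := z)
      (F' := fun y r => heatOdd 1 s y r * Real.exp (-(k * (z - r)))) (bound := fun _ => 2 * M) (s := univ)
      Filter.univ_mem (Eventually.of_forall fun y => ?_) ?_ ?_ (ae_of_all _ fun r hr y _ => ?_) (by simp)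
      (ae_of_all _ fun r _ y _ => (hasDerivAt_heatOdd_left 0 hs y r).mul_const _)).2
    · have := cr 0 y
      exact Continuous.aestronglyMeasurable (by fun_prop)
    · have := cr 0 y
      exact Continuous.intervalIntegrable (by fun_prop) _ _
    · have := cr 1 y
      exact Continuous.aestronglyMeasurable (by fun_prop)
    · rw [uIoc_of_le hz] at hr
      rw [norm_mul, Real.norm_eq_abs, Real.norm_eq_abs, Real.abs_exp]
      refine (mul_le_of_le_one_right (abs_nonneg _) (hexp r hr)).trans ((abs_sub _ _).trans ?_)
      linarith [hM (y - r), hM (y + r)]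
  have hF : ∀ y, freqKernel k s y z = k * V 0 y - V 1 y := fun y => by
    have i0 : IntervalIntegrable (fun r => k * (heatOdd 0 s y r * Real.exp (-(k * (z - r))))) volume 0 z := by
      have := cr 0 y
      exact Continuous.intervalIntegrable (by fun_prop) _ _
    have i1 : IntervalIntegrable (fun r => heatOdd 1 s y r * Real.exp (-(k * (z - r)))) volume 0 z := by
      have := cr 1 y
      exact Continuous.intervalIntegrable (by fun_prop) _ _
    rw [freqKernel_eq k hs, ← intervalIntegral.integral_const_mul, ← intervalIntegral.integral_sub i0 i1]
    congr 1; ext r; ring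
  obtain ⟨B, hB0, hB⟩ := exists_freqKernel_bound ht
  have hθc : Continuous (freqKernel k t x) :=
    continuous_iff_continuousAt.2 fun y => (hasDerivAt_freqKernel k ht x y).continuousAt
  have hG : Integrable fun y : ℝ => Real.exp (-y ^ 2 / (16 * s)) := integrable_exp_neg_sq_div (by positivity)
  have hVi : ∀ n, Integrable (V n) := fun n => by
    obtain ⟨C, hC0, hC⟩ := hVb n
    exact (hG.const_mul C).mono' (hVc n).aestronglyMeasurable (ae_of_all _ hC)
  have hθV : ∀ n, IntegrableOn (fun y => freqKernel k t x y * V n y) (Ioi 0) := fun n => by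
    refine (hVi n).integrableOn.bdd_mul (c := B) hθc.aestronglyMeasurable ?_
    filter_upwards [ae_restrict_mem measurableSet_Ioi] with y hy
    exact hB k x y hk (le_of_lt hy)
  obtain ⟨N, hN⟩ : ∃ N, ∀ y, |k * heatOdd 0 t x y - heatOdd 1 t x y| ≤ N := by
    obtain ⟨M0, _, h0⟩ := exists_heat_le 0 ht
    obtain ⟨M1, _, h1⟩ := exists_heat_le 1 ht
    refine ⟨k * (M0 + M0) + (M1 + M1), fun y => (abs_sub _ _).trans (add_le_add ?_ ?_)⟩
    · rw [abs_mul, abs_of_nonneg hk]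
      exact mul_le_mul_of_nonneg_left ((abs_sub _ _).trans (add_le_add (h0 _) (h0 _))) hk
    · exact (abs_sub _ _).trans (add_le_add (h1 _) (h1 _))
  have ct0 := ct 0
  have ct1 := ct 1
  have cth : Continuous fun y => k * heatOdd 0 t x y - heatOdd 1 t x y := by fun_prop
  have hgV : Integrable (fun y => (k * heatOdd 0 t x y - heatOdd 1 t x y) * V 0 y) :=
    (hVi 0).bdd_mul (c := N) cth.aestronglyMeasurable (ae_of_all _ hN)
  -- integration by parts against the first-order equation of the kernel
  have hparts : ∫ y in Ioi (0 : ℝ), ((k * heatOdd 0 t x y - heatOdd 1 t x y) * V 0 y -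
      freqKernel k t x y * freqKernel k s y z) = 0 := by
    have hd : ∀ y ∈ Ioi (0 : ℝ), HasDerivAt (fun y => freqKernel k t x y * V 0 y)
        ((k * heatOdd 0 t x y - heatOdd 1 t x y) * V 0 y - freqKernel k t x y * freqKernel k s y z) y :=
      fun y _ => ((hasDerivAt_freqKernel k ht x y).mul (hVd y)).congr_deriv (by rw [hF]; ring)
    have hlim : Tendsto (fun y => freqKernel k t x y * V 0 y) atTop (𝓝 0) := by
      obtain ⟨C, hC0, hC⟩ := hVb 0
      rw [tendsto_zero_iff_norm_tendsto_zero]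
      refine squeeze_zero' (Eventually.of_forall fun y => norm_nonneg _) ?_
        (by simpa using ((tendsto_exp_neg_sq_div (by positivity : 0 < 16 * s)).const_mul C).const_mul B)
      filter_upwards [eventually_gt_atTop 0] with y hy
      rw [norm_mul]
      exact mul_le_mul (hB k x y hk hy.le) (hC y) (norm_nonneg _) hB0
    rw [integral_Ioi_of_hasDerivAt_of_tendsto (hθc.mul (hVc 0)).continuousWithinAt hd ?_ hlim]
    · simp [freqKernel, heatOdd_zero_right]
    · refine hgV.integrableOn.sub ?_
      refine (((hθV 0).const_mul k).sub (hθV 1)).congr (ae_of_all _ fun y => ?_)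
      simp only [Pi.sub_apply, hF]; ring
  have hθF : IntegrableOn (fun y => freqKernel k t x y * freqKernel k s y z) (Ioi 0) := by
    refine (((hθV 0).const_mul k).sub (hθV 1)).congr (ae_of_all _ fun y => ?_)
    simp only [Pi.sub_apply, hF]; ring
  rw [integral_sub hgV.integrableOn hθF, sub_eq_zero] at hparts
  rw [← hparts, freqKernel_eq k (add_pos ht hs)]
  -- exchange of the integrals
  have hprod : Integrable (Function.uncurry fun y r => (k * heatOdd 0 t x y - heatOdd 1 t x y) *
      (heatOdd 0 s y r * Real.exp (-(k * (z - r)))))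
      ((volume.restrict (Ioi (0 : ℝ))).prod (volume.restrict (Ioc 0 z))) := by
    obtain ⟨C, hC0, hC⟩ := exists_heatOdd_left_bound 0 hs z
    have h1 := ((hG.const_mul (N * C)).restrict (s := Ioi 0)).mul_prod (ν := volume.restrict (Ioc 0 z))
      (g := fun _ => (1 : ℝ)) (integrable_const _)
    refine h1.mono' ?_ ?_
    · have := co 0
      refine Continuous.aestronglyMeasurable ?_
      simp only [Function.uncurry_def]
      fun_prop
    · have m2 : ∀ᵐ p : ℝ × ℝ ∂((volume.restrict (Ioi (0 : ℝ))).prod (volume.restrict (Ioc 0 z))),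
        p.2 ∈ Ioc 0 z := Measure.quasiMeasurePreserving_snd.ae (ae_restrict_mem measurableSet_Ioc)
      filter_upwards [m2] with p hp
      simp only [Function.uncurry, mul_one]
      rw [norm_mul, norm_mul, Real.norm_eq_abs (Real.exp _), Real.abs_exp, mul_assoc]
      refine mul_le_mul (hN _) ((mul_le_of_le_one_right (norm_nonneg _) (hexp _ hp)).trans
        (hC _ _ (by rw [abs_of_pos hp.1]; exact hp.2))) (by positivity) ((abs_nonneg _).trans (hN 0))
  have e1 : ∀ y, (k * heatOdd 0 t x y - heatOdd 1 t x y) * V 0 y = ∫ r in Ioc 0 z,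
      (k * heatOdd 0 t x y - heatOdd 1 t x y) * (heatOdd 0 s y r * Real.exp (-(k * (z - r)))) := fun y => by
    rw [integral_const_mul, ← intervalIntegral.integral_of_le hz]
  simp_rw [e1]
  rw [integral_integral_swap hprod, intervalIntegral.integral_of_le hz]
  congr 1; ext r
  have i : ∀ n, IntegrableOn (fun y => heatOdd n t x y * heatOdd 0 s y r) (Ioi 0) := fun n => by
    obtain ⟨M, _, hM⟩ := exists_heat_le n ht
    obtain ⟨C, hC0, hC⟩ := exists_heatOdd_left_bound 0 hs |r|
    have hi : Integrable fun y => heatOdd 0 s y r := (hG.const_mul C).mono'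
      ((co 0).comp (Continuous.prodMk_left r)).aestronglyMeasurable (ae_of_all _ fun y => hC y r le_rfl)
    exact (hi.bdd_mul (c := M + M) (ct n).aestronglyMeasurable
      (ae_of_all _ fun y => (abs_sub _ _).trans (add_le_add (hM _) (hM _)))).integrableOn
  have e2 : ∀ y, (k * heatOdd 0 t x y - heatOdd 1 t x y) * (heatOdd 0 s y r * Real.exp (-(k * (z - r)))) =
      (k * (heatOdd 0 t x y * heatOdd 0 s y r) - heatOdd 1 t x y * heatOdd 0 s y r) *
        Real.exp (-(k * (z - r))) := fun y => by ring
  simp_rw [e2]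
  rw [integral_mul_const, integral_sub ((i 0).const_mul k) (i 1), integral_const_mul,
    integral_heatOdd_mul_heatOdd integral_heat_conv ht hs,
    integral_heatOdd_mul_heatOdd integral_heat_one_conv ht hs]

/-! ### The semigroup property -/

theorem integrableOn_exp_neg_mul_sq {t : ℝ} (ht : 0 < t) :
    IntegrableOn (fun k : ℝ => Real.exp (-(t * k ^ 2))) (Ioi 0) := by
  have := (integrable_exp_neg_mul_sq ht).integrableOn (s := Ioi (0 : ℝ))
  simpa using this

/-- The kernel of the solution operator is the inverse Fourier transform of `freqKernel` in the
tangential variable. -/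
theorem vortKernel_eq_integral_freqKernel {t : ℝ} (ht : 0 < t) (x z : ℝ × ℝ) (hz : 0 ≤ z.2) :
    vortKernel 0 0 t x z = 1 / Real.pi * (∫ k in Ioi (0 : ℝ),
      Complex.exp (-(t * k ^ 2) + Complex.I * k * (x.1 - z.1 : ℝ)) * freqKernel k t x.2 z.2).re := by
  rw [vortKernel_eq 0 0 ht, layer_sub_layer 0 0 ht, pow_zero, one_mul]
  congr 2
  set X : ℝ := x.1 - z.1
  have ch := continuous_heat 1 ht
  obtain ⟨N, hN0, hN⟩ := exists_heat_le 1 ht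
  have e1 : ∀ r : ℝ, (heat (0 + 1) t (x.2 + r) : ℂ) * lap 0 t ((z.2 - r : ℝ) - Complex.I * X) =
      ∫ k in Ioi (0 : ℝ), (heat 1 t (x.2 + r) : ℂ) *
        Complex.exp (-(t * k ^ 2) - k * ((z.2 - r : ℝ) - Complex.I * X)) := fun r => by
    rw [integral_const_mul, lap]; simp
  have hi : Integrable (fun p : ℝ × ℝ => (heat 1 t (x.2 + p.1) : ℂ) *
      Complex.exp (-(t * p.2 ^ 2) - p.2 * ((z.2 - p.1 : ℝ) - Complex.I * X)))
      ((volume.restrict (Ioc 0 z.2)).prod (volume.restrict (Ioi 0))) := by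
    refine ((integrable_const N).mul_prod (integrableOn_exp_neg_mul_sq ht)).mono'
      (Continuous.aestronglyMeasurable (by fun_prop)) ?_
    rw [Measure.prod_restrict]
    filter_upwards [ae_restrict_mem (measurableSet_Ioc.prod measurableSet_Ioi)] with p hp
    rw [norm_mul, Complex.norm_real, Complex.norm_exp]
    refine mul_le_mul (hN _) (Real.exp_le_exp.2 ?_) (Real.exp_pos _).le hN0
    have h1 : 0 ≤ p.2 * (z.2 - p.1) := mul_nonneg (le_of_lt hp.2) (by linarith [hp.1.2])
    have e : ((-(t * p.2 ^ 2) - p.2 * ((z.2 - p.1 : ℝ) - Complex.I * X) : ℂ)) =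
        ((-(t * p.2 ^ 2) - p.2 * (z.2 - p.1) : ℝ) : ℂ) + ((p.2 * X : ℝ) : ℂ) * Complex.I := by
      push_cast; ring
    rw [e, Complex.add_re, Complex.ofReal_re, Complex.re_ofReal_mul, Complex.I_re]
    linarith
  have hsw := integral_integral_swap (f := fun r k : ℝ => (heat 1 t (x.2 + r) : ℂ) *
      Complex.exp (-(t * k ^ 2) - k * ((z.2 - r : ℝ) - Complex.I * X))) hi
  have e2 : ∀ k : ℝ, ∫ r in Ioc 0 z.2, (heat 1 t (x.2 + r) : ℂ) *
      Complex.exp (-(t * k ^ 2) - k * ((z.2 - r : ℝ) - Complex.I * X)) =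
      Complex.exp (-(t * k ^ 2) + Complex.I * k * X) *
        (∫ r in (0 : ℝ)..z.2, heat 1 t (x.2 + r) * Real.exp (-(k * (z.2 - r))) : ℝ) := fun k => by
    rw [intervalIntegral.integral_of_le hz, ← integral_complex_ofReal, ← integral_const_mul]
    congr 1; ext r
    push_cast
    rw [show (-(t * k ^ 2) - k * (z.2 - r - Complex.I * X) : ℂ) =
      (-(t * k ^ 2) + Complex.I * k * X) + -(k * (z.2 - r)) by ring, Complex.exp_add _ (-(_ : ℂ))]
    ring
  have e3 : lap 0 t (-(Complex.I * X)) =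
      ∫ k in Ioi (0 : ℝ), Complex.exp (-(t * k ^ 2) + Complex.I * k * X) := by
    rw [lap]; congr 1; ext k
    rw [pow_zero, one_mul]; congr 1; ring
  have hl : IntegrableOn (fun k : ℝ => Complex.exp (-(t * k ^ 2) + Complex.I * k * X)) (Ioi 0) := by
    refine (integrableOn_lap 0 ht (-(Complex.I * X))).congr (ae_of_all _ fun k => ?_)
    show (k : ℂ) ^ 0 * Complex.exp _ = Complex.exp _
    rw [pow_zero, one_mul]; congr 1; ring
  have hi2 := hi.integral_prod_right
  simp only [e2] at hsw hi2
  rw [intervalIntegral.integral_of_le hz]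
  simp_rw [e1]
  rw [hsw, e3, ← integral_const_mul, ← integral_const_mul, ← integral_add (hl.const_mul _) (hi2.const_mul 2)]
  congr 1; ext k
  rw [freqKernel]; push_cast; ring

theorem integrable_heatPoisson_prod {t : ℝ} (ht : 0 < t) (b m : ℝ) :
    Integrable (fun p : ℝ × ℝ => heatPoisson 0 t (b - p.1) (p.2 - m))
      ((volume.restrict (Ioc 0 b)).prod volume) := by
  have cp : Continuous fun p : ℝ × ℝ => heatPoisson 0 t (b - p.1) (p.2 - m) :=
    (continuous_heatPoisson 0 ht).comp (g := fun p : ℝ × ℝ => heatPoisson 0 t p.1 p.2)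
      (f := fun p : ℝ × ℝ => (b - p.1, p.2 - m)) (by fun_prop)
  rw [integrable_prod_iff cp.aestronglyMeasurable]
  refine ⟨?_, ?_⟩
  · filter_upwards [ae_restrict_mem measurableSet_Ioc] with r hr
    exact (integrable_heatPoisson 0 ht (by linarith [hr.2])).comp_sub_right m
  · refine (integrable_const (∫ X, |heat 0 t X|)).mono'
      cp.aestronglyMeasurable.norm.integral_prod_right' ?_
    filter_upwards [ae_restrict_mem measurableSet_Ioc] with r hr
    rw [Real.norm_of_nonneg (integral_nonneg fun _ => norm_nonneg _),
      integral_sub_right_eq_self (fun v => ‖heatPoisson 0 t (b - r) v‖)]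
    exact integral_abs_heatPoisson_le 0 ht (by linarith [hr.2])

/-- The tangential Fourier transform of the kernel of the solution operator. -/
theorem integral_cexp_mul_vortKernel {s k : ℝ} (hs : 0 < s) (hk : 0 ≤ k) (a w : ℝ) (y : ℝ × ℝ) (hy : 0 ≤ y.2) :
    ∫ v : ℝ, Complex.exp (Complex.I * k * (a - v : ℝ)) * vortKernel 0 0 s (v, w) y =
      Complex.exp (-(s * k ^ 2) + Complex.I * k * (a - y.1 : ℝ)) * freqKernel k s w y.2 := by
  have ch := continuous_heat 1 hs
  have c0 := continuous_heat 0 hs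
  obtain ⟨N, hN0, hN⟩ := exists_heat_le 1 hs
  have nexp : ∀ v : ℝ, ‖Complex.exp (-(Complex.I * k * v))‖ = 1 := fun v => by
    rw [show -(Complex.I * k * v) = ((-(k * v) : ℝ) : ℂ) * Complex.I by push_cast; ring]
    exact Complex.norm_exp_ofReal_mul_I _
  have hpp := integrable_heatPoisson_prod hs y.2 0
  simp only [sub_zero] at hpp
  have hi : Integrable (fun p : ℝ × ℝ => (heat 1 s (w + p.1) : ℂ) *
      ((heatPoisson 0 s (y.2 - p.1) p.2 : ℂ) * Complex.exp (-(Complex.I * k * p.2))))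
      ((volume.restrict (Ioc 0 y.2)).prod volume) := by
    refine Integrable.bdd_mul (c := N) ?_ (Continuous.aestronglyMeasurable (by fun_prop))
      (ae_of_all _ fun p => by rw [Complex.norm_real]; exact hN _)
    exact hpp.ofReal.mul_bdd (c := 1) (Continuous.aestronglyMeasurable (by fun_prop))
      (ae_of_all _ fun p => (nexp _).le)
  have hsw := integral_integral_swap (f := fun r v : ℝ => (heat 1 s (w + r) : ℂ) *
      ((heatPoisson 0 s (y.2 - r) v : ℂ) * Complex.exp (-(Complex.I * k * v)))) hi
  have hi2 := hi.integral_prod_right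
  have i0 : Integrable fun v : ℝ => (heat 0 s v : ℂ) * Complex.exp (-(Complex.I * k * v)) :=
    (integrable_heat 0 hs).ofReal.mul_bdd (c := 1) (Continuous.aestronglyMeasurable (by fun_prop))
      (ae_of_all _ fun p => (nexp _).le)
  have e0 : ∫ v : ℝ, Complex.exp (Complex.I * k * (a - v : ℝ)) * vortKernel 0 0 s (v, w) y =
      ∫ v : ℝ, Complex.exp (Complex.I * k * (a - (v + y.1) : ℝ)) * vortKernel 0 0 s (v + y.1, w) y :=
    (integral_add_right_eq_self (fun v : ℝ => Complex.exp (Complex.I * k * (a - v : ℝ)) *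
      vortKernel 0 0 s (v, w) y) y.1).symm
  have e1 : ∀ v : ℝ, Complex.exp (Complex.I * k * (a - (v + y.1) : ℝ)) * vortKernel 0 0 s (v + y.1, w) y =
      Complex.exp (Complex.I * k * (a - y.1 : ℝ)) * (heatOdd 0 s w y.2 * ((heat 0 s v : ℂ) *
        Complex.exp (-(Complex.I * k * v))) + 2 * ∫ r in Ioc 0 y.2, (heat 1 s (w + r) : ℂ) *
      ((heatPoisson 0 s (y.2 - r) v : ℂ) * Complex.exp (-(Complex.I * k * v)))) := fun v => by
    have : ∫ r in Ioc 0 y.2, (heat 1 s (w + r) : ℂ) * ((heatPoisson 0 s (y.2 - r) v : ℂ) *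
        Complex.exp (-(Complex.I * k * v))) = (∫ r in (0 : ℝ)..y.2, heat 1 s (w + r) *
        heatPoisson 0 s (y.2 - r) v : ℝ) * Complex.exp (-(Complex.I * k * v)) := by
      rw [intervalIntegral.integral_of_le hy, ← integral_complex_ofReal, ← integral_mul_const]
      congr 1; ext r; push_cast; ring
    rw [this, vortKernel, show (Complex.I * k * (a - (v + y.1) : ℝ) : ℂ) =
      Complex.I * k * (a - y.1 : ℝ) + -(Complex.I * k * v) by push_cast; ring, Complex.exp_add]
    simp only [add_sub_cancel_right]
    push_cast
    ring
  rw [e0]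
  simp_rw [e1]
  rw [integral_const_mul, integral_add (i0.const_mul _) (hi2.const_mul 2), integral_const_mul,
    integral_const_mul, ← hsw, integral_heat_mul_cexp hs]
  have e2 : ∫ r in Ioc 0 y.2, ∫ v : ℝ, (heat 1 s (w + r) : ℂ) *
      ((heatPoisson 0 s (y.2 - r) v : ℂ) * Complex.exp (-(Complex.I * k * v))) =
      Complex.exp (-(s * k ^ 2)) * (∫ r in (0 : ℝ)..y.2, heat 1 s (w + r) * Real.exp (-(k * (y.2 - r))) : ℝ) := by
    rw [intervalIntegral.integral_of_le hy, ← integral_complex_ofReal, ← integral_const_mul]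
    refine setIntegral_congr_fun measurableSet_Ioc fun r hr => ?_
    rw [integral_const_mul, integral_heatPoisson_mul_cexp hs (by linarith [hr.2]) hk, sub_eq_add_neg,
      Complex.exp_add]
    push_cast; ring
  rw [e2, freqKernel, Complex.exp_add]
  push_cast
  ring

theorem continuous_freqKernel {t : ℝ} (ht : 0 < t) :
    Continuous fun p : ℝ × ℝ × ℝ => freqKernel p.1 t p.2.1 p.2.2 := by
  have h2 := continuous_heat 1 ht
  have h3 : Continuous fun p : ℝ × ℝ × ℝ => heatOdd 0 t p.2.1 p.2.2 :=
    (continuous_heatOdd 0 ht).comp (by fun_prop : Continuous fun p : ℝ × ℝ × ℝ => (p.2.1, p.2.2))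
  have h4 : Continuous fun p : ℝ × ℝ × ℝ => ∫ r in (0 : ℝ)..p.2.2,
      heat 1 t (p.2.1 + r) * Real.exp (-(p.1 * (p.2.2 - r))) :=
    intervalIntegral.continuous_parametric_intervalIntegral_of_continuous
      (f := fun (p : ℝ × ℝ × ℝ) (r : ℝ) => heat 1 t (p.2.1 + r) * Real.exp (-(p.1 * (p.2.2 - r))))
      (by fun_prop) (by fun_prop)
  unfold freqKernel
  fun_prop

theorem integrable_vortKernel_left {t : ℝ} (ht : 0 < t) (y : ℝ × ℝ) (hy : 0 ≤ y.2) :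
    IntegrableOn (fun x => vortKernel 0 0 t x y) openHalf := by
  obtain ⟨C, _, hC⟩ := exists_lintegral_vortKernel_le 0 0
  exact ⟨((continuous_vortKernel 0 0 ht).comp (Continuous.prodMk_left y)).aestronglyMeasurable,
    (hC t ht y hy).trans_lt ENNReal.ofReal_lt_top⟩

/-- The Chapman-Kolmogorov identity for the solution operator, proved at each tangential frequency. -/
theorem integral_vortKernel_mul_vortKernel {t s : ℝ} (ht : 0 < t) (hs : 0 < s) (x y : ℝ × ℝ) (hy : 0 ≤ y.2) :
    ∫ z in openHalf, vortKernel 0 0 t x z * vortKernel 0 0 s z y = vortKernel 0 0 (t + s) x y := by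
  obtain ⟨C, hC0, hC⟩ := exists_freqKernel_bound ht
  have cf := continuous_freqKernel ht
  have cv : Continuous fun z => vortKernel 0 0 s z y := (continuous_vortKernel 0 0 hs).comp (Continuous.prodMk_left y)
  let G : ℝ × ℝ → ℝ → ℂ := fun z k => Complex.exp (-(t * k ^ 2) + Complex.I * k * (x.1 - z.1 : ℝ)) *
    freqKernel k t x.2 z.2 * vortKernel 0 0 s z y
  have cG : Continuous (Function.uncurry G) := by
    have h1 : Continuous fun p : (ℝ × ℝ) × ℝ => freqKernel p.2 t x.2 p.1.2 :=
      cf.comp (by fun_prop : Continuous fun p : (ℝ × ℝ) × ℝ => (p.2, x.2, p.1.2))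
    have h2 : Continuous fun p : (ℝ × ℝ) × ℝ => vortKernel 0 0 s p.1 y := cv.comp continuous_fst
    simp only [Function.uncurry_def, G]
    fun_prop
  have hG : Integrable (Function.uncurry G) ((volume.restrict openHalf).prod (volume.restrict (Ioi 0))) := by
    refine (((integrable_vortKernel_left hs y hy).norm.mul_prod
      ((integrableOn_exp_neg_mul_sq ht).const_mul C))).mono' cG.aestronglyMeasurable ?_
    rw [Measure.prod_restrict]
    filter_upwards [ae_restrict_mem (measurableSet_openHalf.prod measurableSet_Ioi)] with p hp
    simp only [Function.uncurry_def, G]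
    rw [norm_mul, norm_mul, Complex.norm_real, Complex.norm_real, Complex.norm_exp,
      show (-(t * p.2 ^ 2) + Complex.I * p.2 * (x.1 - p.1.1 : ℝ) : ℂ) =
        ((-(t * p.2 ^ 2) : ℝ) : ℂ) + ((p.2 * (x.1 - p.1.1) : ℝ) : ℂ) * Complex.I by push_cast; ring,
      Complex.add_re, Complex.ofReal_re, Complex.re_ofReal_mul, Complex.I_re, mul_zero, add_zero,
      mul_comm, mul_comm C]
    gcongr
    exact hC _ _ _ (le_of_lt hp.2) (le_of_lt hp.1)
  have e1 : ∀ z ∈ openHalf, vortKernel 0 0 t x z * vortKernel 0 0 s z y =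
      1 / Real.pi * (∫ k in Ioi (0 : ℝ), G z k).re := fun z hz => by
    rw [vortKernel_eq_integral_freqKernel ht x z (le_of_lt hz)]
    simp only [G]
    rw [integral_mul_const, mul_comm (∫ k in Ioi (0 : ℝ), _ : ℂ), Complex.re_ofReal_mul]
    ring
  have e2 : ∀ k ∈ Ioi (0 : ℝ), Integrable (fun z => G z k) (volume.restrict openHalf) →
      ∫ z in openHalf, G z k =
      Complex.exp (-((t + s : ℝ) * k ^ 2) + Complex.I * k * (x.1 - y.1 : ℝ)) * freqKernel k (t + s) x.2 y.2 :=
      fun k hk hint => by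
    rw [restrict_openHalf] at hint ⊢
    rw [integral_prod_symm _ hint]
    have e3 : ∀ w : ℝ, ∫ v : ℝ, G (v, w) k = Complex.exp (-((t + s : ℝ) * k ^ 2) + Complex.I * k * (x.1 - y.1 : ℝ)) *
        (freqKernel k t x.2 w * freqKernel k s w y.2 : ℝ) := fun w => by
      have h := integral_cexp_mul_vortKernel hs (le_of_lt hk) x.1 w y hy
      have e4 : ∀ v : ℝ, G (v, w) k = Complex.exp (-(t * k ^ 2)) * freqKernel k t x.2 w *
          (Complex.exp (Complex.I * k * (x.1 - v : ℝ)) * vortKernel 0 0 s (v, w) y) := fun v => by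
        simp only [G]; rw [Complex.exp_add]; ring
      simp_rw [e4]
      rw [integral_const_mul, h, show (-((t + s : ℝ) * k ^ 2) + Complex.I * k * (x.1 - y.1 : ℝ) : ℂ) =
        -(t * k ^ 2) + (-(s * k ^ 2) + Complex.I * k * (x.1 - y.1 : ℝ)) by push_cast; ring, Complex.exp_add (-(t * k ^ 2) : ℂ)]
      push_cast; ring
    simp_rw [e3]
    rw [integral_const_mul, integral_complex_ofReal, integral_freqKernel_mul_freqKernel (le_of_lt hk) ht hs x.2 hy]
  rw [setIntegral_congr_fun measurableSet_openHalf e1, integral_const_mul,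
    vortKernel_eq_integral_freqKernel (add_pos ht hs) x y hy]
  congr 1
  have h5 : ∫ z in openHalf, (∫ k in Ioi (0 : ℝ), G z k).re = (∫ z in openHalf, ∫ k in Ioi (0 : ℝ), G z k).re :=
    integral_re hG.integral_prod_left
  rw [h5, integral_integral_swap hG]
  congr 1
  refine integral_congr_ae ?_
  filter_upwards [ae_restrict_mem measurableSet_Ioi, hG.prod_left_ae] with k hk hint
  exact e2 k hk hint

theorem integrable_vortKernel_prod (μ : Measure ClosedHalf) [IsFiniteMeasure μ] {t : ℝ} (ht : 0 < t) :
    Integrable (fun p : (ℝ × ℝ) × ClosedHalf => vortKernel 0 0 t p.1 p.2.1)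
      ((volume.restrict openHalf).prod μ) := by
  obtain ⟨C, _, hC⟩ := exists_lintegral_vortKernel_le 0 0
  have hm := (continuous_vortKernel_half 0 0 ht).aestronglyMeasurable
    (μ := (volume.restrict openHalf).prod μ)
  have h1 : ∫⁻ p, ‖vortKernel 0 0 t p.1 p.2.1‖ₑ ∂((volume.restrict openHalf).prod μ) < ∞ := by
    rw [lintegral_prod_symm _ hm.enorm]
    calc _ ≤ ∫⁻ _ : ClosedHalf, ENNReal.ofReal (C * (√t)⁻¹ ^ (0 + 0)) ∂μ := lintegral_mono fun y => hC t ht y.1 y.2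
      _ = ENNReal.ofReal (C * (√t)⁻¹ ^ (0 + 0)) * μ univ := lintegral_const _
      _ < ∞ := ENNReal.mul_lt_top ENNReal.ofReal_lt_top (measure_lt_top _ _)
  exact ⟨hm, h1⟩

theorem integral_mul_vorticity (ω : M) {t : ℝ} (ht : 0 < t) {f : ℝ × ℝ → ℝ}
    (hf : AEStronglyMeasurable f (volume.restrict openHalf)) {C : ℝ} (hC : ∀ x ∈ openHalf, |f x| ≤ C) :
    ∫ x in openHalf, f x * vorticity t ω x =
      sint ω fun y => ∫ x in openHalf, f x * vortKernel 0 0 t x y.1 := by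
  have hi : ∀ (μ : Measure ClosedHalf) [IsFiniteMeasure μ], Integrable
      (fun p : (ℝ × ℝ) × ClosedHalf => f p.1 * vortKernel 0 0 t p.1 p.2.1) ((volume.restrict openHalf).prod μ) := by
    intro μ _
    refine (integrable_vortKernel_prod μ ht).bdd_mul (c := C) hf.comp_fst ?_
    exact Measure.quasiMeasurePreserving_fst.ae (p := fun x => ‖f x‖ ≤ C)
      (by filter_upwards [ae_restrict_mem measurableSet_openHalf] with x hx using hC x hx)
  have hsw := fun (μ : Measure ClosedHalf) [IsFiniteMeasure μ] =>
    integral_integral_swap (f := fun x (y : ClosedHalf) => f x * vortKernel 0 0 t x y.1) (hi μ)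
  rw [sint_eq, ← hsw, ← hsw,
    ← integral_sub (hi _).integral_prod_left (hi _).integral_prod_left]
  refine setIntegral_congr_fun measurableSet_openHalf fun x hx => ?_
  simp only
  rw [vorticity_eq_sint ω ht hx, sint_eq, integral_const_mul, integral_const_mul, mul_sub]

theorem T_add (ω : M) {t s : ℝ} (ht : 0 ≤ t) (hs : 0 ≤ s) : T (t + s) ω = T t (T s ω) := by
  rcases ht.eq_or_lt with rfl | ht
  · rw [zero_add, T_zero]
  rcases hs.eq_or_lt with rfl | hs
  · rw [add_zero, T_zero]
  refine T_congr (add_pos ht hs) ht fun x hx => ?_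
  obtain ⟨C, _, hC⟩ := exists_vortKernel_bdd ht
  rw [T_of_pos ω hs, sint_withDensity (integrable_vorticity ω hs) (measurable_vortKernel_right ht x)
    (fun y => hC x y.1 (le_of_lt hx) y.2), integral_area (fun y => vortKernel 0 0 t x y * vorticity s ω y),
    integral_mul_vorticity ω hs (f := fun y => vortKernel 0 0 t x y) (C := C)
      ((continuous_vortKernel 0 0 ht).comp (Continuous.prodMk_right x)).aestronglyMeasurable
      (fun y hy => hC x y (le_of_lt hx) (le_of_lt hy))]
  congr 1
  ext y
  exact (integral_vortKernel_mul_vortKernel ht hs x y.1 y.2).symm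

/-! ### Initial behaviour of the kernel -/

theorem heat_sqrt_mul (n : ℕ) {t : ℝ} (ht : 0 < t) (v : ℝ) :
    heat n t (√t * v) = (√t)⁻¹ ^ (n + 1) * heat n 1 v := by
  have := Real.sqrt_pos.2 ht
  unfold heat
  rw [Real.sqrt_one, inv_one, one_pow, one_mul, mul_one, mul_comm (√t), mul_assoc, mul_inv_cancel₀ this.ne', mul_one]

theorem integral_mul_heat_eq {t : ℝ} (ht : 0 < t) (f : ℝ → ℝ) (m : ℝ) :
    ∫ x, f x * heat 0 t (x - m) = ∫ u, f (m + √t * u) * heat 0 1 u := by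
  have hs := Real.sqrt_pos.2 ht
  have h1 := integral_add_right_eq_self (μ := volume) (fun x => f x * heat 0 t (x - m)) m
  have h2 := Measure.integral_comp_mul_left (fun x => f (x + m) * heat 0 t (x + m - m)) (√t)
  rw [h1, abs_of_pos (inv_pos.2 hs), smul_eq_mul] at h2
  rw [← mul_right_inj' (inv_ne_zero hs.ne'), ← h2, ← integral_const_mul]
  congr 1; ext u
  rw [add_sub_cancel_right, heat_sqrt_mul 0 ht, add_comm m]; ring

theorem poisson_mul {b : ℝ} (hb : 0 < b) (p : ℝ) : poisson b (b * p) = b⁻¹ * poisson 1 p := by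
  unfold poisson
  have := Real.pi_pos
  field_simp

theorem integral_mul_poisson_eq {b : ℝ} (hb : 0 < b) (f : ℝ → ℝ) :
    ∫ v, f v * poisson b v = ∫ p, f (b * p) * poisson 1 p := by
  have h2 := Measure.integral_comp_mul_left (fun x => f x * poisson b x) b
  rw [abs_of_pos (inv_pos.2 hb), smul_eq_mul] at h2
  rw [← mul_right_inj' (inv_ne_zero hb.ne'), ← h2, ← integral_const_mul]
  congr 1; ext u
  rw [poisson_mul hb]; ring

/-- Integrals against `heatPoisson`, with the kernels rescaled to time and height one. -/
theorem integral_mul_heatPoisson {t b C : ℝ} (ht : 0 < t) (hb : 0 < b) {f : ℝ → ℝ} (hf : Continuous f)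
    (hC : ∀ x, |f x| ≤ C) (m : ℝ) : ∫ x, f x * heatPoisson 0 t b (x - m) =
      ∫ p : ℝ × ℝ, f (m + b * p.1 + √t * p.2) * (poisson 1 p.1 * heat 0 1 p.2) := by
  have hi0 := integrable_poisson_mul_heat 0 ht hb
  have hi : Integrable (fun p : ℝ × ℝ => f (p.1 + m) * (poisson b p.2 * heat 0 t (p.1 - p.2)))
      (volume.prod volume) :=
    hi0.bdd_mul (c := C) (Continuous.aestronglyMeasurable (by fun_prop)) (ae_of_all _ fun p => hC _)
  have h1 := integral_add_right_eq_self (μ := volume) (fun x => f x * heatPoisson 0 t b (x - m)) m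
  rw [← h1]
  have e1 : ∀ x : ℝ, f (x + m) * heatPoisson 0 t b (x + m - m) =
      ∫ v, f (x + m) * (poisson b v * heat 0 t (x - v)) := fun x => by
    rw [add_sub_cancel_right, heatPoisson_eq_conv 0 ht hb, integral_const_mul]
  simp_rw [e1]
  rw [integral_integral_swap (f := fun x v => f (x + m) * (poisson b v * heat 0 t (x - v))) hi]
  have e2 : ∀ v : ℝ, ∫ x, f (x + m) * (poisson b v * heat 0 t (x - v)) =
      (∫ u, f (v + √t * u + m) * heat 0 1 u) * poisson b v := fun v => by
    rw [← integral_mul_heat_eq ht (fun x => f (x + m)), ← integral_mul_const]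
    congr 1; ext x; ring
  simp_rw [e2]
  have cp := continuous_poisson one_pos
  have ch := continuous_heat 0 one_pos
  rw [integral_mul_poisson_eq hb (fun v => ∫ u, f (v + √t * u + m) * heat 0 1 u), Measure.volume_eq_prod,
    integral_prod]
  · congr 1; ext p
    rw [← integral_mul_const]
    congr 1; ext u
    rw [show b * p + √t * u + m = m + b * p + √t * u by ring]; ring
  · exact ((integrable_poisson one_pos).mul_prod (integrable_heat 0 one_pos)).bdd_mul (c := C)
      (Continuous.aestronglyMeasurable (by fun_prop)) (ae_of_all _ fun p => hC _)

theorem tendsto_sqrt_nhdsGT : Tendsto (fun t : ℝ => √t) (𝓝[>] 0) (𝓝 0) := by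
  have : Tendsto (fun t : ℝ => √t) (𝓝 0) (𝓝 (√0)) := Real.continuous_sqrt.tendsto 0
  rw [Real.sqrt_zero] at this
  exact this.mono_left nhdsWithin_le_nhds

/-- The Poisson integral as the limit of integrals against `heatPoisson`. -/
theorem tendsto_integral_mul_heatPoisson {F : ℝ × ℝ → ℝ} (hF : Continuous F) {C : ℝ} (hC : ∀ x, |F x| ≤ C)
    (m a b : ℝ) {h : ℝ} (hh : 0 < h) :
    Tendsto (fun t => ∫ x, F (x, √t * a) * heatPoisson 0 t (h - √t * b) (x - m)) (𝓝[>] 0)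
      (𝓝 (∫ x, F (x, 0) * poisson h (x - m))) := by
  have cp := continuous_poisson one_pos
  have ch := continuous_heat 0 one_pos
  have hK : Integrable (fun p : ℝ × ℝ => poisson 1 p.1 * heat 0 1 p.2) :=
    (integrable_poisson one_pos).mul_prod (integrable_heat 0 one_pos)
  have e0 : ∫ x, F (x, 0) * poisson h (x - m) =
      ∫ p : ℝ × ℝ, F (m + h * p.1, 0) * (poisson 1 p.1 * heat 0 1 p.2) := by
    have h1 := integral_add_right_eq_self (μ := volume) (fun x => F (x, 0) * poisson h (x - m)) m
    simp only [add_sub_cancel_right] at h1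
    rw [← h1, integral_mul_poisson_eq hh (fun x => F (x + m, 0))]
    have h2 := integral_prod_mul (μ := (volume : Measure ℝ)) (ν := (volume : Measure ℝ))
      (fun p => F (m + h * p, 0) * poisson 1 p) (heat 0 1)
    rw [integral_heat_zero one_pos, mul_one, ← Measure.volume_eq_prod] at h2
    simp_rw [← mul_assoc]
    rw [h2]
    simp_rw [add_comm m]
  have lim := tendsto_sqrt_nhdsGT
  have hb : ∀ᶠ t in 𝓝[>] (0 : ℝ), 0 < h - √t * b := by
    have h3 : Tendsto (fun t : ℝ => h - √t * b) (𝓝[>] 0) (𝓝 (h - 0 * b)) := (lim.mul_const b).const_sub h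
    rw [zero_mul, sub_zero] at h3
    exact h3.eventually_const_lt hh
  rw [e0]
  refine Tendsto.congr' (f₁ := fun t => ∫ p : ℝ × ℝ, F (m + (h - √t * b) * p.1 + √t * p.2, √t * a) *
    (poisson 1 p.1 * heat 0 1 p.2)) ?_ ?_
  · filter_upwards [hb, self_mem_nhdsWithin] with t hbt ht
    exact (integral_mul_heatPoisson ht hbt (f := fun x => F (x, √t * a)) (by fun_prop) (fun x => hC _) m).symm
  · refine tendsto_integral_filter_of_dominated_convergence
      (fun p : ℝ × ℝ => C * ‖poisson 1 p.1 * heat 0 1 p.2‖)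
      (Eventually.of_forall fun t => Continuous.aestronglyMeasurable (by fun_prop))
      (Eventually.of_forall fun t => ae_of_all _ fun p => ?_) (hK.norm.const_mul C) (ae_of_all _ fun p => ?_)
    · rw [norm_mul]
      exact mul_le_mul_of_nonneg_right (hC _) (norm_nonneg _)
    · refine Tendsto.mul_const _ ((hF.tendsto _).comp ?_)
      have h1 : Tendsto (fun t : ℝ => m + (h - √t * b) * p.1 + √t * p.2) (𝓝[>] 0)
          (𝓝 (m + (h - 0 * b) * p.1 + 0 * p.2)) :=
        ((((lim.mul_const b).const_sub h).mul_const _).const_add m).add (lim.mul_const _)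
      have h2 := lim.mul_const a
      simp only [zero_mul, sub_zero, add_zero] at h1 h2
      exact h1.prodMk_nhds h2

/-- The half-plane heat flow of a bounded continuous function started away from the boundary. -/
theorem tendsto_integral_mul_heat_mul_heat {F : ℝ × ℝ → ℝ} (hF : Continuous F) {C : ℝ} (hC : ∀ x, |F x| ≤ C)
    (y : ℝ × ℝ) (hy : y.2 ≠ 0) :
    Tendsto (fun t => ∫ x in openHalf, F x * (heat 0 t (x.1 - y.1) * heat 0 t (x.2 - y.2))) (𝓝[>] 0)
      (𝓝 (openHalf.indicator F y)) := by
  have ch := continuous_heat 0 one_pos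
  have hC0 : 0 ≤ C := (abs_nonneg _).trans (hC 0)
  have hK : Integrable (fun p : ℝ × ℝ => heat 0 1 p.1 * heat 0 1 p.2) :=
    (integrable_heat 0 one_pos).mul_prod (integrable_heat 0 one_pos)
  have hmeas : Measurable (openHalf.indicator F) := hF.measurable.indicator measurableSet_openHalf
  have hCi : ∀ x, |openHalf.indicator F x| ≤ C := fun x => by
    by_cases hx : x ∈ openHalf
    · rw [indicator_of_mem hx]; exact hC x
    · rw [indicator_of_notMem hx, abs_zero]; exact hC0
  have e0 : openHalf.indicator F y = ∫ p : ℝ × ℝ, openHalf.indicator F y * (heat 0 1 p.1 * heat 0 1 p.2) := by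
    have h2 := integral_prod_mul (μ := (volume : Measure ℝ)) (ν := (volume : Measure ℝ)) (heat 0 1) (heat 0 1)
    rw [← Measure.volume_eq_prod] at h2
    rw [integral_const_mul, h2, integral_heat_zero one_pos]; ring
  have lim := tendsto_sqrt_nhdsGT
  rw [e0]
  refine Tendsto.congr' (f₁ := fun t => ∫ p : ℝ × ℝ, openHalf.indicator F (y.1 + √t * p.1, y.2 + √t * p.2) *
    (heat 0 1 p.1 * heat 0 1 p.2)) ?_ ?_
  · filter_upwards [self_mem_nhdsWithin] with t ht
    have ct := continuous_heat 0 ht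
    have i1 : Integrable (fun p : ℝ × ℝ => openHalf.indicator F (y.1 + √t * p.1, y.2 + √t * p.2) *
        (heat 0 1 p.1 * heat 0 1 p.2)) := hK.bdd_mul (c := C)
      (hmeas.comp (by fun_prop)).aestronglyMeasurable (ae_of_all _ fun p => hCi _)
    have i2 : Integrable (fun x : ℝ × ℝ => openHalf.indicator F x *
        (heat 0 t (x.1 - y.1) * heat 0 t (x.2 - y.2))) := by
      refine Integrable.bdd_mul (c := C) ?_ hmeas.aestronglyMeasurable (ae_of_all _ fun p => hCi _)
      exact ((integrable_heat 0 ht).comp_sub_right y.1).mul_prod ((integrable_heat 0 ht).comp_sub_right y.2)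
    have e1 : ∫ x in openHalf, F x * (heat 0 t (x.1 - y.1) * heat 0 t (x.2 - y.2)) =
        ∫ x : ℝ × ℝ, openHalf.indicator F x * (heat 0 t (x.1 - y.1) * heat 0 t (x.2 - y.2)) := by
      rw [← integral_indicator measurableSet_openHalf]
      congr 1; ext x
      by_cases hx : x ∈ openHalf
      · rw [indicator_of_mem hx, indicator_of_mem hx]
      · rw [indicator_of_notMem hx, indicator_of_notMem hx, zero_mul]
    rw [e1, Measure.volume_eq_prod, integral_prod _ (Measure.volume_eq_prod ℝ ℝ ▸ i1),
      integral_prod _ (Measure.volume_eq_prod ℝ ℝ ▸ i2)]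
    have e2 : ∀ a : ℝ, ∫ b : ℝ, openHalf.indicator F (a, b) * (heat 0 t (a - y.1) * heat 0 t (b - y.2)) =
        (∫ u, openHalf.indicator F (a, y.2 + √t * u) * heat 0 1 u) * heat 0 t (a - y.1) := fun a => by
      rw [← integral_mul_heat_eq ht (fun b => openHalf.indicator F (a, b)), ← integral_mul_const]
      congr 1; ext b; ring
    simp_rw [e2]
    rw [integral_mul_heat_eq ht (fun a => ∫ u, openHalf.indicator F (a, y.2 + √t * u) * heat 0 1 u)]
    congr 1; ext u
    rw [← integral_mul_const]
    congr 1; ext v; ring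
  · refine tendsto_integral_filter_of_dominated_convergence
      (fun p : ℝ × ℝ => C * ‖heat 0 1 p.1 * heat 0 1 p.2‖)
      (Eventually.of_forall fun t => Measurable.aestronglyMeasurable (Measurable.mul (hmeas.comp (by fun_prop))
        (by fun_prop)))
      (Eventually.of_forall fun t => ae_of_all _ fun p => ?_) (hK.norm.const_mul C) (ae_of_all _ fun p => ?_)
    · rw [norm_mul]
      exact mul_le_mul_of_nonneg_right (hCi _) (norm_nonneg _)
    · refine Tendsto.mul_const _ ?_
      have h1 : Tendsto (fun t : ℝ => (y.1 + √t * p.1, y.2 + √t * p.2)) (𝓝[>] 0) (𝓝 y) := by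
        have h1 := (lim.mul_const p.1).const_add y.1
        have h2 := (lim.mul_const p.2).const_add y.2
        rw [zero_mul, add_zero] at h1 h2
        exact h1.prodMk_nhds h2
      -- the indicator is continuous off the boundary line
      refine Tendsto.comp (ContinuousAt.tendsto ?_) h1
      rcases hy.lt_or_gt with hy | hy
      · have hn : ∀ᶠ x in 𝓝 y, x.2 < 0 := continuous_snd.tendsto y |>.eventually_lt_const hy
        refine (continuousAt_const (y := (0 : ℝ))).congr ?_
        filter_upwards [hn] with x hx
        have hx' : x ∉ openHalf := fun h => lt_asymm h hx
        exact (indicator_of_notMem hx' F).symm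
      · refine hF.continuousAt.congr ?_
        filter_upwards [isOpen_openHalf.mem_nhds hy] with x hx
        exact (indicator_of_mem hx F).symm

/-! ### The boundary layer at small times -/

theorem integrable_heat_add {t : ℝ} (ht : 0 < t) :
    Integrable (fun p : ℝ × ℝ => heat 1 t (p.1 + p.2))
      ((volume.restrict (Ioi 0)).prod (volume.restrict (Ioi 0))) := by
  have c1 := continuous_heat 1 ht
  obtain ⟨C, _, hC⟩ := lintegral_lintegral_heat_add_le 0
  have hm : AEStronglyMeasurable (fun p : ℝ × ℝ => heat 1 t (p.1 + p.2))
      ((volume.restrict (Ioi 0)).prod (volume.restrict (Ioi 0))) := Continuous.aestronglyMeasurable (by fun_prop)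
  refine ⟨hm, ?_⟩
  rw [HasFiniteIntegral, lintegral_prod_symm _ hm.enorm]
  exact (hC t ht).trans_lt ENNReal.ofReal_lt_top

/-- The total mass of the profile of the boundary layer. Its double is the mass `-1` of the limit. -/
theorem integral_heat_add : ∫ p : ℝ × ℝ, heat 1 1 (p.1 + p.2)
    ∂((volume.restrict (Ioi 0)).prod (volume.restrict (Ioi 0))) = -(1 / 2) := by
  rw [integral_prod _ (integrable_heat_add one_pos)]
  have h1 : ∀ a : ℝ, ∫ b in Ioi (0 : ℝ), heat 1 1 (a + b) = -heat 0 1 a := fun a => by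
    obtain ⟨C, _, hC⟩ := exists_heat_bound 0
    have hl : Tendsto (fun b => heat 0 1 (a + b)) atTop (𝓝 0) := by
      have h2 : Tendsto (heat 0 1) atTop (𝓝 0) := by
        refine squeeze_zero_norm (fun v => hC 1 one_pos v) ?_
        simpa using (tendsto_exp_neg_sq_div (by norm_num : (0 : ℝ) < 8)).const_mul C
      exact h2.comp (tendsto_atTop_add_const_left _ a tendsto_id)
    rw [integral_Ioi_of_hasDerivAt_of_tendsto' (fun b _ => (hasDerivAt_heat 0 one_pos (a + b)).comp_const_add a b)
      ((integrable_heat 1 one_pos).comp_add_left a).integrableOn hl, add_zero, zero_sub]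
  have h3 : ∫ a in Ioi (0 : ℝ), heat 0 1 a = 1 / 2 := by
    have h := integral_comp_abs (f := heat 0 1)
    have e : ∀ a : ℝ, heat 0 1 |a| = heat 0 1 a := fun a => by
      rcases abs_choice a with h | h <;> rw [h]
      exact heat_zero_neg _ _
    simp_rw [e] at h
    rw [integral_heat_zero one_pos] at h
    linarith
  simp_rw [h1]
  rw [integral_neg, h3]

/-- The part of the kernel produced by the boundary converges to minus the Poisson kernel on the
boundary line. -/
theorem tendsto_integral_boundaryLayer {F : ℝ × ℝ → ℝ} (hF : Continuous F) {C : ℝ} (hC : ∀ x, |F x| ≤ C)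
    (y : ℝ × ℝ) (hy : 0 < y.2) :
    Tendsto (fun t => ∫ x in openHalf, F x * (2 * ∫ r in (0 : ℝ)..y.2, heat 1 t (x.2 + r) *
      heatPoisson 0 t (y.2 - r) (x.1 - y.1))) (𝓝[>] 0) (𝓝 (-∫ x, F (x, 0) * poisson y.2 (x - y.1))) := by
  have hC0 : 0 ≤ C := (abs_nonneg _).trans (hC 0)
  let ν : Measure (ℝ × ℝ) := (volume.restrict (Ioi 0)).prod (volume.restrict (Ioi 0))
  -- the tangential integral, with the normal variables `c` and `r` of `x` and of the segment fixed
  let H : ℝ → ℝ → ℝ → ℝ := fun t c r => ∫ x, F (x, c) * heatPoisson 0 t (y.2 - r) (x - y.1)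
  have hH : ∀ t c r : ℝ, 0 < t → r ≤ y.2 → |H t c r| ≤ C := fun t c r ht hr => by
    have hb : 0 ≤ y.2 - r := by linarith
    have hi := ((integrable_heatPoisson 0 ht hb).comp_sub_right y.1).norm.const_mul C
    rw [← Real.norm_eq_abs]
    refine (norm_integral_le_of_norm_le hi (ae_of_all _ fun x => ?_)).trans ?_
    · rw [norm_mul]; exact mul_le_mul_of_nonneg_right (hC _) (norm_nonneg _)
    · rw [integral_const_mul, integral_sub_right_eq_self (fun x => ‖heatPoisson 0 t (y.2 - r) x‖)]
      refine mul_le_of_le_one_right hC0 ((integral_abs_heatPoisson_le 0 ht hb).trans (le_of_eq ?_))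
      rw [← integral_heat_zero ht]
      exact integral_congr_ae (ae_of_all _ fun x => abs_of_pos (heat_zero_pos ht x))
  -- both normal variables are of order `√t`
  have key : ∀ t : ℝ, 0 < t → ∫ x in openHalf, F x * (2 * ∫ r in (0 : ℝ)..y.2, heat 1 t (x.2 + r) *
      heatPoisson 0 t (y.2 - r) (x.1 - y.1)) =
      2 * ∫ a in Ioi (0 : ℝ), ∫ b in Ioi (0 : ℝ), heat 1 1 (a + b) *
        (Ioc 0 y.2).indicator (H t (√t * a)) (√t * b) := by
    intro t ht
    have hs := Real.sqrt_pos.2 ht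
    have c1 := continuous_heat 1 ht
    have c0 := continuous_heat 0 ht
    have cp := continuous_heatPoisson 0 ht
    have hint : Integrable (fun x : ℝ × ℝ => F x * (2 * ∫ r in (0 : ℝ)..y.2, heat 1 t (x.2 + r) *
        heatPoisson 0 t (y.2 - r) (x.1 - y.1))) (volume.restrict openHalf) := by
      refine Integrable.bdd_mul (c := C) ?_ hF.aestronglyMeasurable (ae_of_all _ hC)
      have h1 : Integrable (fun x : ℝ × ℝ => heat 0 t (x.1 - y.1) * heatOdd 0 t x.2 y.2)
          (volume.restrict openHalf) := by
        refine Integrable.integrableOn ?_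
        refine ((integrable_heat 0 ht).comp_sub_right y.1).mul_prod (g := fun w => heatOdd 0 t w y.2) ?_
        exact ((integrable_heat 0 ht).comp_sub_right y.2).sub ((integrable_heat 0 ht).comp_add_right y.2)
      refine ((integrable_vortKernel_left ht y hy.le).sub h1).congr (ae_of_all _ fun x => ?_)
      simp [vortKernel]
    rw [restrict_openHalf] at hint ⊢
    rw [integral_prod_symm _ hint]
    have e1 : ∀ c : ℝ, ∫ v : ℝ, F (v, c) * (2 * ∫ r in (0 : ℝ)..y.2, heat 1 t (c + r) *
        heatPoisson 0 t (y.2 - r) (v - y.1)) =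
        2 * (√t * ∫ b in Ioi (0 : ℝ), heat 1 t (c + √t * b) * (Ioc 0 y.2).indicator (H t c) (√t * b)) := fun c => by
      obtain ⟨N, hN0, hN⟩ := exists_heat_le 1 ht
      have hi : Integrable (fun p : ℝ × ℝ => F (p.2, c) * (heat 1 t (c + p.1) *
          heatPoisson 0 t (y.2 - p.1) (p.2 - y.1))) ((volume.restrict (Ioc 0 y.2)).prod volume) := by
        refine Integrable.bdd_mul (c := C) ?_ (Continuous.aestronglyMeasurable (by fun_prop)) (ae_of_all _ fun p => hC _)
        refine Integrable.bdd_mul (c := N) ?_ (Continuous.aestronglyMeasurable (by fun_prop)) (ae_of_all _ fun p => hN _)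
        exact integrable_heatPoisson_prod ht y.2 y.1
      have hsw := integral_integral_swap (f := fun r v : ℝ => F (v, c) * (heat 1 t (c + r) *
          heatPoisson 0 t (y.2 - r) (v - y.1))) hi
      have h2 := integral_comp_mul_left_Ioi' (fun r => heat 1 t (c + r) * (Ioc 0 y.2).indicator (H t c) r) 0 hs
      rw [mul_zero, smul_eq_mul] at h2
      have h3 : ∀ v : ℝ, F (v, c) * (2 * ∫ r in (0 : ℝ)..y.2, heat 1 t (c + r) *
          heatPoisson 0 t (y.2 - r) (v - y.1)) = 2 * ∫ r in Ioc 0 y.2, F (v, c) * (heat 1 t (c + r) *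
          heatPoisson 0 t (y.2 - r) (v - y.1)) := fun v => by
        rw [intervalIntegral.integral_of_le hy.le, integral_const_mul]; ring
      simp_rw [h3]
      rw [integral_const_mul, ← hsw, h2]
      congr 1
      have h4 : ∀ r : ℝ, heat 1 t (c + r) * (Ioc 0 y.2).indicator (H t c) r =
          (Ioc 0 y.2).indicator (fun r => heat 1 t (c + r) * H t c r) r := fun r => by
        rw [indicator_mul_right]
      simp_rw [h4]
      rw [setIntegral_indicator measurableSet_Ioc, inter_eq_self_of_subset_right Ioc_subset_Ioi_self]
      congr 1; ext r
      rw [← integral_const_mul]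
      congr 1; ext v; ring
    simp_rw [e1]
    rw [integral_const_mul, integral_const_mul]
    have h5 := integral_comp_mul_left_Ioi' (fun c => ∫ b in Ioi (0 : ℝ), heat 1 t (c + √t * b) *
      (Ioc 0 y.2).indicator (H t c) (√t * b)) 0 hs
    rw [mul_zero, smul_eq_mul] at h5
    rw [← h5, ← integral_const_mul, ← integral_const_mul]
    congr 2; ext a
    rw [← integral_const_mul, ← integral_const_mul]
    congr 1; ext b
    have h6 : √t * (√t * (√t)⁻¹ ^ (1 + 1)) = 1 := by rw [pow_succ, pow_one]; field_simp
    rw [← mul_add, heat_sqrt_mul 1 ht]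
    linear_combination heat 1 1 (a + b) * (Ioc 0 y.2).indicator (H t (√t * a)) (√t * b) * h6
  have hmeas : ∀ t : ℝ, 0 < t → AEStronglyMeasurable (fun p : ℝ × ℝ => heat 1 1 (p.1 + p.2) *
      (Ioc 0 y.2).indicator (H t (√t * p.1)) (√t * p.2)) ν := by
    intro t ht
    have c1 := continuous_heat 1 one_pos
    have hc : Continuous fun q : (ℝ × ℝ) × ℝ => F (q.2, √t * q.1.1) *
        heatPoisson 0 t (y.2 - √t * q.1.2) (q.2 - y.1) :=
      (hF.comp (by fun_prop)).mul ((continuous_heatPoisson 0 ht).comp (g := fun p : ℝ × ℝ => heatPoisson 0 t p.1 p.2)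
        (f := fun q : (ℝ × ℝ) × ℝ => (y.2 - √t * q.1.2, q.2 - y.1)) (by fun_prop))
    have hHm : StronglyMeasurable fun p : ℝ × ℝ => H t (√t * p.1) (√t * p.2) :=
      hc.stronglyMeasurable.integral_prod_right
    have hS : MeasurableSet {p : ℝ × ℝ | √t * p.2 ∈ Ioc 0 y.2} := measurableSet_Ioc.preimage (by fun_prop)
    have hind : StronglyMeasurable fun p : ℝ × ℝ => (Ioc 0 y.2).indicator (H t (√t * p.1)) (√t * p.2) :=
      hHm.indicator hS
    exact (Continuous.aestronglyMeasurable (by fun_prop)).mul hind.aestronglyMeasurable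
  have hbd : ∀ t : ℝ, 0 < t → ∀ p : ℝ × ℝ, ‖heat 1 1 (p.1 + p.2) *
      (Ioc 0 y.2).indicator (H t (√t * p.1)) (√t * p.2)‖ ≤ ‖heat 1 1 (p.1 + p.2)‖ * C := fun t ht p => by
    rw [norm_mul]
    refine mul_le_mul_of_nonneg_left ?_ (norm_nonneg _)
    by_cases h : √t * p.2 ∈ Ioc 0 y.2
    · rw [indicator_of_mem h]; exact hH t _ _ ht h.2
    · rw [indicator_of_notMem h, norm_zero]; exact hC0
  have hdom : Integrable (fun p : ℝ × ℝ => ‖heat 1 1 (p.1 + p.2)‖ * C) ν :=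
    (integrable_heat_add one_pos).norm.mul_const C
  have lim := tendsto_sqrt_nhdsGT
  have main : Tendsto (fun t => ∫ p : ℝ × ℝ, heat 1 1 (p.1 + p.2) *
      (Ioc 0 y.2).indicator (H t (√t * p.1)) (√t * p.2) ∂ν) (𝓝[>] 0)
      (𝓝 (∫ p : ℝ × ℝ, heat 1 1 (p.1 + p.2) * (∫ x, F (x, 0) * poisson y.2 (x - y.1)) ∂ν)) := by
    refine tendsto_integral_filter_of_dominated_convergence _ ?_ ?_ hdom ?_
    · filter_upwards [self_mem_nhdsWithin] with t ht using hmeas t ht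
    · filter_upwards [self_mem_nhdsWithin] with t ht using ae_of_all _ (hbd t ht)
    · simp only [ν]
      rw [Measure.prod_restrict]
      filter_upwards [ae_restrict_mem (measurableSet_Ioi.prod measurableSet_Ioi)] with p hp
      refine Tendsto.const_mul _ ((tendsto_integral_mul_heatPoisson hF hC y.1 p.1 p.2 hy).congr' ?_)
      have h3 : Tendsto (fun t : ℝ => √t * p.2) (𝓝[>] 0) (𝓝 (0 * p.2)) := lim.mul_const _
      rw [zero_mul] at h3
      filter_upwards [h3.eventually_lt_const hy, self_mem_nhdsWithin] with t h1 h2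
      have hmem : √t * p.2 ∈ Ioc 0 y.2 := ⟨mul_pos (Real.sqrt_pos.2 h2) hp.2, h1.le⟩
      rw [indicator_of_mem hmem]
  rw [integral_mul_const, integral_heat_add] at main
  have h6 := main.const_mul 2
  rw [show 2 * (-(1 / 2) * ∫ x, F (x, 0) * poisson y.2 (x - y.1)) =
    -∫ x, F (x, 0) * poisson y.2 (x - y.1) by ring] at h6
  refine h6.congr' ?_
  filter_upwards [self_mem_nhdsWithin] with t ht
  rw [key t ht, integral_prod _ (hdom.mono' (hmeas t ht) (ae_of_all _ (hbd t ht)))]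

/-! ### Vague convergence at time zero -/

/-- The limit of the solution kernel at time zero: a point mass in the interior, and a Poisson sheet
of the opposite sign on the boundary. -/
theorem tendsto_integral_mul_vortKernel {F : ℝ × ℝ → ℝ} (hF : Continuous F) {C : ℝ} (hC : ∀ x, |F x| ≤ C)
    (y : ℝ × ℝ) (hy : 0 ≤ y.2) :
    Tendsto (fun t => ∫ x in openHalf, F x * vortKernel 0 0 t x y) (𝓝[>] 0)
      (𝓝 (openHalf.indicator F y - ∫ r, F (r, 0) * poisson y.2 (r - y.1))) := by
  rcases hy.eq_or_lt with hy | hy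
  · have hy' : y ∉ openHalf := fun h => h.ne hy
    rw [indicator_of_notMem hy', ← hy]
    have e : ∀ t : ℝ, ∫ x in openHalf, F x * vortKernel 0 0 t x y = 0 := fun t => by
      rw [show y = (y.1, 0) from Prod.ext rfl hy.symm]
      simp [vortKernel_boundary]
    simp_rw [e]
    simp [poisson_zero]
  have h1 := tendsto_integral_mul_heat_mul_heat hF hC y hy.ne'
  have h2 := tendsto_integral_mul_heat_mul_heat hF hC (y.1, -y.2) (neg_ne_zero.2 hy.ne')
  have hy' : (y.1, -y.2) ∉ openHalf := fun h : 0 < -y.2 => by linarith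
  rw [indicator_of_notMem hy'] at h2
  have h3 := (h1.sub h2).add (tendsto_integral_boundaryLayer hF hC y hy)
  rw [sub_zero, ← sub_eq_add_neg] at h3
  refine h3.congr' ?_
  filter_upwards [self_mem_nhdsWithin] with t ht
  have ht : 0 < t := ht
  have hi : ∀ m : ℝ, Integrable (fun x : ℝ × ℝ => F x * (heat 0 t (x.1 - y.1) * heat 0 t (x.2 - m)))
      (volume.restrict openHalf) := fun m => by
    refine Integrable.bdd_mul (c := C) (Integrable.integrableOn ?_) hF.aestronglyMeasurable (ae_of_all _ hC)
    exact ((integrable_heat 0 ht).comp_sub_right y.1).mul_prod ((integrable_heat 0 ht).comp_sub_right m)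
  have hv : Integrable (fun x : ℝ × ℝ => F x * vortKernel 0 0 t x y) (volume.restrict openHalf) :=
    (integrable_vortKernel_left ht y hy.le).bdd_mul (c := C) hF.aestronglyMeasurable (ae_of_all _ hC)
  have e : ∀ x : ℝ × ℝ, F x * (2 * ∫ r in (0 : ℝ)..y.2, heat 1 t (x.2 + r) *
      heatPoisson 0 t (y.2 - r) (x.1 - y.1)) = F x * vortKernel 0 0 t x y -
      (F x * (heat 0 t (x.1 - y.1) * heat 0 t (x.2 - y.2)) -
        F x * (heat 0 t (x.1 - y.1) * heat 0 t (x.2 - -y.2))) := fun x => by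
    rw [vortKernel, heatOdd, sub_neg_eq_add]; ring
  have hd : Integrable (fun x : ℝ × ℝ => F x * (heat 0 t (x.1 - y.1) * heat 0 t (x.2 - y.2)) -
      F x * (heat 0 t (x.1 - y.1) * heat 0 t (x.2 - -y.2))) (volume.restrict openHalf) :=
    (hi y.2).sub (hi (-y.2))
  simp_rw [e]
  rw [integral_sub hv hd, integral_sub (hi y.2) (hi (-y.2))]
  ring

theorem measurableSet_interiorPart : MeasurableSet interiorPart :=
  measurableSet_lt measurable_const (measurable_snd.comp measurable_subtype_coe)

/-- The extension of a function on the closed half plane to the plane which is constant in the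
normal variable below the boundary. -/
noncomputable def extendBelow (φ : ClosedHalf → ℝ) (x : ℝ × ℝ) : ℝ := φ ⟨(x.1, max x.2 0), le_max_right _ _⟩

theorem extendBelow_coe (φ : ClosedHalf → ℝ) (x : ClosedHalf) : extendBelow φ x.1 = φ x :=
  congrArg φ (Subtype.ext (Prod.ext rfl (max_eq_left x.2)))

theorem continuous_extendBelow {φ : ClosedHalf → ℝ} (hφ : Continuous φ) : Continuous (extendBelow φ) :=
  hφ.comp (Continuous.subtype_mk (by fun_prop) _)

theorem tendsto_sint_T (ω : M) {φ : ClosedHalf → ℝ} (hφ : Continuous φ) {C : ℝ} (hC : ∀ x, |φ x| ≤ C) :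
    Tendsto (fun t => sint (T t ω) φ) (𝓝[>] 0) (𝓝 (sint ω fun y =>
      openHalf.indicator (extendBelow φ) y.1 - ∫ r, extendBelow φ (r, 0) * poisson y.1.2 (r - y.1.1))) := by
  have hF := continuous_extendBelow hφ
  have hFC : ∀ x, |extendBelow φ x| ≤ C := fun x => hC _
  have hC0 : 0 ≤ C := (abs_nonneg _).trans (hFC 0)
  -- the uniform bound in `L¹` gives the domination for the integral over the vortices
  obtain ⟨B, hB0, hB⟩ := exists_lintegral_vortKernel_le 0 0
  have hbound : ∀ t : ℝ, 0 < t → ∀ y : ClosedHalf,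
      ‖∫ x in openHalf, extendBelow φ x * vortKernel 0 0 t x y.1‖ ≤ C * B := fun t ht y => by
    have hi := (integrable_vortKernel_left ht y.1 y.2)
    refine (norm_integral_le_of_norm_le (hi.norm.const_mul C) (ae_of_all _ fun x => ?_)).trans ?_
    · rw [norm_mul]; exact mul_le_mul_of_nonneg_right (hFC _) (norm_nonneg _)
    · rw [integral_const_mul]
      refine mul_le_mul_of_nonneg_left ?_ hC0
      rw [← ENNReal.ofReal_le_ofReal_iff hB0, ofReal_integral_norm_eq_lintegral_enorm hi]
      simpa using hB t ht y.1 y.2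
  have hlim : ∀ (μ : Measure ClosedHalf) [IsFiniteMeasure μ],
      Tendsto (fun t => ∫ y, (∫ x in openHalf, extendBelow φ x * vortKernel 0 0 t x y.1) ∂μ) (𝓝[>] 0)
      (𝓝 (∫ y, (openHalf.indicator (extendBelow φ) y.1 - ∫ r, extendBelow φ (r, 0) * poisson y.1.2 (r - y.1.1)) ∂μ)) := by
    intro μ _
    refine tendsto_integral_filter_of_dominated_convergence (fun _ => C * B) ?_ ?_ (integrable_const _) ?_
    · filter_upwards [self_mem_nhdsWithin] with t ht
      have hc : Continuous fun p : ClosedHalf × (ℝ × ℝ) => extendBelow φ p.2 * vortKernel 0 0 t p.2 p.1.1 :=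
        (hF.comp continuous_snd).mul ((continuous_vortKernel_half 0 0 ht).comp continuous_swap)
      exact (hc.stronglyMeasurable.integral_prod_right (ν := volume.restrict openHalf)).aestronglyMeasurable
    · filter_upwards [self_mem_nhdsWithin] with t ht using ae_of_all _ (hbound t ht)
    · exact ae_of_all _ fun y => tendsto_integral_mul_vortKernel hF hFC y.1 y.2
  refine ((hlim _).sub (hlim _)).congr' ?_
  filter_upwards [self_mem_nhdsWithin] with t ht
  have ht : 0 < t := ht
  have e : ∀ y : ClosedHalf, φ y * vorticity t ω y.1 = extendBelow φ y.1 * vorticity t ω y.1 := fun y => by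
    rw [extendBelow_coe]
  rw [T_of_pos ω ht, sint_withDensity (integrable_vorticity ω ht) hφ.measurable hC]
  simp_rw [e]
  rw [integral_area (fun x => extendBelow φ x * vorticity t ω x),
    integral_mul_vorticity ω ht hF.aestronglyMeasurable (fun x _ => hFC x), sint_eq]

/-- By Fubini, the Poisson integrals of the test function against `ω` are the integral of the test
function against the tangential trace. -/
theorem sint_initialLimit (ω : M) {φ : ClosedHalf → ℝ} (hφ : Continuous φ) {C : ℝ} (hC : ∀ x, |φ x| ≤ C) :
    (sint ω fun y => openHalf.indicator (extendBelow φ) y.1 - ∫ r, extendBelow φ (r, 0) * poisson y.1.2 (r - y.1.1)) =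
      sint (ω.restrict interiorPart - boundaryMeasure (tangentialTrace ω)) φ := by
  have hF := continuous_extendBelow hφ
  have hFC : ∀ x, |extendBelow φ x| ≤ C := fun x => hC _
  rw [sint_sub_measure _ _ hφ.measurable hC, sint_restrict ω measurableSet_interiorPart hφ.measurable hC,
    boundaryMeasure, sint_map_withDensity (integrable_tangentialTrace ω) measurable_boundary hφ.measurable hC]
  have hi : ∀ (μ : Measure ClosedHalf) [IsFiniteMeasure μ], Integrable (fun p : ℝ × ClosedHalf =>
      extendBelow φ (p.1, 0) * poisson p.2.1.2 (p.1 - p.2.1.1)) (volume.prod μ) := fun μ _ =>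
    (integrable_trace_kernel μ).bdd_mul (c := C) (Continuous.aestronglyMeasurable (by fun_prop))
      (ae_of_all _ fun p => hFC _)
  have h1 : ∀ (μ : Measure ClosedHalf) [IsFiniteMeasure μ],
      ∫ y, (openHalf.indicator (extendBelow φ) y.1 - ∫ r, extendBelow φ (r, 0) * poisson y.1.2 (r - y.1.1)) ∂μ =
      (∫ y in interiorPart, φ y ∂μ) - ∫ r, extendBelow φ (r, 0) * ∫ y : ClosedHalf, poisson y.1.2 (r - y.1.1) ∂μ := by
    intro μ _
    have hind : (fun y : ClosedHalf => openHalf.indicator (extendBelow φ) y.1) = interiorPart.indicator φ := by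
      ext y
      by_cases hy : 0 < y.1.2
      · rw [indicator_of_mem (show y.1 ∈ openHalf from hy), indicator_of_mem (show y ∈ interiorPart from hy),
          extendBelow_coe]
      · rw [indicator_of_notMem (show y.1 ∉ openHalf from hy),
          indicator_of_notMem (show y ∉ interiorPart from hy)]
    have hφi : Integrable (fun y : ClosedHalf => openHalf.indicator (extendBelow φ) y.1) μ := by
      rw [hind]
      exact ((integrable_const C).mono' hφ.aestronglyMeasurable (ae_of_all _ hC)).indicator measurableSet_interiorPart
    rw [integral_sub hφi (hi μ).integral_prod_right, hind, integral_indicator measurableSet_interiorPart,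
      ← integral_integral_swap (f := fun r (y : ClosedHalf) => extendBelow φ (r, 0) * poisson y.1.2 (r - y.1.1)) (hi μ)]
    simp_rw [integral_const_mul]
  have h2 : ∀ (μ : Measure ClosedHalf) [IsFiniteMeasure μ],
      Integrable (fun r => extendBelow φ (r, 0) * ∫ y : ClosedHalf, poisson y.1.2 (r - y.1.1) ∂μ) := fun μ _ => by
    have := (hi μ).integral_prod_left
    simpa only [integral_const_mul] using this
  have h3 : ∀ r : ℝ, φ ⟨(r, 0), le_refl 0⟩ * tangentialTrace ω r =
      extendBelow φ (r, 0) * (∫ y : ClosedHalf, poisson y.1.2 (r - y.1.1) ∂ω.toJordanDecomposition.posPart) -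
      extendBelow φ (r, 0) * ∫ y : ClosedHalf, poisson y.1.2 (r - y.1.1) ∂ω.toJordanDecomposition.negPart := fun r => by
    rw [tangentialTrace_eq, mul_sub, ← extendBelow_coe φ ⟨(r, 0), le_refl 0⟩]
  simp_rw [h3]
  rw [integral_sub (h2 _) (h2 _), sint_eq, h1, h1]
  ring

theorem vagueTendsto_T (ω : M) : VagueTendsto (fun t => T t ω) (𝓝[>] 0)
    (ω.restrict interiorPart - boundaryMeasure (tangentialTrace ω)) := fun φ => by
  have hφ : Continuous fun y => φ y := φ.continuous
  have hC : ∀ x, |φ x| ≤ ‖φ.toBCF‖ := fun x => φ.toBCF.norm_coe_le_norm x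
  rw [← sint_initialLimit ω hφ hC]
  exact tendsto_sint_T ω hφ hC

theorem restrict_interiorPart {ω : M} (h : ω.totalVariation boundaryPart = 0) : ω.restrict interiorPart = ω := by
  have hb : interiorPartᶜ = boundaryPart := by
    ext y
    exact ⟨fun hy => le_antisymm (not_lt.1 hy) y.2, fun (hy : y.1.2 = 0) (hy' : 0 < y.1.2) => hy'.ne' hy⟩
  have h' : ω.toJordanDecomposition.posPart interiorPartᶜ + ω.toJordanDecomposition.negPart interiorPartᶜ = 0 := by
    rw [hb]; exact h
  obtain ⟨h1, h2⟩ := add_eq_zero.1 h'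
  refine VectorMeasure.ext fun A hA => ?_
  rw [VectorMeasure.restrict_apply _ measurableSet_interiorPart hA,
    signedMeasure_apply ω (hA.inter measurableSet_interiorPart), signedMeasure_apply ω hA, measureReal_def,
    measureReal_def, measureReal_def, measureReal_def, measure_inter_conull h1, measure_inter_conull h2]

theorem vagueTendsto_T_of_boundary {ω : M} (h : ω.totalVariation boundaryPart = 0) :
    VagueTendsto (fun t => T t ω) (𝓝[>] 0) (ω - boundaryMeasure (tangentialTrace ω)) := by
  have := vagueTendsto_T ω
  rwa [restrict_interiorPart h] at this

theorem vagueTendsto_T_normalized {ω : M} (h : ω.totalVariation boundaryPart = 0) :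
    VagueTendsto (fun t => T t (normalized ω)) (𝓝[>] 0) (normalized ω) := fun φ =>
  (vagueTendsto_T_of_boundary h φ).congr' (by
    filter_upwards [self_mem_nhdsWithin] with t ht
    rw [T_normalized ω ht])

/-! ### The properties of the solution operator -/

theorem lemma4p1 :
    -- the integrals and derivatives that define `T(t) = -∇^⊥ · S(t) K` make sense
    (∀ ω : M,
      (∀ᵐ x ∂(volume.restrict openHalf), ∀ i : Fin 2,
        Integrable (fun y : ClosedHalf => biotSavartKernel x y.1 i) ω.totalVariation) ∧
      (∀ᵐ x₁ : ℝ,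
        Integrable (fun y : ClosedHalf => biotSavartKernel (x₁, 0) y.1 0) ω.totalVariation) ∧
      Integrable (tangentialTrace ω) ∧
      (∀ t : ℝ, 0 < t → ∀ x ∈ openHalf, ∀ i : Fin 2,
        IntegrableOn (fun z => ∑ j, greenMatrix i j x z t * biotSavart ω z j) openHalf) ∧
      (∀ i : Fin 2, ContDiffOn ℝ ((⊤ : ℕ∞) : WithTop ℕ∞)
        (fun p : ℝ × (ℝ × ℝ) => stokes p.1 (biotSavart ω) p.2 i) (Ioi 0 ×ˢ openHalf)) ∧
      ContDiffOn ℝ ((⊤ : ℕ∞) : WithTop ℕ∞) (fun p : ℝ × (ℝ × ℝ) => vorticity p.1 ω p.2) (Ioi 0 ×ˢ openHalf) ∧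
      (∀ t : ℝ, 0 < t → Integrable (fun x : ClosedHalf => vorticity t ω x.1) area)) ∧
    -- the estimate of all derivatives in `L^q`, `1 ≤ q ≤ ∞`
    (∀ s k₁ k₂ : ℕ, ∃ C : ℝ, ∀ (ω : M) (t : ℝ) (q : ℝ≥0∞), 0 < t → 1 ≤ q →
      eLpNorm (vorticityDeriv s k₁ k₂ t ω) q (volume.restrict openHalf) ≤
        ENNReal.ofReal
            (C * t ^ (-(1 - (q⁻¹).toReal + ((k₁ : ℝ) + (k₂ : ℝ)) / 2 + (s : ℝ)))) *
          ω.totalVariation univ) ∧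
    -- the semigroup property
    (∀ (t s : ℝ) (ω : M), 0 ≤ t → 0 ≤ s → T (t + s) ω = T t (T s ω)) ∧
    -- vague convergence to the initial measure minus its boundary vortex sheet
    (∀ ω : M, ω.totalVariation boundaryPart = 0 →
      VagueTendsto (fun t => T t ω) (𝓝[>] 0) (ω - boundaryMeasure (tangentialTrace ω))) ∧
    -- the same for measures that may charge the boundary line, whose boundary part is lost
    (∀ ω : M,
      VagueTendsto (fun t => T t ω) (𝓝[>] 0)
        (ω.restrict interiorPart - boundaryMeasure (tangentialTrace ω))) ∧
    -- the normalized measure has the same evolution, which is vaguely continuous at time zero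
    (∀ (ω : M) (t : ℝ), 0 < t → T t (normalized ω) = T t ω) ∧
    (∀ ω : M, ω.totalVariation boundaryPart = 0 →
      VagueTendsto (fun t => T t (normalized ω)) (𝓝[>] 0) (normalized ω)) :=
  ⟨fun ω => ⟨ae_integrable_biotSavartKernel ω, ae_integrable_biotSavartKernel_trace ω, integrable_tangentialTrace ω,
    fun _ ht _ hx => integrableOn_stokes ht hx ω, contDiffOn_stokes ω, contDiffOn_vorticity ω,
    fun _ => integrable_vorticity ω⟩, exists_eLpNorm_vorticityDeriv_le, fun _ _ ω => T_add ω,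
    fun _ => vagueTendsto_T_of_boundary, vagueTendsto_T, fun ω _ => T_normalized ω,
    fun _ => vagueTendsto_T_normalized⟩
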